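/- Fix $h\in\mathbb R$ and $x_I>0$. **Potentials.** Let $\mathbb V^1_{x_I}$ be the class of real potentials $V$ on $\mathbb R_+=[0,\infty)$ with $V,V'\in L^1(\mathbb R_+)$, $\operatorname{supp}V\subset[0,x_I]$, and such that $(x_I-\epsilon,x_I)\cap\operatorname{supp}V$ has positive Lebesgue measure for every $\epsilon>0$ ($V$ is identified with its absolutely continuous representative on $[0,\infty)$). For $V\in\mathbb V^1_{x_I}$ and $k\in\mathbb C$ let $f(\cdot,k)$ be the Jost solution, i.e. the solution of $-f''+Vf=k^2f$ on $[0,\infty)$ with $f(x,k)=e^{ikx}$ for $x>x_I$, and let $f_h(k)=h\,f(0,k)+f'(0,k)$ be the Jost function. The Weyl function of $V$ is $$M(\lambda)=\frac{f(0,k)}{f_h(k)},\qquad \lambda=k^2,\ \operatorname{Im}k>0,$$ a meromorphic function on $\Pi=\mathbb C\setminus[0,\infty)$. **Weyl functions.** Let $\mathbb M_{x_I}$ (depending on $h$) be the class of functions $M$ with the following properties, where $\lambda=k^2$. 1. $M$ is analytic in $\Pi$ except for finitely many (possibly no) simple poles $\lambda_1,\dots,\lambda_N<0$, with residues $\alpha_j=\operatorname{Res}_{\lambda=\lambda_j}M>0$.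 2. $M$ extends continuously to both sides of the cut $(0,\infty)$: the function $k\mapsto M(k^2)$, $\operatorname{Im}k>0$, extends continuously to $\{\operatorname{Im}k\ge0,\ k\ne0,\ k^2\ne\lambda_j\}$. Moreover $kM(k^2)=O(1)$ as $k\to0$, $\operatorname{Im}k>0$. 3. With $M^{\pm}(\lambda)$ the boundary values of $M$ at $\lambda>0$ from $\pm\operatorname{Im}>0$, one has $T(\lambda)=\frac1{2\pi i}\bigl(M^-(\lambda)-M^+(\lambda)\bigr)>0$ for all $\lambda>0$. 4. $M(\lambda)=\frac1{ik}+\frac h{k^2}+o(k^{-2})$ as $|k|\to\infty$, $\operatorname{Im}k>0$. 5. Let $k_j=i\sqrt{-\lambda_j}$, and for real $k\neq 0$ let $j(k)=M^{+}(k^2)-\frac1{ik}$ if $k>0$ and $j(k)=M^{-}(k^2)-\frac1{ik}$ if $k<0$. For all $x,y\ge0$ the limit $$g(x,y)=\lim_{R\to\infty}\frac i\pi\int_{-R}^{R}k\cos(kx)\,j(k)\cos(ky)\,dk+\sum_{j=1}^N\alpha_j\cos(k_jx)\cos(k_jy)$$ exists. The Gelfand–Levitan equation $$g(x,y)+K(x,y)+\int_0^xK(x,s)\,g(s,y)\,ds=0,\qquad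 0\le y\le x,$$ has a solution $K$ that is continuous on $\{0\le y\le x\}$, and for each fixed $x>0$ the function $K(x,\cdot)$ is the only continuous solution on $[0,x]$. The function $x\mapsto K(x,x)$ is real-valued and differentiable on $[0,\infty)$ (one-sidedly at $0$), its derivative $\frac{d}{dx}K(x,x)$ is absolutely continuous on every interval $[0,b]$, vanishes for $x>x_I$, and for every $\epsilon>0$ is non-zero on a subset of $(x_I-\epsilon,x_I)\cap(0,\infty)$ of positive Lebesgue measure. **Theorem.** The map $\mathcal J_h:\mathbb V^1_{x_I}\to\mathbb M_{x_I}$ that sends $V$ to its Weyl function $M$ is well-defined (the Weyl function of every $V\in\mathbb V^1_{x_I}$ belongs to $\mathbb M_{x_I}$) and bijective. -/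

import Mathlib

open Set Filter Topology MeasureTheory

noncomputable section

namespace LoveProblem

/-- The class of real potentials `V` with `V, V' ∈ L¹(ℝ₊)`, `supp V ⊆ [0, x_I]`, and such that
`supp V` meets every interval `(x_I - ε, x_I)` in a set of positive Lebesgue measure.
An element of `W^{1,1}(ℝ₊)` is recorded as its absolutely continuous representative on `[0, ∞)`,
extended by zero to the negative half-line. -/
def potentialClass (xI : ℝ) : Set (ℝ → ℝ) :=
  {V | (∀ b > 0, AbsolutelyContinuousOnInterval V 0 b) ∧
    IntegrableOn V (Ioi 0) ∧ IntegrableOn (deriv V) (Ioi 0) ∧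
    tsupport V ⊆ Icc 0 xI ∧
    ∀ ε > 0, 0 < volume (Ioo (xI - ε) xI ∩ tsupport V)}

/-- The pair `(f, f')` is the Jost solution and its `x`-derivative: `-f'' + V f = k² f` on
`[0, ∞)` (derivatives at `0` are one-sided) and `f(x) = e^{ikx}` for `x > x_I`. -/
def IsJostSolution (xI : ℝ) (V : ℝ → ℝ) (k : ℂ) (p : (ℝ → ℂ) × (ℝ → ℂ)) : Prop :=
  (∀ x ≥ 0, HasDerivWithinAt p.1 (p.2 x) (Ici 0) x) ∧
  (∀ x ≥ 0, HasDerivWithinAt p.2 (((V x : ℂ) - k ^ 2) * p.1 x) (Ici 0) x) ∧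
  ∀ x > xI, p.1 x = Complex.exp (Complex.I * k * x)

open Classical in
/-- The Jost solution together with its `x`-derivative. -/
def jost (xI : ℝ) (V : ℝ → ℝ) (k : ℂ) : (ℝ → ℂ) × (ℝ → ℂ) :=
  if hp : ∃ p, IsJostSolution xI V k p then hp.choose else 0

/-- The Jost function `f_h(k) = h f(0,k) + f'(0,k)`. -/
def jostFunction (h xI : ℝ) (V : ℝ → ℝ) (k : ℂ) : ℂ :=
  (jost xI V k).1 0 * h + (jost xI V k).2 0

/-- The plane `Π` of the spectral parameter, cut along `[0, ∞)`. -/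
def cutPlane : Set ℂ := {z | ¬ (0 ≤ z.re ∧ z.im = 0)}

/-- The branch of the square root with positive imaginary part on `cutPlane`. -/
def physRoot (z : ℂ) : ℂ := Complex.I * (-z) ^ (1 / 2 : ℂ)

theorem physRoot_sq (z : ℂ) : physRoot z ^ 2 = z := by
  have h : ((-z) ^ (1 / 2 : ℂ)) ^ 2 = -z := by
    rw [← Complex.cpow_nat_mul]
    norm_num
  rw [physRoot, mul_pow, h, Complex.I_sq]
  ring

theorem physRoot_im_pos {z : ℂ} (hz : z ∈ cutPlane) : 0 < (physRoot z).im := by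
  have h0 : -z ∈ Complex.slitPlane := by
    rw [Complex.mem_slitPlane_iff]
    simp only [cutPlane, mem_ofPred_eq, not_and_or, not_le] at hz
    rcases hz with hz | hz
    · left; simpa using hz
    · right; simpa using hz
  have hne : -z ≠ 0 := Complex.slitPlane_ne_zero h0
  have harg := Complex.mem_slitPlane_iff_arg.mp h0
  have h1 := Complex.neg_pi_lt_arg (-z)
  have h2 := lt_of_le_of_ne (Complex.arg_le_pi (-z)) harg.1
  simp only [physRoot, Complex.mul_im, Complex.I_re, Complex.I_im, zero_mul, one_mul, zero_add]
  rw [Complex.cpow_def_of_ne_zero hne, Complex.exp_re]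
  refine mul_pos (Real.exp_pos _) (Real.cos_pos_of_mem_Ioo ?_)
  have : (Complex.log (-z) * (1 / 2 : ℂ)).im = (-z).arg / 2 := by
    have : (1 / 2 : ℂ) = ((1 / 2 : ℝ) : ℂ) := by norm_num
    rw [this, Complex.im_mul_ofReal, Complex.log_im]
    ring
  rw [this]
  constructor <;> linarith

/-- The Weyl function `M(λ) = f(0,k) / f_h(k)`, `λ = k²`, `Im k > 0`, as a meromorphic function
on `cutPlane`. Such a function is recorded as a function on `ℂ` which is zero at the poles and
outside `cutPlane`; at the zeros of `f_h` this is what division by zero returns. -/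
def weylFunction (h xI : ℝ) (V : ℝ → ℝ) : ℂ → ℂ :=
  cutPlane.indicator fun z => (jost xI V (physRoot z)).1 0 / jostFunction h xI V (physRoot z)

/-- `M⁺`: the boundary value on the cut from the upper side. -/
def upperValue (M : ℂ → ℂ) (l : ℝ) : ℂ := limUnder (𝓝[{z : ℂ | 0 < z.im}] (l : ℂ)) M

/-- `M⁻`: the boundary value on the cut from the lower side. -/
def lowerValue (M : ℂ → ℂ) (l : ℝ) : ℂ := limUnder (𝓝[{z : ℂ | z.im < 0}] (l : ℂ)) M

/-- The jump `T(λ) = (M⁻(λ) - M⁺(λ)) / (2πi)` across the cut. -/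
def jump (M : ℂ → ℂ) (l : ℝ) : ℂ :=
  (lowerValue M l - upperValue M l) / (2 * Real.pi * Complex.I)

/-- `j(k) = M(k²) - 1/(ik)` for real `k ≠ 0`: the value of `M` is taken on the upper side of the
cut for `k > 0` and on the lower side for `k < 0`. -/
def jFun (M : ℂ → ℂ) (k : ℝ) : ℂ :=
  (if 0 < k then upperValue M (k ^ 2) else lowerValue M (k ^ 2)) - 1 / (Complex.I * k)

/-- The function `g(x,y)`, with the integral over the real line cut off at `± R`:
`(i/π) ∫_{-R}^R k cos(kx) j(k) cos(ky) dk + ∑_j α_j cos(k_j x) cos(k_j y)`. -/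
def gCutoff (M : ℂ → ℂ) (P : Finset ℝ) (α : ℝ → ℝ) (x y R : ℝ) : ℂ :=
  Complex.I / Real.pi *
      (∫ k in (-R)..R, (k : ℂ) * Complex.cos (k * x) * jFun M k * Complex.cos (k * y)) +
    ∑ p ∈ P, Complex.cos (physRoot p * x) * α p * Complex.cos (physRoot p * y)

/-- `κ = K(x, ·)` is a continuous solution on `[0, x]` of the Gelfand–Levitan equation
`g(x,y) + K(x,y) + ∫_0^x K(x,s) g(s,y) ds = 0`, `0 ≤ y ≤ x`. -/
def IsGLSolution (g : ℝ → ℝ → ℂ) (x : ℝ) (κ : ℝ → ℂ) : Prop :=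
  ContinuousOn κ (Icc 0 x) ∧
  ∀ y ∈ Icc 0 x, g x y + κ y + ∫ s in (0)..x, κ s * g s y = 0

/-- `M` is analytic in `cutPlane` except for the finite set `P` of simple poles, which are
negative, with residues `α p > 0`. -/
def HasPoles (M : ℂ → ℂ) (P : Finset ℝ) (α : ℝ → ℝ) : Prop :=
  AnalyticOnNhd ℂ M (cutPlane \ ((↑) '' (P : Set ℝ))) ∧
  ∀ p ∈ P, p < 0 ∧ 0 < α p ∧
    Tendsto (fun z : ℂ => (z - p) * M z) (𝓝[≠] (p : ℂ)) (𝓝 (α p : ℂ))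

/-- `M` extends continuously to both sides of the cut, apart from the poles and the origin, and
`k M(k²) = O(1)` as `k → 0`, `Im k > 0`. The closure of `Π` on the Riemann surface of the square
root is parametrised by `k` with `Im k ≥ 0`. -/
def HasBoundaryValues (M : ℂ → ℂ) (P : Finset ℝ) : Prop :=
  (∃ m : ℂ → ℂ,
    ContinuousOn m {k | 0 ≤ k.im ∧ k ≠ 0 ∧ ∀ p ∈ P, k ^ 2 ≠ (p : ℂ)} ∧
    ∀ k : ℂ, 0 < k.im → m k = M (k ^ 2)) ∧
  (fun k : ℂ => k * M (k ^ 2)) =O[𝓝[{k : ℂ | 0 < k.im}] 0] (fun _ => (1 : ℂ))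

/-- `M(λ) = 1/(ik) + h/k² + o(k⁻²)` as `|k| → ∞`, `Im k > 0`. -/
def HasWeylAsymptotics (h : ℝ) (M : ℂ → ℂ) : Prop :=
  (fun k : ℂ => M (k ^ 2) - (1 / (Complex.I * k) + h / k ^ 2))
    =o[Bornology.cobounded ℂ ⊓ 𝓟 {k : ℂ | 0 < k.im}] (fun k : ℂ => 1 / k ^ 2)

/-- The condition on the Gelfand–Levitan equation: `g(x,y)` exists for all `x, y ≥ 0`, the equation
has a unique solution `K`, and `K(x,x)` is real with an absolutely continuous derivative on
`[0, ∞)`, which vanishes for `x > x_I` and is non-zero on a subset of positive measure of every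
interval `(x_I - ε, x_I)`. -/
def HasGLKernel (xI : ℝ) (M : ℂ → ℂ) (P : Finset ℝ) (α : ℝ → ℝ) : Prop :=
  ∃ g K : ℝ → ℝ → ℂ,
    (∀ x ≥ 0, ∀ y ≥ 0, Tendsto (gCutoff M P α x y) atTop (𝓝 (g x y))) ∧
    ContinuousOn (fun q : ℝ × ℝ => K q.1 q.2) {q | 0 ≤ q.2 ∧ q.2 ≤ q.1} ∧
    (∀ x > 0, IsGLSolution g x (K x) ∧
      ∀ κ, IsGLSolution g x κ → EqOn κ (K x) (Icc 0 x)) ∧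
    (∀ x ≥ 0, (K x x).im = 0) ∧
    ∃ D : ℝ → ℝ,
      (∀ x ≥ 0, HasDerivWithinAt (fun t => (K t t).re) (D x) (Ici 0) x) ∧
      (∀ b > 0, AbsolutelyContinuousOnInterval D 0 b) ∧
      (∀ x > xI, D x = 0) ∧
      ∀ ε > 0, 0 < volume {x | x ∈ Ioo (xI - ε) xI ∧ 0 < x ∧ D x ≠ 0}

/-- The class of Weyl functions. The first two clauses fix how a meromorphic function on `cutPlane`
is recorded as a function on `ℂ`. -/
def weylClass (h xI : ℝ) : Set (ℂ → ℂ) :=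
  {M | ∃ (P : Finset ℝ) (α : ℝ → ℝ),
    (∀ z ∉ cutPlane, M z = 0) ∧ (∀ p ∈ P, M p = 0) ∧
    HasPoles M P α ∧ HasBoundaryValues M P ∧
    (∀ l > 0, ∃ t : ℝ, 0 < t ∧ jump M l = t) ∧
    HasWeylAsymptotics h M ∧
    HasGLKernel xI M P α}

end LoveProblem

end

/-! Potential and Weyl function are linked by the transformation operator `1 + K`, which carries
`cos (k x)` to the solution `φ` with `φ(0) = 1`, `φ'(0) = -h`. Its diagonal `K(x,x) = -h + ½ ∫₀ˣ V`
recovers the potential. On the spectral side everything is carried by one function of one variable: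
`g(x,y) = (a(x+y) + a(|x-y|))/2` with `a(t) = g(t,0)`, and `a` is the inverse Laplace transform of
`-τ M(-τ²) - 1`. The Gelfand–Levitan equation ties `a` to `K`, and the proof shows that the chain
`M`, `a`, `K`, `V` can be followed in both directions.

Direct problem. The kernel solves a Goursat integral equation, a contraction in a weighted sup norm
(`exists_isTransformationKernel`). The Jost function is entire; Lagrange's identity puts its zeros
in the upper half-plane on the imaginary axis and makes the residues of `M` positive
(`IsJostFamily.tendsto_residue`). Integration by parts against the absolutely continuous potential
gives `M` up to `O(k⁻³)` (`IsJostFamily.asymptotics`). Once the poles are subtracted, `k M(k²) + i`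
becomes a function `N` analytic in the upper half-plane (`exists_isReduced`), and its `c/k` tail can
be cancelled by an odd function, so the cut-off integrals converge to a continuous `a`
(`IsReduced.exists_tendsto_gCutoff`).

The Gelfand–Levitan equation (`gelfandLevitan_of_weyl`) is obtained without a completeness relation.
At `k = iτ` the Weyl solution `f / f_h` decays like `e^{-τx}/τ`; this bounds the exponential moments
of the defect of the equation as `τ → ∞`, and a Paley–Wiener criterion
(`eqOn_zero_of_exp_integral_bounded`) makes the defect vanish. Its solutions are unique because `(1
+ K)(1 + g)` is triangular (`exists_triangular_factor`), so that the homogeneous equation becomes a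
Volterra equation.

Injectivity. `M` determines `a` by uniqueness of the Laplace transform, `a` determines `K`, and the
diagonal of `K` determines `V`.

Surjectivity. Let `L` solve the Gelfand–Levitan equation of a given `M`, and take for `V` twice the
derivative of `L(x,x)`. Here `a` is known only as a pointwise limit. An `L²` bound for cosine
transforms shows that it still inverts the Laplace transform (`laplace_of_tendsto_cosTransform`),
and the equation itself then makes it continuous (`exists_continuous_of_gelfandLevitan`), with
`L(0,0) = -a(0) = -h`. Hence `L` and the transformation kernel of `V` have the same diagonal. The
diagonal alone determines `a`, by a Gronwall argument (`eq_of_gl_diagonal_eq`). So `M` and the Weyl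
function of `V` agree far out on the negative axis, and the identity theorem finishes the proof
(`HasPoles.eq_of_eventually_eq`). -/

noncomputable section

namespace LoveProblem

/-! ### Weighted contractions, Volterra equations and a Gronwall inequality. -/

section

section FixedPoint

variable {X E : Type*} [TopologicalSpace X] [NormedAddCommGroup E]

/-- Each application of `T` halves the constant in the weighted bound, so the difference of two
fixed points is squeezed to zero pointwise. -/
theorem fixedPoint_unique_of_weighted_contraction {ρ : X → ℝ} {T : (X → E) → X → E}
    (hT : ∀ u v : X → E, Continuous u → Continuous v → ∀ c : ℝ, 0 ≤ c →
      (∀ x, ‖u x - v x‖ ≤ c * Real.exp (ρ x)) → ∀ x, ‖T u x - T v x‖ ≤ c / 2 * Real.exp (ρ x))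
    {u v : X → E} (hu : Continuous u) (hv : Continuous v) (hTu : T u = u) (hTv : T v = v)
    {c : ℝ} (hc : 0 ≤ c) (huv : ∀ x, ‖u x - v x‖ ≤ c * Real.exp (ρ x)) : u = v := by
  have key : ∀ n : ℕ, ∀ x, ‖u x - v x‖ ≤ c / 2 ^ n * Real.exp (ρ x) := by
    intro n
    induction n with
    | zero => simpa using huv
    | succ n ih =>
      intro x
      have := hT u v hu hv (c / 2 ^ n) (by positivity) ih x
      rw [hTu, hTv] at this
      rwa [pow_succ, ← div_div]
  funext x
  rw [← sub_eq_zero, ← norm_le_zero_iff]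
  have h1 : Tendsto (fun n : ℕ => c / 2 ^ n * Real.exp (ρ x)) atTop (𝓝 (0 * Real.exp (ρ x))) := by
    refine Tendsto.mul_const _ ?_
    refine Tendsto.div_atTop tendsto_const_nhds ?_
    exact tendsto_pow_atTop_atTop_of_one_lt (by norm_num)
  rw [zero_mul] at h1
  exact ge_of_tendsto' h1 fun n => key n x

/-- Banach's fixed point theorem on bounded continuous functions, after conjugation by `exp ρ`. A
weight growing fast enough turns Volterra-type operators into contractions on the whole domain at
once. -/
theorem exists_fixedPoint_of_weighted_contraction [NormedSpace ℝ E] [CompleteSpace E] {ρ : X → ℝ}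
    (hρ : Continuous ρ) {T : (X → E) → X → E} (hTc : ∀ u, Continuous u → Continuous (T u))
    {C₀ : ℝ} (hT0 : ∀ x, ‖T 0 x‖ ≤ C₀ * Real.exp (ρ x))
    (hT : ∀ u v : X → E, Continuous u → Continuous v → ∀ c : ℝ, 0 ≤ c →
      (∀ x, ‖u x - v x‖ ≤ c * Real.exp (ρ x)) → ∀ x, ‖T u x - T v x‖ ≤ c / 2 * Real.exp (ρ x)) :
    ∃ u : X → E, Continuous u ∧ (∃ C : ℝ, 0 ≤ C ∧ ∀ x, ‖u x‖ ≤ C * Real.exp (ρ x)) ∧ T u = u := by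
  have lift_cont : ∀ u : BoundedContinuousFunction X E,
      Continuous fun x => Real.exp (ρ x) • u x := fun u => by fun_prop
  have bnd : ∀ u : BoundedContinuousFunction X E, ∀ x,
      ‖T (fun x => Real.exp (ρ x) • u x) x‖ ≤ (C₀ + ‖u‖ / 2) * Real.exp (ρ x) := by
    intro u x
    have h1 := hT (fun x => Real.exp (ρ x) • u x) 0 (lift_cont u) continuous_const ‖u‖
      (norm_nonneg _) (fun x => by
        rw [Pi.zero_apply, sub_zero, norm_smul, Real.norm_eq_abs, Real.abs_exp, mul_comm]
        gcongr; exact u.norm_coe_le_norm x) x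
    have h2 := norm_sub_norm_le (T (fun x => Real.exp (ρ x) • u x) x) (T 0 x)
    have h3 := hT0 x
    linarith
  let S : BoundedContinuousFunction X E → BoundedContinuousFunction X E := fun u =>
    BoundedContinuousFunction.ofNormedAddCommGroup
      (fun x => Real.exp (-ρ x) • T (fun x => Real.exp (ρ x) • u x) x)
      (by have := hTc _ (lift_cont u); fun_prop) (C₀ + ‖u‖ / 2) (fun x => by
        rw [norm_smul, Real.norm_eq_abs, Real.abs_exp, Real.exp_neg]
        have := bnd u x
        rw [inv_mul_le_iff₀ (Real.exp_pos _)]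
        linarith)
  have hS : ContractingWith (1 / 2) S := by
    refine ⟨by rw [← NNReal.coe_lt_coe]; norm_num, ?_⟩
    refine LipschitzWith.of_dist_le_mul fun u v => ?_
    rw [BoundedContinuousFunction.dist_le (by positivity)]
    intro x
    have h1 := hT _ _ (lift_cont u) (lift_cont v) (dist u v) dist_nonneg (fun x => by
      rw [← smul_sub, norm_smul, Real.norm_eq_abs, Real.abs_exp, mul_comm, ← dist_eq_norm]
      gcongr; exact BoundedContinuousFunction.dist_coe_le_dist x) x
    change dist (Real.exp (-ρ x) • T (fun x => Real.exp (ρ x) • u x) x)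
      (Real.exp (-ρ x) • T (fun x => Real.exp (ρ x) • v x) x) ≤ _
    rw [dist_eq_norm, ← smul_sub, norm_smul, Real.norm_eq_abs, Real.abs_exp, Real.exp_neg,
      inv_mul_le_iff₀ (Real.exp_pos _)]
    refine h1.trans_eq ?_
    simp; ring
  set w := ContractingWith.fixedPoint S hS with hw
  have hfix : S w = w := hS.fixedPoint_isFixedPt
  refine ⟨fun x => Real.exp (ρ x) • w x, lift_cont w, ⟨‖w‖, norm_nonneg _, fun x => ?_⟩, ?_⟩
  · rw [norm_smul, Real.norm_eq_abs, Real.abs_exp, mul_comm]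
    gcongr; exact w.norm_coe_le_norm x
  · funext x
    have : S w x = w x := by rw [hfix]
    rw [← this]
    change _ = Real.exp (ρ x) • (Real.exp (-ρ x) • T (fun x => Real.exp (ρ x) • w x) x)
    rw [smul_smul, ← Real.exp_add]
    simp

end FixedPoint

theorem integral_exp_mul_le {l t : ℝ} (hl : 0 < l) :
    ∫ s in (0)..t, Real.exp (l * s) ≤ Real.exp (l * t) / l := by
  have h : ∀ s ∈ uIcc 0 t, HasDerivAt (fun s => Real.exp (l * s) / l) (Real.exp (l * s)) s := by
    intro s _
    have := ((hasDerivAt_id s).const_mul l).exp.div_const l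
    simp only [id, mul_one] at this
    rwa [mul_div_assoc, div_self hl.ne', mul_one] at this
  rw [intervalIntegral.integral_eq_sub_of_hasDerivAt h
    (Continuous.intervalIntegrable (by fun_prop) _ _)]
  have : 0 < Real.exp (l * 0) / l := by positivity
  linarith

/-- Linear Volterra equations of the second kind with bounded continuous data are solvable. -/
theorem exists_volterra_solution {E : Type*} [NormedAddCommGroup E] [NormedSpace ℝ E]
    [CompleteSpace E] {Q : ℝ → ℝ → ℝ} (hQ : Continuous (Function.uncurry Q)) {C : ℝ}
    (hQC : ∀ t s, |Q t s| ≤ C) {F : ℝ → E} (hF : Continuous F) {C₀ : ℝ} (hFC : ∀ t, ‖F t‖ ≤ C₀) :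
    ∃ u : ℝ → E, Continuous u ∧ ∀ t ≥ 0, u t = F t + ∫ s in (0)..t, Q t s • u s := by
  have hC : 0 ≤ C := (abs_nonneg _).trans (hQC 0 0)
  -- This exponent makes `C / l ≤ 1 / 2`, the contraction factor required.
  set l : ℝ := 2 * C + 1 with hl
  have hl0 : 0 < l := by positivity
  have hcont : ∀ u : ℝ → E, Continuous u →
      Continuous fun t => F t + ∫ s in (0)..(max t 0), Q t s • u s := by
    intro u hu
    refine hF.add ?_
    refine intervalIntegral.continuous_parametric_intervalIntegral_of_continuous ?_ (by fun_prop)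
    exact (hQ.smul (hu.comp continuous_snd) : _)
  obtain ⟨u, hu, -, hfix⟩ := exists_fixedPoint_of_weighted_contraction
    (ρ := fun t : ℝ => l * max t 0)
    (T := fun (u : ℝ → E) t => F t + ∫ s in (0)..(max t 0), Q t s • u s) (by fun_prop) hcont
    (C₀ := C₀) (fun t => by
      simp only [Pi.zero_apply, smul_zero, intervalIntegral.integral_zero, add_zero]
      refine (hFC t).trans (le_mul_of_one_le_right ((norm_nonneg _).trans (hFC t)) ?_)
      exact Real.one_le_exp (by positivity))
    (fun u v hu hv c hc h t => by
      have ht0 : (0 : ℝ) ≤ max t 0 := le_max_right _ _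
      rw [add_sub_add_left_eq_sub, ← intervalIntegral.integral_sub]
      · calc ‖∫ s in (0)..(max t 0), (Q t s • u s - Q t s • v s)‖
            ≤ ∫ s in (0)..(max t 0), C * (c * Real.exp (l * s)) := by
              refine intervalIntegral.norm_integral_le_of_norm_le ht0 ?_
                (Continuous.intervalIntegrable (by fun_prop) _ _)
              refine Eventually.of_forall fun s hs => ?_
              rw [← smul_sub, norm_smul]
              have h1 := h s
              rw [max_eq_left hs.1.le] at h1
              exact mul_le_mul (hQC t s) h1 (norm_nonneg _) hC
          _ = C * c * ∫ s in (0)..(max t 0), Real.exp (l * s) := by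
              rw [← intervalIntegral.integral_const_mul]
              congr 1; funext s; ring
          _ ≤ C * c * (Real.exp (l * max t 0) / l) := by
              gcongr; exact integral_exp_mul_le hl0
          _ = c * (C / l) * Real.exp (l * max t 0) := by ring
          _ ≤ c * (1 / 2) * Real.exp (l * max t 0) := by
              have : C / l ≤ 1 / 2 := by
                rw [div_le_div_iff₀ hl0 (by norm_num)]; linarith
              gcongr
          _ = c / 2 * Real.exp (l * max t 0) := by ring
      · exact Continuous.intervalIntegrable (by
          have := hQ.comp (Continuous.prodMk_right t); exact this.smul hu) _ _
      · exact Continuous.intervalIntegrable (by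
          have := hQ.comp (Continuous.prodMk_right t); exact this.smul hv) _ _)
  refine ⟨u, hu, fun t ht => ?_⟩
  have := congrFun hfix t
  simp only [max_eq_left ht] at this
  exact this.symm

/-- Iterating the inequality `n` times leaves `M (C t)ⁿ / n!`, which tends to zero. Only
integrability and an upper bound of `u` are needed. -/
theorem nonpos_of_le_mul_integral {u : ℝ → ℝ} {b C M : ℝ} (hC : 0 ≤ C)
    (hu : IntervalIntegrable u volume 0 b) (hM : ∀ t ∈ Icc 0 b, u t ≤ M)
    (h : ∀ t ∈ Icc 0 b, u t ≤ C * ∫ s in (0)..t, u s) : ∀ t ∈ Icc 0 b, u t ≤ 0 := by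
  have key : ∀ n : ℕ, ∀ t ∈ Icc 0 b, u t ≤ M * ((C * t) ^ n / n.factorial) := by
    intro n
    induction n with
    | zero => simpa using hM
    | succ n ih =>
      intro t ht
      refine (h t ht).trans ?_
      have h1 : ∫ s in (0)..t, u s ≤ ∫ s in (0)..t, M * ((C * s) ^ n / n.factorial) := by
        refine intervalIntegral.integral_mono_on ht.1 ?_
          (Continuous.intervalIntegrable (by fun_prop) _ _)
          fun s hs => ih s ⟨hs.1, hs.2.trans ht.2⟩
        exact hu.mono_set (by
          rw [uIcc_of_le ht.1, uIcc_of_le (ht.1.trans ht.2)]; exact Icc_subset_Icc_right ht.2)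
      have h2 : ∫ s in (0)..t, M * ((C * s) ^ n / n.factorial)
          = M * (C ^ n / n.factorial * (t ^ (n + 1) / (n + 1))) := by
        simp only [mul_pow, mul_div_right_comm]
        simp
      rw [h2] at h1
      refine (mul_le_mul_of_nonneg_left h1 hC).trans_eq ?_
      rw [Nat.factorial_succ]; push_cast
      field_simp
      rw [mul_pow, pow_succ C]; ring
  intro t ht
  have h1 : Tendsto (fun n : ℕ => M * ((C * t) ^ n / n.factorial)) atTop (𝓝 (M * 0)) :=
    (FloorSemiring.tendsto_pow_div_factorial_atTop (C * t)).const_mul M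
  rw [mul_zero] at h1
  exact ge_of_tendsto' h1 fun n => key n t ht

end

/-! ### A Paley–Wiener criterion and Cauchy's theorem in the upper half-plane. -/

section

theorem hasSum_one_sub_exp_neg (z : ℝ) :
    HasSum (fun k : ℕ => (-1) ^ k * z ^ (k + 1) / (k + 1).factorial) (1 - Real.exp (-z)) := by
  have h1 : HasSum (fun n : ℕ => (-z) ^ n / n.factorial) (Real.exp (-z)) := by
    rw [Real.exp_eq_exp_ℝ]; exact NormedSpace.expSeries_div_hasSum_exp (-z)
  rw [← hasSum_nat_add_iff' 1] at h1
  have h2 := h1.neg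
  simp only [Finset.range_one, Finset.sum_singleton, pow_zero, Nat.factorial_zero, Nat.cast_one,
    div_one, neg_sub] at h2
  refine h2.congr_fun ?_
  intro k
  rw [neg_pow]; ring

/-- A Paley–Wiener type criterion: a continuous function on `[0, x]` vanishes if its exponential
moments `∫₀ˣ e^{τ(x-t)} h(t) dt` stay bounded as `τ → ∞`. -/
theorem eqOn_zero_of_exp_integral_bounded {h : ℝ → ℂ} {x : ℝ} (hx : 0 < x)
    (hh : ContinuousOn h (Icc 0 x)) {C τ₀ : ℝ}
    (hb : ∀ τ ≥ τ₀, ‖∫ t in (0)..x, Real.exp (τ * (x - t)) • h t‖ ≤ C) :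
    EqOn h 0 (Icc 0 x) := by
  have hint : IntervalIntegrable h volume 0 x := by
    apply ContinuousOn.intervalIntegrable; rwa [uIcc_of_le hx.le]
  have hmeas : AEStronglyMeasurable h (volume.restrict (uIoc 0 x)) := by
    rw [uIoc_of_le hx.le]; exact hint.1.1
  have hC : 0 ≤ C := (norm_nonneg _).trans (hb τ₀ le_rfl)
  -- It is enough that all primitives vanish; the function is recovered by differentiation, and at
  -- the endpoints by continuity.
  have key : ∀ y ∈ Ico 0 x, ∫ t in (0)..y, h t = 0 := by
    intro y hy
    have hd : 0 < x - y := sub_pos.2 hy.2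
    -- A smooth approximation of the indicator of `t < y`. Its power series in `exp (n (y - t))`
    -- involves only exponentials, so the integral of `φ n • h` is a series of the moments that are
    -- assumed bounded.
    let φ : ℕ → ℝ → ℝ := fun n t => 1 - Real.exp (-Real.exp (n * (y - t)))
    have hlim : Tendsto (fun n : ℕ => ∫ t in (0)..x, φ n t • h t) atTop
        (𝓝 (∫ t in (0)..x, indicator {t | t ≤ y} h t)) := by
      refine intervalIntegral.tendsto_integral_filter_of_dominated_convergence (fun t => ‖h t‖)
        (Eventually.of_forall fun n => ?_) (Eventually.of_forall fun n => ?_) hint.norm ?_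
      · have : Continuous (φ n) := by simp only [φ]; fun_prop
        exact this.aestronglyMeasurable.smul hmeas
      · refine Eventually.of_forall fun t _ => ?_
        rw [norm_smul]
        refine mul_le_of_le_one_left (norm_nonneg _) ?_
        have h1 : 0 < Real.exp (-Real.exp (n * (y - t))) := Real.exp_pos _
        have h2 : Real.exp (-Real.exp (n * (y - t))) ≤ 1 := by
          rw [Real.exp_le_one_iff]; exact neg_nonpos.2 (Real.exp_pos _).le
        rw [Real.norm_eq_abs, abs_le]; constructor <;> simp only [φ] <;> linarith
      · have hne : ∀ᵐ t : ℝ, t ≠ y := by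
          simp [ae_iff, measure_singleton]
        filter_upwards [hne] with t hty _
        rcases lt_or_gt_of_ne hty with hlt | hgt
        · rw [indicator_of_mem (show t ∈ {t | t ≤ y} from hlt.le)]
          have h1 : Tendsto (fun n : ℕ => φ n t) atTop (𝓝 (1 - 0)) := by
            refine tendsto_const_nhds.sub ?_
            refine Real.tendsto_exp_atBot.comp (tendsto_neg_atTop_atBot.comp ?_)
            refine Real.tendsto_exp_atTop.comp ?_
            exact tendsto_natCast_atTop_atTop.atTop_mul_const (sub_pos.2 hlt)
          simpa using h1.smul_const (h t)
        · rw [indicator_of_notMem (show t ∉ {t | t ≤ y} from not_le.2 hgt)]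
          have h1 : Tendsto (fun n : ℕ => φ n t) atTop (𝓝 (1 - Real.exp (-0))) := by
            refine tendsto_const_nhds.sub ?_
            refine (Real.continuous_exp.tendsto _).comp (Tendsto.neg ?_)
            refine Real.tendsto_exp_atBot.comp ?_
            exact tendsto_natCast_atTop_atTop.atTop_mul_const_of_neg (sub_neg.2 hgt)
          simpa using h1.smul_const (h t)
    rw [intervalIntegral.integral_indicator ⟨hy.1, hy.2.le⟩] at hlim
    have hbound : ∀ᶠ n : ℕ in atTop,
        ‖∫ t in (0)..x, φ n t • h t‖ ≤ C * Real.exp (-(n * (x - y))) * Real.exp 1 := by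
      filter_upwards [eventually_ge_atTop (max 1 ⌈max τ₀ 0⌉₊)] with n hn
      have hn1 : 1 ≤ n := (le_max_left _ _).trans hn
      have hnτ : τ₀ ≤ n := by
        have h1 : (⌈max τ₀ 0⌉₊ : ℝ) ≤ n := by exact_mod_cast (le_max_right _ _).trans hn
        exact (le_max_left _ _).trans ((Nat.le_ceil _).trans h1)
      have hsum : HasSum (fun k : ℕ => ∫ t in (0)..x,
          ((-1) ^ k * Real.exp (n * (y - t)) ^ (k + 1) / (k + 1).factorial) • h t)
          (∫ t in (0)..x, φ n t • h t) := by
        refine intervalIntegral.hasSum_integral_of_dominated_convergence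
          (fun k t => Real.exp (n * y) ^ (k + 1) / (k + 1).factorial * ‖h t‖) (fun k => ?_)
          (fun k => ?_) ?_ ?_ ?_
        · have : Continuous fun t : ℝ =>
              (-1) ^ k * Real.exp (n * (y - t)) ^ (k + 1) / ((k + 1).factorial : ℝ) := by fun_prop
          exact this.aestronglyMeasurable.smul hmeas
        · refine Eventually.of_forall fun t ht => ?_
          rw [uIoc_of_le hx.le] at ht
          rw [norm_smul, norm_div, norm_mul, norm_pow, norm_neg, norm_one, one_pow, one_mul,
            norm_pow, Real.norm_eq_abs, Real.abs_exp, Real.norm_natCast]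
          gcongr
          linarith [ht.1]
        · refine Eventually.of_forall fun t _ => Summable.mul_right _ ?_
          have := NormedSpace.expSeries_div_summable (Real.exp (n * y))
          exact this.comp_injective (add_left_injective 1)
        · simp_rw [tsum_mul_right]
          exact hint.norm.const_mul _
        · exact Eventually.of_forall fun t _ => (hasSum_one_sub_exp_neg _).smul_const (h t)
      refine hsum.norm_le_of_bounded
        (g := fun k : ℕ => C * Real.exp (-(n * (x - y))) * (1 ^ k / k.factorial)) ?_ fun k => ?_
      · refine HasSum.mul_left _ ?_
        rw [Real.exp_eq_exp_ℝ]; exact NormedSpace.expSeries_div_hasSum_exp (1 : ℝ)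
      -- The `k`-th term is the moment at `τ = (k + 1) n` times `exp (-(k + 1) n (x - y))`. Since `y
      -- < x` this factor decays, and the factorials make the sum over `k` harmless.
      · have h1 : ∀ t, ((-1) ^ k * Real.exp (n * (y - t)) ^ (k + 1) / (k + 1).factorial) • h t
            = ((-1) ^ k / (k + 1).factorial * Real.exp (-((k + 1) * n * (x - y)))) •
              (Real.exp ((k + 1) * n * (x - t)) • h t) := by
          intro t
          rw [smul_smul, ← Real.exp_nat_mul, mul_assoc, ← Real.exp_add, mul_div_right_comm]
          congr 3; push_cast; ring
        simp_rw [h1]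
        rw [intervalIntegral.integral_smul, norm_smul, norm_mul, norm_div, norm_pow, norm_neg,
          norm_one, Real.norm_natCast, Real.norm_eq_abs (Real.exp _), Real.abs_exp]
        have hk1 : (1 : ℝ) ≤ k + 1 := by linarith [(Nat.cast_nonneg k : (0 : ℝ) ≤ k)]
        have hn0 : (0 : ℝ) ≤ n := Nat.cast_nonneg n
        have h2 := hb ((k + 1) * n) (by nlinarith)
        have h3 : Real.exp (-((k + 1) * n * (x - y))) ≤ Real.exp (-(n * (x - y))) := by
          rw [Real.exp_le_exp]
          have : 0 ≤ n * (x - y) := by positivity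
          nlinarith
        have h4 : (1 : ℝ) ^ k / (k + 1).factorial ≤ 1 ^ k / k.factorial := by
          rw [one_pow]
          apply one_div_le_one_div_of_le (by positivity)
          exact_mod_cast Nat.factorial_le (Nat.le_succ k)
        calc _ ≤ 1 ^ k / (k.factorial : ℝ) * Real.exp (-(n * (x - y))) * C := by gcongr
          _ = _ := by ring
    have hzero : Tendsto (fun n : ℕ => C * Real.exp (-(n * (x - y))) * Real.exp 1) atTop
        (𝓝 (C * 0 * Real.exp 1)) := by
      refine (Tendsto.const_mul _ ?_).mul_const _
      refine Real.tendsto_exp_atBot.comp (tendsto_neg_atTop_atBot.comp ?_)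
      exact tendsto_natCast_atTop_atTop.atTop_mul_const hd
    rw [mul_zero, zero_mul] at hzero
    rw [← norm_le_zero_iff]
    exact le_of_tendsto_of_tendsto hlim.norm hzero hbound
  have hIoo : EqOn h 0 (Ioo 0 x) := by
    intro y hy
    have hca : ContinuousAt h y := hh.continuousAt (Icc_mem_nhds hy.1 hy.2)
    have hd : HasDerivAt (fun u => ∫ t in (0)..u, h t) (h y) y := by
      refine intervalIntegral.integral_hasDerivAt_right
        (hint.mono_set ?_) ?_ hca
      · rw [uIcc_of_le hy.1.le, uIcc_of_le hx.le]; exact Icc_subset_Icc_right hy.2.le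
      · exact ContinuousOn.stronglyMeasurableAtFilter_nhdsWithin (s := Ioo 0 x)
          (hh.mono Ioo_subset_Icc_self) measurableSet_Ioo y |>.filter_mono (by
            rw [isOpen_Ioo.nhdsWithin_eq hy])
    have hd0 : HasDerivAt (fun u => ∫ t in (0)..u, h t) 0 y := by
      refine (hasDerivAt_const y (0 : ℂ)).congr_of_eventuallyEq ?_
      filter_upwards [Ioo_mem_nhds hy.1 hy.2] with u hu
      exact key u ⟨hu.1.le, hu.2⟩
    exact hd.unique hd0
  have := hIoo.of_subset_closure hh continuousOn_const Ioo_subset_Icc_self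
    (by rw [closure_Ioo hx.ne])
  exact this

/-- Cauchy's theorem for the upper half-plane. -/
theorem tendsto_integral_of_upperHalfPlane {G : ℂ → ℂ}
    (hd : DifferentiableOn ℂ G {k | 0 < k.im}) (hc : ContinuousOn G {k | 0 ≤ k.im ∧ k ≠ 0})
    {C ε₀ : ℝ} (hε₀ : 0 < ε₀) (hb : ∀ k : ℂ, 0 ≤ k.im → k.im ≤ ε₀ → k ≠ 0 → ‖G k‖ ≤ C)
    (hdec : ∀ ε > 0, ∃ R₀ : ℝ, ∀ k : ℂ, 0 ≤ k.im → R₀ ≤ ‖k‖ → ‖k‖ * ‖G k‖ ≤ ε) :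
    Tendsto (fun R : ℝ => ∫ s in (-R)..R, G s) atTop (𝓝 0) := by
  -- The segment at height `η` is compared with the other three sides of the rectangle over `[-R,
  -- R]` of top height `R`. There `‖k‖ ≥ R`, so `‖G‖ ≤ e / R`, and their total length is at most `4
  -- R`.
  have key : ∀ e > 0, ∀ R₀ : ℝ, (∀ k : ℂ, 0 ≤ k.im → R₀ ≤ ‖k‖ → ‖k‖ * ‖G k‖ ≤ e) →
      ∀ R : ℝ, 0 < R → R₀ ≤ R → ‖∫ s in (-R)..R, G s‖ ≤ 4 * e := by
    intro e he R₀ hR₀ R hR hRR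
    have bd : ∀ k : ℂ, 0 ≤ k.im → R ≤ ‖k‖ → ‖G k‖ ≤ e / R := by
      intro k hk hkR
      rw [le_div_iff₀ hR]
      have := hR₀ k hk (hRR.trans hkR)
      nlinarith [norm_nonneg (G k)]
    have shifted : ∀ η ∈ Ioo 0 R, ‖∫ s in (-R)..R, G (s + η * Complex.I)‖ ≤ 4 * e := by
      intro η hη
      have h0 := Complex.integral_boundary_rect_eq_zero_of_differentiableOn G
        (-R + η * Complex.I) (R + R * Complex.I) (hd.mono (by
          intro k hk
          have := hk.2
          simp only [mem_preimage, Complex.add_im, Complex.neg_im, Complex.ofReal_im, neg_zero,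
            Complex.mul_im, Complex.I_im, mul_one, Complex.ofReal_re, Complex.I_re, mul_zero,
            add_zero, zero_add] at this
          rw [uIcc_of_le hη.2.le] at this
          exact hη.1.trans_le this.1))
      simp only [Complex.add_re, Complex.neg_re, Complex.ofReal_re, Complex.mul_re, Complex.I_re,
        mul_zero, Complex.ofReal_im, Complex.I_im, mul_one, sub_self, add_zero, Complex.add_im,
        Complex.neg_im, neg_zero, Complex.mul_im, zero_add, smul_eq_mul, Complex.ofReal_neg] at h0
      have t1 : ‖∫ x in (-R)..R, G (x + R * Complex.I)‖ ≤ e / R * |R - -R| := by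
        refine intervalIntegral.norm_integral_le_of_norm_le_const fun x _ => bd _ (by simp [hR.le]) ?_
        calc R = |(x + R * Complex.I : ℂ).im| := by simp [abs_of_pos hR]
          _ ≤ _ := Complex.abs_im_le_norm _
      have t2 : ‖∫ y in η..R, G (R + y * Complex.I)‖ ≤ e / R * |R - η| := by
        refine intervalIntegral.norm_integral_le_of_norm_le_const fun y hy => bd _ ?_ ?_
        · rw [uIoc_of_le hη.2.le] at hy; simpa using (hη.1.trans hy.1).le
        · calc R = |(R + y * Complex.I : ℂ).re| := by simp [abs_of_pos hR]
            _ ≤ _ := Complex.abs_re_le_norm _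
      have t3 : ‖∫ y in η..R, G (-R + y * Complex.I)‖ ≤ e / R * |R - η| := by
        refine intervalIntegral.norm_integral_le_of_norm_le_const fun y hy => bd _ ?_ ?_
        · rw [uIoc_of_le hη.2.le] at hy; simpa using (hη.1.trans hy.1).le
        · calc R = |(-R + y * Complex.I : ℂ).re| := by simp [abs_of_pos hR]
            _ ≤ _ := Complex.abs_re_le_norm _
      have e1 : |R - -R| = 2 * R := by rw [abs_of_pos] <;> linarith
      have e2 : e / R * |R - η| ≤ e := by
        rw [abs_of_pos (by linarith [hη.2])]
        calc e / R * (R - η) ≤ e / R * R := by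
              have := hη.1
              gcongr; linarith
          _ = e := by field_simp
      rw [e1] at t1
      have e3 : e / R * (2 * R) = 2 * e := by field_simp
      have : (∫ x in (-R)..R, G (x + η * Complex.I)) = (∫ x in (-R)..R, G (x + R * Complex.I))
          - Complex.I * (∫ y in η..R, G (R + y * Complex.I))
          + Complex.I * ∫ y in η..R, G (-R + y * Complex.I) := by linear_combination h0
      rw [this]
      refine (norm_add_le _ _).trans ((add_le_add_left (norm_sub_le _ _) _).trans ?_)
      rw [norm_mul, norm_mul, Complex.norm_I, one_mul, one_mul]
      linarith
    -- As `η → 0` the bound near the real axis allows dominated convergence; the missing point `0`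
    -- is a null set.
    have hlim : Tendsto (fun η : ℝ => ∫ s in (-R)..R, G (s + η * Complex.I)) (𝓝[>] 0)
        (𝓝 (∫ s in (-R)..R, G s)) := by
      refine intervalIntegral.tendsto_integral_filter_of_dominated_convergence (fun _ => C)
        ?_ ?_ intervalIntegrable_const ?_
      · filter_upwards [self_mem_nhdsWithin] with η hη
        refine Continuous.aestronglyMeasurable ?_
        refine hc.comp_continuous (by fun_prop) fun s => ⟨by simpa using (le_of_lt hη), fun h0 => ?_⟩
        have := congrArg Complex.im h0
        simp at this
        exact (ne_of_gt hη) this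
      · filter_upwards [Ioc_mem_nhdsGT hε₀] with η hη
        refine Eventually.of_forall fun s _ => hb _ (by simpa using hη.1.le) (by simpa using hη.2)
          fun h0 => ?_
        have := congrArg Complex.im h0
        simp at this
        exact hη.1.ne' this
      · have hne : ∀ᵐ t : ℝ, t ≠ 0 := by simp [ae_iff, measure_singleton]
        filter_upwards [hne] with s hs _
        have h1 : ContinuousWithinAt G {k | 0 ≤ k.im ∧ k ≠ 0} s :=
          hc _ ⟨by simp, by simpa using hs⟩
        refine h1.tendsto.comp (tendsto_nhdsWithin_iff.2 ⟨?_, ?_⟩)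
        · have : Continuous fun η : ℝ => (s + η * Complex.I : ℂ) := by fun_prop
          have h2 := (this.tendsto 0).mono_left (nhdsWithin_le_nhds (s := Ioi 0))
          simpa using h2
        · filter_upwards [self_mem_nhdsWithin] with η hη
          refine ⟨by simpa using (le_of_lt hη), fun h0 => ?_⟩
          have := congrArg Complex.im h0
          simp at this
          exact (ne_of_gt hη) this
    refine le_of_tendsto hlim.norm ?_
    filter_upwards [Ioo_mem_nhdsGT hR] with η hη using shifted η hη
  rw [Metric.tendsto_atTop]
  intro ε hε
  obtain ⟨R₀, hR₀⟩ := hdec (ε / 8) (by positivity)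
  refine ⟨max R₀ 1, fun R hR => ?_⟩
  rw [dist_zero_right]
  have := key (ε / 8) (by positivity) R₀ hR₀ R (by linarith [le_max_right R₀ 1])
    ((le_max_left _ _).trans hR)
  linarith

end

/-! ### An `L²` bound for cosine transforms with exponential weight. -/

section

theorem integrableOn_exp_mul_cos {τ : ℝ} {u : ℂ} (h : |u.im| < τ) :
    IntegrableOn (fun t : ℝ => Complex.exp (-τ * t) * Complex.cos (u * t)) (Ioi 0) ∧
    ∫ t : ℝ in Ioi 0, Complex.exp (-τ * t) * Complex.cos (u * t) = τ / (τ ^ 2 + u ^ 2) := by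
  obtain ⟨h1, h2⟩ := abs_lt.1 h
  have ha : (-τ + u * Complex.I : ℂ).re < 0 := by simp; linarith
  have hb : (-τ - u * Complex.I : ℂ).re < 0 := by simp; linarith
  have ha0 : (-τ + u * Complex.I : ℂ) ≠ 0 := fun h => by rw [h] at ha; simp at ha
  have hb0 : (-τ - u * Complex.I : ℂ) ≠ 0 := fun h => by rw [h] at hb; simp at hb
  have e : (fun t : ℝ => Complex.exp (-τ * t) * Complex.cos (u * t)) = fun t : ℝ =>
      (1 / 2 : ℂ) * (Complex.exp ((-τ + u * Complex.I) * t) +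
        Complex.exp ((-τ - u * Complex.I) * t)) := by
    funext t
    rw [Complex.cos, add_mul, sub_mul, sub_eq_add_neg, Complex.exp_add, Complex.exp_add]
    ring_nf
  have i1 := integrableOn_exp_mul_complex_Ioi ha 0
  have i2 := integrableOn_exp_mul_complex_Ioi hb 0
  have hsum := i1.add i2
  constructor
  · rw [e]; exact hsum.const_mul _
  · rw [e, integral_const_mul, integral_add i1 i2, integral_exp_mul_complex_Ioi ha,
      integral_exp_mul_complex_Ioi hb]
    have : (τ ^ 2 + u ^ 2 : ℂ) = (-τ + u * Complex.I) * (-τ - u * Complex.I) := by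
      ring_nf; rw [Complex.I_sq]; ring
    rw [this]
    simp only [Complex.ofReal_zero, mul_zero, Complex.exp_zero]
    field_simp
    ring

theorem integrable_poisson {τ : ℝ} (hτ : 0 < τ) (c : ℝ) :
    Integrable (fun s : ℝ => τ / (τ ^ 2 + (s + c) ^ 2)) ∧
      ∫ s : ℝ, τ / (τ ^ 2 + (s + c) ^ 2) = Real.pi := by
  have e : (fun s : ℝ => τ / (τ ^ 2 + (s + c) ^ 2)) =
      fun s : ℝ => (fun r : ℝ => (fun y : ℝ => τ⁻¹ * (1 + y ^ 2)⁻¹) (r / τ)) (s + c) := by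
    funext s
    simp only
    field_simp
  rw [e]
  constructor
  · exact ((integrable_inv_one_add_sq.const_mul τ⁻¹).comp_div hτ.ne').comp_add_right c
  · rw [integral_add_right_eq_self (fun r : ℝ => (fun y : ℝ => τ⁻¹ * (1 + y ^ 2)⁻¹) (r / τ)),
      Measure.integral_comp_div (fun y : ℝ => τ⁻¹ * (1 + y ^ 2)⁻¹), integral_const_mul,
      integral_univ_inv_one_add_sq, abs_of_pos hτ, smul_eq_mul]
    field_simp

/-- The finite measure `e^{-τt} dt` on the half-line. -/
def expMeasure (τ : ℝ) : Measure ℝ :=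
  (volume.restrict (Ioi 0)).withDensity fun t => ((Real.exp (-τ * t)).toNNReal : ENNReal)

theorem integrable_expMeasure_iff {τ : ℝ} {f : ℝ → ℂ} :
    Integrable f (expMeasure τ) ↔
      IntegrableOn (fun t : ℝ => Complex.exp (-τ * t) * f t) (Ioi 0) := by
  rw [expMeasure, integrable_withDensity_iff_integrable_smul (by fun_prop)]
  refine integrable_congr (Eventually.of_forall fun t => ?_)
  simp [NNReal.smul_def, Real.coe_toNNReal _ (Real.exp_pos _).le]

theorem integral_expMeasure {τ : ℝ} (f : ℝ → ℂ) :
    ∫ t, f t ∂(expMeasure τ) = ∫ t : ℝ in Ioi 0, Complex.exp (-τ * t) * f t := by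
  rw [expMeasure, integral_withDensity_eq_integral_smul (by fun_prop)]
  congr 1
  funext t
  simp [NNReal.smul_def, Real.coe_toNNReal _ (Real.exp_pos _).le]

theorem isFiniteMeasure_expMeasure {τ : ℝ} (hτ : 0 < τ) : IsFiniteMeasure (expMeasure τ) := by
  have h : Integrable (fun _ : ℝ => (1 : ℂ)) (expMeasure τ) := by
    rw [integrable_expMeasure_iff]
    have := (integrableOn_exp_mul_cos (τ := τ) (u := 0) (by simpa using hτ)).1
    simpa using this
  rwa [integrable_const_iff_isFiniteMeasure one_ne_zero] at h

theorem integral_cos_mul_cos_expMeasure {τ : ℝ} (hτ : 0 < τ) (s r : ℝ) :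
    ∫ t, Complex.cos (s * t) * Complex.cos (r * t) ∂(expMeasure τ) =
      ((τ / (τ ^ 2 + (s + r) ^ 2) + τ / (τ ^ 2 + (s - r) ^ 2)) / 2 : ℝ) := by
  have h1 := integrableOn_exp_mul_cos (τ := τ) (u := ((s + r : ℝ) : ℂ)) (by simpa using hτ)
  have h2 := integrableOn_exp_mul_cos (τ := τ) (u := ((s - r : ℝ) : ℂ)) (by simpa using hτ)
  rw [integral_expMeasure]
  have e : (fun t : ℝ => Complex.exp (-τ * t) * (Complex.cos (s * t) * Complex.cos (r * t))) =
      fun t : ℝ => (1 / 2 : ℂ) * (Complex.exp (-τ * t) * Complex.cos ((s + r : ℝ) * t) +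
        Complex.exp (-τ * t) * Complex.cos ((s - r : ℝ) * t)) := by
    funext t
    push_cast
    rw [add_mul, sub_mul, Complex.cos_add, Complex.cos_sub]
    ring
  rw [e, integral_const_mul, integral_add h1.1 h2.1, h1.2, h2.2]
  push_cast
  ring

/-- An `L²` bound for the cosine transform on the half-line with exponential weight. -/
theorem integral_norm_cosTransform_sq_le {τ : ℝ} (hτ : 0 < τ) {q : ℝ → ℂ} (hq : Integrable q)
    (hq2 : Integrable fun s => ‖q s‖ ^ 2) :
    ∫ t, ‖∫ s : ℝ, q s * Complex.cos (s * t)‖ ^ 2 ∂(expMeasure τ) ≤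
      Real.pi * ∫ s, ‖q s‖ ^ 2 := by
  have := isFiniteMeasure_expMeasure hτ
  have cosb : ∀ s t : ℝ, ‖Complex.cos (s * t)‖ ≤ 1 := fun s t => by
    rw [← Complex.ofReal_mul, ← Complex.ofReal_cos, Complex.norm_real, Real.norm_eq_abs]
    exact Real.abs_cos_le_one _
  let G : ℝ → ℝ × ℝ → ℂ := fun t p =>
    (q p.1 * (starRingEnd ℂ) (q p.2)) * (Complex.cos (p.1 * t) * Complex.cos (p.2 * t))
  have hqq : Integrable (fun p : ℝ × ℝ => q p.1 * (starRingEnd ℂ) (q p.2)) (volume.prod volume) :=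
    hq.mul_prod ((RCLike.conjLIE (K := ℂ)).toContinuousLinearEquiv.toContinuousLinearMap.integrable_comp hq)
  have hG : Integrable (Function.uncurry G) ((expMeasure τ).prod (volume.prod volume)) := by
    have h1 : Integrable (fun z : ℝ × (ℝ × ℝ) => (1 : ℂ) * (q z.2.1 * (starRingEnd ℂ) (q z.2.2)))
        ((expMeasure τ).prod (volume.prod volume)) := (integrable_const (1 : ℂ)).mul_prod hqq
    simp only [one_mul] at h1
    refine h1.mul_bdd (c := 1) (Continuous.aestronglyMeasurable (by fun_prop))
      (Eventually.of_forall fun z => ?_)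
    rw [norm_mul]
    exact mul_le_one₀ (cosb _ _) (norm_nonneg _) (cosb _ _)
  have h1 : ∀ t : ℝ, ((‖∫ s : ℝ, q s * Complex.cos (s * t)‖ ^ 2 : ℝ) : ℂ)
      = ∫ p, G t p ∂(volume.prod volume) := by
    intro t
    have e : ∀ p : ℝ × ℝ, G t p = (q p.1 * Complex.cos (p.1 * t)) *
        (starRingEnd ℂ) (q p.2 * Complex.cos (p.2 * t)) := by
      intro p
      simp only [G, map_mul, ← Complex.cos_conj, Complex.conj_ofReal]
      ring
    simp_rw [e]
    rw [integral_prod_mul (fun s : ℝ => q s * Complex.cos (s * t))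
      (fun s : ℝ => (starRingEnd ℂ) (q s * Complex.cos (s * t))), integral_conj,
      Complex.mul_conj, Complex.normSq_eq_norm_sq]
  -- The squared modulus is a double integral in `(s, r)`. Integrating in `t` first produces this
  -- symmetric Poisson kernel, whose mass in each variable is `π`.
  let Pk : ℝ → ℝ → ℝ := fun s r => (τ / (τ ^ 2 + (s + r) ^ 2) + τ / (τ ^ 2 + (s - r) ^ 2)) / 2
  have hPk0 : ∀ s r, 0 ≤ Pk s r := fun s r => by simp only [Pk]; positivity
  have hPksymm : ∀ s r, Pk s r = Pk r s := fun s r => by simp only [Pk]; ring_nf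
  have hPk : ∀ s, Integrable (Pk s) ∧ ∫ r, Pk s r = Real.pi := by
    intro s
    obtain ⟨a1, a2⟩ := integrable_poisson hτ s
    obtain ⟨b1, b2⟩ := integrable_poisson hτ (-s)
    have e : Pk s = fun r => (τ / (τ ^ 2 + (r + s) ^ 2) + τ / (τ ^ 2 + (r + -s) ^ 2)) / 2 := by
      funext r; simp only [Pk]; ring_nf
    rw [e]
    refine ⟨(a1.add b1).div_const 2, ?_⟩
    rw [integral_div, integral_add a1 b1, a2, b2]; ring
  have hPkc : Continuous (Function.uncurry Pk) := by
    simp only [Pk, Function.uncurry_def]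
    have : ∀ x : ℝ, τ ^ 2 + x ^ 2 ≠ 0 := fun x => by positivity
    fun_prop (disch := intro; apply this)
  have h2 : ((∫ t, ‖∫ s : ℝ, q s * Complex.cos (s * t)‖ ^ 2 ∂(expMeasure τ) : ℝ) : ℂ) =
      ∫ p : ℝ × ℝ, (q p.1 * (starRingEnd ℂ) (q p.2)) * (Pk p.1 p.2 : ℂ) := by
    rw [← integral_complex_ofReal]
    simp_rw [h1]
    rw [integral_integral_swap hG]
    refine integral_congr_ae (Eventually.of_forall fun p => ?_)
    simp only [G]
    rw [integral_const_mul, integral_cos_mul_cos_expMeasure hτ]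
  have hF : Integrable (fun p : ℝ × ℝ => ‖q p.1‖ ^ 2 * Pk p.1 p.2) (volume.prod volume) := by
    rw [integrable_prod_iff]
    · refine ⟨Eventually.of_forall fun s => (hPk s).1.const_mul (‖q s‖ ^ 2), ?_⟩
      have : (fun s : ℝ => ∫ r : ℝ, ‖‖q s‖ ^ 2 * Pk s r‖) = fun s => ‖q s‖ ^ 2 * Real.pi := by
        funext s
        simp_rw [norm_mul, norm_pow, norm_norm, Real.norm_of_nonneg (hPk0 _ _)]
        rw [integral_const_mul, (hPk s).2]
      rw [this]
      exact hq2.mul_const _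
    · exact (hq2.1.comp_fst).mul hPkc.aestronglyMeasurable
  have hF2 : ∫ p : ℝ × ℝ, ‖q p.1‖ ^ 2 * Pk p.1 p.2 = Real.pi * ∫ s, ‖q s‖ ^ 2 := by
    rw [Measure.volume_eq_prod, integral_prod _ hF]
    simp_rw [integral_const_mul, (hPk _).2]
    rw [integral_mul_const, mul_comm]
  have hF' : Integrable (fun p : ℝ × ℝ => ‖q p.2‖ ^ 2 * Pk p.1 p.2) (volume.prod volume) := by
    have := hF.swap
    refine this.congr (Eventually.of_forall fun p => ?_)
    simp only [Function.comp, Prod.fst_swap, Prod.snd_swap, hPksymm p.2 p.1]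
  have hF2' : ∫ p : ℝ × ℝ, ‖q p.2‖ ^ 2 * Pk p.1 p.2 = Real.pi * ∫ s, ‖q s‖ ^ 2 := by
    rw [← hF2, Measure.volume_eq_prod, ← integral_prod_swap]
    simp only [Prod.fst_swap, Prod.snd_swap]
    refine integral_congr_ae (Eventually.of_forall fun p => ?_)
    simp only [hPksymm p.2 p.1]
  -- Schur's test: `|q(s) q(r)|` is at most the mean of the squares, and each square meets a kernel
  -- of mass `π`. The resulting bound is independent of `τ`.
  have h3 : ‖∫ p : ℝ × ℝ, (q p.1 * (starRingEnd ℂ) (q p.2)) * (Pk p.1 p.2 : ℂ)‖ ≤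
      ∫ p : ℝ × ℝ, (‖q p.1‖ ^ 2 * Pk p.1 p.2 + ‖q p.2‖ ^ 2 * Pk p.1 p.2) / 2 := by
    refine norm_integral_le_of_norm_le ((hF.add hF').div_const 2) (Eventually.of_forall fun p => ?_)
    rw [norm_mul, norm_mul, RCLike.norm_conj, Complex.norm_real, Real.norm_of_nonneg (hPk0 _ _)]
    nlinarith [hPk0 p.1 p.2, mul_nonneg (hPk0 p.1 p.2) (sq_nonneg (‖q p.1‖ - ‖q p.2‖))]
  have hadd := integral_add hF hF'
  rw [← Measure.volume_eq_prod] at hadd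
  rw [integral_div, hadd] at h3
  rw [← h2, Complex.norm_real, hF2, hF2'] at h3
  refine (le_abs_self _).trans (h3.trans_eq ?_)
  ring

end

/-! ### Poisson's formula and the Laplace transform of a cosine integral. -/

section

/-- With `c = iτ`, the quotient `(N(k) - N(c)) / ((k - c)(k + c))` is analytic in the half-plane and
`O(|k|⁻²)`, so its integral tends to zero by Cauchy. What is left is `N(c)` times the mass of the
Poisson kernel. -/
theorem tendsto_poisson_integral {N : ℂ → ℂ} (hd : DifferentiableOn ℂ N {k | 0 < k.im})
    (hc : ContinuousOn N {k | 0 ≤ k.im ∧ k ≠ 0}) {C : ℝ}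
    (hb : ∀ k : ℂ, 0 ≤ k.im → k ≠ 0 → ‖N k‖ ≤ C) {τ : ℝ} (hτ : 0 < τ) :
    Tendsto (fun R : ℝ => ∫ s in (-R)..R, N s * (τ / (τ ^ 2 + s ^ 2) : ℝ)) atTop
      (𝓝 (Real.pi * N (τ * Complex.I))) := by
  set c : ℂ := τ * Complex.I with hcdef
  have him : c.im = τ := by simp [hcdef]
  have hC : 0 ≤ C := (norm_nonneg _).trans (hb c (by rw [him]; exact hτ.le) (fun h => by
    rw [h] at him; simp at him; exact hτ.ne him))
  have hcU : {k : ℂ | 0 < k.im} ∈ 𝓝 c :=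
    (isOpen_lt continuous_const Complex.continuous_im).mem_nhds (by simpa [him] using hτ)
  have hcV : {k : ℂ | 0 ≤ k.im ∧ k ≠ 0} ∈ 𝓝 c := by
    filter_upwards [hcU] with k hk
    exact ⟨le_of_lt hk, fun h => by simp [h] at hk⟩
  have hplus : ∀ k : ℂ, 0 ≤ k.im → τ ≤ ‖k + c‖ := fun k hk => by
    refine le_trans ?_ (Complex.abs_im_le_norm _)
    rw [Complex.add_im, him]
    exact le_trans (by linarith) (le_abs_self _)
  have hplus0 : ∀ k : ℂ, 0 ≤ k.im → k + c ≠ 0 := fun k hk h => by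
    have := hplus k hk; rw [h, norm_zero] at this; linarith
  -- `dslope` supplies the value at the removable singularity `c`.
  let G : ℂ → ℂ := fun k => dslope N c k / (k + c)
  have hGne : ∀ k : ℂ, k ≠ c → G k = (N k - N c) / (k - c) / (k + c) := fun k hk => by
    simp only [G]; rw [dslope_of_ne _ hk, slope_def_field]
  have hG := tendsto_integral_of_upperHalfPlane (G := G) (C := 2 * C / (τ / 2) / τ)
    (ε₀ := τ / 2)
    (((Complex.differentiableOn_dslope hcU).2 hd).div (by fun_prop)
      fun k hk => hplus0 k (le_of_lt hk))
    (((continuousOn_dslope hcV).2 ⟨hc, hd.differentiableAt hcU⟩).div (by fun_prop)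
      fun k hk => hplus0 k hk.1) (by positivity)
    (fun k hk0 hk1 hk => by
      have h1 : τ / 2 ≤ ‖k - c‖ := by
        refine le_trans ?_ (Complex.abs_im_le_norm _)
        rw [Complex.sub_im, him, abs_sub_comm]
        exact le_trans (by linarith) (le_abs_self _)
      have hne : k ≠ c := fun h => by rw [h, sub_self, norm_zero] at h1; linarith
      rw [hGne k hne, norm_div, norm_div]
      have h2 := hplus k hk0
      have h3 : ‖N k - N c‖ ≤ 2 * C := by
        refine (norm_sub_le _ _).trans ?_
        have := hb k hk0 hk
        have := hb c (by rw [him]; exact hτ.le) (mem_of_mem_nhds hcV).2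
        linarith
      gcongr)
    (fun ε hε => by
      refine ⟨max (2 * τ) (8 * C / ε) + 1, fun k hk0 hkR => ?_⟩
      have hcn : ‖c‖ = τ := by simp [hcdef, abs_of_pos hτ]
      have k1 : 2 * τ ≤ ‖k‖ := by linarith [le_max_left (2 * τ) (8 * C / ε)]
      have k2 : 8 * C / ε ≤ ‖k‖ := by linarith [le_max_right (2 * τ) (8 * C / ε)]
      have kpos : 0 < ‖k‖ := by linarith
      have h1 : ‖k‖ / 2 ≤ ‖k - c‖ := by
        have := norm_sub_norm_le k c; rw [hcn] at this; linarith
      have h2 : ‖k‖ / 2 ≤ ‖k + c‖ := by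
        have := norm_sub_norm_le k (-c); rw [norm_neg, hcn, sub_neg_eq_add] at this; linarith
      have hne : k ≠ c := fun h => by rw [h, sub_self, norm_zero, hcn] at h1; linarith
      have hk : k ≠ 0 := norm_pos_iff.1 kpos
      rw [hGne k hne, norm_div, norm_div]
      have h3 : ‖N k - N c‖ ≤ 2 * C := by
        refine (norm_sub_le _ _).trans ?_
        have := hb k hk0 hk
        have := hb c (by rw [him]; exact hτ.le) (mem_of_mem_nhds hcV).2
        linarith
      calc ‖k‖ * (‖N k - N c‖ / ‖k - c‖ / ‖k + c‖) ≤ ‖k‖ * (2 * C / (‖k‖ / 2) / (‖k‖ / 2)) := by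
            gcongr
        _ = 8 * C / ‖k‖ := by field_simp; ring
        _ ≤ ε := by
            rw [div_le_iff₀ hε] at k2
            rw [div_le_iff₀ kpos]; linarith)
  have hP := integrable_poisson hτ 0
  simp only [add_zero] at hP
  have hP1 : Tendsto (fun R : ℝ => ∫ s in (-R)..R, τ / (τ ^ 2 + s ^ 2)) atTop (𝓝 Real.pi) := by
    rw [← hP.2]
    exact intervalIntegral_tendsto_integral hP.1 tendsto_neg_atTop_atBot tendsto_id
  have hP2 : Tendsto (fun R : ℝ => ((∫ s in (-R)..R, τ / (τ ^ 2 + s ^ 2) : ℝ) : ℂ)) atTop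
      (𝓝 (Real.pi : ℂ)) := (Complex.continuous_ofReal.tendsto _).comp hP1
  have hsum := (hG.const_mul (τ : ℂ)).add (hP2.mul_const (N c))
  rw [mul_zero, zero_add] at hsum
  refine hsum.congr fun R => ?_
  have hden : ∀ s : ℝ, ((τ : ℂ) ^ 2 + (s : ℂ) ^ 2) ≠ 0 := fun s => by
    have : τ ^ 2 + s ^ 2 ≠ 0 := by positivity
    exact_mod_cast this
  have hpt : ∀ s : ℝ, G s = (N s - N c) / (τ ^ 2 + s ^ 2) := fun s => by
    have hne : (s : ℂ) ≠ c := fun h => by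
      have := congrArg Complex.im h; rw [him] at this; simp at this; exact hτ.ne this
    rw [hGne _ hne, div_div]
    congr 1
    rw [hcdef]; ring_nf; rw [Complex.I_sq]; ring
  have hNm : AEStronglyMeasurable (fun s : ℝ => N s) volume := by
    have h1 : ContinuousOn (fun s : ℝ => N s) {0}ᶜ :=
      hc.comp (by fun_prop) fun s hs => ⟨by simp, by simpa using hs⟩
    have h2 := h1.aestronglyMeasurable (μ := volume) (measurableSet_singleton (0 : ℝ)).compl
    rwa [Measure.restrict_eq_self_of_ae_mem] at h2
    simp [ae_iff, measure_singleton]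
  have hNi : ∀ a b : ℝ, IntervalIntegrable (fun s : ℝ => N s) volume a b := fun a b => by
    refine (intervalIntegrable_const (c := C)).mono_fun hNm.restrict ?_
    have hne : ∀ᵐ t : ℝ, t ≠ 0 := by simp [ae_iff, measure_singleton]
    filter_upwards [ae_restrict_of_ae hne] with s hs
    rw [Real.norm_of_nonneg hC]
    exact hb _ (by simp) (by simpa using hs)
  have hinv : Continuous fun s : ℝ => (((τ / (τ ^ 2 + s ^ 2) : ℝ)) : ℂ) := by
    have : ∀ s : ℝ, τ ^ 2 + s ^ 2 ≠ 0 := fun s => by positivity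
    fun_prop (disch := exact this)
  have e1 : ∀ s : ℝ, (τ : ℂ) * G s = N s * (τ / (τ ^ 2 + s ^ 2) : ℝ) -
      (τ / (τ ^ 2 + s ^ 2) : ℝ) * N c := fun s => by
    rw [hpt]; push_cast
    have := hden s
    field_simp
  rw [← intervalIntegral.integral_const_mul]
  simp_rw [e1]
  have hi2 : IntervalIntegrable (fun s : ℝ => (((τ / (τ ^ 2 + s ^ 2) : ℝ)) : ℂ) * N c)
      volume (-R) R := (hinv.mul continuous_const).intervalIntegrable _ _
  rw [intervalIntegral.integral_sub ((hNi _ _).mul_continuousOn hinv.continuousOn) hi2,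
    intervalIntegral.integral_mul_const,
    intervalIntegral.integral_ofReal]
  ring

/-- Laplace transform of the conditionally convergent cosine integral of the boundary values of a
function analytic in the upper half-plane. -/
theorem laplace_of_tendsto_cosTransform {N : ℂ → ℂ} (hd : DifferentiableOn ℂ N {k | 0 < k.im})
    (hc : ContinuousOn N {k | 0 ≤ k.im ∧ k ≠ 0}) {C : ℝ}
    (hb : ∀ k : ℂ, 0 ≤ k.im → k ≠ 0 → ‖N k‖ ≤ C / (1 + ‖k‖)) {b : ℝ → ℂ}
    (hlim : ∀ t : ℝ, 0 ≤ t → Tendsto (fun R : ℝ => Complex.I / Real.pi *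
      ∫ s in (-R)..R, N s * Complex.cos (s * t)) atTop (𝓝 (b t))) {τ : ℝ} (hτ : 0 < τ) :
    IntegrableOn (fun t : ℝ => Complex.exp (-τ * t) * b t) (Ioi 0) ∧
    ∫ t : ℝ in Ioi 0, Complex.exp (-τ * t) * b t = Complex.I * N (τ * Complex.I) := by
  have hC : 0 ≤ C := by
    have := (norm_nonneg _).trans (hb Complex.I (by simp) Complex.I_ne_zero)
    have h2 : 0 < 1 + ‖Complex.I‖ := by positivity
    have h3 := mul_nonneg this h2.le
    rwa [div_mul_cancel₀ _ h2.ne'] at h3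
  have hb' : ∀ k : ℂ, 0 ≤ k.im → k ≠ 0 → ‖N k‖ ≤ C := fun k h0 h1 =>
    (hb k h0 h1).trans (div_le_self hC (by linarith [norm_nonneg k]))
  have hfin := isFiniteMeasure_expMeasure hτ
  have hne : ∀ᵐ t : ℝ, t ≠ 0 := by simp [ae_iff, measure_singleton]
  have hNm : AEStronglyMeasurable (fun s : ℝ => N s) volume := by
    have h1 : ContinuousOn (fun s : ℝ => N s) {0}ᶜ :=
      hc.comp (by fun_prop) fun s hs => ⟨by simp, by simpa using hs⟩
    have h2 := h1.aestronglyMeasurable (μ := volume) (measurableSet_singleton (0 : ℝ)).compl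
    rwa [Measure.restrict_eq_self_of_ae_mem] at h2
    simp [ae_iff, measure_singleton]
  have hNi : ∀ a b : ℝ, IntervalIntegrable (fun s : ℝ => N s) volume a b := fun a b => by
    refine (intervalIntegrable_const (c := C)).mono_fun hNm.restrict ?_
    filter_upwards [ae_restrict_of_ae hne] with s hs
    rw [Real.norm_of_nonneg hC]
    exact hb' _ (by simp) (by simpa using hs)
  have hN2 : Integrable fun s : ℝ => ‖N s‖ ^ 2 := by
    refine (integrable_inv_one_add_sq.const_mul (C ^ 2)).mono' (hNm.norm.pow 2) ?_
    filter_upwards [hne] with s hs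
    rw [norm_pow, norm_norm, ← div_eq_mul_inv]
    have h1 := hb s (by simp) (by simpa using hs)
    rw [Complex.norm_real, Real.norm_eq_abs] at h1
    calc ‖N s‖ ^ 2 ≤ (C / (1 + |s|)) ^ 2 := by gcongr
      _ = C ^ 2 / (1 + |s|) ^ 2 := by rw [div_pow]
      _ ≤ C ^ 2 / (1 + s ^ 2) := by
        gcongr
        nlinarith [abs_nonneg s, sq_abs s]
  have cosb : ∀ s t : ℝ, ‖Complex.cos (s * t)‖ ≤ 1 := fun s t => by
    rw [← Complex.ofReal_mul, ← Complex.ofReal_cos, Complex.norm_real, Real.norm_eq_abs]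
    exact Real.abs_cos_le_one _
  -- These truncations are only known to converge pointwise. Convergence in `L²` of the weighted
  -- measure is added below, so that the Laplace transform can be exchanged with the limit.
  let B : ℕ → ℝ → ℂ := fun n t => Complex.I / Real.pi *
    ∫ s in (-(n : ℝ))..n, N s * Complex.cos (s * t)
  have hBc : ∀ n, Continuous (B n) := fun n => by
    refine continuous_const.mul ?_
    refine intervalIntegral.continuous_of_dominated_interval (bound := fun s => ‖N s‖)
      (fun t => ?_) (fun t => Eventually.of_forall fun s _ => ?_) (hNi _ _).norm
      (Eventually.of_forall fun s _ => by fun_prop)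
    · exact hNm.restrict.mul (Continuous.aestronglyMeasurable (by fun_prop))
    · rw [norm_mul]; exact mul_le_of_le_one_right (norm_nonneg _) (cosb _ _)
  have hBb : ∀ n, ∃ D : ℝ, ∀ t, ‖B n t‖ ≤ D := fun n => by
    refine ⟨‖Complex.I / Real.pi‖ * ∫ s in (-(n : ℝ))..n, ‖N s‖, fun t => ?_⟩
    rw [norm_mul]
    gcongr
    refine intervalIntegral.norm_integral_le_of_norm_le (by linarith [(n.cast_nonneg : (0:ℝ) ≤ n)])
      (Eventually.of_forall fun s _ => ?_) (hNi _ _).norm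
    rw [norm_mul]; exact mul_le_of_le_one_right (norm_nonneg _) (cosb _ _)
  have hBint : ∀ n, Integrable (B n) (expMeasure τ) := fun n => by
    obtain ⟨D, hD⟩ := hBb n
    exact Integrable.of_bound (hBc n).aestronglyMeasurable D (Eventually.of_forall hD)
  have hBlim : ∀ t : ℝ, 0 ≤ t → Tendsto (fun n => B n t) atTop (𝓝 (b t)) := fun t ht =>
    (hlim t ht).comp tendsto_natCast_atTop_atTop
  have hae : ∀ᵐ t ∂(expMeasure τ), t ∈ Ioi (0 : ℝ) := by
    refine (withDensity_absolutelyContinuous _ _).ae_le ?_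
    exact ae_restrict_mem measurableSet_Ioi
  have hBae : ∀ᵐ t ∂(expMeasure τ), Tendsto (fun n => B n t) atTop (𝓝 (b t)) := by
    filter_upwards [hae] with t ht using hBlim t (le_of_lt ht)
  have hbm : AEStronglyMeasurable b (expMeasure τ) :=
    aestronglyMeasurable_of_tendsto_ae atTop (fun n => (hBc n).aestronglyMeasurable) hBae
  -- the tails of the square integral
  let e : ℕ → ℝ := fun n => (∫ s : ℝ, ‖N s‖ ^ 2) - ∫ s in (-(n : ℝ))..n, ‖N s‖ ^ 2
  have he : Tendsto e atTop (𝓝 0) := by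
    have h1 : Tendsto (fun n : ℕ => ∫ s in (-(n : ℝ))..n, ‖N s‖ ^ 2) atTop
        (𝓝 (∫ s : ℝ, ‖N s‖ ^ 2)) :=
      intervalIntegral_tendsto_integral hN2
        (tendsto_neg_atTop_atBot.comp tendsto_natCast_atTop_atTop) tendsto_natCast_atTop_atTop
    have h2 := (tendsto_const_nhds (x := ∫ s : ℝ, ‖N s‖ ^ 2)).sub h1
    rwa [sub_self] at h2
  -- The difference of two truncations is the cosine transform of `N` cut to `n < |s| ≤ m` up to
  -- endpoints, so the `L²` bound gives a Cauchy estimate by the tail `e n`.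
  have hdiff : ∀ n m : ℕ, n ≤ m → eLpNorm (B m - B n) 2 (expMeasure τ) ≤
      ENNReal.ofReal (√(e n)) := by
    intro n m hnm
    have hnm' : (n : ℝ) ≤ m := by exact_mod_cast hnm
    have hn0 : (0 : ℝ) ≤ n := n.cast_nonneg
    let S : Set ℝ := Ioc (-(m : ℝ)) m \ Ioc (-(n : ℝ)) n
    have hsub : Ioc (-(n : ℝ)) n ⊆ Ioc (-(m : ℝ)) m := Ioc_subset_Ioc (by linarith) hnm'
    have hS : MeasurableSet S := measurableSet_Ioc.diff measurableSet_Ioc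
    let q : ℝ → ℂ := S.indicator fun s => N s
    have hq : Integrable q := by
      rw [integrable_indicator_iff hS]
      have := (hNi (-m) m).1
      exact this.mono_set sdiff_subset
    have hq2e : (fun s => ‖q s‖ ^ 2) = S.indicator fun s : ℝ => ‖N s‖ ^ 2 := by
      funext s
      by_cases hs : s ∈ S <;> simp [q, hs]
    have hq2 : Integrable fun s => ‖q s‖ ^ 2 := by
      rw [hq2e]; exact hN2.indicator hS
    have hq2i : ∫ s, ‖q s‖ ^ 2 ≤ e n := by
      rw [hq2e, integral_indicator hS, setIntegral_sdiff measurableSet_Ioc hN2.integrableOn hsub]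
      simp only [e]
      rw [intervalIntegral.integral_of_le (by linarith)]
      exact sub_le_sub_right (setIntegral_le_integral hN2
        (Eventually.of_forall fun s => sq_nonneg ‖N s‖)) _
    have hdiffeq : ∀ t, (B m - B n) t = Complex.I / Real.pi *
        ∫ s : ℝ, q s * Complex.cos (s * t) := fun t => by
      have e1 : (fun s : ℝ => q s * Complex.cos (s * t)) =
          S.indicator fun s : ℝ => N s * Complex.cos (s * t) := by
        funext s
        by_cases hs : s ∈ S <;> simp [q, hs]
      have hi : IntegrableOn (fun s : ℝ => N s * Complex.cos (s * t)) (Ioc (-(m : ℝ)) m) :=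
        ((hNi (-m) m).mul_continuousOn (by fun_prop)).1
      rw [e1, integral_indicator hS, setIntegral_sdiff measurableSet_Ioc hi hsub, Pi.sub_apply,
        mul_sub]
      simp only [B]
      rw [intervalIntegral.integral_of_le (by linarith),
        intervalIntegral.integral_of_le (by linarith)]
    have hL2 := integral_norm_cosTransform_sq_le hτ hq hq2
    have hmem : MemLp (B m - B n) 2 (expMeasure τ) := by
      obtain ⟨D, hD⟩ := hBb m
      obtain ⟨D', hD'⟩ := hBb n
      exact MemLp.of_bound ((hBc m).sub (hBc n)).aestronglyMeasurable (D + D')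
        (Eventually.of_forall fun t => (norm_sub_le _ _).trans (add_le_add (hD t) (hD' t)))
    rw [hmem.eLpNorm_eq_integral_rpow_norm (by norm_num) (by norm_num)]
    refine ENNReal.ofReal_le_ofReal ?_
    simp only [ENNReal.toReal_ofNat, Real.rpow_ofNat]
    rw [Real.sqrt_eq_rpow, one_div]
    refine Real.rpow_le_rpow (integral_nonneg fun t => by positivity) ?_ (by positivity)
    simp_rw [hdiffeq, norm_mul, mul_pow]
    rw [integral_const_mul, norm_div, Complex.norm_I, Complex.norm_real,
      Real.norm_of_nonneg Real.pi_pos.le]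
    have hpi : (1 / Real.pi) ^ 2 * Real.pi ≤ 1 := by
      have h1 := Real.pi_gt_three
      rw [div_pow, one_pow, div_mul_eq_mul_div, one_mul, div_le_one (by positivity)]
      nlinarith
    have hq0 : 0 ≤ ∫ s, ‖q s‖ ^ 2 := integral_nonneg fun s => by positivity
    calc (1 / Real.pi) ^ 2 * ∫ t, ‖∫ s : ℝ, q s * Complex.cos (s * t)‖ ^ 2 ∂(expMeasure τ)
        ≤ (1 / Real.pi) ^ 2 * (Real.pi * ∫ s, ‖q s‖ ^ 2) := by gcongr
      _ = ((1 / Real.pi) ^ 2 * Real.pi) * ∫ s, ‖q s‖ ^ 2 := by ring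
      _ ≤ 1 * ∫ s, ‖q s‖ ^ 2 := by gcongr
      _ ≤ e n := by rw [one_mul]; exact hq2i
  -- Fatou's lemma in `m` carries the Cauchy estimate over to the pointwise limit `b`.
  have hfatou : ∀ n : ℕ, eLpNorm (B n - b) 2 (expMeasure τ) ≤ ENNReal.ofReal (√(e n)) := by
    intro n
    rw [eLpNorm_sub_comm]
    refine (Lp.eLpNorm_lim_le_liminf_eLpNorm (f := fun m => B m - B n)
      (fun m => ((hBc m).sub (hBc n)).aestronglyMeasurable) (b - B n) ?_).trans ?_
    · filter_upwards [hBae] with t ht using ht.sub_const _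
    · refine liminf_le_of_frequently_le' (Eventually.frequently ?_)
      filter_upwards [eventually_ge_atTop n] with m hm using hdiff n m hm
  -- The weighted measure is finite, so `L²` convergence implies `L¹` convergence and convergence of
  -- the integrals.
  have hL1 : Tendsto (fun n => eLpNorm (B n - b) 1 (expMeasure τ)) atTop (𝓝 0) := by
    have hle : ∀ n, eLpNorm (B n - b) 1 (expMeasure τ) ≤ ENNReal.ofReal (√(e n)) *
        (expMeasure τ) univ ^ (1 / (1 : ENNReal).toReal - 1 / (2 : ENNReal).toReal) := fun n =>
      (eLpNorm_le_eLpNorm_mul_rpow_measure_univ (q := 2) one_le_two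
        ((hBc n).aestronglyMeasurable.sub hbm)).trans (by gcongr; exact hfatou n)
    have hz : Tendsto (fun n => ENNReal.ofReal (√(e n)) *
        (expMeasure τ) univ ^ (1 / (1 : ENNReal).toReal - 1 / (2 : ENNReal).toReal)) atTop
        (𝓝 (0 * (expMeasure τ) univ ^
          (1 / (1 : ENNReal).toReal - 1 / (2 : ENNReal).toReal))) := by
      refine ENNReal.Tendsto.mul_const ?_ (Or.inr ?_)
      · have := (ENNReal.continuous_ofReal.comp Real.continuous_sqrt).tendsto 0
        simp only [Function.comp, Real.sqrt_zero, ENNReal.ofReal_zero] at this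
        exact this.comp he
      · exact ENNReal.rpow_ne_top_of_nonneg (by norm_num) (measure_ne_top _ _)
    rw [zero_mul] at hz
    exact tendsto_of_tendsto_of_tendsto_of_le_of_le tendsto_const_nhds hz (fun _ => zero_le)
      hle
  have hbint : Integrable b (expMeasure τ) := by
    have h1 : Integrable (B 0 - b) (expMeasure τ) := by
      have h2 : MemLp (B 0 - b) 2 (expMeasure τ) :=
        ⟨(hBc 0).aestronglyMeasurable.sub hbm, (hfatou 0).trans_lt ENNReal.ofReal_lt_top⟩
      exact h2.integrable (by norm_num)
    have := (hBint 0).sub h1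
    simpa using this
  refine ⟨integrable_expMeasure_iff.1 hbint, ?_⟩
  rw [← integral_expMeasure]
  have hconv := tendsto_integral_of_L1' b hbm (Eventually.of_forall hBint) hL1
  refine tendsto_nhds_unique hconv ?_
  -- By Fubini the Laplace transform of `B n` is a truncated Poisson integral of `N`, because `cos
  -- (s t)` has the transform `τ / (τ² + s²)`.
  have hpois := ((tendsto_poisson_integral hd hc hb' hτ).comp
    tendsto_natCast_atTop_atTop).const_mul (Complex.I / Real.pi)
  have hval : Complex.I / Real.pi * (Real.pi * N (τ * Complex.I)) = Complex.I * N (τ * Complex.I) := by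
    have : (Real.pi : ℂ) ≠ 0 := by exact_mod_cast Real.pi_ne_zero
    field_simp
  rw [hval] at hpois
  refine hpois.congr fun n => ?_
  simp only [B, Function.comp]
  rw [integral_const_mul]
  congr 1
  have hprod : Integrable (Function.uncurry fun (t s : ℝ) => N s * Complex.cos (s * t))
      ((expMeasure τ).prod (volume.restrict (uIoc (-(n : ℝ)) n))) := by
    have hNr : Integrable (fun s : ℝ => N s) (volume.restrict (uIoc (-(n : ℝ)) n)) :=
      (intervalIntegrable_iff.1 (hNi (-n) n))
    have h1 := (integrable_const (1 : ℂ) (μ := expMeasure τ)).mul_prod hNr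
    simp only [one_mul] at h1
    refine h1.mul_bdd (c := 1) (Continuous.aestronglyMeasurable (by fun_prop))
      (Eventually.of_forall fun z => cosb _ _)
  rw [← intervalIntegral_integral_swap (f := fun (s t : ℝ) => N s * Complex.cos (s * t))
    hprod.swap]
  refine intervalIntegral.integral_congr fun s _ => ?_
  rw [integral_const_mul]
  have := integral_cos_mul_cos_expMeasure hτ s 0
  simp only [Complex.ofReal_zero, zero_mul, Complex.cos_zero, mul_one, add_zero, sub_zero] at this
  rw [this]
  congr 2
  ring

end

/-! ### The Goursat problem for the transformation kernel. -/

section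

/-- `∫₀ˣ cos(κ r) dr`, that is `sin(κ x)/κ`. -/
def cosInt (κ : ℂ) (x : ℝ) : ℂ := ∫ r in (0)..x, Complex.cos (κ * r)

theorem cosInt_zero_left (x : ℝ) : cosInt 0 x = x := by simp [cosInt]

theorem cosInt_of_ne {κ : ℂ} (hκ : κ ≠ 0) (x : ℝ) : cosInt κ x = Complex.sin (κ * x) / κ := by
  have := integral_cos_mul_complex hκ 0 x
  simpa [cosInt] using this

theorem cosInt_zero_right (κ : ℂ) : cosInt κ 0 = 0 := by simp [cosInt]

theorem mul_cosInt (κ : ℂ) (x : ℝ) : κ * cosInt κ x = Complex.sin (κ * x) := by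
  by_cases hκ : κ = 0
  · simp [hκ]
  · rw [cosInt_of_ne hκ]; field_simp

theorem hasDerivAt_cosInt (κ : ℂ) (x : ℝ) : HasDerivAt (cosInt κ) (Complex.cos (κ * x)) x :=
  intervalIntegral.integral_hasDerivAt_right
    (Continuous.intervalIntegrable (by fun_prop) _ _)
    (Continuous.stronglyMeasurableAtFilter (by fun_prop) _ _) (Continuous.continuousAt (by fun_prop))

theorem continuous_cosInt (κ : ℂ) : Continuous (cosInt κ) :=
  continuous_iff_continuousAt.2 fun x => (hasDerivAt_cosInt κ x).continuousAt

theorem continuous_cosInt_uncurry : Continuous fun p : ℂ × ℝ => cosInt p.1 p.2 := by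
  refine intervalIntegral.continuous_parametric_intervalIntegral_of_continuous ?_ continuous_snd
  fun_prop

theorem hasDerivAt_ccos (κ : ℂ) (x : ℝ) :
    HasDerivAt (fun x : ℝ => Complex.cos (κ * x)) (-(κ ^ 2 * cosInt κ x)) x := by
  have h1 : HasDerivAt (fun z : ℂ => Complex.cos (κ * z)) (-Complex.sin (κ * x) * (κ * 1)) x :=
    ((hasDerivAt_id (x : ℂ)).const_mul κ).ccos
  have := h1.comp_ofReal
  convert this using 1
  rw [← mul_cosInt]; ring

theorem cosInt_neg (κ : ℂ) (x : ℝ) : cosInt κ (-x) = -cosInt κ x := by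
  by_cases hκ : κ = 0
  · simp [hκ, cosInt_zero_left]
  · rw [cosInt_of_ne hκ, cosInt_of_ne hκ]
    push_cast
    rw [mul_neg, Complex.sin_neg, neg_div]

theorem cosInt_sub (κ : ℂ) (x t : ℝ) :
    cosInt κ (x - t) = cosInt κ x * Complex.cos (κ * t) - Complex.cos (κ * x) * cosInt κ t := by
  by_cases hκ : κ = 0
  · simp [hκ, cosInt_zero_left]
  · simp only [cosInt_of_ne hκ]
    push_cast
    rw [mul_sub, Complex.sin_sub]
    field_simp

theorem cosInt_add (κ : ℂ) (x t : ℝ) :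
    cosInt κ (x + t) = cosInt κ x * Complex.cos (κ * t) + Complex.cos (κ * x) * cosInt κ t := by
  have := cosInt_sub κ x (-t)
  rw [sub_neg_eq_add, cosInt_neg] at this
  rw [this]
  push_cast
  rw [mul_neg, Complex.cos_neg]; ring

theorem integral_cos_symm (κ : ℂ) (s a : ℝ) :
    ∫ r in (s - a)..(s + a), Complex.cos (κ * r) = 2 * Complex.cos (κ * s) * cosInt κ a := by
  have h : ∀ x y : ℝ, IntervalIntegrable (fun r : ℝ => Complex.cos (κ * r)) volume x y :=
    fun x y => Continuous.intervalIntegrable (by fun_prop) _ _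
  have := intervalIntegral.integral_interval_sub_left (h 0 (s + a)) (h 0 (s - a))
  rw [← this]
  change cosInt κ (s + a) - cosInt κ (s - a) = _
  rw [cosInt_add, cosInt_sub]; ring

/-- Projection of the real line to `[-t, t]`. -/
def clamp (t s : ℝ) : ℝ := max (-t) (min t s)

theorem continuous_clamp : Continuous fun p : ℝ × ℝ => clamp p.1 p.2 := by
  unfold clamp; fun_prop

theorem clamp_mono (t : ℝ) : Monotone (clamp t) := fun a b h => by
  unfold clamp; gcongr

theorem clamp_neg {t : ℝ} (ht : 0 ≤ t) (s : ℝ) : clamp t (-s) = -clamp t s := by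
  unfold clamp
  rcases le_total t s with h | h
  · rcases le_total (-t) (-s) with h' | h' <;>
    simp [min_def, max_def] <;> grind
  · simp [min_def, max_def]; grind

theorem abs_clamp_le {t : ℝ} (ht : 0 ≤ t) (s : ℝ) : |clamp t s| ≤ t := by
  unfold clamp
  rw [abs_le]
  exact ⟨le_max_left _ _, max_le (by linarith) (min_le_left _ _)⟩

/-- Clamped limits amount to intersecting the interval of integration with `[-t, t]`; in indicator
form the order of integration can be exchanged later. -/
theorem integral_clamp {E : Type*} [NormedAddCommGroup E] [NormedSpace ℝ E] (u : ℝ → E) {t : ℝ}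
    (ht : 0 ≤ t) {α β : ℝ} (h : α ≤ β) :
    ∫ s in (clamp t α)..(clamp t β), u s = ∫ s in (-t)..t, (Ioc α β).indicator u s := by
  rw [intervalIntegral.integral_of_le (clamp_mono t h),
    intervalIntegral.integral_of_le (by linarith), setIntegral_indicator measurableSet_Ioc]
  congr 2
  ext s
  simp only [clamp, mem_Ioc, mem_inter_iff, max_lt_iff, min_lt_iff, le_max_iff, le_min_iff]
  constructor
  · rintro ⟨⟨h1, h2⟩, h3⟩; grind
  · rintro ⟨⟨h1, h2⟩, h3, h4⟩; grind

/-- The Goursat integral operator whose fixed point is the transformation kernel. -/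
def goursatOp (h b : ℝ) (q : ℝ → ℝ) (u : ℝ × ℝ → ℝ) (p : ℝ × ℝ) : ℝ :=
  -h + (1 / 2) * (∫ t in (0)..(max ((p.1 + p.2) / 2) 0), q t) +
    (1 / 2) * (∫ t in (0)..(max ((p.1 - p.2) / 2) 0), q t) +
    (1 / 2) * ∫ t in (0)..b, q t *
      ∫ s in (clamp t (p.2 - max (p.1 - t) 0))..(clamp t (p.2 + max (p.1 - t) 0)), u (t, s)

section Goursat

variable {h b : ℝ} {q : ℝ → ℝ}

theorem continuous_goursat_inner {u : ℝ × ℝ → ℝ} (hu : Continuous u) :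
    Continuous fun z : (ℝ × ℝ) × ℝ =>
      ∫ s in (clamp z.2 (z.1.2 - max (z.1.1 - z.2) 0))..(clamp z.2 (z.1.2 + max (z.1.1 - z.2) 0)),
        u (z.2, s) := by
  have hi : ∀ (t x y : ℝ), IntervalIntegrable (fun s => u (t, s)) volume x y :=
    fun t x y => Continuous.intervalIntegrable (by fun_prop) _ _
  have e : (fun z : (ℝ × ℝ) × ℝ =>
      ∫ s in (clamp z.2 (z.1.2 - max (z.1.1 - z.2) 0))..(clamp z.2 (z.1.2 + max (z.1.1 - z.2) 0)),
        u (z.2, s)) = fun z : (ℝ × ℝ) × ℝ =>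
      (∫ s in (0)..(clamp z.2 (z.1.2 + max (z.1.1 - z.2) 0)), u (z.2, s)) -
        ∫ s in (0)..(clamp z.2 (z.1.2 - max (z.1.1 - z.2) 0)), u (z.2, s) := by
    funext z
    rw [intervalIntegral.integral_interval_sub_left (hi _ _ _) (hi _ _ _)]
  rw [e]
  refine Continuous.sub ?_ ?_
  · refine intervalIntegral.continuous_parametric_intervalIntegral_of_continuous
      (f := fun (z : (ℝ × ℝ) × ℝ) s => u (z.2, s)) (by simp only [Function.uncurry_def]; fun_prop) ?_
    exact continuous_clamp.comp (by fun_prop : Continuous fun z : (ℝ × ℝ) × ℝ =>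
      (z.2, z.1.2 + max (z.1.1 - z.2) 0))
  · refine intervalIntegral.continuous_parametric_intervalIntegral_of_continuous
      (f := fun (z : (ℝ × ℝ) × ℝ) s => u (z.2, s)) (by simp only [Function.uncurry_def]; fun_prop) ?_
    exact continuous_clamp.comp (by fun_prop : Continuous fun z : (ℝ × ℝ) × ℝ =>
      (z.2, z.1.2 - max (z.1.1 - z.2) 0))

theorem continuous_goursatOp (hq : Continuous q) {u : ℝ × ℝ → ℝ} (hu : Continuous u) :
    Continuous (goursatOp h b q u) := by
  unfold goursatOp
  have hQ : Continuous fun y : ℝ => ∫ t in (0)..y, q t :=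
    intervalIntegral.continuous_primitive (fun _ _ => hq.intervalIntegrable _ _) 0
  refine ((continuous_const.add (continuous_const.mul (hQ.comp (by fun_prop)))).add
    (continuous_const.mul (hQ.comp (by fun_prop)))).add (continuous_const.mul ?_)
  refine intervalIntegral.continuous_parametric_intervalIntegral_of_continuous' ?_ 0 b
  exact (hq.comp continuous_snd).mul (continuous_goursat_inner hu)

/-- The operator commutes with `r ↦ -r`. By uniqueness its fixed point is then even in the second
variable. -/
theorem goursatOp_reflect (hb : 0 < b) {u : ℝ × ℝ → ℝ} (p : ℝ × ℝ) :
    goursatOp h b q (fun z => u (z.1, -z.2)) (p.1, -p.2) = goursatOp h b q u p := by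
  unfold goursatOp
  have : ∀ t ∈ uIcc 0 b, q t * (∫ s in (clamp t (-p.2 - max (p.1 - t) 0))..(clamp t (-p.2 + max (p.1 - t) 0)),
      u (t, -s)) = q t * ∫ s in (clamp t (p.2 - max (p.1 - t) 0))..(clamp t (p.2 + max (p.1 - t) 0)),
      u (t, s) := by
    intro t ht
    rw [uIcc_of_le hb.le] at ht
    rw [intervalIntegral.integral_comp_neg (fun s => u (t, s)), ← clamp_neg ht.1, ← clamp_neg ht.1]
    ring_nf
  simp only
  rw [intervalIntegral.integral_congr this, sub_neg_eq_add, ← sub_eq_add_neg]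
  ring

theorem goursat_bound (hb : 0 < b) (hq : Continuous q) (hq0 : ∀ t ≥ b, q t = 0) :
    ∃ Q : ℝ, 0 ≤ Q ∧ (∀ t ≥ 0, |q t| ≤ Q) ∧ ∀ y ≥ 0, |∫ t in (0)..y, q t| ≤ Q * b := by
  obtain ⟨Q, hQ⟩ := isCompact_Icc.exists_bound_of_continuousOn (s := Icc 0 b) hq.continuousOn
  have hQ0 : 0 ≤ Q := (norm_nonneg _).trans (hQ 0 ⟨le_rfl, hb.le⟩)
  have hQ1 : ∀ t ≥ 0, |q t| ≤ Q := fun t ht => by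
    rcases le_total t b with h | h
    · exact hQ t ⟨ht, h⟩
    · rw [hq0 t h, abs_zero]; exact hQ0
  refine ⟨Q, hQ0, hQ1, fun y hy => ?_⟩
  have key : ∀ z, 0 ≤ z → z ≤ b → |∫ t in (0)..z, q t| ≤ Q * b := fun z hz hzb => by
    have := intervalIntegral.norm_integral_le_of_norm_le_const (a := 0) (b := z) (C := Q) (f := q)
      fun t ht => hQ1 t (by rw [uIoc_of_le hz] at ht; exact ht.1.le)
    rw [sub_zero, abs_of_nonneg hz] at this
    exact this.trans (by gcongr)
  rcases le_total y b with h | h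
  · exact key y hy h
  · rw [← intervalIntegral.integral_add_adjacent_intervals (b := b) (hq.intervalIntegrable _ _)
      (hq.intervalIntegrable _ _)]
    have : ∫ t in b..y, q t = 0 := by
      rw [intervalIntegral.integral_congr (g := fun _ => 0), intervalIntegral.integral_zero]
      intro t ht
      rw [uIcc_of_le h] at ht
      exact hq0 t ht.1
    rw [this, add_zero]
    exact key b hb.le le_rfl

/-- The weight depends only on the first variable, cut off at `b`. Integrating it in `t` gains `1 /
l`, while `q` contributes `Q` and the inner interval has length at most `2 b`; the exponent `l = 2 Q
b + 1` absorbs both. -/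
theorem goursatOp_contraction (hb : 0 < b) (hq : Continuous q) {Q : ℝ} (hQ : 0 ≤ Q)
    (hqQ : ∀ t ≥ 0, |q t| ≤ Q) {u v : ℝ × ℝ → ℝ} (hu : Continuous u) (hv : Continuous v) {c : ℝ}
    (hc : 0 ≤ c)
    (huv : ∀ p : ℝ × ℝ, ‖u p - v p‖ ≤ c * Real.exp ((2 * Q * b + 1) * max 0 (min p.1 b)))
    (p : ℝ × ℝ) :
    ‖goursatOp h b q u p - goursatOp h b q v p‖ ≤
      c / 2 * Real.exp ((2 * Q * b + 1) * max 0 (min p.1 b)) := by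
  set l := 2 * Q * b + 1 with hl
  have hl0 : 0 < l := by positivity
  set m := max 0 (min p.1 b) with hm
  have hmb : m ≤ b := max_le hb.le (min_le_right _ _)
  have hm0 : 0 ≤ m := le_max_left _ _
  have hin : ∀ w : ℝ × ℝ → ℝ, Continuous w → Continuous fun t : ℝ => q t *
      ∫ s in (clamp t (p.2 - max (p.1 - t) 0))..(clamp t (p.2 + max (p.1 - t) 0)), w (t, s) :=
    fun w hw => hq.mul ((continuous_goursat_inner hw).comp (Continuous.prodMk_right p))
  -- For `t` in `(m, b]` one has `p.1 ≤ t`, the half-width `max (p.1 - t) 0` is zero and the inner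
  -- interval degenerates.
  have hinw : ∀ w : ℝ × ℝ → ℝ, Continuous w → ∫ t in (0)..b, q t *
      ∫ s in (clamp t (p.2 - max (p.1 - t) 0))..(clamp t (p.2 + max (p.1 - t) 0)), w (t, s) =
      ∫ t in (0)..m, q t *
      ∫ s in (clamp t (p.2 - max (p.1 - t) 0))..(clamp t (p.2 + max (p.1 - t) 0)), w (t, s) := by
    intro w hw
    rw [← intervalIntegral.integral_add_adjacent_intervals (b := m)
      ((hin w hw).intervalIntegrable _ _) ((hin w hw).intervalIntegrable _ _), add_eq_left,
      intervalIntegral.integral_of_le hmb]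
    refine setIntegral_eq_zero_of_forall_eq_zero fun t ht => ?_
    have : p.1 ≤ t := by
      by_contra hlt
      have h1 : m < min p.1 b ∨ m = b := by
        rcases lt_or_ge m b with h | h
        · left; exact lt_min (ht.1.trans (not_le.1 hlt)) h
        · right; exact le_antisymm hmb h
      rcases h1 with h1 | h1
      · exact absurd (le_max_right 0 (min p.1 b)) (not_le.2 h1)
      · rw [h1] at ht; exact absurd ht.1 (not_lt.2 ht.2)
    rw [max_eq_right (by linarith), sub_zero, add_zero, intervalIntegral.integral_same, mul_zero]
  unfold goursatOp
  rw [add_sub_add_left_eq_sub, ← mul_sub, norm_mul, hinw u hu, hinw v hv,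
    ← intervalIntegral.integral_sub ((hin u hu).intervalIntegrable _ _)
      ((hin v hv).intervalIntegrable _ _)]
  have h1 : ‖∫ t in (0)..m, (q t * (∫ s in (clamp t (p.2 - max (p.1 - t) 0))..(clamp t (p.2 + max (p.1 - t) 0)), u (t, s)) -
      q t * ∫ s in (clamp t (p.2 - max (p.1 - t) 0))..(clamp t (p.2 + max (p.1 - t) 0)), v (t, s))‖
      ≤ ∫ t in (0)..m, Q * (2 * b) * c * Real.exp (l * t) := by
    refine intervalIntegral.norm_integral_le_of_norm_le hm0 (Eventually.of_forall fun t ht => ?_)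
      (Continuous.intervalIntegrable (by fun_prop) _ _)
    have htb : t ≤ b := ht.2.trans hmb
    rw [← mul_sub, ← intervalIntegral.integral_sub
      (Continuous.intervalIntegrable (by fun_prop) _ _)
      (Continuous.intervalIntegrable (by fun_prop) _ _), norm_mul]
    have h2 := intervalIntegral.norm_integral_le_of_norm_le_const
      (a := clamp t (p.2 - max (p.1 - t) 0)) (b := clamp t (p.2 + max (p.1 - t) 0))
      (C := c * Real.exp (l * t)) (f := fun s => u (t, s) - v (t, s)) (fun s _ => by
        have := huv (t, s)
        simp only [min_eq_left htb, max_eq_right ht.1.le] at this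
        exact this)
    have h3 : |clamp t (p.2 + max (p.1 - t) 0) - clamp t (p.2 - max (p.1 - t) 0)| ≤ 2 * b := by
      refine (abs_sub _ _).trans ?_
      have := abs_clamp_le ht.1.le (p.2 + max (p.1 - t) 0)
      have := abs_clamp_le ht.1.le (p.2 - max (p.1 - t) 0)
      linarith
    calc ‖q t‖ * _ ≤ Q * (c * Real.exp (l * t) * (2 * b)) := by
          refine mul_le_mul (hqQ t ht.1.le) (h2.trans ?_) (norm_nonneg _) hQ
          gcongr
      _ = _ := by ring
  rw [intervalIntegral.integral_const_mul] at h1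
  have h4 := integral_exp_mul_le (t := m) hl0
  calc ‖(1 / 2 : ℝ)‖ * _ ≤ (1 / 2) * (Q * (2 * b) * c * (Real.exp (l * m) / l)) := by
        rw [Real.norm_of_nonneg (by norm_num)]
        gcongr
        exact h1.trans (by gcongr)
    _ = (2 * Q * b / l) * (c / 2 * Real.exp (l * m)) := by field_simp
    _ ≤ 1 * (c / 2 * Real.exp (l * m)) := by
        gcongr
        rw [div_le_one hl0]; linarith
    _ = _ := one_mul _

/-- The integrated form of `K_xx - K_rr = q K` in the cone `|r| ≤ x`, with prescribed values on its
two sides. Evenness in `r` encodes the Neumann condition at `r = 0`, which suits cosines. -/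
theorem exists_goursat_kernel (h : ℝ) (hb : 0 < b) (hq : Continuous q) (hq0 : ∀ t ≥ b, q t = 0) :
    ∃ K : ℝ → ℝ → ℝ, Continuous (Function.uncurry K) ∧ (∃ C : ℝ, ∀ x r, |K x r| ≤ C) ∧
      (∀ x r, K x (-r) = K x r) ∧
      ∀ x ≥ 0, ∀ r, |r| ≤ x → K x r = -h + (1 / 2) * (∫ t in (0)..((x + r) / 2), q t) +
        (1 / 2) * (∫ t in (0)..((x - r) / 2), q t) +
        (1 / 2) * ∫ t in (0)..x, q t *
          ∫ s in (clamp t (r - max (x - t) 0))..(clamp t (r + max (x - t) 0)), K t s := by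
  obtain ⟨Q, hQ, hqQ, hqI⟩ := goursat_bound hb hq hq0
  have hcontr := fun u v hu hv c hc huv =>
    goursatOp_contraction (h := h) (u := u) (v := v) (c := c) hb hq hQ hqQ hu hv hc huv
  obtain ⟨u, hu, ⟨C, hC, huC⟩, hfix⟩ := exists_fixedPoint_of_weighted_contraction
    (ρ := fun p : ℝ × ℝ => (2 * Q * b + 1) * max 0 (min p.1 b)) (by fun_prop)
    (T := goursatOp h b q) (fun u hu => continuous_goursatOp hq hu) (C₀ := |h| + Q * b)
    (fun p => by
      have h1 := hqI (max ((p.1 + p.2) / 2) 0) (le_max_right _ _)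
      have h2 := hqI (max ((p.1 - p.2) / 2) 0) (le_max_right _ _)
      have h3 : ‖goursatOp h b q 0 p‖ ≤ |h| + Q * b := by
        simp only [goursatOp, Pi.zero_apply, intervalIntegral.integral_zero, mul_zero, add_zero,
          Real.norm_eq_abs]
        rw [abs_le] at h1 h2 ⊢
        have := neg_abs_le h
        have := le_abs_self h
        constructor <;> linarith [h1.1, h1.2, h2.1, h2.2]
      refine h3.trans (le_mul_of_one_le_right (by positivity) (Real.one_le_exp ?_))
      positivity) hcontr
  -- The reflected function is a fixed point too, and the two differ by at most twice the common
  -- weighted bound.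
  have hrefl : (fun z : ℝ × ℝ => u (z.1, -z.2)) = u := by
    refine fixedPoint_unique_of_weighted_contraction hcontr (by fun_prop) hu ?_ hfix
      (c := 2 * C) (by positivity) fun p => ?_
    · funext p
      have := goursatOp_reflect (h := h) (q := q) hb (u := u) (p.1, -p.2)
      simp only [neg_neg] at this
      rw [show p = (p.1, p.2) from rfl, this, hfix]
    · refine (norm_sub_le _ _).trans ?_
      have h1 := huC (p.1, -p.2)
      have h2 := huC p
      simp only at h1 h2
      linarith
  refine ⟨fun x r => u (x, r), hu, ⟨C * Real.exp ((2 * Q * b + 1) * b), fun x r => ?_⟩,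
    fun x r => congrFun hrefl (x, r), fun x hx r hr => ?_⟩
  · refine (huC (x, r)).trans ?_
    gcongr
    exact max_le hb.le (min_le_right _ _)
  · have h1 := congrFun hfix (x, r)
    obtain ⟨hr1, hr2⟩ := abs_le.1 hr
    simp only [goursatOp, max_eq_left (by linarith : 0 ≤ (x + r) / 2),
      max_eq_left (by linarith : 0 ≤ (x - r) / 2)] at h1
    change u (x, r) = _
    rw [← h1]
    congr 2
    have hin : Continuous fun t : ℝ => q t *
        ∫ s in (clamp t (r - max (x - t) 0))..(clamp t (r + max (x - t) 0)), u (t, s) :=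
      hq.mul ((continuous_goursat_inner hu).comp (Continuous.prodMk_right (x, r)))
    -- The fixed range `[0, b]` may be replaced by `[0, x]`: between the two ends either the inner
    -- interval is degenerate or `q` vanishes.
    rw [← intervalIntegral.integral_add_adjacent_intervals (b := x)
      (hin.intervalIntegrable _ _) (hin.intervalIntegrable _ _)]
    have h2 : ∫ t in x..b, q t *
        (∫ s in (clamp t (r - max (x - t) 0))..(clamp t (r + max (x - t) 0)), u (t, s)) = 0 := by
      rw [intervalIntegral.integral_congr (g := fun _ => 0), intervalIntegral.integral_zero]
      intro t ht
      rcases le_total x b with hxb | hxb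
      · rw [uIcc_of_le hxb] at ht
        simp only
        rw [max_eq_right (by linarith [ht.1]), sub_zero, add_zero, intervalIntegral.integral_same,
          mul_zero]
      · rw [uIcc_of_ge hxb] at ht
        simp only
        rw [hq0 t ht.1, zero_mul]
    rw [h2, add_zero]

end Goursat

end

/-! ### From the Goursat kernel to the transformation operator. -/

section

/-- The image of `cos(κ x)` under the transformation operator with kernel `K`. -/
def regSol (K : ℝ → ℝ → ℝ) (κ : ℂ) (x : ℝ) : ℂ :=
  Complex.cos (κ * x) + ∫ s in (0)..x, (K x s : ℂ) * Complex.cos (κ * s)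

/-- `1 + K` is the transformation operator of `-d²/dx² + q` with the boundary condition
`f'(0) + h f(0) = 0`. -/
structure IsTransformationKernel (h : ℝ) (q : ℝ → ℝ) (K : ℝ → ℝ → ℝ) : Prop where
  cont : Continuous (Function.uncurry K)
  bdd : ∃ C : ℝ, ∀ x r, |K x r| ≤ C
  diag : ∀ x ≥ 0, K x x = -h + (1 / 2) * ∫ t in (0)..x, q t
  volterra : ∀ κ : ℂ, ∀ x ≥ 0, regSol K κ x = Complex.cos (κ * x) - h * cosInt κ x +
    ∫ t in (0)..x, (q t : ℂ) * cosInt κ (x - t) * regSol K κ t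

theorem integral_even_eq {f : ℝ → ℂ} (hf : Continuous f) (hev : ∀ r, f (-r) = f r) (x : ℝ) :
    ∫ r in (-x)..x, f r = 2 * ∫ r in (0)..x, f r := by
  rw [← intervalIntegral.integral_add_adjacent_intervals (b := 0) (hf.intervalIntegrable _ _)
    (hf.intervalIntegrable _ _)]
  have h1 : ∫ r in (-x)..0, f r = ∫ r in (0)..x, f r := by
    have := intervalIntegral.integral_comp_neg (a := 0) (b := x) f
    rw [neg_zero] at this
    rw [← this]
    simp_rw [hev]
  rw [h1]; ring

/-- Integration by parts differentiates the primitive of `q`. After the substitution `t = (x + r) /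
2` the arguments are `t + (x - t)` and `t - (x - t)`, and the addition formulas combine them into a
product. -/
theorem integral_primitive_mul_cos {q : ℝ → ℝ} (hq : Continuous q) (κ : ℂ) (x : ℝ) :
    ∫ r in (-x)..x, ((∫ t in (0)..((x + r) / 2), q t : ℝ) : ℂ) * Complex.cos (κ * r) =
      2 * ∫ t in (0)..x, (q t : ℂ) * cosInt κ (x - t) * Complex.cos (κ * t) := by
  have hu : ∀ r ∈ uIcc (-x) x, HasDerivAt
      (fun r : ℝ => ((∫ t in (0)..((x + r) / 2), q t : ℝ) : ℂ)) ((q ((x + r) / 2) * (1 / 2) : ℝ) : ℂ) r := by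
    intro r _
    refine HasDerivAt.ofReal_comp ?_
    have h1 : HasDerivAt (fun y => ∫ t in (0)..y, q t) (q ((x + r) / 2)) ((x + r) / 2) :=
      intervalIntegral.integral_hasDerivAt_right (hq.intervalIntegrable _ _)
        (hq.stronglyMeasurableAtFilter _ _) hq.continuousAt
    have h2 : HasDerivAt (fun r : ℝ => (x + r) / 2) (1 / 2) r :=
      ((hasDerivAt_id r).const_add x).div_const 2
    exact h1.comp r h2
  have hv : ∀ r ∈ uIcc (-x) x, HasDerivAt (cosInt κ) (Complex.cos (κ * r)) r :=
    fun r _ => hasDerivAt_cosInt κ r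
  rw [intervalIntegral.integral_mul_deriv_eq_deriv_mul hu hv
    (Continuous.intervalIntegrable (by fun_prop) _ _)
    (Continuous.intervalIntegrable (by fun_prop) _ _)]
  have hS := continuous_cosInt κ
  have hsub : ∫ r in (-x)..x, ((q ((x + r) / 2) * (1 / 2) : ℝ) : ℂ) * cosInt κ r =
      ∫ t in (0)..x, (q t : ℂ) * cosInt κ (2 * t - x) := by
    have := intervalIntegral.integral_comp_add_div (a := -x) (b := x) (c := 2)
      (fun t : ℝ => (1 / 2 : ℂ) * ((q t : ℂ) * cosInt κ (2 * t - x))) two_ne_zero (x / 2)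
    rw [show x / 2 + -x / 2 = 0 by ring, show x / 2 + x / 2 = x by ring,
      intervalIntegral.integral_const_mul] at this
    have h2 : ∀ r : ℝ, ((q ((x + r) / 2) * (1 / 2) : ℝ) : ℂ) * cosInt κ r =
        (1 / 2 : ℂ) * ((q (x / 2 + r / 2) : ℂ) * cosInt κ (2 * (x / 2 + r / 2) - x)) := by
      intro r
      rw [show x / 2 + r / 2 = (x + r) / 2 by ring, show 2 * ((x + r) / 2) - x = r by ring]
      push_cast; ring
    simp_rw [h2]
    rw [intervalIntegral.integral_const_mul, this, intervalIntegral.integral_const_mul]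
    simp
  rw [hsub, show (x + x) / 2 = x by ring, show (x + -x) / 2 = 0 by ring,
    intervalIntegral.integral_same, Complex.ofReal_zero, zero_mul, sub_zero,
    ← intervalIntegral.integral_ofReal, ← intervalIntegral.integral_mul_const,
    ← intervalIntegral.integral_sub (Continuous.intervalIntegrable (by fun_prop) _ _)
      (Continuous.intervalIntegrable (by fun_prop) _ _), ← intervalIntegral.integral_const_mul]
  refine intervalIntegral.integral_congr fun t _ => ?_
  have e1 : cosInt κ x = cosInt κ (t + (x - t)) := by congr 1; ring
  have e2 : cosInt κ (2 * t - x) = cosInt κ (t - (x - t)) := by congr 1; ring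
  rw [e1, e2, cosInt_add κ t, cosInt_sub κ t]
  ring

/-- For fixed `s` in `[-t, t]` the admissible `r` fill the interval of half-width `x - t` about `s`,
which lies in `[-x, x]`. The cosine can therefore be integrated first. -/
theorem integral_clamp_mul_cos {u : ℝ → ℝ} (hu : Continuous u) (κ : ℂ) {x t : ℝ} (ht : 0 ≤ t)
    (htx : t ≤ x) :
    ∫ r in (-x)..x, ((∫ s in (clamp t (r - (x - t)))..(clamp t (r + (x - t))), u s : ℝ) : ℂ) *
      Complex.cos (κ * r) =
      2 * cosInt κ (x - t) * ∫ s in (-t)..t, (u s : ℂ) * Complex.cos (κ * s) := by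
  set a := x - t with ha
  have ha0 : 0 ≤ a := by linarith
  have e1 : ∀ r : ℝ, ((∫ s in (clamp t (r - a))..(clamp t (r + a)), u s : ℝ) : ℂ) *
      Complex.cos (κ * r) =
      ∫ s in (-t)..t, (Ioc (r - a) (r + a)).indicator (fun s => (u s : ℂ)) s * Complex.cos (κ * r) := by
    intro r
    rw [← intervalIntegral.integral_ofReal, integral_clamp _ ht (by linarith),
      intervalIntegral.integral_mul_const]
  simp_rw [e1]
  rw [intervalIntegral_intervalIntegral_swap]
  · have e2 : ∀ s ∈ uIcc (-t) t, ∫ r in (-x)..x, (Ioc (r - a) (r + a)).indicator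
        (fun s => (u s : ℂ)) s * Complex.cos (κ * r) =
        2 * cosInt κ a * ((u s : ℂ) * Complex.cos (κ * s)) := by
      intro s hs
      rw [uIcc_of_le (by linarith)] at hs
      have e3 : (fun r : ℝ => (Ioc (r - a) (r + a)).indicator
          (fun s => (u s : ℂ)) s * Complex.cos (κ * r)) =
          (Ico (s - a) (s + a)).indicator fun r : ℝ => (u s : ℂ) * Complex.cos (κ * r) := by
        funext r
        by_cases hr : r ∈ Ico (s - a) (s + a)
        · rw [indicator_of_mem hr, indicator_of_mem]
          exact ⟨by linarith [hr.2], by linarith [hr.1]⟩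
        · rw [indicator_of_notMem hr, indicator_of_notMem, zero_mul]
          exact fun hr' => hr ⟨by linarith [hr'.2], by linarith [hr'.1]⟩
      rw [e3, intervalIntegral.integral_of_le (by linarith), ← integral_Icc_eq_integral_Ioc,
        setIntegral_indicator measurableSet_Ico,
        inter_eq_right.2 (Ico_subset_Icc_self.trans (Icc_subset_Icc (by linarith [hs.1])
          (by linarith [hs.2]))), integral_Ico_eq_integral_Ioo, ← integral_Ioc_eq_integral_Ioo,
        ← intervalIntegral.integral_of_le (by linarith), intervalIntegral.integral_const_mul,
        integral_cos_symm]
      ring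
    rw [intervalIntegral.integral_congr e2, intervalIntegral.integral_const_mul]
  · have hc : Continuous fun p : ℝ × ℝ => (u p.2 : ℂ) * Complex.cos (κ * p.1) := by fun_prop
    have hS : MeasurableSet {p : ℝ × ℝ | p.2 ∈ Ioc (p.1 - a) (p.1 + a)} := by
      have h1 : MeasurableSet {p : ℝ × ℝ | p.1 - a < p.2} :=
        measurableSet_lt (by fun_prop) (by fun_prop)
      have h2 : MeasurableSet {p : ℝ × ℝ | p.2 ≤ p.1 + a} :=
        measurableSet_le (by fun_prop) (by fun_prop)
      exact h1.inter h2
    have e4 : (Function.uncurry fun r s : ℝ => (Ioc (r - a) (r + a)).indicator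
        (fun s => (u s : ℂ)) s * Complex.cos (κ * r)) =
        {p : ℝ × ℝ | p.2 ∈ Ioc (p.1 - a) (p.1 + a)}.indicator
          fun p : ℝ × ℝ => (u p.2 : ℂ) * Complex.cos (κ * p.1) := by
      funext p
      by_cases hp : p.2 ∈ Ioc (p.1 - a) (p.1 + a)
      · rw [indicator_of_mem (show p ∈ {p : ℝ × ℝ | p.2 ∈ Ioc (p.1 - a) (p.1 + a)} from hp),
          Function.uncurry_def]
        simp only
        rw [indicator_of_mem hp]
      · rw [indicator_of_notMem (show p ∉ {p : ℝ × ℝ | p.2 ∈ Ioc (p.1 - a) (p.1 + a)} from hp),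
          Function.uncurry_def]
        simp only
        rw [indicator_of_notMem hp, zero_mul]
    rw [e4]
    refine IntegrableOn.indicator ?_ hS
    refine (hc.continuousOn.integrableOn_compact
      (isCompact_uIcc.prod isCompact_uIcc)).mono_set (prod_mono uIoc_subset_uIcc uIoc_subset_uIcc)

/-- Multiplying the Goursat equation by `cos (κ r)` and integrating over `[-x, x]` yields the
Volterra equation of the solution with data `(1, -h)`; evenness of the kernel folds the integrals to
`[0, x]`. -/
theorem exists_isTransformationKernel (h : ℝ) {b : ℝ} (hb : 0 < b) {q : ℝ → ℝ} (hq : Continuous q)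
    (hq0 : ∀ t ≥ b, q t = 0) : ∃ K, IsTransformationKernel h q K := by
  obtain ⟨K, hK, hKb, hKev, hKeq⟩ := exists_goursat_kernel h hb hq hq0
  have hKx : ∀ x, Continuous (K x) := fun x => hK.comp (Continuous.prodMk_right x)
  have heven : ∀ (κ : ℂ) (x : ℝ), ∫ s in (-x)..x, (K x s : ℂ) * Complex.cos (κ * s) =
      2 * ∫ s in (0)..x, (K x s : ℂ) * Complex.cos (κ * s) := by
    intro κ x
    refine integral_even_eq (by have := hKx x; fun_prop) (fun r => ?_) x
    rw [hKev]; push_cast; rw [mul_neg, Complex.cos_neg]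
  refine ⟨K, hK, hKb, fun x hx => ?_, fun κ x hx => ?_⟩
  · rw [hKeq x hx x (abs_of_nonneg hx).le]
    have h1 : ∫ t in (0)..x, q t *
        ∫ s in (clamp t (x - max (x - t) 0))..(clamp t (x + max (x - t) 0)), K t s = 0 := by
      rw [intervalIntegral.integral_congr (g := fun _ => 0), intervalIntegral.integral_zero]
      intro t ht
      rw [uIcc_of_le hx] at ht
      -- On the diagonal both clamped limits equal `t`, so the double integral disappears and only
      -- boundary terms remain.
      have e1 : clamp t (x - max (x - t) 0) = t := by
        rw [max_eq_left (by linarith [ht.2])]; unfold clamp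
        rw [min_eq_left (by linarith), max_eq_right (by linarith [ht.1])]
      have e2 : clamp t (x + max (x - t) 0) = t := by
        rw [max_eq_left (by linarith [ht.2])]; unfold clamp
        rw [min_eq_left (by linarith [ht.2]), max_eq_right (by linarith [ht.1])]
      simp only [e1, e2, intervalIntegral.integral_same, mul_zero]
    rw [h1, sub_self, zero_div, intervalIntegral.integral_same]
    simp
  · let In : ℝ → ℝ → ℝ := fun t r =>
      ∫ s in (clamp t (r - max (x - t) 0))..(clamp t (r + max (x - t) 0)), K t s
    have hIn : Continuous fun p : ℝ × ℝ => In p.1 p.2 :=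
      (continuous_goursat_inner (u := Function.uncurry K) hK).comp
        (by fun_prop : Continuous fun p : ℝ × ℝ => ((x, p.2), p.1))
    have hQ : Continuous fun y : ℝ => ∫ t in (0)..y, q t :=
      intervalIntegral.continuous_primitive (fun _ _ => hq.intervalIntegrable _ _) 0
    have hJ : Continuous fun r => ∫ t in (0)..x, q t * In t r := by
      refine intervalIntegral.continuous_parametric_intervalIntegral_of_continuous'
        (f := fun r t => q t * In t r) ?_ 0 x
      exact (hq.comp continuous_snd).mul (hIn.comp continuous_swap)
    have hcos : Continuous fun r : ℝ => Complex.cos (κ * r) := by fun_prop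
    let Q₁ : ℝ → ℂ := fun r => ((∫ t in (0)..((x + r) / 2), q t : ℝ) : ℂ) * Complex.cos (κ * r)
    have hQ₁ : Continuous Q₁ :=
      (Complex.continuous_ofReal.comp (hQ.comp (by fun_prop))).mul hcos
    have hJ₁ : Continuous fun r => ((∫ t in (0)..x, q t * In t r : ℝ) : ℂ) * Complex.cos (κ * r) :=
      (Complex.continuous_ofReal.comp hJ).mul hcos
    -- The two boundary terms are mirror images under `r ↦ -r`, so over the symmetric interval they
    -- contribute equally.
    have hexp : ∀ r ∈ uIcc (-x) x, (K x r : ℂ) * Complex.cos (κ * r) =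
        -h * Complex.cos (κ * r) + (1 / 2) * Q₁ r + (1 / 2) * Q₁ (-r) +
          (1 / 2) * (((∫ t in (0)..x, q t * In t r : ℝ) : ℂ) * Complex.cos (κ * r)) := by
      intro r hr
      rw [uIcc_of_le (by linarith)] at hr
      rw [hKeq x hx r (abs_le.2 hr)]
      simp only [Q₁, In]
      push_cast
      rw [mul_neg, Complex.cos_neg, ← sub_eq_add_neg]
      ring
    have hdouble : ∫ r in (-x)..x, ((∫ t in (0)..x, q t * In t r : ℝ) : ℂ) * Complex.cos (κ * r) =
        4 * ∫ t in (0)..x, (q t : ℂ) * cosInt κ (x - t) *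
          ∫ s in (0)..t, (K t s : ℂ) * Complex.cos (κ * s) := by
      have e1 : ∀ r : ℝ, ((∫ t in (0)..x, q t * In t r : ℝ) : ℂ) * Complex.cos (κ * r) =
          ∫ t in (0)..x, ((q t * In t r : ℝ) : ℂ) * Complex.cos (κ * r) := fun r => by
        rw [← intervalIntegral.integral_ofReal, intervalIntegral.integral_mul_const]
      simp_rw [e1]
      rw [intervalIntegral_intervalIntegral_swap, ← intervalIntegral.integral_const_mul]
      · refine intervalIntegral.integral_congr fun t ht => ?_
        rw [uIcc_of_le hx] at ht
        have e2 : ∀ r : ℝ, ((q t * In t r : ℝ) : ℂ) * Complex.cos (κ * r) = (q t : ℂ) *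
            (((∫ s in (clamp t (r - (x - t)))..(clamp t (r + (x - t))), K t s : ℝ) : ℂ) *
              Complex.cos (κ * r)) := fun r => by
          simp only [In]
          rw [max_eq_left (by linarith [ht.2])]
          push_cast; ring
        simp_rw [e2]
        rw [intervalIntegral.integral_const_mul, integral_clamp_mul_cos (hKx t) κ ht.1 ht.2, heven]
        ring
      · have hc : Continuous (Function.uncurry fun r t : ℝ =>
            ((q t * In t r : ℝ) : ℂ) * Complex.cos (κ * r)) := by
          refine (Complex.continuous_ofReal.comp ((hq.comp continuous_snd).mul
            (hIn.comp continuous_swap))).mul (hcos.comp continuous_fst)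
        exact (hc.continuousOn.integrableOn_compact
          (isCompact_uIcc.prod isCompact_uIcc)).mono_set
            (prod_mono uIoc_subset_uIcc uIoc_subset_uIcc)
    have htot : ∫ s in (0)..x, (K x s : ℂ) * Complex.cos (κ * s) =
        -h * cosInt κ x + (∫ t in (0)..x, (q t : ℂ) * cosInt κ (x - t) * Complex.cos (κ * t)) +
        ∫ t in (0)..x, (q t : ℂ) * cosInt κ (x - t) *
          ∫ s in (0)..t, (K t s : ℂ) * Complex.cos (κ * s) := by
      have h1 := heven κ x
      rw [intervalIntegral.integral_congr hexp, intervalIntegral.integral_add,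
        intervalIntegral.integral_add, intervalIntegral.integral_add,
        intervalIntegral.integral_const_mul, intervalIntegral.integral_const_mul,
        intervalIntegral.integral_const_mul, intervalIntegral.integral_const_mul, hdouble,
        intervalIntegral.integral_comp_neg Q₁, neg_neg,
        integral_primitive_mul_cos hq κ x] at h1
      · have h2 := integral_cos_symm κ 0 x
        simp only [zero_sub, zero_add, Complex.ofReal_zero, mul_zero, Complex.cos_zero,
          mul_one] at h2
        rw [h2] at h1
        linear_combination (-1 / 2 : ℂ) * h1
      all_goals exact Continuous.intervalIntegrable (by fun_prop) _ _
    have hR : Continuous fun t : ℝ => ∫ s in (0)..t, (K t s : ℂ) * Complex.cos (κ * s) := by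
      refine intervalIntegral.continuous_parametric_intervalIntegral_of_continuous
        (f := fun (t : ℝ) (s : ℝ) => (K t s : ℂ) * Complex.cos (κ * s)) ?_ continuous_id
      exact (Complex.continuous_ofReal.comp hK).mul (hcos.comp continuous_snd)
    have hSx : Continuous fun t => cosInt κ (x - t) := (continuous_cosInt κ).comp (by fun_prop)
    simp only [regSol]
    rw [htot]
    have e3 : ∀ t : ℝ, (q t : ℂ) * cosInt κ (x - t) * (Complex.cos (κ * t) +
        ∫ s in (0)..t, (K t s : ℂ) * Complex.cos (κ * s)) =
        (q t : ℂ) * cosInt κ (x - t) * Complex.cos (κ * t) +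
        (q t : ℂ) * cosInt κ (x - t) * ∫ s in (0)..t, (K t s : ℂ) * Complex.cos (κ * s) :=
      fun t => by ring
    simp_rw [e3]
    rw [intervalIntegral.integral_add (Continuous.intervalIntegrable (by fun_prop) _ _)
      (Continuous.intervalIntegrable (by fun_prop) _ _)]
    ring

end

/-! ### Solutions of the Schrödinger equation, fundamental system, Jost solutions. -/

section

/-- `(y, y')` solves `-y'' + q y = k² y` on `[0, ∞)`. -/
structure IsSol (q : ℝ → ℝ) (k : ℂ) (y y' : ℝ → ℂ) : Prop where
  deriv_fst : ∀ x ≥ 0, HasDerivWithinAt y (y' x) (Ici 0) x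
  deriv_snd : ∀ x ≥ 0, HasDerivWithinAt y' (((q x : ℂ) - k ^ 2) * y x) (Ici 0) x

namespace IsSol

variable {q : ℝ → ℝ} {k l : ℂ} {y y' z z' : ℝ → ℂ}

theorem continuousOn_fst (hy : IsSol q k y y') : ContinuousOn y (Ici 0) :=
  fun x hx => (hy.deriv_fst x hx).continuousWithinAt

theorem continuousOn_snd (hy : IsSol q k y y') : ContinuousOn y' (Ici 0) :=
  fun x hx => (hy.deriv_snd x hx).continuousWithinAt

theorem lin (hy : IsSol q k y y') (hz : IsSol q k z z') (a b : ℂ) :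
    IsSol q k (fun x => a * y x + b * z x) (fun x => a * y' x + b * z' x) where
  deriv_fst x hx := ((hy.deriv_fst x hx).const_mul a).add ((hz.deriv_fst x hx).const_mul b)
  deriv_snd x hx := by
    refine (((hy.deriv_snd x hx).const_mul a).add ((hz.deriv_snd x hx).const_mul b)).congr_deriv ?_
    ring

theorem sub (hy : IsSol q k y y') (hz : IsSol q k z z') :
    IsSol q k (fun x => y x - z x) (fun x => y' x - z' x) := by
  have := hy.lin hz 1 (-1)
  simpa only [one_mul, neg_one_mul, ← sub_eq_add_neg] using this

theorem congr_sq (hy : IsSol q k y y') (h : k ^ 2 = l ^ 2) : IsSol q l y y' :=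
  ⟨hy.deriv_fst, fun x hx => by rw [← h]; exact hy.deriv_snd x hx⟩

theorem conj (hy : IsSol q k y y') :
    IsSol q ((starRingEnd ℂ) k) (fun x => (starRingEnd ℂ) (y x)) (fun x => (starRingEnd ℂ) (y' x)) where
  deriv_fst x hx := (hy.deriv_fst x hx).star
  deriv_snd x hx := by
    refine ((hy.deriv_snd x hx).star).congr_deriv ?_
    simp only [← starRingEnd_apply, map_mul, map_sub, map_pow, Complex.conj_ofReal]

/-- Lagrange's identity. -/
theorem wronskian_eq (hy : IsSol q k y y') (hz : IsSol q l z z') {x : ℝ} (hx : 0 ≤ x) :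
    y x * z' x - y' x * z x = y 0 * z' 0 - y' 0 * z 0 +
      (k ^ 2 - l ^ 2) * ∫ t in (0)..x, y t * z t := by
  have hsub : Icc 0 x ⊆ Ici 0 := Icc_subset_Ici_self
  have hc : ContinuousOn (fun t => y t * z' t - y' t * z t) (Icc 0 x) :=
    (((hy.continuousOn_fst.mul hz.continuousOn_snd).sub
      (hy.continuousOn_snd.mul hz.continuousOn_fst)).mono hsub)
  have hd : ∀ t ∈ Ioo 0 x, HasDerivWithinAt (fun t => y t * z' t - y' t * z t)
      ((k ^ 2 - l ^ 2) * (y t * z t)) (Ioi t) t := by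
    intro t ht
    have h0 : (0 : ℝ) ≤ t := ht.1.le
    have := (((hy.deriv_fst t h0).mul (hz.deriv_snd t h0)).sub
      ((hy.deriv_snd t h0).mul (hz.deriv_fst t h0))).mono
      (Ioi_subset_Ici h0 : Ioi t ⊆ Ici 0)
    refine this.congr_deriv ?_
    ring
  have hi : IntervalIntegrable (fun t => (k ^ 2 - l ^ 2) * (y t * z t)) volume 0 x := by
    refine ContinuousOn.intervalIntegrable ?_
    rw [uIcc_of_le hx]
    exact continuousOn_const.mul ((hy.continuousOn_fst.mul hz.continuousOn_fst).mono hsub)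
  have := intervalIntegral.integral_eq_sub_of_hasDeriv_right_of_le hx hc hd hi
  rw [intervalIntegral.integral_const_mul] at this
  linear_combination -this

end IsSol

section RegSol

variable {h : ℝ} {q : ℝ → ℝ} {K : ℝ → ℝ → ℝ}

theorem continuous_regSol (hK : Continuous (Function.uncurry K)) :
    Continuous fun p : ℂ × ℝ => regSol K p.1 p.2 := by
  unfold regSol
  refine Continuous.add (by fun_prop) ?_
  refine intervalIntegral.continuous_parametric_intervalIntegral_of_continuous
    (f := fun (p : ℂ × ℝ) (s : ℝ) => (K p.2 s : ℂ) * Complex.cos (p.1 * s)) ?_ continuous_snd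
  refine (Complex.continuous_ofReal.comp (hK.comp
    (by fun_prop : Continuous fun z : (ℂ × ℝ) × ℝ => (z.1.2, z.2)))).mul (by fun_prop)

theorem continuous_regSol_right (hK : Continuous (Function.uncurry K)) (κ : ℂ) :
    Continuous (regSol K κ) :=
  Continuous.comp (g := fun p : ℂ × ℝ => regSol K p.1 p.2) (f := fun x : ℝ => (κ, x))
    (continuous_regSol hK) (by fun_prop)

/-- The derivative of `regSol`. -/
def regSolDeriv (h : ℝ) (q : ℝ → ℝ) (K : ℝ → ℝ → ℝ) (κ : ℂ) (x : ℝ) : ℂ :=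
  -(κ ^ 2 * cosInt κ x) - h * Complex.cos (κ * x) +
    Complex.cos (κ * x) * (∫ t in (0)..x, (q t : ℂ) * Complex.cos (κ * t) * regSol K κ t) +
    κ ^ 2 * cosInt κ x * ∫ t in (0)..x, (q t : ℂ) * cosInt κ t * regSol K κ t

theorem regSol_zero_right (κ : ℂ) : regSol K κ 0 = 1 := by simp [regSol]

theorem regSolDeriv_zero_right (κ : ℂ) : regSolDeriv h q K κ 0 = -h := by
  simp [regSolDeriv, cosInt_zero_right]

theorem cos_sq_add_cosInt_sq (κ : ℂ) (x : ℝ) :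
    Complex.cos (κ * x) ^ 2 + κ ^ 2 * cosInt κ x ^ 2 = 1 := by
  rw [← mul_pow, mul_cosInt, Complex.cos_sq_add_sin_sq]

/-- The addition formula for `cosInt κ (x - t)` separates `x` from `t` in the Volterra equation.
Only primitives are then differentiated, and `cos² + sin² = 1` produces the term with `q`. -/
theorem isSol_regSol (hq : Continuous q) (hK : IsTransformationKernel h q K) (κ : ℂ) :
    IsSol q κ (regSol K κ) (regSolDeriv h q K κ) := by
  have hφ : Continuous (regSol K κ) := continuous_regSol_right hK.cont κ
  have hS := continuous_cosInt κ
  obtain ⟨I₁, hI₁⟩ : ∃ I : ℝ → ℂ, I = fun x =>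
    ∫ t in (0)..x, (q t : ℂ) * Complex.cos (κ * t) * regSol K κ t := ⟨_, rfl⟩
  obtain ⟨I₂, hI₂⟩ : ∃ I : ℝ → ℂ, I = fun x =>
    ∫ t in (0)..x, (q t : ℂ) * cosInt κ t * regSol K κ t := ⟨_, rfl⟩
  have hrd : ∀ x, regSolDeriv h q K κ x = -(κ ^ 2 * cosInt κ x) - h * Complex.cos (κ * x) +
      Complex.cos (κ * x) * I₁ x + κ ^ 2 * cosInt κ x * I₂ x := fun x => by rw [hI₁, hI₂]; rfl
  have hc₁ : Continuous fun t : ℝ => (q t : ℂ) * Complex.cos (κ * t) * regSol K κ t := by fun_prop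
  have hc₂ : Continuous fun t : ℝ => (q t : ℂ) * cosInt κ t * regSol K κ t := by fun_prop
  have d₁ : ∀ x, HasDerivAt I₁ ((q x : ℂ) * Complex.cos (κ * x) * regSol K κ x) x := fun x => by
    rw [hI₁]
    exact intervalIntegral.integral_hasDerivAt_right (hc₁.intervalIntegrable _ _)
      (hc₁.stronglyMeasurableAtFilter _ _) hc₁.continuousAt
  have d₂ : ∀ x, HasDerivAt I₂ ((q x : ℂ) * cosInt κ x * regSol K κ x) x := fun x => by
    rw [hI₂]
    exact intervalIntegral.integral_hasDerivAt_right (hc₂.intervalIntegrable _ _)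
      (hc₂.stronglyMeasurableAtFilter _ _) hc₂.continuousAt
  have hrep : ∀ x ≥ 0, regSol K κ x = Complex.cos (κ * x) - h * cosInt κ x +
      (cosInt κ x * I₁ x - Complex.cos (κ * x) * I₂ x) := by
    intro x hx
    rw [hK.volterra κ x hx]
    congr 1
    simp only [hI₁, hI₂]
    rw [← intervalIntegral.integral_const_mul, ← intervalIntegral.integral_const_mul,
      ← intervalIntegral.integral_sub (Continuous.intervalIntegrable (by fun_prop) _ _)
        (Continuous.intervalIntegrable (by fun_prop) _ _)]
    refine intervalIntegral.integral_congr fun t _ => ?_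
    rw [cosInt_sub]; ring
  constructor
  · intro x hx
    have := ((hasDerivAt_ccos κ x).sub ((hasDerivAt_cosInt κ x).const_mul (h : ℂ))).add
      (((hasDerivAt_cosInt κ x).mul (d₁ x)).sub ((hasDerivAt_ccos κ x).mul (d₂ x)))
    refine (this.hasDerivWithinAt.congr_of_mem (fun y hy => hrep y hy) hx).congr_deriv ?_
    rw [hrd]
    ring
  · rw [funext hrd]
    intro x hx
    have := ((((hasDerivAt_cosInt κ x).const_mul (κ ^ 2)).neg.sub
      ((hasDerivAt_ccos κ x).const_mul (h : ℂ))).add ((hasDerivAt_ccos κ x).mul (d₁ x))).add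
      (((hasDerivAt_cosInt κ x).const_mul (κ ^ 2)).mul (d₂ x))
    refine (this.hasDerivWithinAt).congr_deriv ?_
    have h1 := hrep x hx
    have h2 := cos_sq_add_cosInt_sq κ x
    linear_combination (-κ ^ 2) * h1.symm + (q x : ℂ) * regSol K κ x * h2

/-- Interval integrals depend analytically on a parameter. -/
theorem differentiable_intervalIntegral_of_continuous {F : ℂ → ℝ → ℂ}
    (hF : Continuous (Function.uncurry F)) (hd : ∀ t, Differentiable ℂ fun z => F z t) (a b : ℝ) :
    Differentiable ℂ fun z => ∫ t in a..b, F z t := by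
  intro z₀
  obtain ⟨C, hC⟩ := ((isCompact_closedBall z₀ 2).prod (isCompact_uIcc (a := a) (b := b))).exists_bound_of_continuousOn
    hF.continuousOn
  have hsw : Continuous fun p : ℝ × ℂ => F p.2 p.1 := hF.comp continuous_swap
  have hmeas := stronglyMeasurable_deriv_with_param (f := fun t z => F z t) (𝕜 := ℂ)
    (by exact hsw)
  refine (intervalIntegral.hasDerivAt_integral_of_dominated_loc_of_deriv_le
    (F := F) (F' := fun z t => deriv (fun z => F z t) z) (bound := fun _ => C / 1)
    (Metric.ball_mem_nhds z₀ one_pos) ?_ ?_ ?_ ?_ intervalIntegrable_const ?_).2.differentiableAt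
  · exact Eventually.of_forall fun z =>
      (hF.comp (Continuous.prodMk_right z)).aestronglyMeasurable
  · exact (hF.comp (Continuous.prodMk_right z₀)).intervalIntegrable _ _
  · exact (hmeas.comp_measurable (measurable_prodMk_right (y := z₀))).aestronglyMeasurable
  · refine Eventually.of_forall fun t ht z hz => ?_
    refine Complex.norm_deriv_le_of_forall_mem_sphere_norm_le one_pos
      (hd t).diffContOnCl fun w hw => ?_
    refine hC (w, t) ⟨?_, uIoc_subset_uIcc ht⟩
    rw [Metric.mem_sphere] at hw
    rw [Metric.mem_ball] at hz
    rw [Metric.mem_closedBall]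
    linarith [dist_triangle w z z₀]
  · exact Eventually.of_forall fun t _ z _ => (hd t z).hasDerivAt

theorem differentiable_cosInt (x : ℝ) : Differentiable ℂ fun κ => cosInt κ x :=
  differentiable_intervalIntegral_of_continuous (F := fun κ r => Complex.cos (κ * r))
    (by simp only [Function.uncurry_def]; fun_prop) (fun t => by fun_prop) 0 x

theorem differentiable_regSol (hK : Continuous (Function.uncurry K)) (x : ℝ) :
    Differentiable ℂ fun κ => regSol K κ x := by
  refine Differentiable.add (by fun_prop) ?_
  refine differentiable_intervalIntegral_of_continuous
    (F := fun κ s => (K x s : ℂ) * Complex.cos (κ * s)) ?_ (fun t => by fun_prop) 0 x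
  exact (Complex.continuous_ofReal.comp (hK.comp
    (by fun_prop : Continuous fun z : ℂ × ℝ => (x, z.2)))).mul (by fun_prop)

theorem differentiable_regSolDeriv (hq : Continuous q) (hK : Continuous (Function.uncurry K))
    (x : ℝ) : Differentiable ℂ fun κ => regSolDeriv h q K κ x := by
  have hφ := continuous_regSol hK
  have hS := continuous_cosInt_uncurry
  have e1 := differentiable_intervalIntegral_of_continuous
    (F := fun κ t => (q t : ℂ) * Complex.cos (κ * t) * regSol K κ t)
    (by simp only [Function.uncurry_def]; fun_prop)
    (fun t => by have := differentiable_regSol hK t; fun_prop) 0 x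
  have e2 := differentiable_intervalIntegral_of_continuous
    (F := fun κ t => (q t : ℂ) * cosInt κ t * regSol K κ t)
    (by simp only [Function.uncurry_def]; fun_prop)
    (fun t => by
      have := differentiable_regSol hK t
      have := differentiable_cosInt t
      fun_prop) 0 x
  have e3 := differentiable_cosInt x
  unfold regSolDeriv
  fun_prop

end RegSol

/-- The fundamental system of solutions, normalised at the origin. -/
structure IsFundamentalSystem (q : ℝ → ℝ) (c c' s s' : ℂ → ℝ → ℂ) : Prop where
  sol_c : ∀ k, IsSol q k (c k) (c' k)
  sol_s : ∀ k, IsSol q k (s k) (s' k)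
  c_zero : ∀ k, c k 0 = 1
  c'_zero : ∀ k, c' k 0 = 0
  s_zero : ∀ k, s k 0 = 0
  s'_zero : ∀ k, s' k 0 = 1
  cont_c : Continuous (Function.uncurry c)
  cont_s : Continuous (Function.uncurry s)
  diff_c : ∀ x, Differentiable ℂ fun k => c k x
  diff_c' : ∀ x, Differentiable ℂ fun k => c' k x
  diff_s : ∀ x, Differentiable ℂ fun k => s k x
  diff_s' : ∀ x, Differentiable ℂ fun k => s' k x

/-- The regular solutions for `h = 0` and `h = 1` have initial data `(1, 0)` and `(1, -1)`: the
first is `c`, and their difference is `s`. -/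
theorem exists_isFundamentalSystem {b : ℝ} (hb : 0 < b) {q : ℝ → ℝ} (hq : Continuous q)
    (hq0 : ∀ t ≥ b, q t = 0) : ∃ c c' s s', IsFundamentalSystem q c c' s s' := by
  obtain ⟨K₀, hK₀⟩ := exists_isTransformationKernel 0 hb hq hq0
  obtain ⟨K₁, hK₁⟩ := exists_isTransformationKernel 1 hb hq hq0
  refine ⟨regSol K₀, regSolDeriv 0 q K₀, fun k x => regSol K₀ k x - regSol K₁ k x,
    fun k x => regSolDeriv 0 q K₀ k x - regSolDeriv 1 q K₁ k x, isSol_regSol hq hK₀,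
    fun k => (isSol_regSol hq hK₀ k).sub (isSol_regSol hq hK₁ k), regSol_zero_right,
    fun k => by rw [regSolDeriv_zero_right]; simp, fun k => by simp [regSol_zero_right],
    fun k => by simp [regSolDeriv_zero_right], continuous_regSol hK₀.cont,
    (continuous_regSol hK₀.cont).sub (continuous_regSol hK₁.cont),
    differentiable_regSol hK₀.cont, differentiable_regSolDeriv hq hK₀.cont,
    fun x => (differentiable_regSol hK₀.cont x).sub (differentiable_regSol hK₁.cont x),
    fun x => (differentiable_regSolDeriv hq hK₀.cont x).sub
      (differentiable_regSolDeriv hq hK₁.cont x)⟩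

theorem IsFundamentalSystem.wronskian {q : ℝ → ℝ} {c c' s s' : ℂ → ℝ → ℂ}
    (H : IsFundamentalSystem q c c' s s') (k : ℂ) {x : ℝ} (hx : 0 ≤ x) :
    c k x * s' k x - c' k x * s k x = 1 := by
  have := (H.sol_c k).wronskian_eq (H.sol_s k) hx
  simpa [H.c_zero, H.c'_zero, H.s_zero, H.s'_zero] using this

/-- A solution with vanishing Cauchy data at one point vanishes identically. -/
theorem IsSol.eq_zero {b : ℝ} (hb : 0 < b) {q : ℝ → ℝ} (hq : Continuous q)
    (hq0 : ∀ t ≥ b, q t = 0) {k : ℂ} {y y' : ℝ → ℂ} (hy : IsSol q k y y') {x₀ : ℝ} (hx₀ : 0 ≤ x₀)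
    (h0 : y x₀ = 0) (h0' : y' x₀ = 0) {x : ℝ} (hx : 0 ≤ x) : y x = 0 ∧ y' x = 0 := by
  -- The Wronskians of `y` with `c` and `s` are constant, vanish at `x₀`, and together recover `y`
  -- and `y'` because the Wronskian of `c` and `s` is `1`.
  obtain ⟨c, c', s, s', H⟩ := exists_isFundamentalSystem hb hq hq0
  have hw := H.wronskian k hx
  have h1 := hy.wronskian_eq (H.sol_c k) hx₀
  have h2 := hy.wronskian_eq (H.sol_c k) hx
  have h3 := hy.wronskian_eq (H.sol_s k) hx₀
  have h4 := hy.wronskian_eq (H.sol_s k) hx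
  rw [h0, h0'] at h1 h3
  constructor
  · linear_combination c k x * (h4 - h3) - s k x * (h2 - h1) - y x * hw
  · linear_combination c' k x * (h4 - h3) - s' k x * (h2 - h1) - y' x * hw

/-- The family of Jost solutions `f(·, k)` of a potential vanishing on `[b, ∞)`. -/
structure IsJostFamily (q : ℝ → ℝ) (b : ℝ) (f f' : ℂ → ℝ → ℂ) : Prop where
  sol : ∀ k, IsSol q k (f k) (f' k)
  eq_exp : ∀ k, ∀ x ≥ b, f k x = Complex.exp (Complex.I * k * x)
  eq_exp' : ∀ k, ∀ x ≥ b, f' k x = Complex.I * k * Complex.exp (Complex.I * k * x)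
  cont : Continuous (Function.uncurry f)
  diff : Differentiable ℂ fun k => f k 0
  diff' : Differentiable ℂ fun k => f' k 0

theorem hasDerivAt_cexp_mul (k : ℂ) (x : ℝ) :
    HasDerivAt (fun x : ℝ => Complex.exp (k * x)) (k * Complex.exp (k * x)) x := by
  have h1 : HasDerivAt (fun z : ℂ => Complex.exp (k * z)) (Complex.exp (k * x) * (k * 1)) x :=
    ((hasDerivAt_id (x : ℂ)).const_mul k).cexp
  refine h1.comp_ofReal.congr_deriv ?_
  ring

/-- Take the combination of `c` and `s` whose Cauchy data at `b` are those of `e^{ikx}`. Its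
coefficients are entire in `k`, and beyond `b`, where the potential vanishes, uniqueness keeps it
equal to the exponential. -/
theorem exists_isJostFamily {b : ℝ} (hb : 0 < b) {q : ℝ → ℝ} (hq : Continuous q)
    (hq0 : ∀ t ≥ b, q t = 0) : ∃ f f', IsJostFamily q b f f' := by
  obtain ⟨c, c', s, s', H⟩ := exists_isFundamentalSystem hb hq hq0
  let A : ℂ → ℂ := fun k => Complex.exp (Complex.I * k * b) * (s' k b - Complex.I * k * s k b)
  let B : ℂ → ℂ := fun k => Complex.exp (Complex.I * k * b) * (Complex.I * k * c k b - c' k b)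
  have hA : Differentiable ℂ A := by
    have := H.diff_s b; have := H.diff_s' b; fun_prop
  have hB : Differentiable ℂ B := by
    have := H.diff_c b; have := H.diff_c' b; fun_prop
  have hsol : ∀ k, IsSol q k (fun x => A k * c k x + B k * s k x)
      (fun x => A k * c' k x + B k * s' k x) := fun k => (H.sol_c k).lin (H.sol_s k) _ _
  have hfb : ∀ k, A k * c k b + B k * s k b = Complex.exp (Complex.I * k * b) := fun k => by
    have := H.wronskian k hb.le
    simp only [A, B]
    linear_combination Complex.exp (Complex.I * k * b) * this
  have hfb' : ∀ k, A k * c' k b + B k * s' k b =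
      Complex.I * k * Complex.exp (Complex.I * k * b) := fun k => by
    have := H.wronskian k hb.le
    simp only [A, B]
    linear_combination (Complex.I * k * Complex.exp (Complex.I * k * b)) * this
  have hexp : ∀ k, ∀ x ≥ b, A k * c k x + B k * s k x = Complex.exp (Complex.I * k * x) ∧
      A k * c' k x + B k * s' k x = Complex.I * k * Complex.exp (Complex.I * k * x) := by
    intro k x hx
    -- Uniqueness is formulated on `[0, ∞)`, so both functions are translated by `b`.
    have hshift : IsSol (fun t => q (t + b)) k (fun t => A k * c k (t + b) + B k * s k (t + b))
        (fun t => A k * c' k (t + b) + B k * s' k (t + b)) := by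
      have hmaps : MapsTo (fun t : ℝ => t + b) (Ici 0) (Ici 0) := fun t ht => by
        simp only [mem_Ici] at ht ⊢; linarith
      constructor
      · intro t ht
        have h1 : HasDerivWithinAt (fun t : ℝ => t + b) 1 (Ici 0) t :=
          ((hasDerivAt_id t).add_const b).hasDerivWithinAt
        have h2 := ((hsol k).deriv_fst (t + b) (hmaps ht)).scomp t h1 hmaps
        simpa [Function.comp_def] using h2
      · intro t ht
        have h1 : HasDerivWithinAt (fun t : ℝ => t + b) 1 (Ici 0) t :=
          ((hasDerivAt_id t).add_const b).hasDerivWithinAt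
        have h2 := ((hsol k).deriv_snd (t + b) (hmaps ht)).scomp t h1 hmaps
        simpa [Function.comp_def] using h2
    have hfree : IsSol (fun t => q (t + b)) k (fun t => Complex.exp (Complex.I * k * (t + b : ℝ)))
        (fun t => Complex.I * k * Complex.exp (Complex.I * k * (t + b : ℝ))) := by
      have h0 : ∀ t : ℝ, HasDerivAt (fun t : ℝ => Complex.exp (Complex.I * k * (t + b : ℝ)))
          (Complex.I * k * Complex.exp (Complex.I * k * (t + b : ℝ))) t := fun t => by
        have h1 := (hasDerivAt_cexp_mul (Complex.I * k) (t + b)).scomp t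
          ((hasDerivAt_id t).add_const b)
        simpa [Function.comp_def] using h1
      constructor
      · exact fun t _ => (h0 t).hasDerivWithinAt
      · intro t ht
        refine ((h0 t).const_mul (Complex.I * k)).hasDerivWithinAt.congr_deriv ?_
        rw [hq0 _ (by linarith)]
        push_cast
        linear_combination (k ^ 2 * Complex.exp (Complex.I * k * (t + b))) * Complex.I_sq
    have hd := hshift.sub hfree
    have hx0 : 0 ≤ x - b := by linarith
    have := hd.eq_zero hb (hq.comp (by fun_prop)) (fun t ht => hq0 _ (by linarith)) le_rfl
      (by simp only [zero_add]; rw [hfb, sub_self]) (by simp only [zero_add]; rw [hfb', sub_self]) hx0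
    simp only [sub_add_cancel] at this
    exact ⟨sub_eq_zero.1 this.1, sub_eq_zero.1 this.2⟩
  refine ⟨fun k x => A k * c k x + B k * s k x, fun k x => A k * c' k x + B k * s' k x, hsol,
    fun k x hx => (hexp k x hx).1, fun k x hx => (hexp k x hx).2, ?_, ?_, ?_⟩
  · exact ((hA.continuous.comp continuous_fst).mul H.cont_c).add
      ((hB.continuous.comp continuous_fst).mul H.cont_s)
  · simpa [H.c_zero, H.s_zero] using hA
  · simpa [H.c'_zero, H.s'_zero] using hB

end

/-! ### Zeros of the Jost function and residues of the Weyl function. -/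

section

namespace IsJostFamily

variable {b : ℝ} {q : ℝ → ℝ} {f f' : ℂ → ℝ → ℂ}

theorem not_both_zero (hJ : IsJostFamily q b f f') (hb : 0 < b) (hq : Continuous q)
    (hq0 : ∀ t ≥ b, q t = 0) (h : ℝ) (k : ℂ) (h0 : f k 0 = 0) (h1 : h * f k 0 + f' k 0 = 0) :
    False := by
  rw [h0, mul_zero, zero_add] at h1
  have := ((hJ.sol k).eq_zero hb hq hq0 le_rfl h0 h1 hb.le).1
  rw [hJ.eq_exp k b le_rfl] at this
  exact Complex.exp_ne_zero _ this

/-- Lagrange's identity with the exponentials inserted at `b`. The choices `l = -k`, `l = -conj k`,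
fixed `k = k₀`, and `k = 0` give respectively the jump, the location of the zeros, the residues, and
the behaviour at the origin. -/
theorem wronskian_end (hJ : IsJostFamily q b f f') (hb : 0 < b) (k l : ℂ) :
    Complex.I * (l - k) * Complex.exp (Complex.I * (k + l) * b) =
      f k 0 * f' l 0 - f' k 0 * f l 0 + (k ^ 2 - l ^ 2) * ∫ t in (0)..b, f k t * f l t := by
  rw [← (hJ.sol k).wronskian_eq (hJ.sol l) hb.le, hJ.eq_exp k b le_rfl, hJ.eq_exp l b le_rfl,
    hJ.eq_exp' k b le_rfl, hJ.eq_exp' l b le_rfl]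
  have : Complex.exp (Complex.I * (k + l) * b) =
      Complex.exp (Complex.I * k * b) * Complex.exp (Complex.I * l * b) := by
    rw [← Complex.exp_add]; ring_nf
  rw [this]; ring

theorem conj_eq (hJ : IsJostFamily q b f f') (hb : 0 < b) (hq : Continuous q)
    (hq0 : ∀ t ≥ b, q t = 0) (k : ℂ) {x : ℝ} (hx : 0 ≤ x) :
    (starRingEnd ℂ) (f k x) = f (-(starRingEnd ℂ) k) x ∧
      (starRingEnd ℂ) (f' k x) = f' (-(starRingEnd ℂ) k) x := by
  have h1 : IsSol q (-(starRingEnd ℂ) k) (fun x => (starRingEnd ℂ) (f k x))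
      (fun x => (starRingEnd ℂ) (f' k x)) := (hJ.sol k).conj.congr_sq (by ring)
  have h2 := (h1.sub (hJ.sol (-(starRingEnd ℂ) k))).eq_zero hb hq hq0 hb.le
    (by rw [hJ.eq_exp _ _ le_rfl, hJ.eq_exp _ _ le_rfl, ← Complex.exp_conj]; simp)
    (by rw [hJ.eq_exp' _ _ le_rfl, hJ.eq_exp' _ _ le_rfl, map_mul, ← Complex.exp_conj]; simp) hx
  exact ⟨sub_eq_zero.1 h2.1, sub_eq_zero.1 h2.2⟩

/-- The Wronskian of `f(·,k)` and its conjugate is `-2ik`, and the real `h` drops out. This yields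
both the absence of real zeros and the sign of the jump. -/
theorem im_real (hJ : IsJostFamily q b f f') (hb : 0 < b) (hq : Continuous q)
    (hq0 : ∀ t ≥ b, q t = 0) (h k : ℝ) :
    (f k 0 * (starRingEnd ℂ) (h * f k 0 + f' k 0)).im = -k := by
  have h1 := hJ.wronskian_end hb k (-k)
  obtain ⟨c0, c1⟩ := hJ.conj_eq hb hq hq0 k le_rfl
  rw [Complex.conj_ofReal] at c0 c1
  rw [← c0, ← c1] at h1
  simp only [add_neg_cancel, mul_zero, zero_mul, Complex.exp_zero, mul_one, neg_sq, sub_self,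
    add_zero] at h1
  have h2 := congrArg Complex.im h1
  simp only [Complex.mul_im, Complex.sub_im, Complex.conj_re, Complex.conj_im, Complex.I_re,
    Complex.I_im, Complex.neg_re, Complex.sub_re, Complex.ofReal_re, map_add, map_mul,
    Complex.conj_ofReal, Complex.add_re, Complex.add_im, Complex.mul_re, Complex.ofReal_im] at h2 ⊢
  linarith

theorem jost_ne_zero_of_real (hJ : IsJostFamily q b f f') (hb : 0 < b) (hq : Continuous q)
    (hq0 : ∀ t ≥ b, q t = 0) (h : ℝ) {k : ℝ} (hk : k ≠ 0) : h * f k 0 + f' k 0 ≠ 0 := by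
  intro h0
  have := hJ.im_real hb hq hq0 h k
  rw [h0] at this
  simp at this
  exact hk this

/-- Self-adjointness: with `l = -conj k` the boundary term at `0` disappears, and after cancelling
`k.re` a negative number would equal `2 Im k ∫ |f|²`. -/
theorem re_eq_zero_of_jost_eq_zero (hJ : IsJostFamily q b f f') (hb : 0 < b) (hq : Continuous q)
    (hq0 : ∀ t ≥ b, q t = 0) (h : ℝ) {k : ℂ} (hk : 0 < k.im) (h0 : h * f k 0 + f' k 0 = 0) :
    k.re = 0 := by
  by_contra hre
  have h1 := hJ.wronskian_end hb k (-(starRingEnd ℂ) k)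
  obtain ⟨c0, c1⟩ := hJ.conj_eq hb hq hq0 k le_rfl
  rw [← c0, ← c1] at h1
  have h2 : f' k 0 = -(h * f k 0) := by linear_combination h0
  have h3 : ∫ t in (0)..b, f k t * f (-(starRingEnd ℂ) k) t =
      ((∫ t in (0)..b, ‖f k t‖ ^ 2 : ℝ) : ℂ) := by
    rw [← intervalIntegral.integral_ofReal]
    refine intervalIntegral.integral_congr fun t ht => ?_
    rw [uIcc_of_le hb.le] at ht
    rw [← (hJ.conj_eq hb hq hq0 k ht.1).1, Complex.mul_conj, Complex.normSq_eq_norm_sq]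
  have hpos : 0 ≤ ∫ t in (0)..b, ‖f k t‖ ^ 2 :=
    intervalIntegral.integral_nonneg hb.le fun t _ => by positivity
  rw [h3, h2] at h1
  simp only [map_neg, map_mul, Complex.conj_ofReal] at h1
  have e1 : -(starRingEnd ℂ) k - k = ((-2 * k.re : ℝ) : ℂ) := by
    apply Complex.ext <;> simp; ring
  have e2 : Complex.I * (k + -(starRingEnd ℂ) k) * b = ((-2 * k.im * b : ℝ) : ℂ) := by
    apply Complex.ext <;> simp; ring
  have e3 : k ^ 2 - (-(starRingEnd ℂ) k) ^ 2 = Complex.I * ((4 * k.re * k.im : ℝ) : ℂ) := by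
    apply Complex.ext <;> simp [pow_two]; ring
  rw [e1, e2, e3, ← Complex.ofReal_exp] at h1
  have h4 : ((-2 * k.re * Real.exp (-2 * k.im * b) : ℝ) : ℂ) =
      ((4 * k.re * k.im * ∫ t in (0)..b, ‖f k t‖ ^ 2 : ℝ) : ℂ) := by
    have hI := Complex.I_ne_zero
    apply mul_left_cancel₀ hI
    push_cast
    push_cast at h1
    linear_combination h1
  have h5 := Complex.ofReal_injective h4
  have h6 : -Real.exp (-2 * k.im * b) = 2 * k.im * ∫ t in (0)..b, ‖f k t‖ ^ 2 := by
    apply mul_left_cancel₀ hre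
    linarith
  have : 0 ≤ 2 * k.im * ∫ t in (0)..b, ‖f k t‖ ^ 2 := by positivity
  linarith [Real.exp_pos (-2 * k.im * b)]

theorem continuous_integral_mul (hJ : IsJostFamily q b f f') (k₀ : ℂ) :
    Continuous fun k => ∫ t in (0)..b, f k₀ t * f k t := by
  refine intervalIntegral.continuous_parametric_intervalIntegral_of_continuous'
    (f := fun k t => f k₀ t * f k t) ?_ 0 b
  have h1 : Continuous (f k₀) := hJ.cont.comp (Continuous.prodMk_right k₀)
  exact (h1.comp continuous_snd).mul hJ.cont

/-- Lagrange's identity factors `f(k₀,0) f_h(k) = (k² - k₀²) J(k)`, where `J(k₀) = ∫₀^∞ f(k₀,·)²` is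
positive because `f(k₀,·)` is real. So the zero is simple in `k²` and the residue is `f(k₀,0)² /
J(k₀)`. -/
theorem tendsto_residue (hJ : IsJostFamily q b f f') (hb : 0 < b) (hq : Continuous q)
    (hq0 : ∀ t ≥ b, q t = 0) (h : ℝ) {k₀ : ℂ} (hk₀ : 0 < k₀.im)
    (h0 : h * f k₀ 0 + f' k₀ 0 = 0) :
    ∃ α : ℝ, 0 < α ∧ Tendsto (fun k => (k ^ 2 - k₀ ^ 2) * (f k 0 / (h * f k 0 + f' k 0)))
      (𝓝[≠] k₀) (𝓝 (α : ℂ)) := by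
  have hre := hJ.re_eq_zero_of_jost_eq_zero hb hq hq0 h hk₀ h0
  have hk0' : k₀ = Complex.I * k₀.im := by apply Complex.ext <;> simp [hre]
  have hk00 : k₀ ≠ 0 := fun h => by rw [h] at hk₀; simp at hk₀
  have hconj : -(starRingEnd ℂ) k₀ = k₀ := by apply Complex.ext <;> simp [hre]
  have hreal : ∀ x ≥ 0, f k₀ x = ((f k₀ x).re : ℂ) := fun x hx => by
    have := (hJ.conj_eq hb hq hq0 k₀ hx).1
    rw [hconj] at this
    exact (Complex.conj_eq_iff_re.1 this).symm
  have hf0 : f k₀ 0 ≠ 0 := fun hf => hJ.not_both_zero hb hq hq0 h k₀ hf h0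
  -- The first term represents the integral of `f(k₀,·) f(k,·)` over `[b, ∞)`, where both factors
  -- are exponentials.
  let J : ℂ → ℂ := fun k => Complex.I * Complex.exp (Complex.I * (k₀ + k) * b) / (k + k₀) +
    ∫ t in (0)..b, f k₀ t * f k t
  have hJid : ∀ k, k + k₀ ≠ 0 → f k₀ 0 * (h * f k 0 + f' k 0) = (k ^ 2 - k₀ ^ 2) * J k := by
    intro k hk
    have h1 := hJ.wronskian_end hb k₀ k
    have h2 : (k ^ 2 - k₀ ^ 2) * (Complex.I * Complex.exp (Complex.I * (k₀ + k) * b) / (k + k₀)) =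
        Complex.I * (k - k₀) * Complex.exp (Complex.I * (k₀ + k) * b) := by
      field_simp; ring
    simp only [J]
    rw [mul_add (k ^ 2 - k₀ ^ 2), h2, h1]
    linear_combination (f k 0) * h0
  have h2k : k₀ + k₀ ≠ 0 := by rw [← two_mul]; exact mul_ne_zero two_ne_zero hk00
  have hJc : ContinuousAt J k₀ := by
    refine ContinuousAt.add (ContinuousAt.div ?_ ?_ h2k) (hJ.continuous_integral_mul k₀).continuousAt
    · exact Continuous.continuousAt (by fun_prop)
    · exact Continuous.continuousAt (by fun_prop)
  let j : ℝ := Real.exp (-2 * k₀.im * b) / (2 * k₀.im) + ∫ t in (0)..b, (f k₀ t).re ^ 2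
  have hj : 0 < j := by
    have : 0 ≤ ∫ t in (0)..b, (f k₀ t).re ^ 2 :=
      intervalIntegral.integral_nonneg hb.le fun t _ => by positivity
    have : 0 < Real.exp (-2 * k₀.im * b) / (2 * k₀.im) := by positivity
    simp only [j]; linarith
  have hJk : J k₀ = j := by
    simp only [J, j]
    push_cast
    rw [← intervalIntegral.integral_ofReal]
    congr 1
    · have e1 : Complex.I * (k₀ + k₀) * b = -2 * k₀.im * b := by
        conv_lhs => rw [hk0']
        linear_combination (2 * k₀.im * b : ℂ) * Complex.I_sq
      have e2 : k₀ + k₀ = Complex.I * (2 * k₀.im) := by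
        conv_lhs => rw [hk0']
        ring
      rw [e1, e2]
      have : (k₀.im : ℂ) ≠ 0 := by exact_mod_cast hk₀.ne'
      field_simp
    · refine intervalIntegral.integral_congr fun t ht => ?_
      rw [uIcc_of_le hb.le] at ht
      rw [hreal t ht.1]; push_cast; simp [sq]
  refine ⟨(f k₀ 0).re ^ 2 / j, ?_, ?_⟩
  · have : (f k₀ 0).re ≠ 0 := fun h1 => hf0 (by rw [hreal 0 le_rfl, h1]; simp)
    positivity
  · have hlim : Tendsto (fun k => f k 0 * f k₀ 0 / J k) (𝓝[≠] k₀)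
        (𝓝 (f k₀ 0 * f k₀ 0 / J k₀)) := by
      refine (Tendsto.div ?_ hJc.tendsto (by rw [hJk]; exact_mod_cast hj.ne')).mono_left
        nhdsWithin_le_nhds
      exact (hJ.diff.continuous.tendsto k₀).mul_const _
    have hval : f k₀ 0 * f k₀ 0 / J k₀ = (((f k₀ 0).re ^ 2 / j : ℝ) : ℂ) := by
      rw [hJk, hreal 0 le_rfl]; push_cast; simp [sq]
    rw [← hval]
    refine hlim.congr' ?_
    have hsum : ∀ᶠ k in 𝓝[≠] k₀, k + k₀ ≠ 0 := by
      have : Tendsto (fun k => k + k₀) (𝓝[≠] k₀) (𝓝 (k₀ + k₀)) :=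
        (Continuous.tendsto (by fun_prop) _).mono_left nhdsWithin_le_nhds
      exact this.eventually_ne h2k
    have hJne : ∀ᶠ k in 𝓝[≠] k₀, J k ≠ 0 :=
      (hJc.tendsto.mono_left nhdsWithin_le_nhds).eventually_ne
        (by rw [hJk]; exact_mod_cast hj.ne')
    filter_upwards [hsum, hJne, self_mem_nhdsWithin] with k hk1 hk2 hk3
    have h1 := hJid k hk1
    have h2 : k ^ 2 - k₀ ^ 2 ≠ 0 := by
      rw [sq_sub_sq]; exact mul_ne_zero hk1 (sub_ne_zero.2 hk3)
    have h3 : h * f k 0 + f' k 0 ≠ 0 := fun h4 => by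
      rw [h4, mul_zero] at h1; exact mul_ne_zero h2 hk2 h1.symm
    rw [mul_div_assoc', div_eq_div_iff hk2 h3]
    linear_combination (f k 0) * h1

/-- If `f_h(0) = 0`, Lagrange's identity with `k₀ = 0` gives `f(0,0) f_h(k) = k J(k)` with `J(0) =
i`: a simple zero, compensated by the factor `k`. -/
theorem isBigO_zero (hJ : IsJostFamily q b f f') (hb : 0 < b) (hq : Continuous q)
    (hq0 : ∀ t ≥ b, q t = 0) (h : ℝ) :
    (fun k : ℂ => k * (f k 0 / (h * f k 0 + f' k 0))) =O[𝓝[≠] 0] (fun _ => (1 : ℂ)) := by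
  have hFc : Continuous fun k => h * f k 0 + f' k 0 := by
    have := hJ.diff.continuous; have := hJ.diff'.continuous; fun_prop
  by_cases hF : h * f 0 0 + f' 0 0 = 0
  · have hf0 : f 0 0 ≠ 0 := fun hf => hJ.not_both_zero hb hq hq0 h 0 hf hF
    let J : ℂ → ℂ := fun k => Complex.I * Complex.exp (Complex.I * k * b) +
      k * ∫ t in (0)..b, f 0 t * f k t
    have hJid : ∀ k, f 0 0 * (h * f k 0 + f' k 0) = k * J k := by
      intro k
      have h1 := hJ.wronskian_end hb 0 k
      simp only [zero_add, sub_zero] at h1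
      simp only [J]
      linear_combination -h1 + (f k 0) * hF
    have hJc : ContinuousAt J 0 := by
      have := hJ.continuous_integral_mul 0
      exact Continuous.continuousAt (by fun_prop)
    have hJ0 : J 0 = Complex.I := by simp [J]
    have hlim : Tendsto (fun k => f k 0 * f 0 0 / J k) (𝓝[≠] 0) (𝓝 (f 0 0 * f 0 0 / J 0)) := by
      refine (Tendsto.div ?_ hJc.tendsto (by rw [hJ0]; exact Complex.I_ne_zero)).mono_left
        nhdsWithin_le_nhds
      exact (hJ.diff.continuous.tendsto 0).mul_const _
    refine (hlim.isBigO_one ℂ).congr' ?_ EventuallyEq.rfl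
    have hJne : ∀ᶠ k in 𝓝[≠] 0, J k ≠ 0 :=
      (hJc.tendsto.mono_left nhdsWithin_le_nhds).eventually_ne
        (by rw [hJ0]; exact Complex.I_ne_zero)
    filter_upwards [hJne, self_mem_nhdsWithin] with k hk2 hk3
    have h1 := hJid k
    have h3 : h * f k 0 + f' k 0 ≠ 0 := fun h4 => by
      rw [h4, mul_zero] at h1; exact mul_ne_zero hk3 hk2 h1.symm
    rw [mul_div_assoc', div_eq_div_iff hk2 h3]
    linear_combination (f k 0) * h1
  · have hlim : Tendsto (fun k : ℂ => k * (f k 0 / (h * f k 0 + f' k 0))) (𝓝[≠] 0)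
        (𝓝 (0 * (f 0 0 / (h * f 0 0 + f' 0 0)))) := by
      refine Tendsto.mono_left ?_ nhdsWithin_le_nhds
      exact tendsto_id.mul ((hJ.diff.continuous.tendsto 0).div (hFc.tendsto 0) hF)
    exact hlim.isBigO_one ℂ

end IsJostFamily

end

/-! ### High-energy asymptotics of the Jost solution and the Weyl function. -/

section

/-- The Laplace-type integral of an absolutely continuous function decays like `1 / |c|`. -/
theorem norm_integral_exp_mul_le_of_absolutelyContinuous {V : ℝ → ℝ} {b : ℝ} (hb : 0 ≤ b)
    (hV : AbsolutelyContinuousOnInterval V 0 b) :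
    ∃ D : ℝ, ∀ c : ℂ, c.re ≤ 0 → c ≠ 0 → ‖∫ t in (0)..b, Complex.exp (c * t) * V t‖ ≤ D / ‖c‖ := by
  let D₀ : ℝ := |V b| + |V 0| + ∫ t in (0)..b, |deriv V t|
  -- Integration by parts is carried out for real-valued functions; `L` stands for the real part and
  -- for the imaginary part.
  have key : ∀ c : ℂ, c.re ≤ 0 → c ≠ 0 → ∀ L : ℂ →L[ℝ] ℝ, (∀ z, |L z| ≤ ‖z‖) →
      |∫ t in (0)..b, V t * L (Complex.exp (c * t))| ≤ D₀ / ‖c‖ := by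
    intro c hc hc0 L hL
    have hcp : 0 < ‖c‖ := norm_pos_iff.2 hc0
    have hder : ∀ t : ℝ, HasDerivAt (fun t : ℝ => L (Complex.exp (c * t) / c))
        (L (Complex.exp (c * t))) t := fun t => by
      have h1 := (hasDerivAt_cexp_mul c t).div_const c
      rw [mul_div_cancel_left₀ _ hc0] at h1
      exact L.hasFDerivAt.comp_hasDerivAt t h1
    have hbd : ∀ t : ℝ, 0 ≤ t → |L (Complex.exp (c * t) / c)| ≤ 1 / ‖c‖ := fun t ht => by
      refine (hL _).trans ?_
      rw [norm_div, Complex.norm_exp]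
      gcongr
      rw [Real.exp_le_one_iff]
      simp only [Complex.re_mul_ofReal]
      exact mul_nonpos_of_nonpos_of_nonneg hc ht
    have hac : AbsolutelyContinuousOnInterval (fun t : ℝ => L (Complex.exp (c * t) / c)) 0 b := by
      apply ContDiffOn.absolutelyContinuousOnInterval
      exact ContDiff.contDiffOn (L.contDiff.comp (((contDiff_const.mul Complex.ofRealCLM.contDiff).cexp).div_const c))
    have h := hV.integral_mul_deriv_eq_deriv_mul hac
    have hde : deriv (fun t : ℝ => L (Complex.exp (c * t) / c)) =
        fun t : ℝ => L (Complex.exp (c * t)) := funext fun t => (hder t).deriv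
    rw [hde] at h
    rw [h]
    have h1 : |V b * L (Complex.exp (c * b) / c)| ≤ |V b| * (1 / ‖c‖) := by
      rw [abs_mul]; gcongr; exact hbd b hb
    have h2 : |V 0 * L (Complex.exp (c * (0 : ℝ)) / c)| ≤ |V 0| * (1 / ‖c‖) := by
      rw [abs_mul]; gcongr; exact hbd 0 le_rfl
    have h3 : |∫ t in (0)..b, deriv V t * L (Complex.exp (c * t) / c)| ≤
        (∫ t in (0)..b, |deriv V t|) * (1 / ‖c‖) := by
      rw [← intervalIntegral.integral_mul_const]
      refine intervalIntegral.norm_integral_le_of_norm_le (f := fun t => deriv V t * L (Complex.exp (c * t) / c)) hb (ae_of_all _ fun t ht => ?_)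
        (hV.intervalIntegrable_deriv.abs.mul_const _)
      rw [Real.norm_eq_abs, abs_mul]
      gcongr
      exact hbd t ht.1.le
    calc _ ≤ |V b| * (1 / ‖c‖) + |V 0| * (1 / ‖c‖) +
          (∫ t in (0)..b, |deriv V t|) * (1 / ‖c‖) :=
        (abs_sub _ _).trans (add_le_add ((abs_sub _ _).trans (add_le_add h1 h2)) h3)
      _ = D₀ / ‖c‖ := by simp only [D₀]; ring
  refine ⟨2 * D₀, fun c hc hc0 => ?_⟩
  have hVc : ContinuousOn V (uIcc 0 b) := hV.continuousOn
  have hint : IntervalIntegrable (fun t : ℝ => Complex.exp (c * t) * V t) volume 0 b := by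
    apply ContinuousOn.intervalIntegrable
    exact ContinuousOn.mul (Continuous.continuousOn (by fun_prop))
      (Complex.continuous_ofReal.comp_continuousOn hVc)
  have hre := key c hc hc0 Complex.reCLM Complex.abs_re_le_norm
  have him := key c hc hc0 Complex.imCLM Complex.abs_im_le_norm
  have e1 : (∫ t in (0)..b, Complex.exp (c * t) * V t).re =
      ∫ t in (0)..b, V t * Complex.reCLM (Complex.exp (c * t)) := by
    rw [← Complex.reCLM_apply, ← Complex.reCLM.intervalIntegral_comp_comm hint]
    refine intervalIntegral.integral_congr fun t _ => ?_
    simp only [Complex.reCLM_apply, Complex.re_mul_ofReal]; ring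
  have e2 : (∫ t in (0)..b, Complex.exp (c * t) * V t).im =
      ∫ t in (0)..b, V t * Complex.imCLM (Complex.exp (c * t)) := by
    rw [← Complex.imCLM_apply, ← Complex.imCLM.intervalIntegral_comp_comm hint]
    refine intervalIntegral.integral_congr fun t _ => ?_
    simp only [Complex.imCLM_apply, Complex.im_mul_ofReal]; ring
  refine (Complex.norm_le_abs_re_add_abs_im _).trans ?_
  rw [e1, e2]
  calc _ ≤ D₀ / ‖c‖ + D₀ / ‖c‖ := add_le_add hre him
    _ = _ := by ring

namespace IsJostFamily

variable {b : ℝ} {q : ℝ → ℝ} {f f' : ℂ → ℝ → ℂ}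

/-- Variation of constants: `e^{∓ikx} (f' ± ik f)` has derivative `e^{∓ikx} q f`, and its value at
`b` is `2ik` for the upper sign and `0` for the lower. -/
theorem integral_identities (hJ : IsJostFamily q b f f') (hq : Continuous q) (k : ℂ)
    {x : ℝ} (hx : x ∈ Icc 0 b) :
    Complex.exp (-(Complex.I * k) * x) * (f' k x + Complex.I * k * f k x) = 2 * Complex.I * k -
        ∫ t in x..b, (q t : ℂ) * (Complex.exp (-(Complex.I * k) * t) * f k t) ∧
      Complex.exp (Complex.I * k * x) * (f' k x - Complex.I * k * f k x) =
        -∫ t in x..b, Complex.exp (2 * Complex.I * k * t) *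
          (q t * (Complex.exp (-(Complex.I * k) * t) * f k t)) := by
  have hfc : Continuous (f k) := hJ.cont.comp (Continuous.prodMk_right k)
  have hsub : Icc x b ⊆ Ici 0 := fun t ht => hx.1.trans ht.1
  constructor
  · have h := intervalIntegral.integral_eq_sub_of_hasDeriv_right_of_le hx.2
      (f := fun t : ℝ => Complex.exp (-(Complex.I * k) * t) * (f' k t + Complex.I * k * f k t))
      (f' := fun t : ℝ => (q t : ℂ) * (Complex.exp (-(Complex.I * k) * t) * f k t))
      (ContinuousOn.mul (Continuous.continuousOn (by fun_prop))
        (((hJ.sol k).continuousOn_snd.mono hsub).add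
          (Continuous.continuousOn (by fun_prop)))) (fun t ht => by
        have ht0 : 0 ≤ t := hx.1.trans ht.1.le
        have h1 := (hasDerivAt_cexp_mul (-(Complex.I * k)) t).hasDerivWithinAt (s := Ici 0)
        have h2 := ((hJ.sol k).deriv_snd t ht0).add
          (((hJ.sol k).deriv_fst t ht0).const_mul (Complex.I * k))
        refine ((h1.mul h2).mono (Ioi_subset_Ici (hx.1.trans ht.1.le))).congr_deriv ?_
        simp only [Pi.add_apply]
        linear_combination (-k ^ 2 * Complex.exp (-(Complex.I * k) * t) * f k t) * Complex.I_sq)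
      (Continuous.intervalIntegrable (by fun_prop) _ _)
    rw [h, hJ.eq_exp k b le_rfl, hJ.eq_exp' k b le_rfl]
    have : Complex.exp (-(Complex.I * k) * b) * Complex.exp (Complex.I * k * b) = 1 := by
      rw [← Complex.exp_add]; simp
    linear_combination (2 * Complex.I * k) * this
  · have h := intervalIntegral.integral_eq_sub_of_hasDeriv_right_of_le hx.2
      (f := fun t : ℝ => Complex.exp (Complex.I * k * t) * (f' k t - Complex.I * k * f k t))
      (f' := fun t : ℝ => Complex.exp (2 * Complex.I * k * t) *
          (q t * (Complex.exp (-(Complex.I * k) * t) * f k t)))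
      (ContinuousOn.mul (Continuous.continuousOn (by fun_prop))
        (((hJ.sol k).continuousOn_snd.mono hsub).sub
          (Continuous.continuousOn (by fun_prop)))) (fun t ht => by
        have ht0 : 0 ≤ t := hx.1.trans ht.1.le
        have h1 := (hasDerivAt_cexp_mul (Complex.I * k) t).hasDerivWithinAt (s := Ici 0)
        have h2 := ((hJ.sol k).deriv_snd t ht0).sub
          (((hJ.sol k).deriv_fst t ht0).const_mul (Complex.I * k))
        refine ((h1.mul h2).mono (Ioi_subset_Ici (hx.1.trans ht.1.le))).congr_deriv ?_
        simp only [Pi.sub_apply]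
        have : Complex.exp (2 * Complex.I * k * t) * Complex.exp (-(Complex.I * k) * t) =
            Complex.exp (Complex.I * k * t) := by rw [← Complex.exp_add]; ring_nf
        linear_combination (-k ^ 2 * Complex.exp (Complex.I * k * t) * f k t) * Complex.I_sq -
          q t * f k t * this)
      (Continuous.intervalIntegrable (by fun_prop) _ _)
    rw [h, hJ.eq_exp k b le_rfl, hJ.eq_exp' k b le_rfl]
    ring

/-- Let `S` be the maximum of `|e^{-ikx} f|` on `[0, b]`. The two identities bound the deviation
from `1` by `B b S / |k|`, and `|k| ≥ 2 B b` then forces `S ≤ 2`. -/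
theorem norm_exp_mul_sub_one_le (hJ : IsJostFamily q b f f') (hb : 0 < b) (hq : Continuous q)
    {B : ℝ} (hB : ∀ t ∈ Icc 0 b, |q t| ≤ B) {k : ℂ} (hk : 0 ≤ k.im) (hkB : 2 * (B * b) ≤ ‖k‖)
    (hk0 : k ≠ 0) {x : ℝ} (hx : x ∈ Icc 0 b) :
    ‖Complex.exp (-(Complex.I * k) * x) * f k x - 1‖ ≤ 2 * (B * b) / ‖k‖ := by
  have hfc : Continuous (f k) := hJ.cont.comp (Continuous.prodMk_right k)
  have hB0 : 0 ≤ B := (abs_nonneg _).trans (hB 0 ⟨le_rfl, hb.le⟩)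
  have hkp : 0 < ‖k‖ := norm_pos_iff.2 hk0
  obtain ⟨x₀, hx₀, hmax⟩ := isCompact_Icc.exists_isMaxOn (nonempty_Icc.2 hb.le)
    (f := fun x : ℝ => ‖Complex.exp (-(Complex.I * k) * x) * f k x‖)
    (Continuous.continuousOn (by fun_prop))
  obtain ⟨S, hS⟩ : ∃ S, S = ‖Complex.exp (-(Complex.I * k) * x₀) * f k x₀‖ := ⟨_, rfl⟩
  have hS0 : 0 ≤ S := hS ▸ norm_nonneg _
  have hmS : ∀ t ∈ Icc 0 b, ‖Complex.exp (-(Complex.I * k) * t) * f k t‖ ≤ S := fun t ht =>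
    hS ▸ hmax ht
  have key : ∀ x ∈ Icc 0 b, ‖Complex.exp (-(Complex.I * k) * x) * f k x - 1‖ ≤ B * b * S / ‖k‖ := by
    intro x hx
    obtain ⟨h1, h2⟩ := hJ.integral_identities hq k hx
    have hlen : b - x ≤ b := by linarith [hx.1]
    have b1 : ‖∫ t in x..b, (q t : ℂ) * (Complex.exp (-(Complex.I * k) * t) * f k t)‖ ≤
        B * b * S := by
      refine (intervalIntegral.norm_integral_le_of_norm_le_const (C := B * S) fun t ht => ?_).trans ?_
      · rw [uIoc_of_le hx.2] at ht
        have ht' : t ∈ Icc 0 b := ⟨hx.1.trans ht.1.le, ht.2⟩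
        rw [norm_mul, Complex.norm_real]
        exact mul_le_mul (hB t ht') (hmS t ht') (norm_nonneg _) hB0
      · rw [abs_of_nonneg (by linarith [hx.2])]
        nlinarith [mul_nonneg hB0 hS0]
    have b2 : ‖Complex.exp (-(Complex.I * k) * x) * (f' k x - Complex.I * k * f k x)‖ ≤
        B * b * S := by
      -- Multiplying the second identity by `e^{-2ikx}` leaves the factor `e^{2ik(t-x)}`, of modulus
      -- at most `1` since `t ≥ x` and `Im k ≥ 0`.
      have e : Complex.exp (-(Complex.I * k) * x) * (f' k x - Complex.I * k * f k x) =
          -∫ t in x..b, Complex.exp (2 * Complex.I * k * (t - x)) *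
            (q t * (Complex.exp (-(Complex.I * k) * t) * f k t)) := by
        have e1 : Complex.exp (-(Complex.I * k) * x) = Complex.exp (-(2 * Complex.I * k * x)) *
            Complex.exp (Complex.I * k * x) := by rw [← Complex.exp_add]; ring_nf
        rw [e1, mul_assoc, h2, mul_neg, ← intervalIntegral.integral_const_mul]
        congr 1
        refine intervalIntegral.integral_congr fun t _ => ?_
        rw [← mul_assoc, ← Complex.exp_add]
        ring_nf
      rw [e, norm_neg]
      refine (intervalIntegral.norm_integral_le_of_norm_le_const (C := B * S) fun t ht => ?_).trans ?_
      · rw [uIoc_of_le hx.2] at ht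
        have ht' : t ∈ Icc 0 b := ⟨hx.1.trans ht.1.le, ht.2⟩
        have hE : ‖Complex.exp (2 * Complex.I * k * (t - x))‖ ≤ 1 := by
          rw [Complex.norm_exp, Real.exp_le_one_iff]
          have : (2 * Complex.I * k * ((t : ℂ) - x)).re = -(2 * k.im * (t - x)) := by
            rw [← Complex.ofReal_sub, Complex.re_mul_ofReal]; simp
          rw [this]
          have : 0 ≤ t - x := by linarith [ht.1]
          have := mul_nonneg hk this
          linarith
        rw [norm_mul, norm_mul, Complex.norm_real, ← one_mul (B * S)]
        exact mul_le_mul hE (mul_le_mul (hB t ht') (hmS t ht') (norm_nonneg _) hB0) (by positivity)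
          zero_le_one
      · rw [abs_of_nonneg (by linarith [hx.2])]
        nlinarith [mul_nonneg hB0 hS0]
    have e : 2 * Complex.I * k * (Complex.exp (-(Complex.I * k) * x) * f k x - 1) =
        -(∫ t in x..b, (q t : ℂ) * (Complex.exp (-(Complex.I * k) * t) * f k t)) -
        Complex.exp (-(Complex.I * k) * x) * (f' k x - Complex.I * k * f k x) := by
      linear_combination h1
    have e' := congrArg norm e
    rw [norm_mul, norm_mul, norm_mul, Complex.norm_I, Complex.norm_ofNat] at e'
    have := norm_sub_le (-(∫ t in x..b, (q t : ℂ) * (Complex.exp (-(Complex.I * k) * t) * f k t)))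
      (Complex.exp (-(Complex.I * k) * x) * (f' k x - Complex.I * k * f k x))
    rw [norm_neg, ← e'] at this
    rw [le_div_iff₀ hkp]
    linarith
  have hS2 : S ≤ 2 := by
    have h1 := key x₀ hx₀
    have h2 : S ≤ 1 + B * b * S / ‖k‖ := by
      have := norm_sub_norm_le (Complex.exp (-(Complex.I * k) * x₀) * f k x₀) 1
      rw [← hS, norm_one] at this
      linarith
    have h3 : B * b * S / ‖k‖ ≤ S / 2 := by
      rw [div_le_iff₀ hkp]
      nlinarith
    linarith
  refine (key x hx).trans ?_
  refine div_le_div_of_nonneg_right ?_ hkp.le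
  have := mul_le_mul_of_nonneg_left hS2 (mul_nonneg hB0 hb.le)
  linarith

/-- The high-energy asymptotics of the Weyl function. -/
theorem asymptotics (hJ : IsJostFamily q b f f') (hb : 0 < b) (hq : Continuous q) (h : ℝ)
    (hosc : ∃ D : ℝ, ∀ c : ℂ, c.re ≤ 0 → c ≠ 0 →
      ‖∫ t in (0)..b, Complex.exp (c * t) * q t‖ ≤ D / ‖c‖) :
    ∃ C R₀ : ℝ, 0 < C ∧ 0 < R₀ ∧ ∀ k : ℂ, 0 ≤ k.im → R₀ ≤ ‖k‖ →
      h * f k 0 + f' k 0 ≠ 0 ∧ ‖f k 0 / (h * f k 0 + f' k 0) - (1 / (Complex.I * k) + h / k ^ 2)‖ ≤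
        C / ‖k‖ ^ 3 ∧ ‖k‖ / 4 ≤ ‖h * f k 0 + f' k 0‖ := by
  obtain ⟨D, hD⟩ := hosc
  obtain ⟨B, hB⟩ := isCompact_Icc.exists_bound_of_continuousOn (hq.continuousOn (s := Icc 0 b))
  have hB0 : 0 ≤ B := (norm_nonneg _).trans (hB 0 ⟨le_rfl, hb.le⟩)
  let Q := B * b
  have hQ : 0 ≤ Q := mul_nonneg hB0 hb.le
  let C₁ := |D| + 2 * Q ^ 2
  have hC₁ : 0 ≤ C₁ := by positivity
  refine ⟨2 * (2 * C₁ + h ^ 2 + 2 * |h| * C₁) + 1, 4 * Q + 2 * (|h| + 2 * C₁) + 1, by positivity,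
    by positivity, fun k hk hkR => ?_⟩
  have hah : 0 ≤ |h| := abs_nonneg h
  have hk1 : 1 ≤ ‖k‖ := by linarith
  have hkp : 0 < ‖k‖ := by linarith
  have hk0 : k ≠ 0 := norm_pos_iff.1 hkp
  have hm : ∀ t ∈ Icc 0 b, ‖Complex.exp (-(Complex.I * k) * t) * f k t - 1‖ ≤ 2 * Q / ‖k‖ :=
    fun t ht => hJ.norm_exp_mul_sub_one_le hb hq hB hk
      (by show 2 * Q ≤ ‖k‖; linarith) hk0 ht
  have hfc : Continuous (f k) := hJ.cont.comp (Continuous.prodMk_right k)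
  have h0mem : (0 : ℝ) ∈ Icc 0 b := ⟨le_rfl, hb.le⟩
  -- `f'(0) - ik f(0)` is `O(1/k)`: the main part is the oscillatory integral of `q`, and the
  -- correction carries `e^{-ikt} f - 1 = O(1/k)`.
  obtain ⟨n, hn⟩ : ∃ n, n = f' k 0 - Complex.I * k * f k 0 := ⟨_, rfl⟩
  have hnb : ‖n‖ ≤ C₁ / ‖k‖ := by
    have h2 := (hJ.integral_identities hq k h0mem).2
    simp only [Complex.ofReal_zero, mul_zero, Complex.exp_zero, one_mul, ← hn] at h2
    have hsplit : ∫ t in (0)..b, Complex.exp (2 * Complex.I * k * t) *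
          (q t * (Complex.exp (-(Complex.I * k) * t) * f k t)) =
        (∫ t in (0)..b, Complex.exp (2 * Complex.I * k * t) * q t) +
        ∫ t in (0)..b, Complex.exp (2 * Complex.I * k * t) *
          (q t * (Complex.exp (-(Complex.I * k) * t) * f k t - 1)) := by
      rw [← intervalIntegral.integral_add (Continuous.intervalIntegrable (by fun_prop) _ _)
        (Continuous.intervalIntegrable (by fun_prop) _ _)]
      refine intervalIntegral.integral_congr fun t _ => ?_
      ring
    have hE : ∀ t : ℝ, 0 ≤ t → ‖Complex.exp (2 * Complex.I * k * t)‖ ≤ 1 := fun t ht => by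
      rw [Complex.norm_exp, Real.exp_le_one_iff, Complex.re_mul_ofReal]
      have : (2 * Complex.I * k).re = -(2 * k.im) := by simp
      rw [this]
      have := mul_nonneg hk ht
      linarith
    have h3 : ‖∫ t in (0)..b, Complex.exp (2 * Complex.I * k * t) *
          (q t * (Complex.exp (-(Complex.I * k) * t) * f k t - 1))‖ ≤ 2 * Q ^ 2 / ‖k‖ := by
      refine (intervalIntegral.norm_integral_le_of_norm_le_const (C := 1 * (B * (2 * Q / ‖k‖)))
        fun t ht => ?_).trans ?_
      · rw [uIoc_of_le hb.le] at ht
        have ht' : t ∈ Icc 0 b := ⟨ht.1.le, ht.2⟩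
        rw [norm_mul, norm_mul, Complex.norm_real]
        exact mul_le_mul (hE t ht'.1) (mul_le_mul (hB t ht') (hm t ht') (norm_nonneg _) hB0)
          (by positivity) zero_le_one
      · rw [sub_zero, abs_of_pos hb]
        apply le_of_eq
        simp only [Q]; ring
    have h4 := hD (2 * Complex.I * k) (by simp; exact hk)
      (mul_ne_zero (mul_ne_zero two_ne_zero Complex.I_ne_zero) hk0)
    have h5 : D / ‖2 * Complex.I * k‖ ≤ |D| / ‖k‖ := by
      rw [norm_mul, norm_mul, Complex.norm_I, Complex.norm_ofNat, mul_one]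
      refine (div_le_div_of_nonneg_right (le_abs_self D) (by positivity)).trans ?_
      apply div_le_div_of_nonneg_left (abs_nonneg _) hkp
      linarith
    rw [h2, hsplit, norm_neg]
    refine (norm_add_le _ _).trans ?_
    simp only [C₁, add_div]
    linarith
  have hm0 := hm 0 h0mem
  simp only [Complex.ofReal_zero, mul_zero, Complex.exp_zero, one_mul] at hm0
  have hf0 : 1 / 2 ≤ ‖f k 0‖ := by
    have h1 : 2 * Q / ‖k‖ ≤ 1 / 2 := by rw [div_le_iff₀ hkp]; linarith
    have h2 := norm_sub_norm_le (1 : ℂ) (f k 0)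
    rw [norm_one, norm_sub_rev] at h2
    linarith
  have hf0p : 0 < ‖f k 0‖ := by linarith
  have hf00 : f k 0 ≠ 0 := norm_pos_iff.1 hf0p
  -- Then `f_h / f = ik + h + ε` with `ε = O(1/k)`, so the Weyl function is the reciprocal of `d`.
  obtain ⟨ε, hε⟩ : ∃ ε, ε = n / f k 0 := ⟨_, rfl⟩
  have hεb : ‖ε‖ ≤ 2 * C₁ / ‖k‖ := by
    rw [hε, norm_div, div_le_iff₀ hf0p]
    refine hnb.trans ?_
    rw [show 2 * C₁ / ‖k‖ * ‖f k 0‖ = C₁ / ‖k‖ * (2 * ‖f k 0‖) by ring]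
    exact le_mul_of_one_le_right (by positivity) (by linarith)
  have hεb' : ‖ε‖ ≤ 2 * C₁ := hεb.trans (div_le_self (by positivity) hk1)
  obtain ⟨d, hd⟩ : ∃ d, d = Complex.I * k + h + ε := ⟨_, rfl⟩
  have hF : h * f k 0 + f' k 0 = f k 0 * d := by
    have : ε * f k 0 = n := by rw [hε]; field_simp
    rw [hd]; linear_combination -this - hn
  have hdb : ‖k‖ / 2 ≤ ‖d‖ := by
    have h1 := norm_sub_norm_le (Complex.I * k) (-(h + ε))
    rw [sub_neg_eq_add, ← add_assoc, ← hd, norm_mul, Complex.norm_I, one_mul, norm_neg] at h1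
    have h2 : ‖(h : ℂ) + ε‖ ≤ |h| + 2 * C₁ := by
      refine (norm_add_le _ _).trans ?_
      rw [Complex.norm_real, Real.norm_eq_abs]
      linarith
    linarith
  have hdp : 0 < ‖d‖ := by linarith
  have hd0 : d ≠ 0 := norm_pos_iff.1 hdp
  rw [hF]
  refine ⟨mul_ne_zero hf00 hd0, ?_, ?_⟩
  -- The exact remainder of `1 / d` after two terms; its numerator is bounded because `k ε` is.
  · have e : f k 0 / (f k 0 * d) - (1 / (Complex.I * k) + h / k ^ 2) =
        (Complex.I * k * ε - h ^ 2 - h * ε) / (k ^ 2 * d) := by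
      have hI : (1 : ℂ) / (Complex.I * k) = -Complex.I / k := by
        rw [one_div, mul_inv, Complex.inv_I]; ring
      rw [hI]
      field_simp
      rw [hd]
      linear_combination (k ^ 2) * Complex.I_sq
    rw [e, norm_div, norm_mul, norm_pow]
    have hnum : ‖Complex.I * k * ε - h ^ 2 - h * ε‖ ≤ 2 * C₁ + h ^ 2 + 2 * |h| * C₁ := by
      have n1 : ‖Complex.I * k * ε‖ ≤ 2 * C₁ := by
        rw [norm_mul, norm_mul, Complex.norm_I, one_mul]
        rw [le_div_iff₀ hkp] at hεb
        linarith
      have n2 : ‖(h : ℂ) ^ 2‖ = h ^ 2 := by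
        rw [norm_pow, Complex.norm_real, Real.norm_eq_abs, sq_abs]
      have n3 : ‖(h : ℂ) * ε‖ ≤ |h| * (2 * C₁) := by
        rw [norm_mul, Complex.norm_real, Real.norm_eq_abs]; gcongr
      have := norm_sub_le (Complex.I * k * ε - h ^ 2) (h * ε)
      have := norm_sub_le (Complex.I * k * ε) ((h : ℂ) ^ 2)
      linarith
    calc _ ≤ (2 * C₁ + h ^ 2 + 2 * |h| * C₁) / (‖k‖ ^ 2 * (‖k‖ / 2)) := by gcongr
      _ = 2 * (2 * C₁ + h ^ 2 + 2 * |h| * C₁) / ‖k‖ ^ 3 := by field_simp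
      _ ≤ _ := by gcongr; linarith
  · rw [norm_mul]
    nlinarith

/-- All these zeros lie in a disc. Infinitely many would accumulate and make the entire function
`f_h` vanish identically, against its behaviour for large `k`. -/
theorem finite_zeros (hJ : IsJostFamily q b f f') (h : ℝ) {R₀ : ℝ}
    (hR : ∀ k : ℂ, 0 ≤ k.im → R₀ ≤ ‖k‖ → h * f k 0 + f' k 0 ≠ 0) :
    {k : ℂ | 0 ≤ k.im ∧ h * f k 0 + f' k 0 = 0}.Finite := by
  have hd : Differentiable ℂ fun k => h * f k 0 + f' k 0 :=
    (hJ.diff.const_mul (h : ℂ)).add hJ.diff'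
  have ha : AnalyticOnNhd ℂ (fun k => h * f k 0 + f' k 0) univ :=
    hd.differentiableOn.analyticOnNhd isOpen_univ
  by_contra hinf
  have hsub : {k : ℂ | 0 ≤ k.im ∧ h * f k 0 + f' k 0 = 0} ⊆ Metric.closedBall 0 R₀ := by
    intro k hk
    rw [mem_closedBall_zero_iff]
    by_contra hk'
    exact hR k hk.1 (not_le.1 hk').le hk.2
  obtain ⟨z, -, hz⟩ := Set.Infinite.exists_accPt_of_subset_isCompact hinf
    (isCompact_closedBall (0 : ℂ) R₀) hsub
  have hfr : ∃ᶠ k in 𝓝[≠] z, h * f k 0 + f' k 0 = 0 := by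
    rw [accPt_iff_frequently_nhdsNE] at hz
    exact hz.mono fun k hk => hk.2
  have h0 := ha.eqOn_zero_of_preconnected_of_frequently_eq_zero isPreconnected_univ
    (mem_univ z) hfr
  have h1 := h0 (mem_univ (Complex.I * (|R₀| : ℝ)))
  refine hR (Complex.I * (|R₀| : ℝ)) (by simp) ?_ h1
  rw [norm_mul, Complex.norm_I, Complex.norm_real, Real.norm_eq_abs, abs_abs, one_mul]
  exact le_abs_self _

end IsJostFamily

end

/-! ### The intertwining relation of the transformation operator. -/

section

/-- The operator `1 + K`. -/
def transOp (K : ℝ → ℝ → ℝ) (w : ℝ → ℂ) (x : ℝ) : ℂ := w x + ∫ s in (0)..x, (K x s : ℂ) * w s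

/-- The twofold antiderivative vanishing to second order at the origin. -/
def secondInt (p : ℝ → ℂ) (x : ℝ) : ℂ := ∫ t in (0)..x, ((x : ℂ) - t) * p t

section secondInt

variable {p r : ℝ → ℂ}

theorem continuous_secondInt (hp : Continuous p) : Continuous (secondInt p) :=
  intervalIntegral.continuous_parametric_intervalIntegral_of_continuous
    (f := fun (x : ℝ) (t : ℝ) => ((x : ℂ) - t) * p t) (by simp only [Function.uncurry_def]; fun_prop)
    continuous_id

theorem secondInt_add (hp : Continuous p) (hr : Continuous r) (x : ℝ) :
    secondInt (fun t => p t + r t) x = secondInt p x + secondInt r x := by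
  unfold secondInt
  rw [← intervalIntegral.integral_add (Continuous.intervalIntegrable (by fun_prop) _ _)
    (Continuous.intervalIntegrable (by fun_prop) _ _)]
  exact intervalIntegral.integral_congr fun t _ => by ring

theorem secondInt_const_mul (a : ℂ) (x : ℝ) :
    secondInt (fun t => a * p t) x = a * secondInt p x := by
  unfold secondInt
  rw [← intervalIntegral.integral_const_mul]
  exact intervalIntegral.integral_congr fun t _ => by ring

theorem secondInt_congr {x : ℝ} (hx : 0 ≤ x) (h : ∀ t ∈ Icc 0 x, p t = r t) :
    secondInt p x = secondInt r x := by
  refine intervalIntegral.integral_congr fun t ht => ?_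
  rw [uIcc_of_le hx] at ht
  simp only [h t ht]

theorem norm_secondInt_le {x C X : ℝ} (hx : x ∈ Icc 0 X) (h : ∀ t ∈ Icc 0 X, ‖p t‖ ≤ C) :
    ‖secondInt p x‖ ≤ X ^ 2 * C := by
  have hX : 0 ≤ X := hx.1.trans hx.2
  have hC : 0 ≤ C := (norm_nonneg _).trans (h 0 ⟨le_rfl, hX⟩)
  refine (intervalIntegral.norm_integral_le_of_norm_le_const (C := X * C) fun t ht => ?_).trans ?_
  · rw [uIoc_of_le hx.1] at ht
    rw [norm_mul, ← Complex.ofReal_sub, Complex.norm_real, Real.norm_eq_abs,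
      abs_of_nonneg (by linarith [ht.2])]
    exact mul_le_mul (by linarith [ht.1, hx.2]) (h t ⟨ht.1.le, ht.2.trans hx.2⟩) (norm_nonneg _) hX
  · rw [sub_zero, abs_of_nonneg hx.1]
    nlinarith [mul_nonneg hX hC, hx.2]

theorem norm_secondInt_le_integral {x X : ℝ} (hp : Continuous p) (hx : x ∈ Icc 0 X) :
    ‖secondInt p x‖ ≤ X * ∫ t in (0)..x, ‖p t‖ := by
  rw [← intervalIntegral.integral_const_mul]
  refine intervalIntegral.norm_integral_le_of_norm_le hx.1 (ae_of_all _ fun t ht => ?_)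
    (Continuous.intervalIntegrable (by fun_prop) _ _)
  rw [norm_mul, ← Complex.ofReal_sub, Complex.norm_real, Real.norm_eq_abs,
    abs_of_nonneg (by linarith [ht.2])]
  gcongr
  linarith [ht.1, hx.2]

theorem hasDerivAt_integral {p : ℝ → ℂ} (hp : Continuous p) (x : ℝ) :
    HasDerivAt (fun x => ∫ t in (0)..x, p t) (p x) x :=
  intervalIntegral.integral_hasDerivAt_right (hp.intervalIntegrable _ _)
    (hp.stronglyMeasurableAtFilter _ _) hp.continuousAt

theorem hasDerivAt_ofReal (x : ℝ) : HasDerivAt (fun x : ℝ => (x : ℂ)) 1 x :=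
  Complex.ofRealCLM.hasDerivAt

theorem hasDerivAt_secondInt (hp : Continuous p) (x : ℝ) :
    HasDerivAt (secondInt p) (∫ t in (0)..x, p t) x := by
  have e : secondInt p = fun x : ℝ =>
      (x : ℂ) * (∫ t in (0)..x, p t) - ∫ t in (0)..x, (t : ℂ) * p t := by
    funext x
    rw [← intervalIntegral.integral_const_mul, ← intervalIntegral.integral_sub
      (Continuous.intervalIntegrable (by fun_prop) _ _)
      (Continuous.intervalIntegrable (by fun_prop) _ _)]
    exact intervalIntegral.integral_congr fun t _ => by ring
  rw [e]
  have h2 : HasDerivAt (fun x : ℝ => ∫ t in (0)..x, (t : ℂ) * p t) ((x : ℂ) * p x) x :=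
    hasDerivAt_integral (p := fun t : ℝ => (t : ℂ) * p t) (by fun_prop) x
  refine (((hasDerivAt_ofReal x).mul (hasDerivAt_integral hp x)).sub h2).congr_deriv ?_
  ring

theorem eq_secondInt {f f' : ℝ → ℂ} (hp : Continuous p)
    (hf : ∀ x ≥ 0, HasDerivWithinAt f (f' x) (Ici 0) x)
    (hf' : ∀ x ≥ 0, HasDerivWithinAt f' (p x) (Ici 0) x) (h0 : f 0 = 0) (h0' : f' 0 = 0)
    {x : ℝ} (hx : 0 ≤ x) : f x = secondInt p x := by
  have key : ∀ {g : ℝ → ℂ}, (∀ x ≥ 0, HasDerivWithinAt g 0 (Ici 0) x) → g 0 = 0 →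
      ∀ x ≥ 0, g x = 0 := by
    intro g hg hg0 x hx
    have := intervalIntegral.integral_eq_sub_of_hasDeriv_right_of_le hx (f := g)
      (f' := fun _ => 0) (fun t ht => ((hg t ht.1).mono Icc_subset_Ici_self).continuousWithinAt)
      (fun t ht => (hg t ht.1.le).mono (Ioi_subset_Ici ht.1.le))
      (Continuous.intervalIntegrable (by fun_prop) _ _)
    rw [intervalIntegral.integral_zero, hg0, sub_zero] at this
    exact this.symm
  have h1 : ∀ x ≥ 0, f' x = ∫ t in (0)..x, p t := fun x hx => by
    refine sub_eq_zero.1 (key (g := fun x => f' x - ∫ t in (0)..x, p t) (fun t ht => ?_) (by simp [h0']) x hx)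
    exact ((hf' t ht).sub (hasDerivAt_integral hp t).hasDerivWithinAt).congr_deriv (sub_self _)
  refine sub_eq_zero.1 (key (g := fun x => f x - secondInt p x) (fun t ht => ?_)
    (by simp [h0, secondInt]) x hx)
  refine ((hf t ht).sub (hasDerivAt_secondInt hp t).hasDerivWithinAt).congr_deriv ?_
  rw [h1 t ht, sub_self]

end secondInt

section transOp

variable {K : ℝ → ℝ → ℝ} {w v : ℝ → ℂ}

theorem continuous_transOp (hK : Continuous (Function.uncurry K)) (hw : Continuous w) :
    Continuous (transOp K w) := by
  unfold transOp
  refine hw.add ?_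
  exact intervalIntegral.continuous_parametric_intervalIntegral_of_continuous
    (f := fun (x : ℝ) (s : ℝ) => (K x s : ℂ) * w s) ((Complex.continuous_ofReal.comp hK).mul
      (by fun_prop)) continuous_id

theorem transOp_add (hK : Continuous (Function.uncurry K)) (hw : Continuous w) (hv : Continuous v)
    (x : ℝ) : transOp K (fun t => w t + v t) x = transOp K w x + transOp K v x := by
  have hKx : Continuous (K x) := hK.comp (Continuous.prodMk_right x)
  have : ∫ s in (0)..x, (K x s : ℂ) * (w s + v s) =
      (∫ s in (0)..x, (K x s : ℂ) * w s) + ∫ s in (0)..x, (K x s : ℂ) * v s := by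
    rw [← intervalIntegral.integral_add (Continuous.intervalIntegrable (by fun_prop) _ _)
      (Continuous.intervalIntegrable (by fun_prop) _ _)]
    exact intervalIntegral.integral_congr fun t _ => by ring
  unfold transOp
  rw [this]
  ring

theorem transOp_const_mul (a : ℂ) (x : ℝ) :
    transOp K (fun t => a * w t) x = a * transOp K w x := by
  unfold transOp
  rw [mul_add, ← intervalIntegral.integral_const_mul]
  congr 1
  exact intervalIntegral.integral_congr fun t _ => by ring

theorem transOp_congr {x : ℝ} (hx : 0 ≤ x) (h : ∀ t ∈ Icc 0 x, w t = v t) :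
    transOp K w x = transOp K v x := by
  unfold transOp
  rw [h x ⟨hx, le_rfl⟩]
  congr 1
  refine intervalIntegral.integral_congr fun t ht => ?_
  rw [uIcc_of_le hx] at ht
  simp only [h t ht]

theorem norm_transOp_le {x C B X : ℝ} (hB : ∀ x r, |K x r| ≤ B) (hx : x ∈ Icc 0 X)
    (h : ∀ t ∈ Icc 0 X, ‖w t‖ ≤ C) : ‖transOp K w x‖ ≤ (1 + B * X) * C := by
  have hX : 0 ≤ X := hx.1.trans hx.2
  have hC : 0 ≤ C := (norm_nonneg _).trans (h 0 ⟨le_rfl, hX⟩)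
  have hB0 : 0 ≤ B := (abs_nonneg _).trans (hB 0 0)
  refine (norm_add_le _ _).trans ?_
  have : ‖∫ s in (0)..x, (K x s : ℂ) * w s‖ ≤ B * C * |x - 0| := by
    refine intervalIntegral.norm_integral_le_of_norm_le_const fun t ht => ?_
    rw [uIoc_of_le hx.1] at ht
    rw [norm_mul, Complex.norm_real]
    exact mul_le_mul (hB _ _) (h t ⟨ht.1.le, ht.2.trans hx.2⟩) (norm_nonneg _) hB0
  rw [sub_zero, abs_of_nonneg hx.1] at this
  have h3 := h x hx
  nlinarith [mul_nonneg hB0 hC, hx.2, mul_le_mul_of_nonneg_left hx.2 (mul_nonneg hB0 hC)]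

theorem transOp_cos (κ : ℂ) : transOp K (fun t => Complex.cos (κ * t)) = regSol K κ := rfl

theorem transOp_one : transOp K (fun _ => 1) = regSol K 0 := by
  funext x
  simp [transOp, regSol]

end transOp

section intertwining

variable {K : ℝ → ℝ → ℝ} {q : ℝ → ℝ}

/-- The defect in the intertwining relation `(d²/dx² - q) (1 + K) w = (1 + K) w''` for
`w = secondInt p`, integrated twice. -/
def intertwiningDefect (K : ℝ → ℝ → ℝ) (q : ℝ → ℝ) (p : ℝ → ℂ) (x : ℝ) : ℂ :=
  transOp K (secondInt p) x -
    secondInt (fun t => q t * transOp K (secondInt p) t + transOp K p t) x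

theorem intertwiningDefect_lin (hK : Continuous (Function.uncurry K)) (hq : Continuous q)
    {p r : ℝ → ℂ} (hp : Continuous p) (hr : Continuous r) (a b : ℂ) (x : ℝ) :
    intertwiningDefect K q (fun t => a * p t + b * r t) x =
      a * intertwiningDefect K q p x + b * intertwiningDefect K q r x := by
  have e1 : secondInt (fun t => a * p t + b * r t) = fun x => a * secondInt p x + b * secondInt r x := by
    funext x
    rw [secondInt_add (by fun_prop) (by fun_prop), secondInt_const_mul, secondInt_const_mul]
  have hJp := continuous_secondInt hp
  have hJr := continuous_secondInt hr
  have e2 : transOp K (fun x => a * secondInt p x + b * secondInt r x) =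
      fun x => a * transOp K (secondInt p) x + b * transOp K (secondInt r) x := by
    funext x
    rw [transOp_add hK (by fun_prop) (by fun_prop), transOp_const_mul, transOp_const_mul]
  have e3 : transOp K (fun t => a * p t + b * r t) =
      fun x => a * transOp K p x + b * transOp K r x := by
    funext x
    rw [transOp_add hK (by fun_prop) (by fun_prop), transOp_const_mul, transOp_const_mul]
  have c1 := continuous_transOp hK hJp
  have c2 := continuous_transOp hK hJr
  have c3 := continuous_transOp hK hp
  have c4 := continuous_transOp hK hr
  unfold intertwiningDefect
  rw [e1, e2, e3]
  have e4 : (fun t => (q t : ℂ) * (a * transOp K (secondInt p) t + b * transOp K (secondInt r) t) +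
      (a * transOp K p t + b * transOp K r t)) = fun t =>
      a * (q t * transOp K (secondInt p) t + transOp K p t) +
      b * (q t * transOp K (secondInt r) t + transOp K r t) := by funext t; ring
  rw [e4, secondInt_add (by fun_prop) (by fun_prop), secondInt_const_mul, secondInt_const_mul]
  ring

theorem norm_intertwiningDefect_le {B Q X C x : ℝ} (hB : ∀ x r, |K x r| ≤ B)
    (hQ : ∀ t ∈ Icc 0 X, |q t| ≤ Q) (hx : x ∈ Icc 0 X) {p : ℝ → ℂ} (hp : ∀ t ∈ Icc 0 X, ‖p t‖ ≤ C) :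
    ‖intertwiningDefect K q p x‖ ≤
      ((1 + B * X) * X ^ 2 + X ^ 2 * (Q * ((1 + B * X) * X ^ 2) + (1 + B * X))) * C := by
  have hX : 0 ≤ X := hx.1.trans hx.2
  have hQ0 : 0 ≤ Q := (abs_nonneg _).trans (hQ 0 ⟨le_rfl, hX⟩)
  have h1 : ∀ t ∈ Icc 0 X, ‖transOp K (secondInt p) t‖ ≤ (1 + B * X) * (X ^ 2 * C) := fun t ht =>
    norm_transOp_le hB ht fun s hs => norm_secondInt_le hs hp
  have h2 : ∀ t ∈ Icc 0 X, ‖q t * transOp K (secondInt p) t + transOp K p t‖ ≤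
      Q * ((1 + B * X) * (X ^ 2 * C)) + (1 + B * X) * C := fun t ht => by
    refine (norm_add_le _ _).trans (add_le_add ?_ (norm_transOp_le hB ht hp))
    rw [norm_mul, Complex.norm_real]
    exact mul_le_mul (hQ t ht) (h1 t ht) (norm_nonneg _) hQ0
  refine (norm_sub_le _ _).trans ((add_le_add (h1 x hx) (norm_secondInt_le hx h2)).trans ?_)
  apply le_of_eq
  ring

variable {h : ℝ}

theorem secondInt_cos {κ : ℂ} (hκ : κ ≠ 0) {x : ℝ} (hx : 0 ≤ x) :
    secondInt (fun t => Complex.cos (κ * t)) x = (1 - Complex.cos (κ * x)) / κ ^ 2 := by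
  symm
  refine eq_secondInt (f := fun x : ℝ => (1 - Complex.cos (κ * x)) / κ ^ 2) (f' := cosInt κ) (by fun_prop)
    (fun x _ => ?_) (fun x _ => (hasDerivAt_cosInt κ x).hasDerivWithinAt) (by simp)
    (cosInt_zero_right κ) hx
  refine (((hasDerivAt_ccos κ x).const_sub 1).div_const (κ ^ 2)).hasDerivWithinAt.congr_deriv ?_
  field_simp

/-- Since the twofold antiderivative of `cos (κ t)` is `(1 - cos (κ t)) / κ²`, the claim reduces to
the equations solved by the regular solutions at `κ` and at `0`. -/
theorem intertwiningDefect_cos (hq : Continuous q) (hK : IsTransformationKernel h q K) {κ : ℂ}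
    (hκ : κ ≠ 0) {x : ℝ} (hx : 0 ≤ x) :
    intertwiningDefect K q (fun t => Complex.cos (κ * t)) x = 0 := by
  have e1 : ∀ x ≥ 0, transOp K (secondInt fun t => Complex.cos (κ * t)) x =
      (regSol K 0 x - regSol K κ x) / κ ^ 2 := by
    intro x hx
    rw [transOp_congr hx (v := fun t : ℝ => (1 / κ ^ 2) * 1 + (-1 / κ ^ 2) * Complex.cos (κ * t))
      (fun t ht => by rw [secondInt_cos hκ ht.1]; ring),
      transOp_add hK.cont (by fun_prop) (by fun_prop), transOp_const_mul, transOp_const_mul,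
      transOp_cos, transOp_one]
    ring
  have c0 := continuous_regSol_right hK.cont 0
  have c1 := continuous_regSol_right hK.cont κ
  unfold intertwiningDefect
  rw [sub_eq_zero, e1 x hx, secondInt_congr hx (r := fun t =>
    q t * ((regSol K 0 t - regSol K κ t) / κ ^ 2) + regSol K κ t)
    (fun t ht => by rw [e1 t ht.1, transOp_cos])]
  have s0 := isSol_regSol hq hK 0
  have s1 := isSol_regSol hq hK κ
  refine eq_secondInt (f := fun x => (regSol K 0 x - regSol K κ x) / κ ^ 2)
    (f' := fun x => (regSolDeriv h q K 0 x - regSolDeriv h q K κ x) / κ ^ 2) (by fun_prop)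
    (fun x hx => ((s0.deriv_fst x hx).sub (s1.deriv_fst x hx)).div_const _) (fun x hx => ?_)
    (by simp [regSol_zero_right]) (by simp [regSolDeriv_zero_right]) hx
  refine (((s0.deriv_snd x hx).sub (s1.deriv_snd x hx)).div_const _).congr_deriv ?_
  field_simp
  ring

/-- A factor `cos² (ν t)` splits the frequency `m` into `m` and `m ± 2`. Odd frequencies stay odd,
hence non-zero, and the case of a single cosine applies. -/
theorem intertwiningDefect_cos_pow_mul (hq : Continuous q) (hK : IsTransformationKernel h q K)
    {ν : ℝ} (hν : ν ≠ 0) {x : ℝ} (hx : 0 ≤ x) (j : ℕ) :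
    ∀ m : ℤ, Odd m → intertwiningDefect K q
      (fun t => Complex.cos (ν * t) ^ (2 * j) * Complex.cos ((m * ν : ℂ) * t)) x = 0 := by
  induction j with
  | zero =>
    intro m hm
    have hm0 : m ≠ 0 := fun h => by subst h; revert hm; decide
    have := intertwiningDefect_cos hq hK (κ := m * ν)
      (mul_ne_zero (by exact_mod_cast hm0) (by exact_mod_cast hν)) hx
    simpa using this
  | succ j ih =>
    intro m hm
    have e : (fun t : ℝ => Complex.cos (ν * t) ^ (2 * (j + 1)) * Complex.cos ((m * ν : ℂ) * t)) =
        fun t : ℝ => (1 / 2) * (Complex.cos (ν * t) ^ (2 * j) * Complex.cos ((m * ν : ℂ) * t)) +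
          1 * ((1 / 4) * (Complex.cos (ν * t) ^ (2 * j) *
            Complex.cos (((m + 2 : ℤ) * ν : ℂ) * t)) +
          (1 / 4) * (Complex.cos (ν * t) ^ (2 * j) *
            Complex.cos (((m - 2 : ℤ) * ν : ℂ) * t))) := by
      funext t
      have h1 : ((m + 2 : ℤ) * ν : ℂ) * t = (m * ν : ℂ) * t + 2 * (ν * t) := by push_cast; ring
      have h2 : ((m - 2 : ℤ) * ν : ℂ) * t = (m * ν : ℂ) * t - 2 * (ν * t) := by push_cast; ring
      rw [h1, h2, Complex.cos_add, Complex.cos_sub, Complex.cos_two_mul]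
      ring
    rw [e, intertwiningDefect_lin hK.cont hq (by fun_prop) (by fun_prop),
      intertwiningDefect_lin hK.cont hq (by fun_prop) (by fun_prop), ih m hm,
      ih (m + 2) (hm.add_even (by decide)), ih (m - 2) (hm.sub_even (by decide))]
    ring

theorem intertwiningDefect_cos_mul_polynomial (hq : Continuous q)
    (hK : IsTransformationKernel h q K) {ν : ℝ} (hν : ν ≠ 0) {x : ℝ} (hx : 0 ≤ x)
    (P : Polynomial ℝ) : intertwiningDefect K q
      (fun t => ((Real.cos (ν * t) * P.eval (Real.cos (ν * t) ^ 2) : ℝ) : ℂ)) x = 0 := by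
  induction P using Polynomial.induction_on' with
  | add P R hP hR =>
    have e : (fun t : ℝ => ((Real.cos (ν * t) * (P + R).eval (Real.cos (ν * t) ^ 2) : ℝ) : ℂ)) =
        fun t : ℝ => 1 * ((Real.cos (ν * t) * P.eval (Real.cos (ν * t) ^ 2) : ℝ) : ℂ) +
          1 * ((Real.cos (ν * t) * R.eval (Real.cos (ν * t) ^ 2) : ℝ) : ℂ) := by
      funext t
      rw [Polynomial.eval_add]
      push_cast
      ring
    have hc : ∀ P : Polynomial ℝ, Continuous fun t : ℝ =>
        ((Real.cos (ν * t) * P.eval (Real.cos (ν * t) ^ 2) : ℝ) : ℂ) := fun P => by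
      have := P.continuous
      fun_prop
    rw [e, intertwiningDefect_lin hK.cont hq (hc P) (hc R), hP, hR]
    ring
  | monomial n a =>
    have e : (fun t : ℝ => ((Real.cos (ν * t) * (Polynomial.monomial n a).eval
          (Real.cos (ν * t) ^ 2) : ℝ) : ℂ)) =
        fun t : ℝ => (a : ℂ) * (Complex.cos (ν * t) ^ (2 * n) *
          Complex.cos (((1 : ℤ) * ν : ℂ) * t)) + 0 * 1 := by
      funext t
      rw [Polynomial.eval_monomial]
      push_cast
      rw [one_mul]
      ring
    rw [e, intertwiningDefect_lin hK.cont hq (by fun_prop) (by fun_prop),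
      intertwiningDefect_cos_pow_mul hq hK hν hx n 1 (by decide)]
    ring

/-- The intertwining relation. -/
theorem intertwiningDefect_eq_zero (hq : Continuous q) (hK : IsTransformationKernel h q K)
    {p : ℝ → ℂ} (hp : Continuous p) {x : ℝ} (hx : 0 ≤ x) : intertwiningDefect K q p x = 0 := by
  have key : ∀ f : ℝ → ℝ, Continuous f → intertwiningDefect K q (fun t => (f t : ℂ)) x = 0 := by
    intro f hf
    obtain ⟨B, hB⟩ := hK.bdd
    obtain ⟨Q, hQ⟩ := isCompact_Icc.exists_bound_of_continuousOn (hq.continuousOn (s := Icc 0 x))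
    let c := (1 + B * x) * x ^ 2 + x ^ 2 * (Q * ((1 + B * x) * x ^ 2) + (1 + B * x))
    -- With `ν t ≤ 1` on `[0, x]` the cosine is injective and at least `cos 1 > 0` there, so a
    -- continuous `f` can be approximated uniformly by `cos (ν t) P(cos² (ν t))`.
    let ν : ℝ := 1 / (x + 1)
    have hν : 0 < ν := by positivity
    have hνt : ∀ t ∈ Icc 0 x, 0 ≤ ν * t ∧ ν * t ≤ 1 := fun t ht =>
      ⟨mul_nonneg hν.le ht.1, by
        simp only [ν]; rw [one_div_mul_eq_div, div_le_one (by positivity)]; linarith [ht.2]⟩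
    have hcos1 : 0 < Real.cos 1 := Real.cos_one_pos
    have hcos : ∀ t ∈ Icc 0 x, Real.cos 1 ≤ Real.cos (ν * t) := fun t ht =>
      Real.cos_le_cos_of_nonneg_of_le_pi (hνt t ht).1 (by linarith [Real.pi_gt_three]) (hνt t ht).2
    have hle : ∀ ε > 0, ‖intertwiningDefect K q (fun t => (f t : ℂ)) x‖ ≤ c * ε := by
      intro ε hε
      -- Weierstrass approximation of `f(t) / cos (ν t)` in the variable `y = cos² (ν t)`.
      obtain ⟨P, hP⟩ := exists_polynomial_near_of_continuousOn (Real.cos 1 ^ 2) 1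
        (fun y => f (Real.arccos (√y) / ν) / √y) (by
          refine ContinuousOn.div (Continuous.continuousOn (by
            have := Real.continuous_arccos; fun_prop)) (by fun_prop) fun y hy => ?_
          exact (Real.sqrt_pos.2 (lt_of_lt_of_le (by positivity) hy.1)).ne') ε hε
      have e : (fun t => (f t : ℂ)) = fun t : ℝ =>
          1 * ((Real.cos (ν * t) * P.eval (Real.cos (ν * t) ^ 2) : ℝ) : ℂ) +
          1 * ((f t - Real.cos (ν * t) * P.eval (Real.cos (ν * t) ^ 2) : ℝ) : ℂ) := by
        funext t; push_cast; ring
      have hPc := P.continuous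
      rw [e, intertwiningDefect_lin hK.cont hq (by fun_prop) (by fun_prop),
        intertwiningDefect_cos_mul_polynomial hq hK hν.ne' hx, mul_zero, zero_add, one_mul]
      refine norm_intertwiningDefect_le hB hQ ⟨hx, le_rfl⟩ fun t ht => ?_
      have h1 := hcos t ht
      have hct : 0 < Real.cos (ν * t) := by linarith
      have h2 := hP (Real.cos (ν * t) ^ 2) ⟨by gcongr, by
        rw [sq_le_one_iff_abs_le_one]; exact Real.abs_cos_le_one _⟩
      rw [Real.sqrt_sq hct.le, Real.arccos_cos (hνt t ht).1
        (by linarith [(hνt t ht).2, Real.pi_gt_three]), mul_div_cancel_left₀ _ hν.ne'] at h2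
      rw [Complex.norm_real, Real.norm_eq_abs]
      have e2 : f t - Real.cos (ν * t) * P.eval (Real.cos (ν * t) ^ 2) =
          -(Real.cos (ν * t) * (P.eval (Real.cos (ν * t) ^ 2) - f t / Real.cos (ν * t))) := by
        field_simp; ring
      rw [e2, abs_neg, abs_mul, abs_of_pos hct]
      have := Real.cos_le_one (ν * t)
      nlinarith [abs_nonneg (P.eval (Real.cos (ν * t) ^ 2) - f t / Real.cos (ν * t))]
    have hlim : Tendsto (fun ε : ℝ => c * ε) (𝓝[>] 0) (𝓝 (c * 0)) :=
      (Continuous.tendsto (by fun_prop) _).mono_left nhdsWithin_le_nhds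
    rw [mul_zero] at hlim
    have := ge_of_tendsto hlim (eventually_nhdsWithin_of_forall fun ε hε => hle ε hε)
    exact norm_le_zero_iff.1 this
  have e : p = fun t => 1 * ((p t).re : ℂ) + Complex.I * ((p t).im : ℂ) := by
    funext t
    rw [one_mul, mul_comm Complex.I, Complex.re_add_im]
  have hre := Complex.continuous_re.comp hp
  have him := Complex.continuous_im.comp hp
  rw [e, intertwiningDefect_lin hK.cont hq (p := fun t => ((p t).re : ℂ)) (r := fun t => ((p t).im : ℂ))
    (Complex.continuous_ofReal.comp hre) (Complex.continuous_ofReal.comp him)]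
  have h1 := key _ hre
  have h2 := key _ him
  simp only [Function.comp_def] at h1 h2
  rw [h1, h2]
  ring

end intertwining

end

/-! ### Perturbed sine functions and the Gelfand–Levitan kernel. -/

section

/-- The solution `v` of `v'' + κ² v = a` vanishing to second order at the origin. -/
def convSol (κ : ℂ) (a : ℝ → ℂ) (x : ℝ) : ℂ := ∫ t in (0)..x, cosInt κ (x - t) * a t

theorem convSol_eq (κ : ℂ) {a : ℝ → ℂ} (ha : Continuous a) (x : ℝ) :
    convSol κ a x = cosInt κ x * (∫ t in (0)..x, Complex.cos (κ * t) * a t) -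
      Complex.cos (κ * x) * ∫ t in (0)..x, cosInt κ t * a t := by
  have hS := continuous_cosInt κ
  unfold convSol
  rw [← intervalIntegral.integral_const_mul, ← intervalIntegral.integral_const_mul,
    ← intervalIntegral.integral_sub (Continuous.intervalIntegrable (by fun_prop) _ _)
      (Continuous.intervalIntegrable (by fun_prop) _ _)]
  refine intervalIntegral.integral_congr fun t _ => ?_
  rw [cosInt_sub]; ring

theorem continuous_convSol (κ : ℂ) {a : ℝ → ℂ} (ha : Continuous a) : Continuous (convSol κ a) := by
  have hS := continuous_cosInt κ
  exact intervalIntegral.continuous_parametric_intervalIntegral_of_continuous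
    (f := fun (x : ℝ) (t : ℝ) => cosInt κ (x - t) * a t)
    (by simp only [Function.uncurry_def]; fun_prop) continuous_id

theorem convSol_eq_secondInt (κ : ℂ) {a : ℝ → ℂ} (ha : Continuous a) {x : ℝ} (hx : 0 ≤ x) :
    convSol κ a x = secondInt (fun t => a t - κ ^ 2 * convSol κ a t) x := by
  have hS := continuous_cosInt κ
  have hv := continuous_convSol κ ha
  have d₁ : ∀ x : ℝ, HasDerivAt (fun x => ∫ t in (0)..x, Complex.cos (κ * t) * a t)
      (Complex.cos (κ * x) * a x) x := fun x =>
    hasDerivAt_integral (p := fun t : ℝ => Complex.cos (κ * t) * a t) (by fun_prop) x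
  have d₂ : ∀ x : ℝ, HasDerivAt (fun x => ∫ t in (0)..x, cosInt κ t * a t)
      (cosInt κ x * a x) x := fun x =>
    hasDerivAt_integral (p := fun t : ℝ => cosInt κ t * a t) (by fun_prop) x
  refine eq_secondInt (f' := fun x => Complex.cos (κ * x) *
    (∫ t in (0)..x, Complex.cos (κ * t) * a t) + κ ^ 2 * cosInt κ x *
      ∫ t in (0)..x, cosInt κ t * a t) (by fun_prop) (fun x _ => ?_) (fun x _ => ?_)
      (by simp [convSol]) (by simp) hx
  · have := ((hasDerivAt_cosInt κ x).mul (d₁ x)).sub ((hasDerivAt_ccos κ x).mul (d₂ x))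
    rw [funext (convSol_eq κ ha)]
    refine this.hasDerivWithinAt.congr_deriv ?_
    ring
  · have := ((hasDerivAt_ccos κ x).mul (d₁ x)).add
      (((hasDerivAt_cosInt κ x).const_mul (κ ^ 2)).mul (d₂ x))
    refine this.hasDerivWithinAt.congr_deriv ?_
    rw [convSol_eq κ ha]
    linear_combination a x * cos_sq_add_cosInt_sq κ x

theorem cosInt_eq_sub_secondInt (κ : ℂ) {x : ℝ} (hx : 0 ≤ x) :
    cosInt κ x = x - κ ^ 2 * secondInt (cosInt κ) x := by
  have hS := continuous_cosInt κ
  have := eq_secondInt (p := fun t => κ ^ 2 * cosInt κ t) (f := fun x : ℝ => (x : ℂ) - cosInt κ x)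
    (f' := fun x : ℝ => 1 - Complex.cos (κ * x)) (by fun_prop)
    (fun x _ => ((hasDerivAt_ofReal x).sub (hasDerivAt_cosInt κ x)).hasDerivWithinAt)
    (fun x _ => ((hasDerivAt_ccos κ x).const_sub 1).hasDerivWithinAt.congr_deriv (by ring))
    (by simp [cosInt_zero_right]) (by simp) hx
  rw [secondInt_const_mul] at this
  linear_combination -this

/-- A function with `‖w‖ ≤ η + B ∫ ‖w‖` satisfies `‖w‖ ≤ η exp (B x)`. -/
theorem norm_le_exp_of_le_integral {w : ℝ → ℂ} (hw : Continuous w) {η B X : ℝ} (hB : 0 ≤ B)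
    (hη : 0 ≤ η) (h : ∀ x ∈ Icc 0 X, ‖w x‖ ≤ η + B * ∫ t in (0)..x, ‖w t‖) {x : ℝ}
    (hx : x ∈ Icc 0 X) : ‖w x‖ ≤ η * Real.exp (B * x) := by
  have hexp : ∀ x : ℝ, η * Real.exp (B * x) = η + B * ∫ t in (0)..x, η * Real.exp (B * t) := by
    intro x
    have hd : ∀ t ∈ uIcc 0 x, HasDerivAt (fun t : ℝ => η * Real.exp (B * t))
        (B * (η * Real.exp (B * t))) t := fun t _ => by
      have := (((hasDerivAt_id t).const_mul B).exp).const_mul η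
      refine this.congr_deriv ?_
      simp only [id]; ring
    have := intervalIntegral.integral_eq_sub_of_hasDerivAt hd
      (Continuous.intervalIntegrable (by fun_prop) _ _)
    rw [intervalIntegral.integral_const_mul] at this
    rw [this]; simp
  obtain ⟨C, hC⟩ := isCompact_Icc.exists_bound_of_continuousOn (hw.continuousOn (s := Icc 0 X))
  have := nonpos_of_le_mul_integral (u := fun t => ‖w t‖ - η * Real.exp (B * t)) (b := X) (M := C)
    hB (Continuous.intervalIntegrable (by fun_prop) _ _) (fun t ht => by
      have := hC t ht
      have : 0 ≤ η * Real.exp (B * t) := by positivity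
      linarith) (fun t ht => by
      rw [intervalIntegral.integral_sub (Continuous.intervalIntegrable (by fun_prop) _ _)
        (Continuous.intervalIntegrable (by fun_prop) _ _)]
      have h1 := h t ht
      have h2 := hexp t
      rw [mul_sub]
      linarith) x hx
  linarith

section transOp

variable {h : ℝ} {K : ℝ → ℝ → ℝ} {q : ℝ → ℝ}

/-- Boundedness of the inverse of `1 + K`, by Gronwall's inequality. -/
theorem norm_le_of_transOp_le {w : ℝ → ℂ} (hw : Continuous w)
    {η B X : ℝ} (hB : ∀ x r, |K x r| ≤ B)
    (h : ∀ x ∈ Icc 0 X, ‖transOp K w x‖ ≤ η) {x : ℝ}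
    (hx : x ∈ Icc 0 X) : ‖w x‖ ≤ η * Real.exp (B * x) := by
  have hB0 : 0 ≤ B := (abs_nonneg _).trans (hB 0 0)
  refine norm_le_exp_of_le_integral hw hB0
    ((norm_nonneg _).trans (h x hx)) (fun y hy => ?_) hx
  have e : w y = transOp K w y - ∫ s in (0)..y, (K y s : ℂ) * w s := by simp [transOp]
  rw [e]
  refine (norm_sub_le _ _).trans (add_le_add (h y hy) ?_)
  rw [← intervalIntegral.integral_const_mul]
  refine intervalIntegral.norm_integral_le_of_norm_le hy.1 (ae_of_all _ fun t ht => ?_)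
    (Continuous.intervalIntegrable (by fun_prop) _ _)
  rw [norm_mul, Complex.norm_real]
  gcongr
  exact hB _ _

theorem IsSol.eq_add_secondInt {κ : ℂ} {y y' : ℝ → ℂ} (hq : Continuous q) (hy : IsSol q κ y y')
    (hyc : Continuous y) (h0 : y 0 = 0) (h1 : y' 0 = 1) {x : ℝ} (hx : 0 ≤ x) :
    y x = x + secondInt (fun t => (q t - κ ^ 2) * y t) x := by
  have := eq_secondInt (p := fun t => ((q t : ℂ) - κ ^ 2) * y t) (f := fun x : ℝ => y x - x)
    (f' := fun x : ℝ => y' x - 1) (by fun_prop)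
    (fun x hx => (hy.deriv_fst x hx).sub (hasDerivAt_ofReal x).hasDerivWithinAt)
    (fun x hx => (hy.deriv_snd x hx).sub_const 1) (by simp [h0]) (by simp [h1]) hx
  linear_combination this

/-- The transformation operator carries perturbed sine functions with the same leading part to
solutions. -/
theorem transOp_eq_of_eq_sub_secondInt (hq : Continuous q) (hK : IsTransformationKernel h q K)
    {s s' : ℂ → ℝ → ℂ} (hs : ∀ κ, IsSol q κ (s κ) (s' κ)) (hsc : ∀ κ, Continuous (s κ))
    (hs0 : ∀ κ, s κ 0 = 0) (hs1 : ∀ κ, s' κ 0 = 1) {X : ℝ} {e u : ℝ → ℂ} (he : Continuous e)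
    (hTe : ∀ x ∈ Icc 0 X, transOp K e x = s 0 x) (κ : ℂ) (hu : Continuous u)
    (hue : ∀ x ∈ Icc 0 X, u x = e x - κ ^ 2 * secondInt u x) {x : ℝ} (hx : x ∈ Icc 0 X) :
    transOp K u x = s κ x := by
  have cJ := continuous_secondInt hu
  have cT := continuous_transOp hK.cont hu
  have cTJ := continuous_transOp hK.cont cJ
  have hsc0 := hsc 0
  have hscκ := hsc κ
  have hsub : ∀ x ∈ Icc 0 X, ∀ t ∈ Icc 0 x, t ∈ Icc 0 X := fun x hx t ht => ⟨ht.1, ht.2.trans hx.2⟩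
  have h1 : ∀ x ∈ Icc 0 X, transOp K u x = s 0 x - κ ^ 2 * transOp K (secondInt u) x := by
    intro x hx
    rw [transOp_congr hx.1 (v := fun t => e t + (-κ ^ 2) * secondInt u t)
      (fun t ht => by rw [hue t (hsub x hx t ht)]; ring), transOp_add hK.cont he (by fun_prop),
      transOp_const_mul, hTe x hx]
    ring
  have h2 : ∀ x ∈ Icc 0 X, transOp K (secondInt u) x =
      secondInt (fun t => q t * transOp K (secondInt u) t + transOp K u t) x := fun x hx =>
    sub_eq_zero.1 (intertwiningDefect_eq_zero hq hK hu hx.1)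
  -- The intertwining relation turns the equation of `u` into the integral equation of `s κ`; the
  -- two are then compared by Gronwall.
  have h3 : ∀ x ∈ Icc 0 X, transOp K u x =
      x + secondInt (fun t => (q t - κ ^ 2) * transOp K u t) x := by
    intro x hx
    have e1 := (hs 0).eq_add_secondInt hq (hsc 0) (hs0 0) (hs1 0) hx.1
    rw [h1 x hx, e1, h2 x hx, ← secondInt_const_mul]
    have e2 : secondInt (fun t => (q t - κ ^ 2) * transOp K u t) x =
        secondInt (fun t => ((q t - 0 ^ 2) * s 0 t) + (-1) * (κ ^ 2 *
          (q t * transOp K (secondInt u) t + transOp K u t))) x :=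
      secondInt_congr hx.1 fun t ht => by
        have := h1 t (hsub x hx t ht)
        linear_combination (q t : ℂ) * this
    rw [e2, secondInt_add (by fun_prop) (by fun_prop), secondInt_const_mul (a := -1)]
    ring
  obtain ⟨Q, hQ⟩ := isCompact_Icc.exists_bound_of_continuousOn (hq.continuousOn (s := Icc 0 X))
  have hX : 0 ≤ X := hx.1.trans hx.2
  have hQ0 : 0 ≤ Q := (norm_nonneg _).trans (hQ 0 ⟨le_rfl, hX⟩)
  have h4 : ∀ x ∈ Icc 0 X, ‖transOp K u x - s κ x‖ ≤ 0 + X * (Q + ‖κ‖ ^ 2) *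
      ∫ t in (0)..x, ‖transOp K u t - s κ t‖ := by
    intro x hx
    have e1 : transOp K u x - s κ x =
        secondInt (fun t => (q t - κ ^ 2) * (transOp K u t - s κ t)) x := by
      have : secondInt (fun t => (q t - κ ^ 2) * (transOp K u t - s κ t)) x =
        secondInt (fun t => (q t - κ ^ 2) * transOp K u t + (-1) * ((q t - κ ^ 2) * s κ t)) x :=
          secondInt_congr hx.1 fun t _ => by ring
      rw [this, secondInt_add (by fun_prop) (by fun_prop), secondInt_const_mul, h3 x hx,
        (hs κ).eq_add_secondInt hq (hsc κ) (hs0 κ) (hs1 κ) hx.1]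
      ring
    rw [e1, zero_add, mul_assoc]
    refine (norm_secondInt_le_integral (by fun_prop) hx).trans ?_
    refine mul_le_mul_of_nonneg_left ?_ hX
    rw [← intervalIntegral.integral_const_mul]
    refine intervalIntegral.integral_mono_on hx.1 (Continuous.intervalIntegrable (by fun_prop) _ _)
      (Continuous.intervalIntegrable (by fun_prop) _ _) fun t ht => ?_
    rw [norm_mul]
    gcongr
    refine (norm_sub_le _ _).trans (add_le_add ?_ (norm_pow _ _).le)
    rw [Complex.norm_real]
    exact hQ t (hsub x hx t ht)
  have := norm_le_exp_of_le_integral (w := fun x => transOp K u x - s κ x) (by fun_prop)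
    (by positivity) le_rfl h4 hx
  rw [zero_mul] at this
  exact sub_eq_zero.1 (norm_le_zero_iff.1 this)

end transOp

/-- The Gelfand–Levitan kernel. -/
def glKernel (a : ℝ → ℂ) (x y : ℝ) : ℂ := (a (x + y) + a |x - y|) / 2

theorem continuous_glKernel {a : ℝ → ℂ} (ha : Continuous a) :
    Continuous fun p : ℝ × ℝ => glKernel a p.1 p.2 := by
  unfold glKernel
  fun_prop

theorem glKernel_comm (a : ℝ → ℂ) (x y : ℝ) : glKernel a x y = glKernel a y x := by
  unfold glKernel
  rw [add_comm x y, abs_sub_comm]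

/-- The substitutions `u = s + r`, `u = s - r` for `r ≤ s`, and `u = r - s` for `r ≥ s` reduce
everything to truncated Laplace integrals of `a`. -/
theorem integral_exp_mul_glKernel {a : ℝ → ℂ} (ha : Continuous a) (τ : ℝ) {s x : ℝ}
    (hs : 0 ≤ s) (hsx : s ≤ x) :
    ∫ r in (0)..x, Complex.exp (-τ * r) * glKernel a s r =
      (Complex.exp (τ * s) * ((∫ u in (0)..(x + s), Complex.exp (-τ * u) * a u) -
        ∫ u in (0)..s, Complex.exp (-τ * u) * a u) +
      Complex.exp (-τ * s) * (∫ u in (0)..s, Complex.exp (τ * u) * a u) +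
      Complex.exp (-τ * s) * ∫ u in (0)..(x - s), Complex.exp (-τ * u) * a u) / 2 := by
  have hi : ∀ c : ℂ, Continuous fun u : ℝ => Complex.exp (c * u) * a u := fun c => by fun_prop
  have e1 : ∫ r in (0)..x, Complex.exp (-τ * r) * a (s + r) = Complex.exp (τ * s) *
      ((∫ u in (0)..(x + s), Complex.exp (-τ * u) * a u) -
        ∫ u in (0)..s, Complex.exp (-τ * u) * a u) := by
    rw [intervalIntegral.integral_interval_sub_left ((hi _).intervalIntegrable _ _)
      ((hi _).intervalIntegrable _ _), ← intervalIntegral.integral_const_mul]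
    have := intervalIntegral.integral_comp_add_right (a := 0) (b := x)
      (fun u : ℝ => Complex.exp (τ * s) * (Complex.exp (-τ * u) * a u)) s
    rw [zero_add] at this
    rw [← this]
    refine intervalIntegral.integral_congr fun r _ => ?_
    rw [← mul_assoc, ← Complex.exp_add, add_comm s r]
    push_cast
    ring_nf
  have e2 : ∫ r in (0)..s, Complex.exp (-τ * r) * a |s - r| = Complex.exp (-τ * s) *
      ∫ u in (0)..s, Complex.exp (τ * u) * a u := by
    rw [← intervalIntegral.integral_const_mul]
    have := intervalIntegral.integral_comp_sub_left (a := 0) (b := s)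
      (fun u : ℝ => Complex.exp (-τ * s) * (Complex.exp (τ * u) * a u)) s
    rw [sub_zero, sub_self] at this
    rw [← this]
    refine intervalIntegral.integral_congr fun r hr => ?_
    rw [uIcc_of_le hs] at hr
    rw [abs_of_nonneg (by linarith [hr.2]), ← mul_assoc, ← Complex.exp_add]
    push_cast
    ring_nf
  have e3 : ∫ r in s..x, Complex.exp (-τ * r) * a |s - r| = Complex.exp (-τ * s) *
      ∫ u in (0)..(x - s), Complex.exp (-τ * u) * a u := by
    rw [← intervalIntegral.integral_const_mul]
    have := intervalIntegral.integral_comp_sub_right (a := s) (b := x)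
      (fun u : ℝ => Complex.exp (-τ * s) * (Complex.exp (-τ * u) * a u)) s
    rw [sub_self] at this
    rw [← this]
    refine intervalIntegral.integral_congr fun r hr => ?_
    rw [uIcc_of_le hsx] at hr
    rw [abs_sub_comm, abs_of_nonneg (by linarith [hr.1]), ← mul_assoc, ← Complex.exp_add]
    push_cast
    ring_nf
  have e4 := intervalIntegral.integral_add_adjacent_intervals (a := 0) (b := s) (c := x) (μ := volume)
    (f := fun r : ℝ => Complex.exp (-τ * r) * a |s - r|)
    (Continuous.intervalIntegrable (by fun_prop) _ _) (Continuous.intervalIntegrable (by fun_prop) _ _)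
  have e5 : ∫ r in (0)..x, Complex.exp (-τ * r) * glKernel a s r =
      ((∫ r in (0)..x, Complex.exp (-τ * r) * a (s + r)) +
        ∫ r in (0)..x, Complex.exp (-τ * r) * a |s - r|) / 2 := by
    rw [← intervalIntegral.integral_add (Continuous.intervalIntegrable (by fun_prop) _ _)
      (Continuous.intervalIntegrable (by fun_prop) _ _), ← intervalIntegral.integral_div]
    refine intervalIntegral.integral_congr fun r _ => ?_
    simp only [glKernel]
    ring
  rw [e5, e1, ← e4, e2, e3]
  ring

theorem cos_I_mul (τ : ℝ) (x : ℝ) : Complex.cos (Complex.I * τ * x) =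
    (Complex.exp (τ * x) + Complex.exp (-τ * x)) / 2 := by
  rw [Complex.cos]
  have e1 : Complex.I * τ * x * Complex.I = -τ * x := by
    linear_combination (τ * x : ℂ) * Complex.I_sq
  have e2 : -(Complex.I * τ * x) * Complex.I = τ * x := by
    linear_combination (-τ * x : ℂ) * Complex.I_sq
  rw [e1, e2, add_comm]

theorem cosInt_I_mul {τ : ℝ} (hτ : τ ≠ 0) (x : ℝ) : cosInt (Complex.I * τ) x =
    (Complex.exp (τ * x) - Complex.exp (-τ * x)) / (2 * τ) := by
  have hτ' : (τ : ℂ) ≠ 0 := by exact_mod_cast hτ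
  rw [cosInt_of_ne (mul_ne_zero Complex.I_ne_zero hτ'), Complex.sin]
  have e1 : Complex.I * τ * x * Complex.I = -τ * x := by
    linear_combination (τ * x : ℂ) * Complex.I_sq
  have e2 : -(Complex.I * τ * x) * Complex.I = τ * x := by
    linear_combination (-τ * x : ℂ) * Complex.I_sq
  rw [e1, e2]
  have := Complex.I_ne_zero
  field_simp

theorem convSol_I_mul {τ : ℝ} (hτ : τ ≠ 0) {a : ℝ → ℂ} (ha : Continuous a) (x : ℝ) :
    convSol (Complex.I * τ) a x =
      (Complex.exp (τ * x) * (∫ u in (0)..x, Complex.exp (-τ * u) * a u) -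
        Complex.exp (-τ * x) * ∫ u in (0)..x, Complex.exp (τ * u) * a u) / (2 * τ) := by
  rw [← intervalIntegral.integral_const_mul, ← intervalIntegral.integral_const_mul,
    ← intervalIntegral.integral_sub (Continuous.intervalIntegrable (by fun_prop) _ _)
      (Continuous.intervalIntegrable (by fun_prop) _ _), ← intervalIntegral.integral_div]
  refine intervalIntegral.integral_congr fun t _ => ?_
  rw [cosInt_I_mul hτ]
  have e1 : Complex.exp (τ * (x - t : ℝ)) = Complex.exp (τ * x) * Complex.exp (-τ * t) := by
    rw [← Complex.exp_add]; push_cast; ring_nf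
  have e2 : Complex.exp (-τ * (x - t : ℝ)) = Complex.exp (-τ * x) * Complex.exp (τ * t) := by
    rw [← Complex.exp_add]; push_cast; ring_nf
  rw [e1, e2]
  ring

/-- The truncated Laplace transform of the rows of the Gelfand–Levitan kernel. -/
theorem norm_integral_exp_mul_glKernel_add_le {a : ℝ → ℂ} (ha : Continuous a) {τ C : ℝ} {m : ℂ}
    (hτ : 0 < τ) {s x : ℝ} (hs : 0 ≤ s) (hsx : s ≤ x)
    (hL : ∀ y ∈ Icc 0 (2 * x), ‖(-τ * m - 1) - ∫ u in (0)..y, Complex.exp (-τ * u) * a u‖ ≤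
      C * Real.exp (-τ * y)) :
    ‖(∫ r in (0)..x, Complex.exp (-τ * r) * glKernel a s r) + Complex.exp (-τ * s) +
      τ * (m * Complex.cos (Complex.I * τ * s) + (cosInt (Complex.I * τ) s +
        convSol (Complex.I * τ) a s))‖ ≤ C * Real.exp (-τ * x) := by
  have hτ' : (τ : ℂ) ≠ 0 := by exact_mod_cast hτ.ne'
  rw [integral_exp_mul_glKernel ha τ hs hsx, cos_I_mul, cosInt_I_mul hτ.ne',
    convSol_I_mul hτ.ne' ha]
  have h1 := hL (x + s) ⟨by linarith, by linarith⟩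
  have h2 := hL (x - s) ⟨by linarith, by linarith⟩
  obtain ⟨I₁, hI₁⟩ : ∃ I, I = ∫ u in (0)..(x + s), Complex.exp (-τ * u) * a u := ⟨_, rfl⟩
  obtain ⟨I₂, hI₂⟩ : ∃ I, I = ∫ u in (0)..(x - s), Complex.exp (-τ * u) * a u := ⟨_, rfl⟩
  obtain ⟨I₃, hI₃⟩ : ∃ I, I = ∫ u in (0)..s, Complex.exp (-τ * u) * a u := ⟨_, rfl⟩
  obtain ⟨I₄, hI₄⟩ : ∃ I, I = ∫ u in (0)..s, Complex.exp (τ * u) * a u := ⟨_, rfl⟩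
  rw [← hI₁] at h1
  rw [← hI₂] at h2
  rw [← hI₁, ← hI₂, ← hI₃, ← hI₄]
  -- Two tails of the Laplace transform remain, cut at `x + s` and `x - s`. Their weights `e^{τs}`
  -- and `e^{-τs}` turn both bounds into `e^{-τx}`.
  have e : (Complex.exp (τ * s) * (I₁ - I₃) + Complex.exp (-τ * s) * I₄ +
      Complex.exp (-τ * s) * I₂) / 2 + Complex.exp (-τ * s) +
      τ * (m * ((Complex.exp (τ * s) + Complex.exp (-τ * s)) / 2) +
        ((Complex.exp (τ * s) - Complex.exp (-τ * s)) / (2 * τ) +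
          (Complex.exp (τ * s) * I₃ - Complex.exp (-τ * s) * I₄) / (2 * τ))) =
      -(Complex.exp (τ * s) * ((-τ * m - 1) - I₁) +
        Complex.exp (-τ * s) * ((-τ * m - 1) - I₂)) / 2 := by
    field_simp
    ring
  rw [e, norm_div, norm_neg, Complex.norm_ofNat, div_le_iff₀ two_pos]
  refine (norm_add_le _ _).trans ?_
  rw [norm_mul, norm_mul, Complex.norm_exp, Complex.norm_exp]
  have r1 : ((τ : ℂ) * s).re = τ * s := by simp
  have r2 : (-(τ : ℂ) * s).re = -τ * s := by simp
  rw [r1, r2]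
  have m1 : Real.exp (τ * s) * (C * Real.exp (-τ * (x + s))) = C * Real.exp (-τ * x) := by
    rw [mul_left_comm, ← Real.exp_add]; ring_nf
  have m2 : Real.exp (-τ * s) * (C * Real.exp (-τ * (x - s))) = C * Real.exp (-τ * x) := by
    rw [mul_left_comm, ← Real.exp_add]; ring_nf
  have := mul_le_mul_of_nonneg_left h1 (Real.exp_pos (τ * s)).le
  have := mul_le_mul_of_nonneg_left h2 (Real.exp_pos (-τ * s)).le
  linarith

end

/-! ### The Gelfand–Levitan equation for the transformation kernel. -/

section

variable {h : ℝ} {K : ℝ → ℝ → ℝ} {q : ℝ → ℝ}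

theorem exists_transOp_eq (hK : Continuous (Function.uncurry K)) {B : ℝ}
    (hB : ∀ x r, |K x r| ≤ B) {F : ℝ → ℂ} (hF : Continuous F) {X : ℝ} (hX : 0 ≤ X) :
    ∃ e, Continuous e ∧ ∀ x ∈ Icc 0 X, transOp K e x = F x := by
  obtain ⟨C₀, hC₀⟩ := isCompact_Icc.exists_bound_of_continuousOn (hF.continuousOn (s := Icc 0 X))
  obtain ⟨e, he, hes⟩ := exists_volterra_solution (Q := fun x s => -K x s)
    hK.neg (C := B) (fun x r => by rw [abs_neg]; exact hB x r)
    (F := fun t => F (max 0 (min t X))) (by fun_prop) (C₀ := C₀)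
    (fun t => hC₀ _ ⟨le_max_left _ _, max_le hX (min_le_right _ _)⟩)
  refine ⟨e, he, fun x hx => ?_⟩
  rw [transOp, hes x hx.1, min_eq_left hx.2, max_eq_right hx.1]
  have : ∫ s in (0)..x, (-K x s) • e s = -∫ s in (0)..x, (K x s : ℂ) * e s := by
    rw [← intervalIntegral.integral_neg]
    refine intervalIntegral.integral_congr fun s _ => ?_
    rw [Complex.real_smul]
    push_cast
    ring
  rw [this]
  ring

/-- If `d - τ² d₂ = δ` with `d₂'' = d` and `d` stays bounded as `τ → ∞`, the Laplace-type integral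
of `δ` stays bounded. -/
theorem norm_integral_exp_sub_le {d δ : ℝ → ℂ} (hd : Continuous d)
    {τ X C C' : ℝ} (hτ : 1 ≤ τ) (hX : 0 ≤ X)
    (hdδ : ∀ x ∈ Icc 0 X, d x = δ x + τ ^ 2 * secondInt d x) (hC : ∀ x ∈ Icc 0 X, ‖d x‖ ≤ C)
    (hC' : ∀ x ∈ Icc 0 X, ‖δ x‖ ≤ C') :
    ‖∫ t in (0)..X, Real.exp (τ * (X - t)) • δ t‖ ≤ C * X + (C + C') := by
  -- With `D` the twofold antiderivative of `d`, the function `e^{-τt} (D' + τ D)` has the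
  -- derivative `e^{-τt} (d - τ² D)`, so the Laplace integral of `δ` is explicit.
  have hder : ∀ t ∈ uIcc 0 X, HasDerivAt (fun t : ℝ => Complex.exp (-τ * t) *
      ((∫ r in (0)..t, d r) + τ * secondInt d t))
      (Complex.exp (-τ * t) * (d t - τ ^ 2 * secondInt d t)) t := fun t _ => by
    refine ((hasDerivAt_cexp_mul (-τ) t).mul ((hasDerivAt_integral hd t).add
      ((hasDerivAt_secondInt hd t).const_mul (τ : ℂ)))).congr_deriv ?_
    simp only [Pi.add_apply]
    ring
  have cJ := continuous_secondInt hd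
  have h1 := intervalIntegral.integral_eq_sub_of_hasDerivAt hder
    (Continuous.intervalIntegrable (by fun_prop) _ _)
  have h2 : ∫ t in (0)..X, Real.exp (τ * (X - t)) • δ t =
      (∫ r in (0)..X, d r) + τ * secondInt d X := by
    have e : ∫ t in (0)..X, Real.exp (τ * (X - t)) • δ t = Complex.exp (τ * X) *
        ∫ t in (0)..X, Complex.exp (-τ * t) * (d t - τ ^ 2 * secondInt d t) := by
      rw [← intervalIntegral.integral_const_mul]
      refine intervalIntegral.integral_congr fun t ht => ?_
      rw [uIcc_of_le hX] at ht
      rw [hdδ t ht, Complex.real_smul, ← mul_assoc, ← Complex.exp_add]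
      push_cast
      ring_nf
    have hS0 : secondInt d 0 = 0 := by simp [secondInt]
    rw [e, h1, hS0]
    simp only [intervalIntegral.integral_same, mul_zero, add_zero, sub_zero]
    rw [← mul_assoc, ← Complex.exp_add]
    have : (τ : ℂ) * X + -τ * X = 0 := by ring
    rw [this, Complex.exp_zero, one_mul]
  have hXm : X ∈ Icc 0 X := ⟨hX, le_rfl⟩
  rw [h2]
  refine (norm_add_le _ _).trans (add_le_add ?_ ?_)
  · have := intervalIntegral.norm_integral_le_of_norm_le_const (a := 0) (b := X) (f := d) (C := C)
      fun t ht => by rw [uIoc_of_le hX] at ht; exact hC t ⟨ht.1.le, ht.2⟩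
    rwa [sub_zero, abs_of_nonneg hX] at this
  -- The term `τ D(X)` is read off from the hypothesis at `X`, where `τ² D` is bounded; `τ ≥ 1`
  -- suffices.
  · have h3 : (τ : ℂ) * (τ * secondInt d X) = d X - δ X := by
      rw [hdδ X hXm]; ring
    have h4 : τ * ‖(τ : ℂ) * secondInt d X‖ ≤ C + C' := by
      have := congrArg norm h3
      rw [norm_mul, Complex.norm_real, Real.norm_eq_abs, abs_of_nonneg (by linarith)] at this
      rw [this]
      exact (norm_sub_le _ _).trans (add_le_add (hC X hXm) (hC' X hXm))
    nlinarith [norm_nonneg ((τ : ℂ) * secondInt d X)]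

/-- The transformation kernel satisfies the Gelfand–Levitan equation built from the inverse
Laplace transform of the Weyl function. -/
theorem gelfandLevitan_of_weyl (hq : Continuous q) (hK : IsTransformationKernel h q K)
    {s s' : ℂ → ℝ → ℂ} (hs : ∀ κ, IsSol q κ (s κ) (s' κ)) (hsc : ∀ κ, Continuous (s κ))
    (hs0 : ∀ κ, s κ 0 = 0) (hs1 : ∀ κ, s' κ 0 = 1) {a : ℝ → ℂ} (ha : Continuous a) {m : ℝ → ℂ}
    (hψ : ∃ C τ₁ : ℝ, ∀ τ ≥ τ₁, ∀ x ≥ 0,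
      τ * ‖m τ * regSol K (Complex.I * τ) x + s (Complex.I * τ) x‖ ≤ C * Real.exp (-τ * x))
    (hL : ∀ X : ℝ, ∃ C τ₁ : ℝ, ∀ τ : ℝ, τ₁ ≤ τ → ∀ y ∈ Icc 0 X,
      ‖(-τ * m τ - 1) - ∫ u in (0)..y, Complex.exp (-τ * u) * a u‖ ≤ C * Real.exp (-τ * y))
    {X : ℝ} (hX : 0 < X) {y : ℝ} (hy : y ∈ Icc 0 X) :
    glKernel a X y + K X y + ∫ s in (0)..X, (K X s : ℂ) * glKernel a s y = 0 := by
  obtain ⟨B, hB⟩ := hK.bdd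
  have hB0 : 0 ≤ B := (abs_nonneg _).trans (hB 0 0)
  obtain ⟨C₁, τ₁, hψ⟩ := hψ
  obtain ⟨C₂, τ₂, hL⟩ := hL (2 * X)
  -- Two candidates for the preimage of `s(iτ)` under `1 + K`: `u τ`, built from the preimage `e` of
  -- `s(0)`, and `w τ`, built from `a` through `e' = t + secondInt a`. The first half of the proof
  -- shows `e = e'`; the second shows that the defect `H` of the equation vanishes.
  obtain ⟨e, he, hTe⟩ := exists_transOp_eq hK.cont hB (hsc 0) hX.le
  let e' : ℝ → ℂ := fun t => t + secondInt a t
  have he' : Continuous e' := by have := continuous_secondInt ha; fun_prop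
  have hgc := continuous_glKernel ha
  have hgcx : ∀ x, Continuous (glKernel a x) := fun x => hgc.comp (Continuous.prodMk_right x)
  let w : ℝ → ℝ → ℂ := fun τ x => cosInt (Complex.I * τ) x + convSol (Complex.I * τ) a x
  let u : ℝ → ℝ → ℂ := fun τ x => e x - (Complex.I * τ) ^ 2 * convSol (Complex.I * τ) e x
  have hwc : ∀ τ, Continuous (w τ) := fun τ =>
    (continuous_cosInt _).add (continuous_convSol _ ha)
  have huc : ∀ τ, Continuous (u τ) := fun τ =>
    he.sub (continuous_const.mul (continuous_convSol _ he))
  have hwe : ∀ τ, ∀ x ∈ Icc 0 X, w τ x = e' x - (Complex.I * τ) ^ 2 * secondInt (w τ) x := by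
    intro τ x hx
    have h1 := cosInt_eq_sub_secondInt (Complex.I * τ) hx.1
    have h2 := convSol_eq_secondInt (Complex.I * τ) ha hx.1
    have c1 := continuous_cosInt (Complex.I * τ)
    have c2 := continuous_convSol (Complex.I * τ) ha
    have h3 : secondInt (fun t => a t - (Complex.I * τ) ^ 2 * convSol (Complex.I * τ) a t) x =
        secondInt a x + -(Complex.I * τ) ^ 2 * secondInt (convSol (Complex.I * τ) a) x := by
      rw [← secondInt_const_mul, ← secondInt_add ha (by fun_prop)]
      exact secondInt_congr hx.1 fun t _ => by ring
    have h4 : secondInt (w τ) x = secondInt (cosInt (Complex.I * τ)) x +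
        secondInt (convSol (Complex.I * τ) a) x := secondInt_add c1 c2 x
    rw [h4]
    simp only [w, e']
    linear_combination h1 + h2 + h3
  have hue : ∀ τ, ∀ x ∈ Icc 0 X, u τ x = e x - (Complex.I * τ) ^ 2 * secondInt (u τ) x := by
    intro τ x hx
    simp only [u]
    rw [convSol_eq_secondInt _ he hx.1]
  have hTu : ∀ τ : ℝ, ∀ x ∈ Icc 0 X, transOp K (u τ) x = s (Complex.I * τ) x := fun τ x hx =>
    transOp_eq_of_eq_sub_secondInt hq hK hs hsc hs0 hs1 he hTe _ (huc τ) (hue τ) hx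
  obtain ⟨G, hG⟩ := (isCompact_Icc.prod isCompact_Icc).exists_bound_of_continuousOn
    (hgc.continuousOn (s := Icc 0 X ×ˢ Icc 0 X))
  have hG0 : 0 ≤ G := (norm_nonneg _).trans (hG (0, 0) ⟨⟨le_rfl, hX.le⟩, ⟨le_rfl, hX.le⟩⟩)
  have hXm : X ∈ Icc 0 X := ⟨hX.le, le_rfl⟩
  let τ₀ : ℝ := max 1 (max τ₁ τ₂)
  have hτ₀1 : 1 ≤ τ₀ := le_max_left _ _
  have hτ₀2 : τ₁ ≤ τ₀ := (le_max_left _ _).trans (le_max_right _ _)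
  have hτ₀3 : τ₂ ≤ τ₀ := (le_max_right _ _).trans (le_max_right _ _)
  have hC₂ : 0 ≤ C₂ := by
    have := (norm_nonneg _).trans (hL τ₀ hτ₀3 0 ⟨le_rfl, by linarith⟩)
    simpa using this
  have hC₁ : 0 ≤ C₁ := by
    have := hψ τ₀ hτ₀2 0 le_rfl
    have h2 : 0 ≤ τ₀ * ‖m τ₀ * regSol K (Complex.I * τ₀) 0 + s (Complex.I * τ₀) 0‖ := by positivity
    simpa using h2.trans this
  have hexp1 : ∀ τ : ℝ, 0 ≤ τ → ∀ x : ℝ, 0 ≤ x → Real.exp (-τ * x) ≤ 1 := fun τ hτ x hx => by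
    rw [Real.exp_le_one_iff]
    nlinarith [mul_nonneg hτ hx]
  have hnexp : ∀ τ x : ℝ, ‖Complex.exp (-τ * x)‖ = Real.exp (-τ * x) := fun τ x => by
    rw [Complex.norm_exp]; simp
  have hcosc : ∀ τ : ℝ, Continuous fun x : ℝ => m τ * Complex.cos (Complex.I * τ * x) :=
    fun τ => by fun_prop
  have hΓ : ∀ τ ≥ τ₀, ∀ x ∈ Icc 0 X, ∀ r ∈ Icc 0 x,
      ‖(∫ t in (0)..x, Complex.exp (-τ * t) * glKernel a r t) + Complex.exp (-τ * r) +
      τ * (m τ * Complex.cos (Complex.I * τ * r) + w τ r)‖ ≤ C₂ * Real.exp (-τ * x) :=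
    fun τ hτ x hx r hr => norm_integral_exp_mul_glKernel_add_le ha (by linarith) hr.1 hr.2
      fun y hy => hL τ (by linarith) y ⟨hy.1, by linarith [hy.2, hx.2]⟩
  -- On the `a` side the Laplace tail estimate keeps `m cos + w` bounded as `τ → ∞`.
  have hbw : ∀ τ ≥ τ₀, ∀ x ∈ Icc 0 X, ‖m τ * Complex.cos (Complex.I * τ * x) + w τ x‖ ≤
      C₂ + G * X + 1 := by
    intro τ hτ x hx
    have hτ1 : 1 ≤ τ := hτ₀1.trans hτ
    have h1 := hΓ τ hτ x hx x ⟨hx.1, le_rfl⟩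
    have h2 : ‖∫ t in (0)..x, Complex.exp (-τ * t) * glKernel a x t‖ ≤ G * X := by
      refine (intervalIntegral.norm_integral_le_of_norm_le_const (C := G) fun t ht => ?_).trans ?_
      · rw [uIoc_of_le hx.1] at ht
        rw [norm_mul, hnexp, ← one_mul G]
        exact mul_le_mul (hexp1 τ (by linarith) t ht.1.le)
          (hG (x, t) ⟨hx, ⟨ht.1.le, ht.2.trans hx.2⟩⟩) (norm_nonneg _) zero_le_one
      · rw [sub_zero, abs_of_nonneg hx.1]
        exact mul_le_mul_of_nonneg_left hx.2 hG0
    have h3 := hexp1 τ (by linarith) x hx.1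
    have h4 := hnexp τ x
    obtain ⟨z, hz⟩ : ∃ z, z = m τ * Complex.cos (Complex.I * τ * x) + w τ x := ⟨_, rfl⟩
    rw [← hz] at h1 ⊢
    have h5 : ‖(τ : ℂ) * z‖ ≤ C₂ + G * X + 1 := by
      have e1 : (τ : ℂ) * z = ((∫ t in (0)..x, Complex.exp (-τ * t) * glKernel a x t) +
        Complex.exp (-τ * x) + τ * z) - (∫ t in (0)..x, Complex.exp (-τ * t) * glKernel a x t) -
        Complex.exp (-τ * x) := by ring
      rw [e1]
      refine (norm_sub_le _ _).trans (add_le_add ((norm_sub_le _ _).trans (add_le_add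
        (h1.trans ?_) h2)) (by linarith))
      exact mul_le_of_le_one_right hC₂ h3
    rw [norm_mul, Complex.norm_real, Real.norm_eq_abs, abs_of_nonneg (by linarith)] at h5
    nlinarith [norm_nonneg z]
  have hTcos : ∀ (τ : ℝ) (v : ℝ → ℂ), Continuous v → ∀ x,
      transOp K (fun x => m τ * Complex.cos (Complex.I * τ * x) + v x) x =
        m τ * regSol K (Complex.I * τ) x + transOp K v x := fun τ v hv x => by
    rw [transOp_add hK.cont (hcosc τ) hv, transOp_const_mul, transOp_cos]
  -- On the potential side `1 + K` maps `m cos + u` to the Weyl solution, which is bounded, and `1 +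
  -- K` has a bounded inverse.
  have hbu : ∀ τ ≥ τ₀, ∀ x ∈ Icc 0 X, ‖m τ * Complex.cos (Complex.I * τ * x) + u τ x‖ ≤
      C₁ * Real.exp (B * X) := by
    intro τ hτ x hx
    have hτ1 : 1 ≤ τ := hτ₀1.trans hτ
    have := norm_le_of_transOp_le (η := C₁) ((hcosc τ).add (huc τ)) hB (fun x hx => ?_) hx
    · refine this.trans ?_
      gcongr
      exact hx.2
    · simp only [Pi.add_def]
      rw [hTcos τ _ (huc τ), hTu τ x hx]
      have h1 := hψ τ (by linarith) x hx.1
      have h2 := mul_le_of_le_one_right hC₁ (hexp1 τ (by linarith) x hx.1)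
      nlinarith [norm_nonneg (m τ * regSol K (Complex.I * τ) x + s (Complex.I * τ) x)]
  -- The growing parts cancel in `u - w`, which is therefore bounded; it solves `d - τ² D = e - e'`
  -- with `D'' = d`, so the exponential moments of `e - e'` are bounded.
  have hee : ∀ x ∈ Icc 0 X, e x = e' x := by
    obtain ⟨C', hC'⟩ := isCompact_Icc.exists_bound_of_continuousOn
      ((he.sub he').continuousOn (s := Icc 0 X))
    have := eqOn_zero_of_exp_integral_bounded hX (h := fun x => e x - e' x)
      (he.sub he').continuousOn (τ₀ := τ₀) (fun τ hτ => norm_integral_exp_sub_le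
      (d := fun x => u τ x - w τ x) (δ := fun x => e x - e' x) ((huc τ).sub (hwc τ))
      (hτ₀1.trans hτ) hX.le (C := C₁ * Real.exp (B * X) + (C₂ + G * X + 1)) (C' := C') ?_ ?_ hC')
    · exact fun x hx => sub_eq_zero.1 (this hx)
    · intro x hx
      have e1 : secondInt (fun x => u τ x - w τ x) x = secondInt (u τ) x - secondInt (w τ) x := by
        have := secondInt_add (huc τ) (continuous_const.mul (hwc τ)) (p := u τ)
          (r := fun t => (-1) * w τ t) x
        rw [secondInt_const_mul] at this
        rw [sub_eq_add_neg, neg_eq_neg_one_mul, ← this]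
        exact secondInt_congr hx.1 fun t _ => by ring
      rw [e1]
      linear_combination hue τ x hx - hwe τ x hx -
        (τ ^ 2 * (secondInt (u τ) x - secondInt (w τ) x)) * Complex.I_sq
    · intro x hx
      have e1 : u τ x - w τ x = (m τ * Complex.cos (Complex.I * τ * x) + u τ x) -
        (m τ * Complex.cos (Complex.I * τ * x) + w τ x) := by ring
      rw [e1]
      exact (norm_sub_le _ _).trans (add_le_add (hbu τ hτ x hx) (hbw τ hτ x hx))
  have hTe' : ∀ x ∈ Icc 0 X, transOp K e' x = s 0 x := fun x hx => by
    rw [← hTe x hx]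
    exact transOp_congr hx.1 fun t ht => (hee t ⟨ht.1, ht.2.trans hx.2⟩).symm
  have hTw : ∀ τ : ℝ, ∀ x ∈ Icc 0 X, transOp K (w τ) x = s (Complex.I * τ) x := fun τ x hx =>
    transOp_eq_of_eq_sub_secondInt hq hK hs hsc hs0 hs1 he' hTe' _ (hwc τ) (hwe τ) hx
  have hKX : Continuous (K X) := hK.cont.comp (Continuous.prodMk_right X)
  let H : ℝ → ℂ := fun y => glKernel a X y + K X y + ∫ s in (0)..X, (K X s : ℂ) * glKernel a s y
  have hIc : Continuous fun y => ∫ s in (0)..X, (K X s : ℂ) * glKernel a s y :=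
    intervalIntegral.continuous_parametric_intervalIntegral_of_continuous'
      (f := fun (y s : ℝ) => (K X s : ℂ) * glKernel a s y)
      (by
        have : Continuous fun p : ℝ × ℝ => glKernel a p.2 p.1 :=
          hgc.comp (by fun_prop : Continuous fun p : ℝ × ℝ => (p.2, p.1))
        simp only [Function.uncurry_def]
        fun_prop) 0 X
  have hgX := hgcx X
  have hHc : Continuous H := by simp only [H]; fun_prop
  refine eqOn_zero_of_exp_integral_bounded hX (h := H) hHc.continuousOn (τ₀ := τ₀)
    (C := (1 + B * X) * C₂ + C₁ + 1) (fun τ hτ => ?_) hy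
  have hτ1 : 1 ≤ τ := hτ₀1.trans hτ
  let γ : ℝ → ℂ := fun r => ∫ t in (0)..X, Complex.exp (-τ * t) * glKernel a r t
  have hγ : Continuous γ :=
    intervalIntegral.continuous_parametric_intervalIntegral_of_continuous'
      (f := fun (r t : ℝ) => Complex.exp (-τ * t) * glKernel a r t)
      (by simp only [Function.uncurry_def]; fun_prop) 0 X
  -- `ρ` is of size `e^{-τX}` by `hΓ`. Applying `1 + K` to it gives the Laplace integral of the
  -- defect `H`, up to the Weyl solution and `e^{-τX}`, which are equally small.
  let ρ : ℝ → ℂ := fun r => γ r + Complex.exp (-τ * r) +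
    τ * (m τ * Complex.cos (Complex.I * τ * r) + w τ r)
  have hwτ := hwc τ
  have hcτ := hcosc τ
  have hTρ : transOp K ρ X = transOp K (fun r => γ r + Complex.exp (-τ * r)) X +
      τ * (m τ * regSol K (Complex.I * τ) X + s (Complex.I * τ) X) := by
    rw [← hTw τ X hXm, ← hTcos τ _ (hwc τ), ← transOp_const_mul,
      ← transOp_add hK.cont (by fun_prop) (by fun_prop)]
  have hswap : ∫ t in (0)..X, Complex.exp (-τ * t) *
      (∫ s in (0)..X, (K X s : ℂ) * glKernel a s t) = ∫ s in (0)..X, (K X s : ℂ) * γ s := by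
    have e1 : ∀ t : ℝ, Complex.exp (-τ * t) * (∫ s in (0)..X, (K X s : ℂ) * glKernel a s t) =
        ∫ s in (0)..X, Complex.exp (-τ * t) * ((K X s : ℂ) * glKernel a s t) := fun t => by
      rw [intervalIntegral.integral_const_mul]
    simp only [e1]
    rw [MeasureTheory.intervalIntegral_intervalIntegral_swap]
    · refine intervalIntegral.integral_congr fun r _ => ?_
      simp only [γ]
      rw [← intervalIntegral.integral_const_mul]
      exact intervalIntegral.integral_congr fun t _ => by ring
    · have hc : Continuous (Function.uncurry fun (t s : ℝ) =>
          Complex.exp (-τ * t) * ((K X s : ℂ) * glKernel a s t)) := by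
        have : Continuous fun p : ℝ × ℝ => glKernel a p.2 p.1 :=
          hgc.comp (by fun_prop : Continuous fun p : ℝ × ℝ => (p.2, p.1))
        simp only [Function.uncurry_def]
        fun_prop
      refine (hc.continuousOn.integrableOn_compact (isCompact_uIcc.prod isCompact_uIcc)).mono_set
        (prod_mono uIoc_subset_uIcc uIoc_subset_uIcc)
  have hHint : ∫ t in (0)..X, Complex.exp (-τ * t) * H t =
      transOp K ρ X - τ * (m τ * regSol K (Complex.I * τ) X + s (Complex.I * τ) X) -
        Complex.exp (-τ * X) := by
    have e1 : ∫ t in (0)..X, Complex.exp (-τ * t) * H t = γ X +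
        (∫ t in (0)..X, Complex.exp (-τ * t) * K X t) + ∫ s in (0)..X, (K X s : ℂ) * γ s := by
      rw [← hswap]
      simp only [γ]
      rw [← intervalIntegral.integral_add (Continuous.intervalIntegrable (by fun_prop) _ _)
        (Continuous.intervalIntegrable (by fun_prop) _ _),
        ← intervalIntegral.integral_add (Continuous.intervalIntegrable (by fun_prop) _ _)
        (Continuous.intervalIntegrable (by fun_prop) _ _)]
      refine intervalIntegral.integral_congr fun t _ => ?_
      simp only [H]
      ring
    have e2 : ∫ s in (0)..X, (K X s : ℂ) * (γ s + Complex.exp (-τ * s)) =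
        (∫ s in (0)..X, (K X s : ℂ) * γ s) + ∫ t in (0)..X, Complex.exp (-τ * t) * K X t := by
      rw [← intervalIntegral.integral_add (Continuous.intervalIntegrable (by fun_prop) _ _)
        (Continuous.intervalIntegrable (by fun_prop) _ _)]
      exact intervalIntegral.integral_congr fun t _ => by ring
    rw [hTρ, e1, transOp, e2]
    ring
  have hbρ : ‖transOp K ρ X‖ ≤ (1 + B * X) * (C₂ * Real.exp (-τ * X)) :=
    norm_transOp_le hB hXm fun r hr => hΓ τ hτ X hXm r hr
  have hbψ := hψ τ (by linarith) X hX.le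
  have e3 : ∫ t in (0)..X, Real.exp (τ * (X - t)) • H t =
      Complex.exp (τ * X) * ∫ t in (0)..X, Complex.exp (-τ * t) * H t := by
    rw [← intervalIntegral.integral_const_mul]
    refine intervalIntegral.integral_congr fun t _ => ?_
    rw [Complex.real_smul, ← mul_assoc, ← Complex.exp_add]
    push_cast
    ring_nf
  rw [e3, hHint, norm_mul, Complex.norm_exp]
  have r1 : ((τ : ℂ) * X).re = τ * X := by simp
  rw [r1]
  have hb : ‖transOp K ρ X - τ * (m τ * regSol K (Complex.I * τ) X + s (Complex.I * τ) X) -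
      Complex.exp (-τ * X)‖ ≤ ((1 + B * X) * C₂ + C₁ + 1) * Real.exp (-τ * X) := by
    refine (norm_sub_le _ _).trans ?_
    have := norm_sub_le (transOp K ρ X)
      (τ * (m τ * regSol K (Complex.I * τ) X + s (Complex.I * τ) X))
    rw [norm_mul (τ : ℂ), Complex.norm_real, Real.norm_eq_abs, abs_of_nonneg (by linarith)] at this
    rw [hnexp]
    linarith
  calc _ ≤ Real.exp (τ * X) * (((1 + B * X) * C₂ + C₁ + 1) * Real.exp (-τ * X)) := by gcongr
    _ = (1 + B * X) * C₂ + C₁ + 1 := by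
      rw [mul_left_comm, ← Real.exp_add, show τ * X + -τ * X = 0 by ring, Real.exp_zero, mul_one]

end

/-! ### Triangular factorisation; the diagonal determines the data. -/

section

/-- Change of the order of integration over a triangle. -/
theorem integral_integral_triangle {F : ℝ → ℝ → ℂ} (hF : Continuous (Function.uncurry F)) {x : ℝ}
    (hx : 0 ≤ x) : ∫ s in (0)..x, ∫ u in s..x, F u s = ∫ u in (0)..x, ∫ s in (0)..u, F u s := by
  let G : ℝ → ℝ → ℂ := fun s u => if s ≤ u then F u s else 0
  have hF1 : ∀ s, Continuous fun u => F u s := fun s => hF.comp (Continuous.prodMk_left s)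
  have hF2 : ∀ u, Continuous (F u) := fun u => hF.comp (Continuous.prodMk_right u)
  have hG : IntegrableOn (Function.uncurry G) (uIoc 0 x ×ˢ uIoc 0 x) := by
    have h1 : IntegrableOn (fun p : ℝ × ℝ => F p.2 p.1) (uIoc 0 x ×ˢ uIoc 0 x) :=
      ((hF.comp (by fun_prop : Continuous fun p : ℝ × ℝ => (p.2, p.1))).continuousOn.integrableOn_compact
        (isCompact_uIcc.prod isCompact_uIcc)).mono_set (prod_mono uIoc_subset_uIcc uIoc_subset_uIcc)
    have hm : MeasurableSet {p : ℝ × ℝ | p.1 ≤ p.2} := measurableSet_le measurable_fst measurable_snd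
    refine (Integrable.indicator h1 hm).congr (ae_of_all _ fun p => ?_)
    by_cases hp : p.1 ≤ p.2 <;> simp [G, indicator, Function.uncurry, hp]
  have hGu : ∀ s, IntervalIntegrable (fun u => G s u) volume 0 x := fun s => by
    have h1 : IntegrableOn (fun u => F u s) (uIoc 0 x) := ((hF1 s).intervalIntegrable 0 x).def'
    have : IntegrableOn (fun u => G s u) (uIoc 0 x) := by
      refine (Integrable.indicator h1 (measurableSet_Ici (a := s))).congr (ae_of_all _ fun u => ?_)
      by_cases hp : s ≤ u <;> simp [G, indicator, hp]
    exact intervalIntegrable_iff.2 this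
  have hGs : ∀ u, IntervalIntegrable (fun s => G s u) volume 0 x := fun u => by
    have h1 : IntegrableOn (fun s => F u s) (uIoc 0 x) := ((hF2 u).intervalIntegrable 0 x).def'
    have : IntegrableOn (fun s => G s u) (uIoc 0 x) := by
      refine (Integrable.indicator h1 (measurableSet_Iic (a := u))).congr (ae_of_all _ fun s => ?_)
      by_cases hp : s ≤ u <;> simp [G, indicator, hp]
    exact intervalIntegrable_iff.2 this
  have hsub : ∀ {c d : ℝ}, c ∈ Icc 0 x → d ∈ Icc 0 x → uIcc c d ⊆ uIcc 0 x := fun hc hd => by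
    rw [uIcc_of_le hx]
    exact uIcc_subset_Icc hc hd
  have e1 : ∫ s in (0)..x, ∫ u in s..x, F u s = ∫ s in (0)..x, ∫ u in (0)..x, G s u := by
    refine intervalIntegral.integral_congr fun s hs => ?_
    rw [uIcc_of_le hx] at hs
    have h1 := intervalIntegral.integral_add_adjacent_intervals (a := 0) (b := s) (c := x)
      ((hGu s).mono_set (hsub ⟨le_rfl, hx⟩ hs)) ((hGu s).mono_set (hsub hs ⟨hx, le_rfl⟩))
    have h2 : ∫ u in (0)..s, G s u = 0 := by
      rw [intervalIntegral.integral_of_le hs.1, integral_Ioc_eq_integral_Ioo]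
      refine setIntegral_eq_zero_of_forall_eq_zero fun u hu => ?_
      simp [G, not_le.2 hu.2]
    rw [h2, zero_add] at h1
    rw [← h1]
    refine intervalIntegral.integral_congr fun u hu => ?_
    rw [uIcc_of_le hs.2] at hu
    simp [G, hu.1]
  have e2 : ∫ u in (0)..x, ∫ s in (0)..u, F u s = ∫ u in (0)..x, ∫ s in (0)..x, G s u := by
    refine intervalIntegral.integral_congr fun u hu => ?_
    rw [uIcc_of_le hx] at hu
    have h1 := intervalIntegral.integral_add_adjacent_intervals (a := 0) (b := u) (c := x)
      ((hGs u).mono_set (hsub ⟨le_rfl, hx⟩ hu)) ((hGs u).mono_set (hsub hu ⟨hx, le_rfl⟩))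
    have h2 : ∫ s in u..x, G s u = 0 := by
      rw [intervalIntegral.integral_of_le hu.2]
      refine setIntegral_eq_zero_of_forall_eq_zero fun s hs => ?_
      simp [G, not_le.2 hs.1]
    rw [h2, add_zero] at h1
    rw [← h1]
    refine intervalIntegral.integral_congr fun s hs => ?_
    rw [uIcc_of_le hu.1] at hs
    simp [G, hs.2]
  rw [e1, e2]
  exact MeasureTheory.intervalIntegral_intervalIntegral_swap hG

section factor

variable {K : ℝ → ℝ → ℝ} {g : ℝ → ℝ → ℂ}

/-- The kernel of `(1 + K)(1 + g)`. -/
def factorKernel (K : ℝ → ℝ → ℝ) (g : ℝ → ℝ → ℂ) (s t : ℝ) : ℂ :=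
  g s t + ∫ u in (0)..s, (K s u : ℂ) * g u t

theorem continuous_factorKernel (hK : Continuous (Function.uncurry K))
    (hg : Continuous (Function.uncurry g)) : Continuous (Function.uncurry (factorKernel K g)) := by
  unfold factorKernel
  refine Continuous.add (by simpa [Function.uncurry_def] using hg) ?_
  refine intervalIntegral.continuous_parametric_intervalIntegral_of_continuous
    (f := fun (p : ℝ × ℝ) (u : ℝ) => (K p.1 u : ℂ) * g u p.2) ?_ continuous_fst
  exact (Complex.continuous_ofReal.comp (hK.comp
    (by fun_prop : Continuous fun z : (ℝ × ℝ) × ℝ => (z.1.1, z.2)))).mul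
    (hg.comp (by fun_prop : Continuous fun z : (ℝ × ℝ) × ℝ => (z.2, z.1.2)))

/-- Backward Volterra equations are solvable. -/
theorem exists_backward_volterra (hK : Continuous (Function.uncurry K)) {B : ℝ}
    (hB : ∀ x r, |K x r| ≤ B) {x : ℝ} {k : ℝ → ℂ} (hk : Continuous k) {C : ℝ}
    (hkC : ∀ t, ‖k t‖ ≤ C) :
    ∃ k' : ℝ → ℂ, Continuous k' ∧ ∀ t ≤ x, k t = k' t + ∫ s in t..x, k' s * (K s t : ℂ) := by
  -- The reflection `t ↦ x - t` turns the backward equation into a forward one.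
  obtain ⟨e, he, hes⟩ := exists_volterra_solution (Q := fun t s => -K (x - s) (x - t))
    ((hK.comp (by fun_prop : Continuous fun p : ℝ × ℝ => (x - p.2, x - p.1))).neg) (C := B)
    (fun t s => by rw [abs_neg]; exact hB _ _) (F := fun t => k (x - t)) (by fun_prop) (C₀ := C)
    (fun t => hkC _)
  refine ⟨fun t => e (x - t), by fun_prop, fun t ht => ?_⟩
  have h1 := hes (x - t) (by linarith)
  simp only [sub_sub_cancel] at h1
  show k t = e (x - t) + ∫ s in t..x, e (x - s) * (K s t : ℂ)
  rw [h1]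
  have h2 := intervalIntegral.integral_comp_sub_left (a := t) (b := x)
    (fun s => (-K (x - s) t) • e s) x
  rw [sub_self] at h2
  rw [← h2]
  have h3 : ∫ s in t..x, (-K (x - (x - s)) t) • e (x - s) =
      -∫ s in t..x, e (x - s) * (K s t : ℂ) := by
    rw [← intervalIntegral.integral_neg]
    refine intervalIntegral.integral_congr fun s _ => ?_
    simp only [sub_sub_cancel]
    rw [Complex.real_smul]
    push_cast
    ring
  rw [h3]
  ring

/-- Triangular factorisation of the Gelfand–Levitan operator. -/
theorem exists_triangular_factor (hK : Continuous (Function.uncurry K)) {B : ℝ}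
    (hB : ∀ x r, |K x r| ≤ B) (hg : Continuous (Function.uncurry g))
    {x : ℝ} (hGL : ∀ s ∈ Ioc 0 x, ∀ t ∈ Icc 0 s, factorKernel K g s t = -K s t)
    {k : ℝ → ℂ} (hk : Continuous k) {C : ℝ} (hkC : ∀ t, ‖k t‖ ≤ C) :
    ∃ k' : ℝ → ℂ, Continuous k' ∧ (∀ t ≤ x, k t = k' t + ∫ s in t..x, k' s * (K s t : ℂ)) ∧
      ∀ t ∈ Icc 0 x, k t + ∫ s in (0)..x, k s * g s t =
        k' t + ∫ s in (0)..t, k' s * factorKernel K g s t := by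
  obtain ⟨k', hk', hkk⟩ := exists_backward_volterra hK hB hk hkC (x := x)
  refine ⟨k', hk', hkk, fun t ht => ?_⟩
  have hx : 0 ≤ x := ht.1.trans ht.2
  have hgt : Continuous fun s => g s t := hg.comp (Continuous.prodMk_left t)
  have hKt : Continuous fun s => K s t := hK.comp (Continuous.prodMk_left t)
  have hE : Continuous fun s => factorKernel K g s t :=
    (continuous_factorKernel hK hg).comp (Continuous.prodMk_left t)
  have hF : Continuous (Function.uncurry fun u s => k' u * K u s * g s t) := by
    have h1 : Continuous fun p : ℝ × ℝ => K p.1 p.2 := hK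
    simp only [Function.uncurry_def]
    fun_prop
  have e1 : ∫ s in (0)..x, k s * g s t = (∫ s in (0)..x, k' s * g s t) +
      ∫ s in (0)..x, ∫ u in s..x, k' u * K u s * g s t := by
    have e0 : ∀ s ≤ x, ∫ u in s..x, k' u * K u s * g s t = k s * g s t - k' s * g s t :=
      fun s hs => by
        rw [intervalIntegral.integral_mul_const, hkk s hs]; ring
    rw [← sub_eq_iff_eq_add', ← intervalIntegral.integral_sub
      (Continuous.intervalIntegrable (by fun_prop) _ _)
      (Continuous.intervalIntegrable (by fun_prop) _ _)]
    refine intervalIntegral.integral_congr fun s hs => ?_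
    rw [uIcc_of_le hx] at hs
    exact (e0 s hs.2).symm
  rw [e1, integral_integral_triangle hF hx]
  have e2 : (∫ s in (0)..x, k' s * g s t) + ∫ u in (0)..x, ∫ s in (0)..u, k' u * K u s * g s t =
      ∫ s in (0)..x, k' s * factorKernel K g s t := by
    have e3 : ∀ u, ∫ s in (0)..u, k' u * K u s * g s t =
        k' u * factorKernel K g u t - k' u * g u t := fun u => by
      simp only [factorKernel, mul_assoc]
      rw [intervalIntegral.integral_const_mul]
      ring
    simp only [e3]
    rw [intervalIntegral.integral_sub (Continuous.intervalIntegrable (by fun_prop) _ _)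
      (Continuous.intervalIntegrable (by fun_prop) _ _)]
    ring
  -- For `s ≥ t` the Gelfand–Levitan equation makes the kernel of `(1 + K)(1 + g)` equal to `-K`,
  -- which cancels the backward integral defining `k` from `k'`. Only an integral over `[0, t]`
  -- survives.
  have e4 : ∫ s in t..x, k' s * factorKernel K g s t = -∫ s in t..x, k' s * (K s t : ℂ) := by
    rw [← intervalIntegral.integral_neg]
    refine intervalIntegral.integral_congr_ae (ae_of_all _ fun s hs => ?_)
    rw [uIoc_of_le ht.2] at hs
    rw [hGL s ⟨ht.1.trans_lt hs.1, hs.2⟩ t ⟨ht.1, hs.1.le⟩]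
    ring
  have e5 := intervalIntegral.integral_add_adjacent_intervals (a := 0) (b := t) (c := x)
    (μ := volume) (f := fun s => k' s * factorKernel K g s t)
    (Continuous.intervalIntegrable (by fun_prop) _ _) (Continuous.intervalIntegrable (by fun_prop) _ _)
  rw [e2, ← e5, e4, hkk t ht.2]
  ring

/-- Solutions of the Gelfand–Levitan equation are unique. -/
theorem eq_zero_of_gl_homogeneous (hK : Continuous (Function.uncurry K)) {B : ℝ}
    (hB : ∀ x r, |K x r| ≤ B) (hg : Continuous (Function.uncurry g))
    {x : ℝ} (hGL : ∀ s ∈ Ioc 0 x, ∀ t ∈ Icc 0 s, factorKernel K g s t = -K s t)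
    {k : ℝ → ℂ} (hk : Continuous k) {C : ℝ} (hkC : ∀ t, ‖k t‖ ≤ C)
    (h0 : ∀ t ∈ Icc 0 x, k t + ∫ s in (0)..x, k s * g s t = 0) : ∀ t ∈ Icc 0 x, k t = 0 := by
  obtain ⟨k', hk', hkk, hfac⟩ := exists_triangular_factor hK hB hg hGL hk hkC
  have hE := continuous_factorKernel hK hg
  obtain ⟨D, hD⟩ := (isCompact_Icc.prod isCompact_Icc).exists_bound_of_continuousOn
    (hE.continuousOn (s := Icc 0 x ×ˢ Icc 0 x))
  have hk0 : ∀ t ∈ Icc 0 x, k' t = 0 := by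
    intro t ht
    have hx : 0 ≤ x := ht.1.trans ht.2
    have hD0 : 0 ≤ D := (norm_nonneg _).trans (hD (0, 0) ⟨⟨le_rfl, hx⟩, ⟨le_rfl, hx⟩⟩)
    -- After the factorisation the homogeneous equation is a forward Volterra equation for `k'`.
    have := norm_le_exp_of_le_integral hk' hD0 le_rfl (X := x) (fun t ht => ?_) ht
    · rw [zero_mul] at this
      exact norm_le_zero_iff.1 this
    · have h1 := hfac t ht
      rw [h0 t ht] at h1
      rw [eq_neg_of_add_eq_zero_left h1.symm, norm_neg, zero_add,
        ← intervalIntegral.integral_const_mul]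
      have hEt : Continuous fun s => factorKernel K g s t := hE.comp (Continuous.prodMk_left t)
      refine intervalIntegral.norm_integral_le_of_norm_le ht.1 (ae_of_all _ fun s hs => ?_)
        (Continuous.intervalIntegrable (by fun_prop) _ _)
      rw [norm_mul, mul_comm]
      gcongr
      exact hD (s, t) ⟨⟨hs.1.le, hs.2.trans ht.2⟩, ht⟩
  intro t ht
  rw [hkk t ht.2, hk0 t ht, zero_add]
  refine intervalIntegral.integral_zero_ae (ae_of_all _ fun s hs => ?_)
  rw [uIoc_of_le ht.2] at hs
  rw [hk0 s ⟨ht.1.trans hs.1.le, hs.2⟩, zero_mul]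

end factor

/-- Each of the arguments `s + t`, `t - s` and `s - t` sweeps a part of `[0, 2x]` with unit speed;
the factor `3/2` is rounded up to `2`. -/
theorem integral_norm_glKernel_le {δ : ℝ → ℂ} (hδ : Continuous δ) {x t : ℝ} (ht : t ∈ Icc 0 x) :
    ∫ s in (0)..x, ‖glKernel δ s t‖ ≤ 2 * ∫ u in (0)..(2 * x), ‖δ u‖ := by
  have hx : 0 ≤ x := ht.1.trans ht.2
  have hmono : ∀ {c d : ℝ}, 0 ≤ c → c ≤ d → d ≤ 2 * x → ∫ u in c..d, ‖δ u‖ ≤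
      ∫ u in (0)..(2 * x), ‖δ u‖ := fun hc hcd hd =>
    intervalIntegral.integral_mono_interval hc hcd hd (ae_of_all _ fun _ => norm_nonneg _)
      (Continuous.intervalIntegrable (by fun_prop) _ _)
  have e1 : ∫ s in (0)..x, ‖δ (s + t)‖ ≤ ∫ u in (0)..(2 * x), ‖δ u‖ := by
    rw [intervalIntegral.integral_comp_add_right (fun u => ‖δ u‖)]
    exact hmono (by linarith [ht.1]) (by linarith) (by linarith [ht.2])
  have e2 : ∫ s in (0)..t, ‖δ |s - t|‖ ≤ ∫ u in (0)..(2 * x), ‖δ u‖ := by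
    have h1 : ∫ s in (0)..t, ‖δ |s - t|‖ = ∫ s in (0)..t, ‖δ (t - s)‖ := by
      refine intervalIntegral.integral_congr fun s hs => ?_
      rw [uIcc_of_le ht.1] at hs
      rw [abs_sub_comm, abs_of_nonneg (by linarith [hs.2])]
    rw [h1, intervalIntegral.integral_comp_sub_left (fun u => ‖δ u‖)]
    exact hmono (by linarith) (by linarith [ht.1]) (by linarith [ht.2])
  have e3 : ∫ s in t..x, ‖δ |s - t|‖ ≤ ∫ u in (0)..(2 * x), ‖δ u‖ := by
    have h1 : ∫ s in t..x, ‖δ |s - t|‖ = ∫ s in t..x, ‖δ (s - t)‖ := by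
      refine intervalIntegral.integral_congr fun s hs => ?_
      rw [uIcc_of_le ht.2] at hs
      rw [abs_of_nonneg (by linarith [hs.1])]
    rw [h1, intervalIntegral.integral_comp_sub_right (fun u => ‖δ u‖)]
    exact hmono (by linarith) (by linarith [ht.2]) (by linarith [ht.1])
  have e4 := intervalIntegral.integral_add_adjacent_intervals (a := 0) (b := t) (c := x)
    (μ := volume) (f := fun s => ‖δ |s - t|‖)
    (Continuous.intervalIntegrable (by fun_prop) _ _) (Continuous.intervalIntegrable (by fun_prop) _ _)
  have e5 : ∫ s in (0)..x, ‖glKernel δ s t‖ ≤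
      (∫ s in (0)..x, ‖δ (s + t)‖) / 2 + (∫ s in (0)..x, ‖δ |s - t|‖) / 2 := by
    rw [← intervalIntegral.integral_div, ← intervalIntegral.integral_div,
      ← intervalIntegral.integral_add (Continuous.intervalIntegrable (by fun_prop) _ _)
      (Continuous.intervalIntegrable (by fun_prop) _ _)]
    have hg : Continuous fun s => glKernel δ s t :=
      (continuous_glKernel hδ).comp (Continuous.prodMk_left t)
    refine intervalIntegral.integral_mono_on hx (Continuous.intervalIntegrable (by fun_prop) _ _)
      (Continuous.intervalIntegrable (by fun_prop) _ _) fun s _ => ?_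
    rw [glKernel, norm_div, Complex.norm_ofNat, ← add_div]
    gcongr
    exact norm_add_le _ _
  have e6 : 0 ≤ ∫ u in (0)..(2 * x), ‖δ u‖ :=
    intervalIntegral.integral_nonneg (by linarith) fun _ _ => norm_nonneg _
  linarith

theorem glKernel_sub (a A : ℝ → ℂ) (x y : ℝ) :
    glKernel (fun t => a t - A t) x y = glKernel a x y - glKernel A x y := by
  unfold glKernel
  ring

/-- The diagonal of the solution of the Gelfand–Levitan equation determines its kernel. -/
theorem eq_of_gl_diagonal_eq {K : ℝ → ℝ → ℝ} (hK : Continuous (Function.uncurry K)) {B : ℝ}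
    (hB : ∀ x r, |K x r| ≤ B) {a A : ℝ → ℂ} (ha : Continuous a) (hA : Continuous A)
    (hGL : ∀ s > 0, ∀ t ∈ Icc 0 s, factorKernel K (glKernel A) s t = -K s t)
    {L : ℝ → ℝ → ℂ} (hL : ContinuousOn (fun p : ℝ × ℝ => L p.1 p.2) {p | 0 ≤ p.2 ∧ p.2 ≤ p.1})
    (hGL' : ∀ x > 0, ∀ y ∈ Icc 0 x, glKernel a x y + L x y +
      ∫ s in (0)..x, L x s * glKernel a s y = 0)
    (hdiag : ∀ x > 0, L x x = K x x) {t : ℝ} (ht : 0 ≤ t) : a t = A t := by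
  let δ : ℝ → ℂ := fun t => a t - A t
  have hδ : Continuous δ := ha.sub hA
  have hgδ := continuous_glKernel hδ
  have hgA := continuous_glKernel hA
  have hga := continuous_glKernel ha
  have hE := continuous_factorKernel (g := glKernel A) hK hgA
  have hB0 : 0 ≤ B := (abs_nonneg _).trans (hB 0 0)
  -- Subtracting the two equations, `k = L(x,·) - K(x,·)` satisfies `k (1 + g_A) = -ρ` with `ρ`
  -- linear in `δ`. The factor `k'` then solves a Volterra equation with source `-ρ`, and equal
  -- diagonals mean `k'(x) = 0`. So `ρ(x)`, which contains `(δ(2x) + δ(0)) / 2`, is bounded by a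
  -- multiple of `∫ |δ|`.
  have main : ∀ X > 0, ∃ C ≥ 0, ∀ x ∈ Ioc 0 X, ‖δ (2 * x) + δ 0‖ ≤ C * ∫ u in (0)..(2 * x), ‖δ u‖ := by
    intro X hX
    obtain ⟨D, hD⟩ := (isCompact_Icc.prod isCompact_Icc).exists_bound_of_continuousOn
      (hE.continuousOn (s := Icc 0 X ×ˢ Icc 0 X))
    have hD0 : 0 ≤ D := (norm_nonneg _).trans (hD (0, 0) ⟨⟨le_rfl, hX.le⟩, ⟨le_rfl, hX.le⟩⟩)
    have hcpt : IsCompact {p : ℝ × ℝ | p ∈ Icc 0 X ×ˢ Icc 0 X ∧ 0 ≤ p.2 ∧ p.2 ≤ p.1} :=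
      (isCompact_Icc.prod isCompact_Icc).inter_right
        ((isClosed_le continuous_const continuous_snd).inter (isClosed_le continuous_snd continuous_fst))
    obtain ⟨C, hC⟩ := hcpt.exists_bound_of_continuousOn (hL.mono fun p hp => hp.2)
    have hC0 : 0 ≤ C := (norm_nonneg _).trans (hC (0, 0)
      ⟨⟨⟨le_rfl, hX.le⟩, ⟨le_rfl, hX.le⟩⟩, le_rfl, le_rfl⟩)
    refine ⟨2 * (D * ((2 + X * (C * 2)) * Real.exp (D * X)) + C * 2), by positivity,
      fun x hx => ?_⟩
    have hx0 : 0 ≤ x := hx.1.le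
    obtain ⟨Φ, hΦ⟩ : ∃ Φ, Φ = ∫ u in (0)..(2 * x), ‖δ u‖ := ⟨_, rfl⟩
    have hΦ0 : 0 ≤ Φ := hΦ ▸ intervalIntegral.integral_nonneg (by linarith) fun _ _ => norm_nonneg _
    have hLx : ContinuousOn (L x) (Icc 0 x) :=
      hL.comp (f := fun y => (x, y)) (by fun_prop) fun y hy => ⟨hy.1, hy.2⟩
    let c : ℝ → ℝ := fun t => max 0 (min t x)
    have hc : ∀ t, c t ∈ Icc 0 x := fun t => ⟨le_max_left _ _, max_le hx0 (min_le_right _ _)⟩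
    have hcc : Continuous c := by fun_prop
    have hct : ∀ t ∈ Icc 0 x, c t = t := fun t ht => by
      simp only [c]; rw [min_eq_left ht.2, max_eq_right ht.1]
    let l : ℝ → ℂ := fun t => L x (c t)
    have hl : Continuous l := hLx.comp_continuous hcc hc
    have hlC : ∀ t, ‖l t‖ ≤ C := fun t => hC (x, c t)
      ⟨⟨⟨hx0, hx.2⟩, ⟨(hc t).1, (hc t).2.trans hx.2⟩⟩, (hc t).1, (hc t).2⟩
    have hlL : ∀ t ∈ Icc 0 x, l t = L x t := fun t ht => by simp only [l]; rw [hct t ht]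
    have hKx : Continuous (K x) := hK.comp (Continuous.prodMk_right x)
    let k : ℝ → ℂ := fun t => l t - K x t
    have hk : Continuous k := by fun_prop
    obtain ⟨k', hk', hkk, hfac⟩ := exists_triangular_factor hK hB (g := glKernel A) hgA
      (x := x) (fun s hs => hGL s hs.1) hk (C := C + B) (fun t => (norm_sub_le _ _).trans
        (add_le_add (hlC t) (by rw [Complex.norm_real]; exact hB _ _)))
    let ρ : ℝ → ℂ := fun t => glKernel δ x t + ∫ s in (0)..x, l s * glKernel δ s t
    have hsec : ∀ {f : ℝ → ℂ}, Continuous f → ∀ t, Continuous fun s => glKernel f s t :=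
      fun hf t => (continuous_glKernel hf).comp (Continuous.prodMk_left t)
    have hρc : Continuous ρ := by
      refine (hgδ.comp (Continuous.prodMk_right x)).add ?_
      refine intervalIntegral.continuous_parametric_intervalIntegral_of_continuous'
        (f := fun t s => l s * glKernel δ s t) ?_ 0 x
      have : Continuous fun p : ℝ × ℝ => glKernel δ p.2 p.1 :=
        hgδ.comp (by fun_prop : Continuous fun p : ℝ × ℝ => (p.2, p.1))
      simp only [Function.uncurry_def]
      fun_prop
    have hkρ : ∀ t ∈ Icc 0 x, k t + ∫ s in (0)..x, k s * glKernel A s t = -ρ t := by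
      intro t ht
      have h1 := hGL' x hx.1 t ht
      have h2 := hGL x hx.1 t ht
      have h3 : ∫ s in (0)..x, L x s * glKernel a s t = ∫ s in (0)..x, l s * glKernel a s t := by
        refine intervalIntegral.integral_congr fun s hs => ?_
        rw [uIcc_of_le hx0] at hs
        rw [hlL s hs]
      have ca := hsec ha t
      have cA := hsec hA t
      have cδ := hsec hδ t
      have h4 : ∫ s in (0)..x, k s * glKernel A s t = (∫ s in (0)..x, l s * glKernel a s t) -
          (∫ s in (0)..x, l s * glKernel δ s t) - ∫ s in (0)..x, (K x s : ℂ) * glKernel A s t := by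
        rw [← intervalIntegral.integral_sub (Continuous.intervalIntegrable (by fun_prop) _ _)
          (Continuous.intervalIntegrable (by fun_prop) _ _),
          ← intervalIntegral.integral_sub (Continuous.intervalIntegrable (by fun_prop) _ _)
          (Continuous.intervalIntegrable (by fun_prop) _ _)]
        refine intervalIntegral.integral_congr fun s _ => ?_
        simp only [k, δ, glKernel_sub]
        ring
      rw [h4]
      rw [h3, ← hlL t ht] at h1
      simp only [factorKernel] at h2
      simp only [k, ρ, δ, glKernel_sub] at h4 ⊢
      linear_combination h1 - h2
    have hint : ∀ t ∈ Icc 0 x, ‖∫ s in (0)..x, l s * glKernel δ s t‖ ≤ C * (2 * Φ) := by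
      intro t ht
      have cδ := hsec hδ t
      have h1 : ‖∫ s in (0)..x, l s * glKernel δ s t‖ ≤ C * ∫ s in (0)..x, ‖glKernel δ s t‖ := by
        rw [← intervalIntegral.integral_const_mul]
        refine intervalIntegral.norm_integral_le_of_norm_le hx0 (ae_of_all _ fun s _ => ?_)
          (Continuous.intervalIntegrable (by fun_prop) _ _)
        rw [norm_mul]
        gcongr
        exact hlC s
      refine h1.trans (mul_le_mul_of_nonneg_left ?_ hC0)
      rw [hΦ]
      exact integral_norm_glKernel_le hδ ht
    have hρint : ∫ t in (0)..x, ‖ρ t‖ ≤ (2 + X * (C * 2)) * Φ := by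
      have cδ := hsec hδ x
      have h1 : ∫ t in (0)..x, ‖ρ t‖ ≤ ∫ t in (0)..x, (‖glKernel δ t x‖ + C * (2 * Φ)) := by
        refine intervalIntegral.integral_mono_on hx0 (Continuous.intervalIntegrable (by fun_prop) _ _)
          (Continuous.intervalIntegrable (by fun_prop) _ _) fun t ht => ?_
        rw [glKernel_comm δ t x]
        exact (norm_add_le _ _).trans (add_le_add le_rfl (hint t ht))
      rw [intervalIntegral.integral_add (Continuous.intervalIntegrable (by fun_prop) _ _)
        (Continuous.intervalIntegrable (by fun_prop) _ _), intervalIntegral.integral_const, sub_zero,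
        smul_eq_mul] at h1
      have h2 := integral_norm_glKernel_le hδ (x := x) (t := x) ⟨hx0, le_rfl⟩
      rw [← hΦ] at h2
      have h3 : x * (C * (2 * Φ)) ≤ X * (C * (2 * Φ)) :=
        mul_le_mul_of_nonneg_right hx.2 (by positivity)
      linarith
    have hDE : ∀ t ∈ Icc 0 x, ‖∫ s in (0)..t, k' s * factorKernel K (glKernel A) s t‖ ≤
        D * ∫ s in (0)..t, ‖k' s‖ := by
      intro t ht
      have hEt : Continuous fun s => factorKernel K (glKernel A) s t :=
        hE.comp (Continuous.prodMk_left t)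
      rw [← intervalIntegral.integral_const_mul]
      refine intervalIntegral.norm_integral_le_of_norm_le ht.1 (ae_of_all _ fun s hs => ?_)
        (Continuous.intervalIntegrable (by fun_prop) _ _)
      rw [norm_mul, mul_comm]
      gcongr
      exact hD (s, t) ⟨⟨hs.1.le, hs.2.trans (ht.2.trans hx.2)⟩, ht.1, ht.2.trans hx.2⟩
    have hk'b : ∀ t ∈ Icc 0 x, ‖k' t‖ ≤ ‖ρ t‖ + D * ∫ s in (0)..t, ‖k' s‖ := by
      intro t ht
      have h1 := hfac t ht
      rw [hkρ t ht] at h1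
      have h2 : k' t = -ρ t - ∫ s in (0)..t, k' s * factorKernel K (glKernel A) s t := by
        rw [h1]; ring
      rw [h2]
      refine (norm_sub_le _ _).trans ?_
      rw [norm_neg]
      exact add_le_add le_rfl (hDE t ht)
    let Y : ℝ → ℝ := fun t => ∫ s in (0)..t, ‖k' s‖
    have hYc : Continuous Y := intervalIntegral.continuous_primitive
      (fun c d => Continuous.intervalIntegrable (by fun_prop) c d) 0
    have hY0 : ∀ t ≥ 0, 0 ≤ Y t := fun t ht =>
      intervalIntegral.integral_nonneg ht fun _ _ => norm_nonneg _
    have hYn : ∀ t ≥ 0, ‖(Y t : ℂ)‖ = Y t := fun t ht => by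
      rw [Complex.norm_real, Real.norm_eq_abs, abs_of_nonneg (hY0 t ht)]
    have hYb : Y x ≤ (2 + X * (C * 2)) * Φ * Real.exp (D * x) := by
      have := norm_le_exp_of_le_integral (w := fun t => (Y t : ℂ)) (by fun_prop) hD0
        (η := (2 + X * (C * 2)) * Φ) (by positivity) (X := x) (fun t ht => ?_) ⟨hx0, le_rfl⟩
      · rwa [hYn x hx0] at this
      · have e1 : ∫ s in (0)..t, ‖(Y s : ℂ)‖ = ∫ s in (0)..t, Y s := by
          refine intervalIntegral.integral_congr fun s hs => ?_
          rw [uIcc_of_le ht.1] at hs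
          exact hYn s hs.1
        rw [e1, hYn t ht.1]
        have h1 : Y t ≤ ∫ s in (0)..t, (‖ρ s‖ + D * Y s) :=
          intervalIntegral.integral_mono_on ht.1 (Continuous.intervalIntegrable (by fun_prop) _ _)
            (Continuous.intervalIntegrable (by fun_prop) _ _) fun s hs =>
            hk'b s ⟨hs.1, hs.2.trans ht.2⟩
        rw [intervalIntegral.integral_add (Continuous.intervalIntegrable (by fun_prop) _ _)
          (Continuous.intervalIntegrable (by fun_prop) _ _), intervalIntegral.integral_const_mul] at h1
        have h2 : ∫ s in (0)..t, ‖ρ s‖ ≤ ∫ s in (0)..x, ‖ρ s‖ :=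
          intervalIntegral.integral_mono_interval le_rfl ht.1 ht.2
            (ae_of_all _ fun _ => norm_nonneg _) (Continuous.intervalIntegrable (by fun_prop) _ _)
        linarith
    have hxm : x ∈ Icc 0 x := ⟨hx0, le_rfl⟩
    -- At `t = x` the backward integral is empty, so `k'(x)` is the difference of the diagonals.
    have hk'x : k' x = 0 := by
      have h1 := hkk x le_rfl
      rw [intervalIntegral.integral_same, add_zero] at h1
      rw [← h1]
      simp only [k]
      rw [hlL x hxm, hdiag x hx.1, sub_self]
    have hρx : ‖ρ x‖ ≤ D * ((2 + X * (C * 2)) * Φ * Real.exp (D * X)) := by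
      have h1 := hfac x hxm
      rw [hkρ x hxm, hk'x, zero_add] at h1
      have h2 := hDE x hxm
      rw [← h1, norm_neg] at h2
      refine h2.trans (mul_le_mul_of_nonneg_left (hYb.trans ?_) hD0)
      gcongr
      exact hx.2
    have e1 : δ (2 * x) + δ 0 = 2 * (ρ x - ∫ s in (0)..x, l s * glKernel δ s x) := by
      simp only [ρ, glKernel, sub_self, abs_zero, add_sub_cancel_right]
      rw [← two_mul x]
      ring
    rw [e1, norm_mul, Complex.norm_ofNat, ← hΦ]
    have h3 := norm_sub_le (ρ x) (∫ s in (0)..x, l s * glKernel δ s x)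
    have h4 := hint x hxm
    nlinarith
  have hprim : Continuous fun t => ∫ u in (0)..t, ‖δ u‖ := intervalIntegral.continuous_primitive
    (fun c d => Continuous.intervalIntegrable (by fun_prop) c d) 0
  -- Letting `x → 0` in `main` gives `2 δ(0) = 0`; afterwards the estimate is a Gronwall inequality
  -- in `r = 2x`.
  have hδ0 : δ 0 = 0 := by
    obtain ⟨C, -, hC⟩ := main 1 one_pos
    have h1 : Tendsto (fun x => ‖δ (2 * x) + δ 0‖) (𝓝[>] 0) (𝓝 ‖δ (2 * 0) + δ 0‖) :=
      (Continuous.tendsto (by fun_prop) _).mono_left nhdsWithin_le_nhds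
    have h2 : Tendsto (fun x => C * ∫ u in (0)..(2 * x), ‖δ u‖) (𝓝[>] 0)
        (𝓝 (C * ∫ u in (0)..(2 * 0), ‖δ u‖)) :=
      (Continuous.tendsto (f := fun x : ℝ => C * ∫ u in (0)..(2 * x), ‖δ u‖)
        (continuous_const.mul (hprim.comp (by fun_prop : Continuous fun x : ℝ => 2 * x))) _).mono_left
        nhdsWithin_le_nhds
    have h3 := le_of_tendsto_of_tendsto h1 h2 (by
      filter_upwards [Ioc_mem_nhdsGT one_pos] with x hx using hC x hx)
    rw [mul_zero, intervalIntegral.integral_same, mul_zero] at h3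
    have h4 := norm_le_zero_iff.1 h3
    rw [← two_mul] at h4
    simpa using h4
  obtain ⟨C, hC0, hC⟩ := main (t + 1) (by linarith)
  have := norm_le_exp_of_le_integral hδ hC0 le_rfl (X := t) (fun r hr => ?_) ⟨ht, le_rfl⟩
  · rw [zero_mul] at this
    exact sub_eq_zero.1 (norm_le_zero_iff.1 this)
  · rcases hr.1.eq_or_lt with h0 | h0
    · rw [← h0, hδ0]; simp
    · have := hC (r / 2) ⟨by linarith, by linarith [hr.2]⟩
      rw [mul_div_cancel₀ r two_ne_zero, hδ0, add_zero] at this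
      linarith

end

/-! ### The cut plane, boundary values, and Jost data of a potential. -/

section

theorem isOpen_cutPlane : IsOpen cutPlane := by
  have : cutPlane = (fun z : ℂ => -z) ⁻¹' Complex.slitPlane := by
    ext z
    simp only [cutPlane, mem_ofPred_eq, mem_preimage, Complex.mem_slitPlane_iff, Complex.neg_re,
      Complex.neg_im, not_and_or, not_le, neg_pos, ne_eq, neg_eq_zero]
  rw [this]
  exact Complex.isOpen_slitPlane.preimage continuous_neg

theorem mem_cutPlane_of_im_ne_zero {z : ℂ} (hz : z.im ≠ 0) : z ∈ cutPlane := fun h => hz h.2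

theorem ofReal_mem_cutPlane {p : ℝ} (hp : p < 0) : (p : ℂ) ∈ cutPlane := fun h => by
  have := h.1
  rw [Complex.ofReal_re] at this
  linarith

theorem sq_mem_cutPlane {k : ℂ} (hk : 0 < k.im) : k ^ 2 ∈ cutPlane := by
  rintro ⟨h1, h2⟩
  simp only [pow_two, Complex.mul_re, Complex.mul_im] at h1 h2
  have h3 : k.re = 0 := by
    have : k.re * k.im = 0 := by linarith
    exact (mul_eq_zero.1 this).resolve_right hk.ne'
  rw [h3] at h1
  nlinarith

theorem physRoot_of_sq_eq {k z : ℂ} (hk : 0 < k.im) (hz : k ^ 2 = z) : physRoot z = k := by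
  have h1 := physRoot_im_pos (hz ▸ sq_mem_cutPlane hk)
  have h2 := physRoot_sq z
  rw [← hz] at h1 h2 ⊢
  rcases sq_eq_sq_iff_eq_or_eq_neg.1 h2 with h | h
  · exact h
  · rw [h, Complex.neg_im] at h1
    linarith

theorem physRoot_sq_of_im_pos {k : ℂ} (hk : 0 < k.im) : physRoot (k ^ 2) = k :=
  physRoot_of_sq_eq hk rfl

theorem physRoot_ofReal_neg {p : ℝ} (hp : p < 0) : physRoot p = Complex.I * (√(-p) : ℝ) := by
  refine physRoot_of_sq_eq (by simpa using Real.sqrt_pos.2 (neg_pos.2 hp)) ?_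
  rw [mul_pow, Complex.I_sq, ← Complex.ofReal_pow, Real.sq_sqrt (by linarith)]
  push_cast
  ring

theorem differentiableAt_physRoot {z : ℂ} (hz : z ∈ cutPlane) : DifferentiableAt ℂ physRoot z := by
  have h0 : -z ∈ Complex.slitPlane := by
    rw [Complex.mem_slitPlane_iff]
    simp only [cutPlane, mem_ofPred_eq, not_and_or, not_le] at hz
    rcases hz with hz | hz
    · left; simpa using hz
    · right; simpa using hz
  unfold physRoot
  exact ((differentiableAt_id.neg).cpow_const h0).const_mul _

theorem ofReal_ne_of_im_ne_zero {z : ℂ} (hz : z.im ≠ 0) (p : ℝ) : z ≠ p := fun h => hz (by simp [h])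

theorem tendsto_cpow_half {l : ℝ} (hl : 0 < l) :
    Tendsto (fun z : ℂ => z ^ (1 / 2 : ℂ)) (𝓝 (l : ℂ)) (𝓝 ((√l : ℝ) : ℂ)) := by
  have h1 : ((l : ℂ)) ^ (1 / 2 : ℂ) = ((√l : ℝ) : ℂ) := by
    rw [Real.sqrt_eq_rpow, Complex.ofReal_cpow hl.le]
    norm_num
  rw [← h1]
  exact (continuousAt_id.cpow continuousAt_const (Complex.ofReal_mem_slitPlane.2 hl)).tendsto

theorem cpow_half_sq (z : ℂ) : (z ^ (1 / 2 : ℂ)) ^ 2 = z := by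
  rw [← Complex.cpow_nat_mul]
  norm_num

theorem physRoot_re_mul_im (z : ℂ) : 2 * ((physRoot z).re * (physRoot z).im) = z.im := by
  have := congrArg Complex.im (physRoot_sq z)
  rw [pow_two, Complex.mul_im] at this
  linarith

/-- Near `l` the principal root has positive real part, and `2 Re · Im = Im z` shows that for `Im z
> 0` it is the root with positive imaginary part. -/
theorem tendsto_physRoot_upper {l : ℝ} (hl : 0 < l) :
    Tendsto physRoot (𝓝[{z : ℂ | 0 < z.im}] (l : ℂ)) (𝓝 ((√l : ℝ) : ℂ)) := by
  have h1 := (tendsto_cpow_half hl).mono_left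
    (nhdsWithin_le_nhds (s := {z : ℂ | 0 < z.im}))
  refine h1.congr' ?_
  have h2 : ∀ᶠ z in 𝓝[{z : ℂ | 0 < z.im}] (l : ℂ), 0 < (z ^ (1 / 2 : ℂ)).re :=
    ((Complex.continuous_re.tendsto _).comp h1).eventually_const_lt (by simpa using hl)
  filter_upwards [h2, self_mem_nhdsWithin] with z hz hz'
  replace hz' : 0 < z.im := hz'
  have h3 := physRoot_im_pos (mem_cutPlane_of_im_ne_zero (ne_of_gt hz'))
  have h4 := physRoot_re_mul_im z
  rcases sq_eq_sq_iff_eq_or_eq_neg.1 ((physRoot_sq z).trans (cpow_half_sq z).symm) with h | h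
  · exact h.symm
  · rw [← h4] at hz'
    have h5 : (physRoot z).re < 0 := by rw [h, Complex.neg_re]; linarith
    nlinarith

/-- For `Im z < 0` the sign rule selects the negative of the principal root, hence the limit `-√l`.
-/
theorem tendsto_physRoot_lower {l : ℝ} (hl : 0 < l) :
    Tendsto physRoot (𝓝[{z : ℂ | z.im < 0}] (l : ℂ)) (𝓝 (-((√l : ℝ) : ℂ))) := by
  have h1 := (tendsto_cpow_half hl).mono_left
    (nhdsWithin_le_nhds (s := {z : ℂ | z.im < 0}))
  refine h1.neg.congr' ?_
  have h2 : ∀ᶠ z in 𝓝[{z : ℂ | z.im < 0}] (l : ℂ), 0 < (z ^ (1 / 2 : ℂ)).re :=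
    ((Complex.continuous_re.tendsto _).comp h1).eventually_const_lt (by simpa using hl)
  filter_upwards [h2, self_mem_nhdsWithin] with z hz hz'
  replace hz' : z.im < 0 := hz'
  have h3 := physRoot_im_pos (mem_cutPlane_of_im_ne_zero (ne_of_lt hz'))
  have h4 := physRoot_re_mul_im z
  rcases sq_eq_sq_iff_eq_or_eq_neg.1 ((physRoot_sq z).trans (cpow_half_sq z).symm) with h | h
  · rw [← h4] at hz'
    rw [← h] at hz
    nlinarith
  · exact h.symm

/-- The closed upper half-plane without the origin and without square roots of points of `P`. -/
def kDomain (P : Finset ℝ) : Set ℂ := {k | 0 ≤ k.im ∧ k ≠ 0 ∧ ∀ p ∈ P, k ^ 2 ≠ (p : ℂ)}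

theorem physRoot_mem_kDomain (P : Finset ℝ) {z : ℂ} (hz : z.im ≠ 0) : physRoot z ∈ kDomain P := by
  have h := physRoot_im_pos (mem_cutPlane_of_im_ne_zero hz)
  refine ⟨h.le, fun h0 => by rw [h0] at h; simp at h, fun p _ => ?_⟩
  rw [physRoot_sq]
  exact ofReal_ne_of_im_ne_zero hz p

theorem ofReal_mem_kDomain {P : Finset ℝ} (hP : ∀ p ∈ P, p < 0) {s : ℝ} (hs : s ≠ 0) :
    (s : ℂ) ∈ kDomain P := by
  refine ⟨by simp, by exact_mod_cast hs, fun p hp h => ?_⟩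
  have h1 : s ^ 2 = p := by exact_mod_cast h
  nlinarith [hP p hp, sq_nonneg s]

theorem neBot_upper (l : ℝ) : (𝓝[{z : ℂ | 0 < z.im}] (l : ℂ)).NeBot := by
  rw [← mem_closure_iff_nhdsWithin_neBot, Complex.closure_setOfPred_lt_im]
  simp

theorem neBot_lower (l : ℝ) : (𝓝[{z : ℂ | z.im < 0}] (l : ℂ)).NeBot := by
  rw [← mem_closure_iff_nhdsWithin_neBot, Complex.closure_setOfPred_im_lt]
  simp

section boundary

variable {M m : ℂ → ℂ} {P : Finset ℝ}

theorem upperValue_eq (hP : ∀ p ∈ P, p < 0) (hm : ContinuousOn m (kDomain P))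
    (hmM : ∀ k : ℂ, 0 < k.im → m k = M (k ^ 2)) {l : ℝ} (hl : 0 < l) :
    upperValue M l = m ((√l : ℝ) : ℂ) := by
  have := neBot_upper l
  refine Tendsto.limUnder_eq ?_
  have h1 : Tendsto physRoot (𝓝[{z : ℂ | 0 < z.im}] (l : ℂ)) (𝓝[kDomain P] ((√l : ℝ) : ℂ)) :=
    tendsto_nhdsWithin_of_tendsto_nhds_of_eventually_within _ (tendsto_physRoot_upper hl)
      (eventually_nhdsWithin_of_forall fun z hz => physRoot_mem_kDomain P (ne_of_gt hz))
  have h2 := (hm _ (ofReal_mem_kDomain hP (Real.sqrt_pos.2 hl).ne')).tendsto.comp h1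
  refine h2.congr' (eventually_nhdsWithin_of_forall fun z hz => ?_)
  simp only [Function.comp]
  rw [hmM _ (physRoot_im_pos (mem_cutPlane_of_im_ne_zero (ne_of_gt hz))), physRoot_sq]

theorem lowerValue_eq (hP : ∀ p ∈ P, p < 0) (hm : ContinuousOn m (kDomain P))
    (hmM : ∀ k : ℂ, 0 < k.im → m k = M (k ^ 2)) {l : ℝ} (hl : 0 < l) :
    lowerValue M l = m ((-√l : ℝ) : ℂ) := by
  have := neBot_lower l
  refine Tendsto.limUnder_eq ?_
  have h0 := tendsto_physRoot_lower hl
  rw [← Complex.ofReal_neg] at h0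
  have h1 : Tendsto physRoot (𝓝[{z : ℂ | z.im < 0}] (l : ℂ)) (𝓝[kDomain P] ((-√l : ℝ) : ℂ)) :=
    tendsto_nhdsWithin_of_tendsto_nhds_of_eventually_within _ h0
      (eventually_nhdsWithin_of_forall fun z hz => physRoot_mem_kDomain P (ne_of_lt hz))
  have h2 := (hm _ (ofReal_mem_kDomain hP (neg_ne_zero.2 (Real.sqrt_pos.2 hl).ne'))).tendsto.comp h1
  refine h2.congr' (eventually_nhdsWithin_of_forall fun z hz => ?_)
  simp only [Function.comp]
  rw [hmM _ (physRoot_im_pos (mem_cutPlane_of_im_ne_zero (ne_of_lt hz))), physRoot_sq]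

/-- The two sides of the cut are the two halves of the real `k`-axis, so the case distinction
disappears in terms of `m`. -/
theorem jFun_eq (hP : ∀ p ∈ P, p < 0) (hm : ContinuousOn m (kDomain P))
    (hmM : ∀ k : ℂ, 0 < k.im → m k = M (k ^ 2)) {s : ℝ} (hs : s ≠ 0) :
    jFun M s = m s - 1 / (Complex.I * s) := by
  have hs2 : 0 < s ^ 2 := by positivity
  unfold jFun
  split_ifs with h
  · rw [upperValue_eq hP hm hmM hs2, Real.sqrt_sq h.le]
  · rw [lowerValue_eq hP hm hmM hs2, Real.sqrt_sq_eq_abs, abs_of_nonpos (not_lt.1 h), neg_neg]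

end boundary

section potential

variable {xI : ℝ} {V : ℝ → ℝ}

/-- The extension of a potential to the line which is constant on the negative half-line. -/
def extendPot (V : ℝ → ℝ) (t : ℝ) : ℝ := V (max t 0)

theorem extendPot_of_nonneg (V : ℝ → ℝ) {t : ℝ} (ht : 0 ≤ t) : extendPot V t = V t := by
  rw [extendPot, max_eq_left ht]

theorem continuous_extendPot (hV : ∀ b > 0, AbsolutelyContinuousOnInterval V 0 b) :
    Continuous (extendPot V) := by
  have h : ContinuousOn V (Ici 0) := by
    intro x hx
    have h1 := (hV (x + 1) (by linarith [mem_Ici.1 hx])).continuousOn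
    rw [uIcc_of_le (by linarith [mem_Ici.1 hx])] at h1
    have h2 := h1 x ⟨hx, by linarith⟩
    refine h2.mono_of_mem_nhdsWithin ?_
    exact mem_nhdsWithin.2 ⟨Iio (x + 1), isOpen_Iio, by simp, fun y hy => ⟨hy.2, hy.1.le⟩⟩
  exact h.comp_continuous (by fun_prop) fun t => mem_Ici.2 (le_max_right _ _)

theorem eq_zero_of_tsupport_subset (hV : tsupport V ⊆ Icc 0 xI) {t : ℝ} (ht : t ∉ Icc 0 xI) :
    V t = 0 := by
  by_contra h
  exact ht (hV (subset_tsupport V h))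

theorem extendPot_eq_zero (hxI : 0 < xI) (hV : ∀ b > 0, AbsolutelyContinuousOnInterval V 0 b)
    (hs : tsupport V ⊆ Icc 0 xI) : ∀ t ≥ xI, extendPot V t = 0 := by
  have hc := continuous_extendPot hV
  have h1 : ∀ t ∈ Ioi xI, extendPot V t = 0 := fun t ht => by
    rw [extendPot_of_nonneg V (hxI.le.trans (le_of_lt ht))]
    exact eq_zero_of_tsupport_subset hs fun h => absurd h.2 (not_le.2 ht)
  have h2 : EqOn (extendPot V) (fun _ => 0) (closure (Ioi xI)) :=
    EqOn.closure h1 hc continuous_const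
  rw [closure_Ioi] at h2
  exact fun t ht => h2 ht

/-- `jost` is a chosen solution, so uniqueness has to identify it. The Cauchy data are compared at
`xI + 1`, where the difference vanishes in a neighbourhood and therefore has zero derivative. -/
theorem jost_eq (hxI : 0 < xI) (hV : ∀ b > 0, AbsolutelyContinuousOnInterval V 0 b)
    (hs : tsupport V ⊆ Icc 0 xI) {f f' : ℂ → ℝ → ℂ} (hJ : IsJostFamily (extendPot V) xI f f')
    (k : ℂ) : (jost xI V k).1 0 = f k 0 ∧ (jost xI V k).2 0 = f' k 0 := by
  have hq := continuous_extendPot hV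
  have hq0 := extendPot_eq_zero hxI hV hs
  have hex : ∃ p, IsJostSolution xI V k p :=
    ⟨(f k, f' k), (hJ.sol k).deriv_fst, fun x hx => by
      have := (hJ.sol k).deriv_snd x hx
      rwa [extendPot_of_nonneg V hx] at this, fun x hx => hJ.eq_exp k x (le_of_lt hx)⟩
  have hjost : IsJostSolution xI V k (jost xI V k) := by
    rw [jost, dif_pos hex]
    exact hex.choose_spec
  obtain ⟨h1, h2, h3⟩ := hjost
  have hsol : IsSol (extendPot V) k (jost xI V k).1 (jost xI V k).2 :=
    ⟨h1, fun x hx => by rw [extendPot_of_nonneg V hx]; exact h2 x hx⟩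
  have hd := hsol.sub (hJ.sol k)
  have hx0 : (0 : ℝ) ≤ xI + 1 := by linarith
  have e1 : ∀ x > xI, (jost xI V k).1 x - f k x = 0 := fun x hx => by
    rw [h3 x hx, hJ.eq_exp k x (le_of_lt hx), sub_self]
  have e2 : (jost xI V k).2 (xI + 1) - f' k (xI + 1) = 0 := by
    have d1 := (hd.deriv_fst (xI + 1) hx0).hasDerivAt (Ici_mem_nhds (by linarith))
    have d2 : HasDerivAt (fun x => (jost xI V k).1 x - f k x) 0 (xI + 1) := by
      refine (hasDerivAt_const (xI + 1) (0 : ℂ)).congr_of_eventuallyEq ?_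
      filter_upwards [Ioi_mem_nhds (show xI < xI + 1 by linarith)] with x hx using e1 x hx
    exact d1.unique d2
  have := hd.eq_zero hxI hq hq0 hx0 (e1 _ (by linarith)) e2 (x := 0) le_rfl
  exact ⟨sub_eq_zero.1 this.1, sub_eq_zero.1 this.2⟩

end potential

end

/-! ### Analytic properties of the Weyl function of a potential. -/

section

section weyl

variable {h xI : ℝ} {V : ℝ → ℝ} {f f' : ℂ → ℝ → ℂ}

theorem weylFunction_eq (hxI : 0 < xI) (hV : ∀ b > 0, AbsolutelyContinuousOnInterval V 0 b)
    (hs : tsupport V ⊆ Icc 0 xI) (hJ : IsJostFamily (extendPot V) xI f f') {z : ℂ}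
    (hz : z ∈ cutPlane) : weylFunction h xI V z =
      f (physRoot z) 0 / (h * f (physRoot z) 0 + f' (physRoot z) 0) := by
  obtain ⟨h1, h2⟩ := jost_eq hxI hV hs hJ (physRoot z)
  rw [weylFunction, indicator_of_mem hz, jostFunction, h1, h2, mul_comm (f (physRoot z) 0)]

/-- The squares of the zeros of the Jost function in the upper half-plane. -/
theorem exists_poles (hxI : 0 < xI) (hV : ∀ b > 0, AbsolutelyContinuousOnInterval V 0 b)
    (hs : tsupport V ⊆ Icc 0 xI) (hJ : IsJostFamily (extendPot V) xI f f')
    (hfin : {k : ℂ | 0 ≤ k.im ∧ h * f k 0 + f' k 0 = 0}.Finite) :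
    ∃ P : Finset ℝ, (∀ p ∈ P, p < 0) ∧
      ∀ k : ℂ, 0 < k.im → (h * f k 0 + f' k 0 = 0 ↔ ∃ p ∈ P, k ^ 2 = (p : ℂ)) := by
  have hq := continuous_extendPot hV
  have hq0 := extendPot_eq_zero hxI hV hs
  let S : Set ℝ := {p | p < 0 ∧ h * f (Complex.I * (√(-p) : ℝ)) 0 + f' (Complex.I * (√(-p) : ℝ)) 0 = 0}
  have hS : S.Finite := by
    refine Set.Finite.of_finite_image (f := fun p : ℝ => Complex.I * ((√(-p) : ℝ) : ℂ))
      (hfin.subset ?_) ?_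
    · rintro _ ⟨p, hp, rfl⟩
      exact ⟨by simp, hp.2⟩
    · intro p hp r hr hpr
      have h1 : (√(-p) : ℝ) = √(-r) := by
        exact_mod_cast mul_left_cancel₀ Complex.I_ne_zero hpr
      have h2 := (Real.sqrt_inj (by linarith [hp.1]) (by linarith [hr.1])).1 h1
      linarith
  refine ⟨hS.toFinset, fun p hp => ((hS.mem_toFinset).1 hp).1, fun k hk => ⟨fun hF => ?_, ?_⟩⟩
  · have hre := hJ.re_eq_zero_of_jost_eq_zero hxI hq hq0 h hk hF
    have hke : k = Complex.I * (k.im : ℝ) := by apply Complex.ext <;> simp [hre]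
    have hsq : √(-(-(k.im ^ 2))) = k.im := by rw [neg_neg, Real.sqrt_sq hk.le]
    refine ⟨-(k.im ^ 2), (hS.mem_toFinset).2 ⟨by simpa using pow_pos hk 2, ?_⟩, ?_⟩
    · rw [hsq, ← hke]; exact hF
    · conv_lhs => rw [hke]
      rw [mul_pow, Complex.I_sq]; push_cast; ring
  · rintro ⟨p, hp, hkp⟩
    obtain ⟨hp0, hF⟩ := (hS.mem_toFinset).1 hp
    rw [← physRoot_ofReal_neg hp0, physRoot_of_sq_eq hk hkp] at hF
    exact hF

theorem exists_family (hxI : 0 < xI) (hV : ∀ b > 0, AbsolutelyContinuousOnInterval V 0 b)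
    (hs : tsupport V ⊆ Icc 0 xI) (h : ℝ) : ∃ f f', IsJostFamily (extendPot V) xI f f' ∧
    ∃ C R₀ : ℝ, 0 < C ∧ 0 < R₀ ∧ ∀ k : ℂ, 0 ≤ k.im → R₀ ≤ ‖k‖ →
      h * f k 0 + f' k 0 ≠ 0 ∧ ‖f k 0 / (h * f k 0 + f' k 0) - (1 / (Complex.I * k) + h / k ^ 2)‖ ≤
        C / ‖k‖ ^ 3 ∧ ‖k‖ / 4 ≤ ‖h * f k 0 + f' k 0‖ := by
  have hq := continuous_extendPot hV
  obtain ⟨f, f', hJ⟩ := exists_isJostFamily hxI hq (extendPot_eq_zero hxI hV hs)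
  refine ⟨f, f', hJ, hJ.asymptotics hxI hq h ?_⟩
  obtain ⟨D, hD⟩ := norm_integral_exp_mul_le_of_absolutelyContinuous hxI.le (hV xI hxI)
  refine ⟨D, fun c hc hc0 => ?_⟩
  have : ∫ t in (0)..xI, Complex.exp (c * t) * extendPot V t =
      ∫ t in (0)..xI, Complex.exp (c * t) * V t := by
    refine intervalIntegral.integral_congr fun t ht => ?_
    rw [uIcc_of_le hxI.le] at ht
    simp only [extendPot_of_nonneg V ht.1]
  rw [this]
  exact hD c hc hc0

/-- On the real axis the Wronskian excludes zeros of the denominator; above it the zeros are exactly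
the square roots of points of `P`. -/
theorem continuousOn_jostRatio (hxI : 0 < xI) (hV : ∀ b > 0, AbsolutelyContinuousOnInterval V 0 b)
    (hs : tsupport V ⊆ Icc 0 xI) (hJ : IsJostFamily (extendPot V) xI f f') {P : Finset ℝ}
    (hP : ∀ k : ℂ, 0 < k.im → (h * f k 0 + f' k 0 = 0 ↔ ∃ p ∈ P, k ^ 2 = (p : ℂ))) :
    ContinuousOn (fun k => f k 0 / (h * f k 0 + f' k 0)) (kDomain P) := by
  have hq := continuous_extendPot hV
  have hq0 := extendPot_eq_zero hxI hV hs
  have h1 := hJ.diff.continuous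
  have h2 := hJ.diff'.continuous
  refine ContinuousOn.div h1.continuousOn (Continuous.continuousOn (by fun_prop)) ?_
  rintro k ⟨hk1, hk2, hk3⟩
  rcases hk1.eq_or_lt with hk | hk
  · have hke : k = (k.re : ℂ) := by apply Complex.ext <;> simp [← hk]
    rw [hke] at hk2 ⊢
    exact hJ.jost_ne_zero_of_real hxI hq hq0 h (by exact_mod_cast hk2)
  · rw [Ne, hP k hk]
    rintro ⟨p, hp, hkp⟩
    exact hk3 p hp hkp

/-- The limit of `(k² - k₀²) M(k²)` at `k₀` becomes the residue in `λ` by composition with the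
analytic, injective `physRoot`. -/
theorem exists_hasPoles (hxI : 0 < xI) (hV : ∀ b > 0, AbsolutelyContinuousOnInterval V 0 b)
    (hs : tsupport V ⊆ Icc 0 xI) (hJ : IsJostFamily (extendPot V) xI f f') {P : Finset ℝ}
    (hP0 : ∀ p ∈ P, p < 0)
    (hP : ∀ k : ℂ, 0 < k.im → (h * f k 0 + f' k 0 = 0 ↔ ∃ p ∈ P, k ^ 2 = (p : ℂ))) :
    (∀ p ∈ P, weylFunction h xI V p = 0) ∧ ∃ α, HasPoles (weylFunction h xI V) P α := by
  have hq := continuous_extendPot hV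
  have hq0 := extendPot_eq_zero hxI hV hs
  have hroot : ∀ p ∈ P, 0 < (physRoot p).im ∧
      h * f (physRoot p) 0 + f' (physRoot p) 0 = 0 := fun p hp => by
    have h1 := physRoot_im_pos (ofReal_mem_cutPlane (hP0 p hp))
    exact ⟨h1, (hP _ h1).2 ⟨p, hp, physRoot_sq _⟩⟩
  have hα : ∀ p : ℝ, ∃ α : ℝ, p ∈ P → 0 < α ∧ Tendsto (fun k => (k ^ 2 - physRoot p ^ 2) *
      (f k 0 / (h * f k 0 + f' k 0))) (𝓝[≠] physRoot p) (𝓝 (α : ℂ)) := by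
    intro p
    by_cases hp : p ∈ P
    · obtain ⟨α, hα⟩ := hJ.tendsto_residue hxI hq hq0 h (hroot p hp).1 (hroot p hp).2
      exact ⟨α, fun _ => hα⟩
    · exact ⟨0, fun h => absurd h hp⟩
  choose α hα using hα
  refine ⟨fun p hp => ?_, α, ?_, fun p hp => ⟨hP0 p hp, (hα p hp).1, ?_⟩⟩
  · rw [weylFunction_eq hxI hV hs hJ (ofReal_mem_cutPlane (hP0 p hp)), (hroot p hp).2, div_zero]
  · have hopen : IsOpen (cutPlane \ ((↑) '' (P : Set ℝ) : Set ℂ)) :=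
      isOpen_cutPlane.sdiff ((P.finite_toSet.image _).isClosed)
    refine DifferentiableOn.analyticOnNhd (fun z hz => ?_) hopen
    have hd := differentiableAt_physRoot hz.1
    have hF : h * f (physRoot z) 0 + f' (physRoot z) 0 ≠ 0 := by
      rw [Ne, hP _ (physRoot_im_pos hz.1), physRoot_sq]
      rintro ⟨p, hp, hzp⟩
      exact hz.2 ⟨p, hp, hzp.symm⟩
    have h1 : DifferentiableAt ℂ (fun z => f (physRoot z) 0) z :=
      DifferentiableAt.comp z (hJ.diff _) hd
    have h2 : DifferentiableAt ℂ (fun z => f' (physRoot z) 0) z :=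
      DifferentiableAt.comp z (hJ.diff' _) hd
    have h3 : DifferentiableAt ℂ (weylFunction h xI V) z := by
      refine (h1.div ((h1.const_mul (h : ℂ)).add h2) hF).congr_of_eventuallyEq ?_
      filter_upwards [isOpen_cutPlane.mem_nhds hz.1] with w hw
      exact weylFunction_eq hxI hV hs hJ hw
    exact h3.differentiableWithinAt
  · have hcut := ofReal_mem_cutPlane (hP0 p hp)
    have h1 : Tendsto physRoot (𝓝[≠] (p : ℂ)) (𝓝[≠] physRoot p) := by
      refine tendsto_nhdsWithin_of_tendsto_nhds_of_eventually_within _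
        ((differentiableAt_physRoot hcut).continuousAt.tendsto.mono_left nhdsWithin_le_nhds)
        (eventually_nhdsWithin_of_forall fun z hz heq => hz ?_)
      rw [mem_singleton_iff] at heq ⊢
      rw [← physRoot_sq z, heq, physRoot_sq]
    refine ((hα p hp).2.comp h1).congr' ?_
    filter_upwards [mem_nhdsWithin_of_mem_nhds (isOpen_cutPlane.mem_nhds hcut)] with z hz
    simp only [Function.comp]
    rw [weylFunction_eq hxI hV hs hJ hz, physRoot_sq, physRoot_sq]

theorem weylFunction_sq (hxI : 0 < xI) (hV : ∀ b > 0, AbsolutelyContinuousOnInterval V 0 b)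
    (hs : tsupport V ⊆ Icc 0 xI) (hJ : IsJostFamily (extendPot V) xI f f') {k : ℂ}
    (hk : 0 < k.im) : f k 0 / (h * f k 0 + f' k 0) = weylFunction h xI V (k ^ 2) := by
  rw [weylFunction_eq hxI hV hs hJ (sq_mem_cutPlane hk), physRoot_sq_of_im_pos hk]

theorem hasBoundaryValues_weylFunction (hxI : 0 < xI)
    (hV : ∀ b > 0, AbsolutelyContinuousOnInterval V 0 b)
    (hs : tsupport V ⊆ Icc 0 xI) (hJ : IsJostFamily (extendPot V) xI f f') {P : Finset ℝ}
    (hP : ∀ k : ℂ, 0 < k.im → (h * f k 0 + f' k 0 = 0 ↔ ∃ p ∈ P, k ^ 2 = (p : ℂ))) :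
    HasBoundaryValues (weylFunction h xI V) P := by
  refine ⟨⟨_, continuousOn_jostRatio hxI hV hs hJ hP, fun k hk => weylFunction_sq hxI hV hs hJ hk⟩, ?_⟩
  have h1 := (hJ.isBigO_zero hxI (continuous_extendPot hV) (extendPot_eq_zero hxI hV hs) h).mono
    (nhdsWithin_mono (0 : ℂ) (s := {k : ℂ | 0 < k.im}) fun k hk h0 => by
      rw [mem_singleton_iff] at h0
      rw [h0] at hk
      simp at hk)
  refine h1.congr' (eventually_nhdsWithin_of_forall fun k hk => ?_) EventuallyEq.rfl
  show k * _ = k * _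
  rw [← weylFunction_sq hxI hV hs hJ hk]

/-- At real `k` the two boundary values are complex conjugates, so the Wronskian evaluates the jump
as `k / (π |f_h(k)|²)`. -/
theorem jump_weylFunction_pos (hxI : 0 < xI) (hV : ∀ b > 0, AbsolutelyContinuousOnInterval V 0 b)
    (hs : tsupport V ⊆ Icc 0 xI) (hJ : IsJostFamily (extendPot V) xI f f') {P : Finset ℝ}
    (hP0 : ∀ p ∈ P, p < 0)
    (hP : ∀ k : ℂ, 0 < k.im → (h * f k 0 + f' k 0 = 0 ↔ ∃ p ∈ P, k ^ 2 = (p : ℂ)))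
    {l : ℝ} (hl : 0 < l) : ∃ t : ℝ, 0 < t ∧ jump (weylFunction h xI V) l = t := by
  have hq := continuous_extendPot hV
  have hq0 := extendPot_eq_zero hxI hV hs
  have hc := continuousOn_jostRatio hxI hV hs hJ hP
  have hmM : ∀ k : ℂ, 0 < k.im → f k 0 / (h * f k 0 + f' k 0) = weylFunction h xI V (k ^ 2) :=
    fun k hk => weylFunction_sq hxI hV hs hJ hk
  have hsl : 0 < √l := Real.sqrt_pos.2 hl
  obtain ⟨s, hs'⟩ : ∃ s, s = √l := ⟨_, rfl⟩
  have h1 := upperValue_eq hP0 hc hmM hl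
  have h2 := lowerValue_eq hP0 hc hmM hl
  rw [← hs'] at h1 h2 hsl
  have hF := hJ.jost_ne_zero_of_real hxI hq hq0 h hsl.ne'
  have him := hJ.im_real hxI hq hq0 h s
  obtain ⟨c0, c1⟩ := hJ.conj_eq hxI hq hq0 s le_rfl
  rw [Complex.conj_ofReal] at c0 c1
  rw [Complex.ofReal_neg, ← c0, ← c1] at h2
  obtain ⟨F, hFe⟩ : ∃ F, F = h * f s 0 + f' s 0 := ⟨_, rfl⟩
  have hconj : h * (starRingEnd ℂ) (f s 0) + (starRingEnd ℂ) (f' s 0) = (starRingEnd ℂ) F := by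
    rw [hFe]; simp
  rw [hconj] at h2
  rw [← hFe] at h1 hF him
  have hN : 0 < Complex.normSq F := Complex.normSq_pos.2 hF
  refine ⟨s / (Real.pi * Complex.normSq F), by positivity, ?_⟩
  rw [jump, h1, h2]
  have hd : (starRingEnd ℂ) (f s 0) / (starRingEnd ℂ) F - f s 0 / F =
      2 * Complex.I * s / Complex.normSq F := by
    have hF' : (starRingEnd ℂ) F ≠ 0 := (map_ne_zero _).2 hF
    have e1 : (starRingEnd ℂ) (f s 0) * F - f s 0 * (starRingEnd ℂ) F = 2 * Complex.I * s := by
      have e2 : (starRingEnd ℂ) (f s 0) * F = (starRingEnd ℂ) (f s 0 * (starRingEnd ℂ) F) := by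
        rw [map_mul, Complex.conj_conj]
      have e3 := Complex.sub_conj (f s 0 * (starRingEnd ℂ) F)
      rw [e2]
      rw [him] at e3
      push_cast at e3
      linear_combination -e3
    rw [div_sub_div _ _ hF' hF, mul_comm ((starRingEnd ℂ) F) (f s 0), e1,
      mul_comm ((starRingEnd ℂ) F) F, Complex.mul_conj]
  rw [hd]
  have hpi : (Real.pi : ℂ) ≠ 0 := by exact_mod_cast Real.pi_ne_zero
  have hI := Complex.I_ne_zero
  have hN' : (Complex.normSq F : ℂ) ≠ 0 := by exact_mod_cast hN.ne'
  push_cast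
  field_simp

theorem hasWeylAsymptotics_of_bound {M : ℂ → ℂ} {C R₀ : ℝ}
    (hb : ∀ k : ℂ, 0 < k.im → R₀ ≤ ‖k‖ →
      ‖M (k ^ 2) - (1 / (Complex.I * k) + h / k ^ 2)‖ ≤ C / ‖k‖ ^ 3) : HasWeylAsymptotics h M := by
  rw [HasWeylAsymptotics, Asymptotics.isLittleO_iff]
  intro c hc
  have h1 : ∀ᶠ k : ℂ in Bornology.cobounded ℂ, max (max R₀ 1) (|C| / c) ≤ ‖k‖ :=
    tendsto_norm_cobounded_atTop.eventually_ge_atTop _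
  filter_upwards [h1.filter_mono inf_le_left, mem_inf_of_right (mem_principal_self _)] with k hk1 hk2
  have hk3 : R₀ ≤ ‖k‖ := (le_max_left _ _).trans ((le_max_left _ _).trans hk1)
  have hk4 : 1 ≤ ‖k‖ := (le_max_right _ _).trans ((le_max_left _ _).trans hk1)
  have hk5 : |C| / c ≤ ‖k‖ := (le_max_right _ _).trans hk1
  have hkp : 0 < ‖k‖ := by linarith
  refine (hb k hk2 hk3).trans ?_
  rw [norm_div, norm_one, norm_pow, div_le_iff₀ (by positivity)]
  rw [div_le_iff₀ hc] at hk5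
  have : c * (1 / ‖k‖ ^ 2) * ‖k‖ ^ 3 = ‖k‖ * c := by field_simp
  rw [this]
  exact (le_abs_self C).trans hk5

end weyl

end

/-! ### The reduced function: removal of the poles. -/

section

open Classical in
/-- Finitely many removable singularities can be removed. -/
theorem exists_differentiableOn_extension {U Z : Set ℂ} (hU : IsOpen U) (hZ : Z.Finite) {f : ℂ → ℂ}
    (hf : DifferentiableOn ℂ f (U \ Z))
    (h : ∀ z ∈ Z, z ∈ U → Tendsto (fun w => (w - z) * f w) (𝓝[≠] z) (𝓝 0)) :
    ∃ F : ℂ → ℂ, DifferentiableOn ℂ F U ∧ ∀ w ∉ Z, F w = f w := by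
  let F : ℂ → ℂ := fun w => if w ∈ Z then limUnder (𝓝[≠] w) f else f w
  have hFf : ∀ w ∉ Z, F w = f w := fun w hw => if_neg hw
  have hZc : IsOpen Zᶜ := hZ.isClosed.isOpen_compl
  have hUZ : IsOpen (U \ Z) := hU.sdiff hZ.isClosed
  have hdf : ∀ w ∈ U \ Z, DifferentiableAt ℂ F w := fun w hw => by
    refine ((hf w hw).differentiableAt (hUZ.mem_nhds hw)).congr_of_eventuallyEq ?_
    filter_upwards [hZc.mem_nhds hw.2] with v hv using hFf v hv
  refine ⟨F, fun z hz => ?_, hFf⟩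
  by_cases hzZ : z ∈ Z
  · have hpun : ∀ᶠ w in 𝓝[≠] z, w ∈ U \ Z := by
      have h1 : IsOpen (U \ (Z \ {z})) := hU.sdiff (hZ.subset sdiff_subset).isClosed
      have h2 : U \ (Z \ {z}) ∈ 𝓝 z := h1.mem_nhds ⟨hz, fun h => h.2 rfl⟩
      filter_upwards [mem_nhdsWithin_of_mem_nhds h2, self_mem_nhdsWithin] with w hw1 hw2
      exact ⟨hw1.1, fun h => hw1.2 ⟨h, hw2⟩⟩
    have hlim : Tendsto f (𝓝[≠] z) (𝓝 (limUnder (𝓝[≠] z) f)) := by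
      refine Complex.tendsto_limUnder_of_differentiable_on_punctured_nhds_of_isLittleO
        (hpun.mono fun w hw => (hf w hw).differentiableAt (hUZ.mem_nhds hw)) ?_
      refine (Asymptotics.isLittleO_iff_tendsto' ?_).2 ?_
      · filter_upwards [self_mem_nhdsWithin] with w hw h0
        exact absurd (sub_eq_zero.1 (inv_eq_zero.1 h0)) hw
      · have h1 : Tendsto (fun w => (w - z) * f z) (𝓝[≠] z) (𝓝 ((z - z) * f z)) :=
          (Continuous.tendsto (by fun_prop) _).mono_left nhdsWithin_le_nhds
        have h2 := (h z hzZ hz).sub h1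
        rw [sub_self, zero_mul, sub_zero] at h2
        refine h2.congr fun w => ?_
        rw [div_inv_eq_mul]
        ring
    have hcont : ContinuousAt F z := by
      rw [continuousAt_iff_punctured_nhds]
      have : F z = limUnder (𝓝[≠] z) f := if_pos hzZ
      rw [this]
      exact hlim.congr' (hpun.mono fun w hw => (hFf w hw.2).symm)
    exact (Complex.analyticAt_of_differentiable_on_punctured_nhds_of_continuousAt
      (hpun.mono hdf) hcont).differentiableAt.differentiableWithinAt
  · exact (hdf z ⟨hz, hzZ⟩).differentiableWithinAt

theorem finite_sq_mem (P : Finset ℝ) : {k : ℂ | ∃ p ∈ P, k ^ 2 = (p : ℂ)}.Finite := by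
  have : {k : ℂ | ∃ p ∈ P, k ^ 2 = (p : ℂ)} = ⋃ p ∈ P, {k : ℂ | k ^ 2 = (p : ℂ)} := by
    ext k; simp
  rw [this]
  refine P.finite_toSet.biUnion fun p _ => ?_
  refine ((finite_singleton (-physRoot p)).insert (physRoot p)).subset fun k hk => ?_
  rw [mem_ofPred_eq, ← physRoot_sq (p : ℂ)] at hk
  exact sq_eq_sq_iff_eq_or_eq_neg.1 hk

theorem neBot_upper_of_im_nonneg {k : ℂ} (hk : 0 ≤ k.im) : (𝓝[{z : ℂ | 0 < z.im}] k).NeBot := by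
  rw [← mem_closure_iff_nhdsWithin_neBot, Complex.closure_setOfPred_lt_im]
  exact hk

/-- Estimates in the open half-plane pass to real points by continuity, every such point being a
limit from above. -/
theorem norm_le_of_upper {G : ℂ → ℂ} (hG : ContinuousOn G {k | 0 ≤ k.im ∧ k ≠ 0}) {c : ℂ → ℝ}
    (hc : ContinuousOn c {0}ᶜ) {O : Set ℂ} (hO : IsOpen O)
    (h : ∀ k ∈ O, 0 < k.im → ‖G k‖ ≤ c k) {k : ℂ} (hkO : k ∈ O) (hk : 0 ≤ k.im) (hk0 : k ≠ 0) :
    ‖G k‖ ≤ c k := by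
  have := neBot_upper_of_im_nonneg hk
  have h1 : Tendsto (fun z => ‖G z‖) (𝓝[{z : ℂ | 0 < z.im}] k) (𝓝 ‖G k‖) :=
    ((hG k ⟨hk, hk0⟩).mono fun z hz => ⟨le_of_lt hz, fun h => by
      have hz' : 0 < z.im := hz
      rw [h] at hz'
      simp at hz'⟩).tendsto.norm
  have h2 : Tendsto c (𝓝[{z : ℂ | 0 < z.im}] k) (𝓝 (c k)) :=
    (hc.continuousAt (isOpen_compl_singleton.mem_nhds hk0)).tendsto.mono_left nhdsWithin_le_nhds
  refine le_of_tendsto_of_tendsto h1 h2 ?_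
  filter_upwards [mem_nhdsWithin_of_mem_nhds (hO.mem_nhds hkO), self_mem_nhdsWithin] with z hz1 hz2
  exact h z hz1 hz2

/-- The sum of the principal parts. -/
def poleSum (P : Finset ℝ) (α : ℝ → ℝ) (k : ℂ) : ℂ := ∑ p ∈ P, (α p : ℂ) * (k / (k ^ 2 - p))

theorem differentiableAt_poleSum {P : Finset ℝ} {α : ℝ → ℝ} {k : ℂ}
    (hk : ∀ p ∈ P, k ^ 2 ≠ (p : ℂ)) : DifferentiableAt ℂ (poleSum P α) k := by
  unfold poleSum
  refine DifferentiableAt.fun_sum fun p hp => ?_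
  have : DifferentiableAt ℂ (fun k : ℂ => k ^ 2 - (p : ℂ)) k := by fun_prop
  exact (differentiableAt_fun_id.div this (sub_ne_zero.2 (hk p hp))).const_mul _

/-- `k M(k²) + i` minus the principal parts, extended over the poles. -/
structure IsReduced (h : ℝ) (M m : ℂ → ℂ) (P : Finset ℝ) (α : ℝ → ℝ) (N : ℂ → ℂ) : Prop where
  cont_m : ContinuousOn m (kDomain P)
  m_eq : ∀ k : ℂ, 0 < k.im → m k = M (k ^ 2)
  diff : DifferentiableOn ℂ N {k | 0 < k.im}
  cont : ContinuousOn N {k | 0 ≤ k.im ∧ k ≠ 0}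
  eq : ∀ k ∈ kDomain P, N k = k * m k + Complex.I - poleSum P α k
  decay : ∀ ε > 0, ∃ R₀ : ℝ, 0 < R₀ ∧ ∀ k : ℂ, 0 ≤ k.im → R₀ ≤ ‖k‖ →
    ‖k‖ * ‖N k - ((h : ℂ) - ∑ p ∈ P, (α p : ℂ)) / k‖ ≤ ε
  bound : ∃ C : ℝ, ∀ k : ℂ, 0 ≤ k.im → k ≠ 0 → ‖N k‖ ≤ C / (1 + ‖k‖)

/-- Writing `w - z = (w² - p₀) / (w + z)`, both `w m(w)` and the principal part at `p₀` contribute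
half the residue, since `z / (z + z) = 1 / 2`. -/
theorem tendsto_residue_cancel {M : ℂ → ℂ} {P : Finset ℝ} {α : ℝ → ℝ} (hM : HasPoles M P α)
    {m : ℂ → ℂ} (hmM : ∀ k : ℂ, 0 < k.im → m k = M (k ^ 2)) {z : ℂ} (hz : 0 < z.im) {p₀ : ℝ}
    (hp₀ : p₀ ∈ P) (hzp : z ^ 2 = (p₀ : ℂ)) :
    Tendsto (fun w => (w - z) * (w * m w + Complex.I - poleSum P α w)) (𝓝[≠] z) (𝓝 0) := by
  have hz0 : z ≠ 0 := fun h => by rw [h] at hz; simp at hz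
  have hzz : z + z ≠ 0 := by rw [← two_mul]; exact mul_ne_zero two_ne_zero hz0
  have hid : Tendsto (fun w : ℂ => w) (𝓝[≠] z) (𝓝 z) := nhdsWithin_le_nhds
  have hsum : ∀ᶠ w in 𝓝[≠] z, w + z ≠ 0 := (hid.add_const z).eventually_ne hzz
  have hup : ∀ᶠ w in 𝓝[≠] z, 0 < w.im :=
    nhdsWithin_le_nhds ((isOpen_lt continuous_const Complex.continuous_im).mem_nhds hz)
  have hsq : Tendsto (fun w : ℂ => w ^ 2) (𝓝[≠] z) (𝓝[≠] (p₀ : ℂ)) := by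
    refine tendsto_nhdsWithin_of_tendsto_nhds_of_eventually_within _ (hzp ▸ hid.pow 2) ?_
    filter_upwards [hsum, self_mem_nhdsWithin] with w hw1 hw2 h0
    rw [mem_singleton_iff, ← hzp, ← sub_eq_zero, sq_sub_sq] at h0
    exact mul_ne_zero hw1 (sub_ne_zero.2 hw2) h0
  have hhalf : Tendsto (fun w : ℂ => w / (w + z)) (𝓝[≠] z) (𝓝 (1 / 2)) := by
    have h1 := hid.div (hid.add_const z) hzz
    have h2 : z / (z + z) = 1 / 2 := by field_simp; norm_num
    rwa [h2] at h1
  have t1 : Tendsto (fun w => (w - z) * (w * m w)) (𝓝[≠] z) (𝓝 (1 / 2 * α p₀)) := by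
    refine (hhalf.mul ((hM.2 p₀ hp₀).2.2.comp hsq)).congr' ?_
    filter_upwards [hsum, hup] with w hw1 hw2
    simp only [Function.comp]
    rw [hmM w hw2, ← hzp, sq_sub_sq]
    field_simp
  have t0 : Tendsto (fun w : ℂ => w - z) (𝓝[≠] z) (𝓝 0) := by
    have := hid.sub_const z
    rwa [sub_self] at this
  have t2 : Tendsto (fun w => (w - z) * Complex.I) (𝓝[≠] z) (𝓝 (0 * Complex.I)) := t0.mul_const _
  have t3 : Tendsto (fun w => ∑ p ∈ P, (w - z) * ((α p : ℂ) * (w / (w ^ 2 - p)))) (𝓝[≠] z)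
      (𝓝 (∑ p ∈ P, if p = p₀ then 1 / 2 * (α p : ℂ) else 0)) := by
    refine tendsto_finsetSum _ fun p hp => ?_
    split_ifs with h
    · rw [h]
      refine (hhalf.mul_const (α p₀ : ℂ)).congr' ?_
      filter_upwards [hsum, self_mem_nhdsWithin] with w hw1 hw2
      have : w - z ≠ 0 := sub_ne_zero.2 hw2
      rw [← hzp, sq_sub_sq]
      field_simp
    · have h1 : z ^ 2 - (p : ℂ) ≠ 0 := by
        rw [hzp, sub_ne_zero]
        exact fun h' => h (by exact_mod_cast h'.symm)
      have h2 := t0.mul ((hid.div ((hid.pow 2).sub_const (p : ℂ)) h1).const_mul (α p : ℂ))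
      rwa [zero_mul] at h2
  rw [Finset.sum_ite_eq' P p₀, if_pos hp₀] at t3
  have := (t1.add t2).sub t3
  rw [zero_mul, add_zero, sub_self] at this
  refine this.congr fun w => ?_
  rw [poleSum, ← Finset.mul_sum]
  ring

/-- The identity `k² / (k² - p) = 1 + p / (k² - p)` extracts the sum of residues, which is why the
coefficient of `1 / k` is `h - ∑ α`; the constant `i` cancels `1 / (ik)`. -/
theorem mul_reduced_sub {P : Finset ℝ} {α : ℝ → ℝ} {k : ℂ} (hk0 : k ≠ 0)
    (hk : ∀ p ∈ P, k ^ 2 ≠ (p : ℂ)) (h : ℝ) (w : ℂ) :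
    k * (k * w + Complex.I - poleSum P α k - ((h : ℂ) - ∑ p ∈ P, (α p : ℂ)) / k) =
      k ^ 2 * (w - (1 / (Complex.I * k) + h / k ^ 2)) -
        ∑ p ∈ P, (α p : ℂ) * (p / (k ^ 2 - p)) := by
  have hs : k * poleSum P α k = (∑ p ∈ P, (α p : ℂ)) +
      ∑ p ∈ P, (α p : ℂ) * (p / (k ^ 2 - p)) := by
    rw [poleSum, Finset.mul_sum, ← Finset.sum_add_distrib]
    refine Finset.sum_congr rfl fun p hp => ?_
    have : k ^ 2 - (p : ℂ) ≠ 0 := sub_ne_zero.2 (hk p hp)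
    field_simp
    ring
  have hI : (1 : ℂ) / (Complex.I * k) = -Complex.I / k := by
    rw [one_div, mul_inv, Complex.inv_I]; ring
  rw [hI, mul_sub k (k * w + Complex.I - poleSum P α k), mul_sub k (k * w + Complex.I), hs]
  field_simp
  ring

/-- Inside the half-plane the poles become removable singularities; on the real axis no poles were
present. The decay comes from the asymptotics of `M`, extended to real `k` by continuity. -/
theorem exists_isReduced {h : ℝ} {M m : ℂ → ℂ} {P : Finset ℝ} {α : ℝ → ℝ} (hM : HasPoles M P α)
    (hm : ContinuousOn m (kDomain P)) (hmM : ∀ k : ℂ, 0 < k.im → m k = M (k ^ 2))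
    (hO : (fun k : ℂ => k * M (k ^ 2)) =O[𝓝[{k : ℂ | 0 < k.im}] 0] (fun _ => (1 : ℂ)))
    (has : HasWeylAsymptotics h M) : ∃ N, IsReduced h M m P α N := by
  have hP0 : ∀ p ∈ P, p < 0 := fun p hp => (hM.2 p hp).1
  let Z : Set ℂ := {k | ∃ p ∈ P, k ^ 2 = (p : ℂ)}
  have hZ : Z.Finite := finite_sq_mem P
  have hUo : IsOpen {k : ℂ | 0 < k.im} := isOpen_lt continuous_const Complex.continuous_im
  let f₀ : ℂ → ℂ := fun k => k * m k + Complex.I - poleSum P α k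
  have hcutP : IsOpen (cutPlane \ ((↑) '' (P : Set ℝ) : Set ℂ)) :=
    isOpen_cutPlane.sdiff ((P.finite_toSet.image _).isClosed)
  have hf₀ : DifferentiableOn ℂ f₀ ({k | 0 < k.im} \ Z) := by
    intro k hk
    have hkZ : ∀ p ∈ P, k ^ 2 ≠ (p : ℂ) := fun p hp h => hk.2 ⟨p, hp, h⟩
    have hmk : DifferentiableAt ℂ m k := by
      have h1 : DifferentiableAt ℂ M (k ^ 2) := (hM.1 (k ^ 2) ⟨sq_mem_cutPlane hk.1, by
        rintro ⟨p, hp, hpk⟩; exact hkZ p hp hpk.symm⟩).differentiableAt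
      have h2 : DifferentiableAt ℂ (fun k : ℂ => M (k ^ 2)) k :=
        DifferentiableAt.comp k h1 (differentiableAt_id.pow 2)
      refine h2.congr_of_eventuallyEq ?_
      filter_upwards [hUo.mem_nhds hk.1] with w hw using hmM w hw
    exact (((differentiableAt_id.mul hmk).add_const _).sub
      (differentiableAt_poleSum hkZ)).differentiableWithinAt
  obtain ⟨N, hNd, hNf⟩ := exists_differentiableOn_extension hUo hZ hf₀ (by
    rintro z ⟨p, hp, hzp⟩ hz
    exact tendsto_residue_cancel hM hmM hz hp hzp)
  have hNeq : ∀ k ∈ kDomain P, N k = k * m k + Complex.I - poleSum P α k := fun k hk =>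
    hNf k fun ⟨p, hp, h⟩ => hk.2.2 p hp h
  have hNc : ContinuousOn N {k | 0 ≤ k.im ∧ k ≠ 0} := by
    rintro k ⟨hk, hk0⟩
    rcases hk.eq_or_lt with h0 | h0
    · have hke : k = (k.re : ℂ) := by apply Complex.ext <;> simp [← h0]
      have hkD : k ∈ kDomain P := by
        rw [hke] at hk0 ⊢
        exact ofReal_mem_kDomain hP0 (by exact_mod_cast hk0)
      have hcf : ContinuousOn (fun k => k * m k + Complex.I - poleSum P α k) (kDomain P) :=
        ((continuousOn_id.mul hm).add continuousOn_const).sub fun k hk =>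
          (differentiableAt_poleSum hk.2.2).continuousAt.continuousWithinAt
      have h1 : ContinuousWithinAt N (kDomain P) k := (hcf k hkD).congr hNeq (hNeq k hkD)
      refine h1.mono_of_mem_nhdsWithin ?_
      have hkZ : k ∈ Zᶜ := fun ⟨p, hp, h⟩ => hkD.2.2 p hp h
      filter_upwards [mem_nhdsWithin_of_mem_nhds (hZ.isClosed.isOpen_compl.mem_nhds hkZ),
        self_mem_nhdsWithin] with w hw1 hw2
      exact ⟨hw2.1, hw2.2, fun p hp h => hw1 ⟨p, hp, h⟩⟩
    · exact ((hNd k h0).differentiableAt (hUo.mem_nhds h0)).continuousAt.continuousWithinAt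
  have hdecay : ∀ ε > 0, ∃ R₀ : ℝ, 0 < R₀ ∧ ∀ k : ℂ, 0 ≤ k.im → R₀ ≤ ‖k‖ →
      ‖k‖ * ‖N k - ((h : ℂ) - ∑ p ∈ P, (α p : ℂ)) / k‖ ≤ ε := by
    intro ε hε
    have e1 := (Asymptotics.isLittleO_iff.1 has) (half_pos hε)
    have tsq : Tendsto (fun k : ℂ => k ^ 2) (Bornology.cobounded ℂ) (Bornology.cobounded ℂ) := by
      rw [← tendsto_norm_atTop_iff_cobounded]
      simp only [norm_pow]
      exact (tendsto_pow_atTop two_ne_zero).comp tendsto_norm_cobounded_atTop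
    have tp : ∀ p : ℝ, Tendsto (fun k : ℂ => (α p : ℂ) * (p / (k ^ 2 - p))) (Bornology.cobounded ℂ)
        (𝓝 0) := fun p => by
      have h1 : Tendsto (fun k : ℂ => k ^ 2 - p) (Bornology.cobounded ℂ) (Bornology.cobounded ℂ) := by
        rw [← tendsto_norm_atTop_iff_cobounded]
        refine tendsto_atTop_mono (fun k => ?_) (tendsto_atTop_add_const_right _ (-‖(p : ℂ)‖)
          (tendsto_norm_cobounded_atTop.comp tsq))
        simp only [Function.comp]
        have := norm_sub_norm_le (k ^ 2) (p : ℂ)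
        linarith
      have h2 := ((tendsto_inv₀_cobounded.comp h1).const_mul (p : ℂ)).const_mul (α p : ℂ)
      simpa [div_eq_mul_inv] using h2
    have tS : Tendsto (fun k : ℂ => ∑ p ∈ P, (α p : ℂ) * (p / (k ^ 2 - p))) (Bornology.cobounded ℂ)
        (𝓝 0) := by
      have := tendsto_finsetSum P fun p _ => tp p
      simpa using this
    have e2 : ∀ᶠ k in Bornology.cobounded ℂ ⊓ 𝓟 {k : ℂ | 0 < k.im},
        ‖∑ p ∈ P, (α p : ℂ) * (p / (k ^ 2 - p))‖ < ε / 2 :=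
      ((tendsto_zero_iff_norm_tendsto_zero.1 tS).eventually_lt_const
        (half_pos hε)).filter_mono inf_le_left
    have e3 : ∀ᶠ k in Bornology.cobounded ℂ ⊓ 𝓟 {k : ℂ | 0 < k.im}, k ∉ Z := by
      have : ∀ᶠ k in Bornology.cobounded ℂ, k ∉ Z :=
        (Bornology.isBounded_def.1 hZ.isBounded)
      exact this.filter_mono inf_le_left
    have e4 : ∀ᶠ k in Bornology.cobounded ℂ ⊓ 𝓟 {k : ℂ | 0 < k.im},
        ‖N k - ((h : ℂ) - ∑ p ∈ P, (α p : ℂ)) / k‖ ≤ ε / ‖k‖ := by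
      filter_upwards [e1, e2, e3, mem_inf_of_right (mem_principal_self _)] with k h1 h2 h3 h4
      have hk4 : 0 < k.im := h4
      have hk0 : k ≠ 0 := fun h => by rw [h] at hk4; simp at hk4
      have hkp : 0 < ‖k‖ := norm_pos_iff.2 hk0
      have hkD : k ∈ kDomain P := ⟨hk4.le, hk0, fun p hp h => h3 ⟨p, hp, h⟩⟩
      have key := mul_reduced_sub (α := α) hk0 hkD.2.2 h (M (k ^ 2))
      rw [← hmM k hk4, ← hNeq k hkD, hmM k hk4] at key
      rw [le_div_iff₀ hkp, mul_comm, ← norm_mul, key]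
      refine (norm_sub_le _ _).trans ?_
      rw [norm_mul, norm_pow]
      rw [norm_div, norm_one, norm_pow, mul_one_div, le_div_iff₀ (by positivity)] at h1
      linarith
    rw [eventually_inf_principal, (Filter.hasBasis_cobounded_norm).eventually_iff] at e4
    obtain ⟨R, -, hR⟩ := e4
    refine ⟨|R| + 1, by positivity, fun k hk hkR => ?_⟩
    have hkp : 0 < ‖k‖ := by linarith [abs_nonneg R]
    have hk0 : k ≠ 0 := norm_pos_iff.1 hkp
    have := norm_le_of_upper (G := fun k => N k - ((h : ℂ) - ∑ p ∈ P, (α p : ℂ)) / k)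
      (c := fun k => ε / ‖k‖) (hNc.sub (continuousOn_const.div continuousOn_id fun k hk => hk.2))
      (continuousOn_const.div continuous_norm.continuousOn fun k hk => norm_ne_zero_iff.2 hk)
      (O := {k | |R| < ‖k‖}) (isOpen_lt continuous_const continuous_norm)
      (fun k hk1 hk2 => hR (le_of_lt ((le_abs_self R).trans_lt hk1)) hk2)
      (k := k) (by simp only [mem_ofPred_eq]; linarith) hk hk0
    rwa [le_div_iff₀ hkp, mul_comm] at this
  refine ⟨N, hm, hmM, hNd, hNc, hNeq, hdecay, ?_⟩
  obtain ⟨R₀, hR₀, hdec⟩ := hdecay 1 one_pos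
  obtain ⟨c₁, hc₁⟩ := hO.bound
  have hZ0 : (0 : ℂ) ∈ Zᶜ := fun ⟨p, hp, h⟩ => by
    have : (p : ℂ) ≠ 0 := by exact_mod_cast (hP0 p hp).ne
    exact this (by rw [← h]; ring)
  have hS0 : ContinuousAt (fun k => ‖poleSum P α k‖) 0 :=
    (differentiableAt_poleSum fun p hp h => hZ0 ⟨p, hp, h⟩).continuousAt.norm
  have hnear : ∀ᶠ k in 𝓝[{k : ℂ | 0 < k.im}] 0, ‖N k‖ ≤ c₁ + 1 + (‖poleSum P α 0‖ + 1) := by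
    filter_upwards [hc₁, nhdsWithin_le_nhds (hZ.isClosed.isOpen_compl.mem_nhds hZ0),
      nhdsWithin_le_nhds (hS0.tendsto.eventually_le_const (lt_add_one _)), self_mem_nhdsWithin]
      with k h1 h2 h3 h4
    have hk4 : 0 < k.im := h4
    have hk0 : k ≠ 0 := fun h => by rw [h] at hk4; simp at hk4
    rw [hNeq k ⟨hk4.le, hk0, fun p hp h => h2 ⟨p, hp, h⟩⟩, hmM k hk4]
    refine (norm_sub_le _ _).trans (add_le_add ((norm_add_le _ _).trans ?_) h3)
    rw [Complex.norm_I]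
    rw [norm_one, mul_one] at h1
    linarith
  obtain ⟨r, hr, hball⟩ := Metric.mem_nhdsWithin_iff.1 hnear
  let c₂ := c₁ + 1 + (‖poleSum P α 0‖ + 1)
  have hcomp : IsCompact {k : ℂ | 0 ≤ k.im ∧ r / 2 ≤ ‖k‖ ∧ ‖k‖ ≤ R₀} := by
    refine (isCompact_closedBall (0 : ℂ) R₀).of_isClosed_subset ?_ fun k hk => by
      rw [mem_closedBall_zero_iff]; exact hk.2.2
    exact (isClosed_le continuous_const Complex.continuous_im).inter
      ((isClosed_le continuous_const continuous_norm).inter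
        (isClosed_le continuous_norm continuous_const))
  obtain ⟨c₃, hc₃⟩ := hcomp.exists_bound_of_continuousOn (hNc.mono fun k hk =>
    ⟨hk.1, norm_pos_iff.1 (lt_of_lt_of_le (by linarith) hk.2.1)⟩)
  let c₄ := 1 + ‖(h : ℂ) - ∑ p ∈ P, (α p : ℂ)‖
  -- One summand for each region: near the origin, the compact half-annulus, and the neighbourhood
  -- of infinity.
  refine ⟨|c₂| * (1 + r) + |c₃| * (1 + R₀) + c₄ * (1 + 1 / R₀), fun k hk hk0 => ?_⟩
  have hkp : 0 < ‖k‖ := norm_pos_iff.2 hk0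
  have hc₄ : 0 ≤ c₄ := by positivity
  have p1 : 0 ≤ |c₂| * (1 + r) := by positivity
  have p2 : 0 ≤ |c₃| * (1 + R₀) := by positivity
  have p3 : 0 ≤ c₄ * (1 + 1 / R₀) := by positivity
  rw [le_div_iff₀ (by positivity)]
  rcases lt_or_ge ‖k‖ r with h1 | h1
  · have := norm_le_of_upper hNc (c := fun _ => c₂) continuousOn_const (O := Metric.ball 0 r)
      Metric.isOpen_ball (fun k hk1 hk2 => hball ⟨hk1, hk2⟩) (mem_ball_zero_iff.2 h1) hk hk0
    have h2 : ‖N k‖ * (1 + ‖k‖) ≤ |c₂| * (1 + r) :=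
      mul_le_mul (this.trans (le_abs_self _)) (by linarith) (by positivity) (abs_nonneg _)
    linarith
  · rcases le_or_gt ‖k‖ R₀ with h2 | h2
    · have := hc₃ k ⟨hk, by linarith, h2⟩
      have h3 : ‖N k‖ * (1 + ‖k‖) ≤ |c₃| * (1 + R₀) :=
        mul_le_mul (this.trans (le_abs_self _)) (by linarith) (by positivity) (abs_nonneg _)
      linarith
    · have h3 := hdec k hk h2.le
      have h4 : ‖k‖ * ‖N k‖ ≤ c₄ := by
        have e : k * N k = k * (N k - ((h : ℂ) - ∑ p ∈ P, (α p : ℂ)) / k) +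
            ((h : ℂ) - ∑ p ∈ P, (α p : ℂ)) := by field_simp; ring
        rw [← norm_mul, e]
        refine (norm_add_le _ _).trans ?_
        rw [norm_mul]
        simp only [c₄]
        linarith
      have h5 : ‖N k‖ ≤ c₄ * (1 / R₀) := by
        rw [mul_one_div, le_div_iff₀ hR₀]
        nlinarith [norm_nonneg (N k)]
      nlinarith

end

/-! ### The Gelfand–Levitan function as an inverse Laplace transform. -/

section

theorem integral_symm_of_odd {f : ℝ → ℂ} (hf : ∀ s, f (-s) = -f s) (R : ℝ) :
    ∫ s in (-R)..R, f s = 0 := by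
  have h1 := intervalIntegral.integral_comp_neg (a := -R) (b := R) f
  rw [neg_neg] at h1
  simp_rw [hf] at h1
  rw [intervalIntegral.integral_neg] at h1
  have h2 : (2 : ℂ) * ∫ s in (-R)..R, f s = 0 := by linear_combination -h1
  exact (mul_eq_zero.1 h2).resolve_left two_ne_zero

theorem two_mul_cos_mul_cos (z : ℂ) (x y : ℝ) : 2 * (Complex.cos (z * x) * Complex.cos (z * y)) =
    Complex.cos (z * (x + y : ℝ)) + Complex.cos (z * (|x - y| : ℝ)) := by
  have h : Complex.cos (z * (|x - y| : ℝ)) = Complex.cos (z * (x - y : ℝ)) := by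
    rcases abs_choice (x - y) with h | h <;> rw [h]
    rw [Complex.ofReal_neg, mul_neg, Complex.cos_neg]
  rw [h]
  push_cast
  rw [mul_add, mul_sub, Complex.cos_add, Complex.cos_sub]
  ring

namespace IsReduced

variable {h : ℝ} {M m N : ℂ → ℂ} {P : Finset ℝ} {α : ℝ → ℝ}

theorem aestronglyMeasurable (hr : IsReduced h M m P α N) :
    AEStronglyMeasurable (fun s : ℝ => N s) volume := by
  have h1 : ContinuousOn (fun s : ℝ => N s) {0}ᶜ :=
    hr.cont.comp (by fun_prop) fun s hs => ⟨by simp, by simpa using hs⟩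
  have h2 := h1.aestronglyMeasurable (μ := volume) (measurableSet_singleton (0 : ℝ)).compl
  rwa [Measure.restrict_eq_self_of_ae_mem (by simp [ae_iff, measure_singleton])] at h2

theorem exists_norm_le (hr : IsReduced h M m P α N) :
    ∃ C : ℝ, 0 ≤ C ∧ ∀ k : ℂ, 0 ≤ k.im → k ≠ 0 → ‖N k‖ ≤ C := by
  obtain ⟨C, hC⟩ := hr.bound
  refine ⟨|C|, abs_nonneg _, fun k hk hk0 => (hC k hk hk0).trans
    ((div_le_div_of_nonneg_right (le_abs_self C) (by positivity)).trans ?_)⟩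
  exact div_le_self (abs_nonneg _) (by linarith [norm_nonneg k])

theorem intervalIntegrable (hr : IsReduced h M m P α N) (a b : ℝ) :
    IntervalIntegrable (fun s : ℝ => N s) volume a b := by
  obtain ⟨C, hC0, hC⟩ := hr.exists_norm_le
  have hne : ∀ᵐ t : ℝ, t ≠ 0 := by simp [ae_iff, measure_singleton]
  refine (intervalIntegrable_const (c := C)).mono_fun hr.aestronglyMeasurable.restrict ?_
  filter_upwards [ae_restrict_of_ae hne] with s hs
  rw [Real.norm_of_nonneg hC0]
  exact hC s (by simp) (by simpa using hs)

theorem continuous_poleSum_ofReal (hP : ∀ p ∈ P, p < 0) :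
    Continuous fun s : ℝ => poleSum P α s := by
  refine continuous_iff_continuousAt.2 fun s => ?_
  refine ContinuousAt.comp (f := fun s : ℝ => (s : ℂ)) (differentiableAt_poleSum fun p hp h => ?_).continuousAt
    Complex.continuous_ofReal.continuousAt
  have h1 : s ^ 2 = p := by exact_mod_cast h
  nlinarith [hP p hp, sq_nonneg s]

/-- The principal parts are odd in `k` and the cosines even, so they drop out of the symmetric
integral and `k j(k)` may be replaced by `N`. -/
theorem gCutoff_eq (hr : IsReduced h M m P α N) (hP : ∀ p ∈ P, p < 0) (x y R : ℝ) :
    gCutoff M P α x y R = Complex.I / Real.pi *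
      (∫ s in (-R)..R, N s * (Complex.cos (s * x) * Complex.cos (s * y))) +
      ∑ p ∈ P, α p * (Complex.cos (physRoot p * x) * Complex.cos (physRoot p * y)) := by
  unfold gCutoff
  congr 1
  · congr 1
    have hne : ∀ᵐ t : ℝ, t ≠ 0 := by simp [ae_iff, measure_singleton]
    have e1 : ∫ k in (-R)..R, (k : ℂ) * Complex.cos (k * x) * jFun M k * Complex.cos (k * y) =
        ∫ s in (-R)..R, (N s * (Complex.cos (s * x) * Complex.cos (s * y)) +
          poleSum P α s * (Complex.cos (s * x) * Complex.cos (s * y))) := by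
      refine intervalIntegral.integral_congr_ae (hne.mono fun s hs _ => ?_)
      have hs' : (s : ℂ) ≠ 0 := by exact_mod_cast hs
      rw [jFun_eq hP hr.cont_m hr.m_eq hs, hr.eq s (ofReal_mem_kDomain hP hs), one_div, mul_inv,
        Complex.inv_I]
      field_simp
      ring
    have hc : Continuous fun s : ℝ => Complex.cos (s * x) * Complex.cos (s * y) := by fun_prop
    have hc' : Continuous fun s : ℝ => poleSum P α s * (Complex.cos (s * x) * Complex.cos (s * y)) :=
      (continuous_poleSum_ofReal hP).mul hc
    rw [e1, intervalIntegral.integral_add ((hr.intervalIntegrable _ _).mul_continuousOn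
      hc.continuousOn) (hc'.intervalIntegrable _ _)]
    have e2 : ∫ s in (-R)..R, poleSum P α s * (Complex.cos (s * x) * Complex.cos (s * y)) = 0 := by
      refine integral_symm_of_odd (f := fun s : ℝ => poleSum P α s *
        (Complex.cos (s * x) * Complex.cos (s * y))) (fun s => ?_) R
      have : poleSum P α ((-s : ℝ) : ℂ) = -poleSum P α s := by
        simp only [poleSum, Complex.ofReal_neg, neg_sq, neg_div, mul_neg, Finset.sum_neg_distrib]
      rw [this, Complex.ofReal_neg, neg_mul (s : ℂ) x, neg_mul (s : ℂ) y, Complex.cos_neg,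
        Complex.cos_neg, neg_mul]
    rw [e2, add_zero]
  · exact Finset.sum_congr rfl fun p _ => by ring

/-- The product formula for cosines reduces `g` to a function of one variable already at finite
cut-off. -/
theorem gCutoff_eq_half (hr : IsReduced h M m P α N) (hP : ∀ p ∈ P, p < 0) (x y R : ℝ) :
    gCutoff M P α x y R = (gCutoff M P α (x + y) 0 R + gCutoff M P α |x - y| 0 R) / 2 := by
  rw [hr.gCutoff_eq hP, hr.gCutoff_eq hP, hr.gCutoff_eq hP]
  simp only [Complex.ofReal_zero, mul_zero, Complex.cos_zero, mul_one]
  have hi : ∀ u : ℝ, IntervalIntegrable (fun s : ℝ => N s * Complex.cos (s * u)) volume (-R) R :=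
    fun u => (hr.intervalIntegrable _ _).mul_continuousOn (by fun_prop)
  have e1 : ∫ s in (-R)..R, N s * (Complex.cos (s * x) * Complex.cos (s * y)) =
      ((∫ s in (-R)..R, N s * Complex.cos (s * (x + y : ℝ))) +
        ∫ s in (-R)..R, N s * Complex.cos (s * (|x - y| : ℝ))) / 2 := by
    rw [← intervalIntegral.integral_add (hi _) (hi _), ← intervalIntegral.integral_div]
    refine intervalIntegral.integral_congr fun s _ => ?_
    linear_combination N s / 2 * two_mul_cos_mul_cos s x y
  have e2 : ∑ p ∈ P, (α p : ℂ) * (Complex.cos (physRoot p * x) * Complex.cos (physRoot p * y)) =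
      ((∑ p ∈ P, (α p : ℂ) * Complex.cos (physRoot p * (x + y : ℝ))) +
        ∑ p ∈ P, (α p : ℂ) * Complex.cos (physRoot p * (|x - y| : ℝ))) / 2 := by
    rw [← Finset.sum_add_distrib, Finset.sum_div]
    refine Finset.sum_congr rfl fun p _ => ?_
    linear_combination (α p : ℂ) / 2 * two_mul_cos_mul_cos (physRoot p) x y
  rw [e1, e2]
  ring

theorem eq_glKernel_of_tendsto (hr : IsReduced h M m P α N) (hP : ∀ p ∈ P, p < 0)
    {g : ℝ → ℝ → ℂ} (hg : ∀ x ≥ 0, ∀ y ≥ 0, Tendsto (gCutoff M P α x y) atTop (𝓝 (g x y)))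
    {x y : ℝ} (hx : 0 ≤ x) (hy : 0 ≤ y) : g x y = glKernel (fun t => g t 0) x y := by
  refine tendsto_nhds_unique (hg x hx y hy) ?_
  refine (((hg (x + y) (by positivity) 0 le_rfl).add (hg |x - y| (abs_nonneg _) 0
    le_rfl)).div_const 2).congr fun R => ?_
  rw [hr.gCutoff_eq_half hP x y]

theorem tendsto_glKernel (hr : IsReduced h M m P α N) (hP : ∀ p ∈ P, p < 0)
    {a : ℝ → ℂ} (ha : ∀ t ≥ 0, Tendsto (gCutoff M P α t 0) atTop (𝓝 (a t)))
    {x y : ℝ} (hx : 0 ≤ x) (hy : 0 ≤ y) :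
    Tendsto (gCutoff M P α x y) atTop (𝓝 (glKernel a x y)) := by
  refine (((ha (x + y) (by positivity)).add (ha |x - y| (abs_nonneg _))).div_const 2).congr
    fun R => ?_
  rw [hr.gCutoff_eq_half hP x y]

theorem tendsto_cosTransform (hr : IsReduced h M m P α N) (hP : ∀ p ∈ P, p < 0)
    {a : ℝ → ℂ} (ha : ∀ t ≥ 0, Tendsto (gCutoff M P α t 0) atTop (𝓝 (a t))) {t : ℝ} (ht : 0 ≤ t) :
    Tendsto (fun R : ℝ => Complex.I / Real.pi * ∫ s in (-R)..R, N s * Complex.cos (s * t)) atTop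
      (𝓝 (a t - ∑ p ∈ P, α p * Complex.cos (physRoot p * t))) := by
  refine ((ha t ht).sub_const _).congr fun R => ?_
  rw [hr.gCutoff_eq hP]
  simp

end IsReduced

/-- The function `a` is the inverse Laplace transform of `-τ M(-τ²) - 1`. -/
def IsLaplaceInverse (M : ℂ → ℂ) (a : ℝ → ℂ) : Prop :=
  ∃ τ₀ : ℝ, ∀ τ : ℝ, τ₀ ≤ τ → IntegrableOn (fun t : ℝ => Complex.exp (-τ * t) * a t) (Ioi 0) ∧
    ∫ t : ℝ in Ioi 0, Complex.exp (-τ * t) * a t = -τ * M (-(τ : ℂ) ^ 2) - 1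

/-- The integral part of `a` has the Laplace transform `i N(iτ)`. Each cosine from the finite sum
has the transform `τ / (τ² + p)`, and together these cancel the principal parts of `N` at `iτ`. -/
theorem IsReduced.isLaplaceInverse {h : ℝ} {M m N : ℂ → ℂ} {P : Finset ℝ} {α : ℝ → ℝ}
    (hr : IsReduced h M m P α N) (hP : ∀ p ∈ P, p < 0) {a : ℝ → ℂ}
    (ha : ∀ t ≥ 0, Tendsto (gCutoff M P α t 0) atTop (𝓝 (a t))) : IsLaplaceInverse M a := by
  obtain ⟨C, hC⟩ := hr.bound
  -- This threshold exceeds every `√(-p)`, the growth rate of the corresponding hyperbolic cosine.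
  refine ⟨1 + ∑ p ∈ P, √(-p), fun τ hτ => ?_⟩
  have hτp : ∀ p ∈ P, √(-p) < τ := fun p hp => by
    have := Finset.single_le_sum (fun p _ => Real.sqrt_nonneg (-p)) hp
    linarith
  have hτ0 : 0 < τ := by
    have : 0 ≤ ∑ p ∈ P, √(-p) := Finset.sum_nonneg fun p _ => Real.sqrt_nonneg _
    linarith
  have hτc : (τ : ℂ) ≠ 0 := by exact_mod_cast hτ0.ne'
  have hsq : ∀ p ∈ P, -τ ^ 2 < p := fun p hp => by
    have h1 := (Real.sqrt_lt' hτ0).1 (hτp p hp)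
    linarith
  have hsqc : ∀ p ∈ P, (τ : ℂ) ^ 2 + p ≠ 0 := fun p hp h => by
    have h1 : τ ^ 2 + p = 0 := by exact_mod_cast h
    linarith [hsq p hp]
  obtain ⟨i1, e1⟩ := laplace_of_tendsto_cosTransform hr.diff hr.cont hC
    (fun t ht => hr.tendsto_cosTransform hP ha ht) hτ0
  have hcos : ∀ p ∈ P, IntegrableOn (fun t : ℝ => (α p : ℂ) *
      (Complex.exp (-τ * t) * Complex.cos (physRoot p * t))) (Ioi 0) ∧
      ∫ t : ℝ in Ioi 0, (α p : ℂ) * (Complex.exp (-τ * t) * Complex.cos (physRoot p * t)) =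
        α p * (τ / (τ ^ 2 + p)) := fun p hp => by
    have h1 : |(physRoot p).im| < τ := by
      rw [physRoot_ofReal_neg (hP p hp)]
      simpa [abs_of_nonneg (Real.sqrt_nonneg _)] using hτp p hp
    obtain ⟨i2, e2⟩ := integrableOn_exp_mul_cos h1
    refine ⟨i2.const_mul _, ?_⟩
    rw [integral_const_mul, e2, physRoot_sq]
  have i3 := integrable_finsetSum P fun p hp => (hcos p hp).1
  have e3 := integral_finsetSum P fun p hp => (hcos p hp).1
  have esum : ∀ t : ℝ, Complex.exp (-τ * t) * a t = Complex.exp (-τ * t) *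
      (a t - ∑ p ∈ P, α p * Complex.cos (physRoot p * t)) +
      ∑ p ∈ P, (α p : ℂ) * (Complex.exp (-τ * t) * Complex.cos (physRoot p * t)) := fun t => by
    rw [mul_sub, Finset.mul_sum, sub_add, ← Finset.sum_sub_distrib, Finset.sum_eq_zero, sub_zero]
    intro p _
    ring
  simp_rw [esum]
  refine ⟨i1.add i3, ?_⟩
  rw [integral_add i1 i3, e1, e3, Finset.sum_congr rfl fun p hp => (hcos p hp).2]
  have him : 0 < ((τ : ℂ) * Complex.I).im := by simpa using hτ0
  have hI2 : ((τ : ℂ) * Complex.I) ^ 2 = -(τ : ℂ) ^ 2 := by rw [mul_pow, Complex.I_sq]; ring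
  have hmem : (τ : ℂ) * Complex.I ∈ kDomain P := by
    refine ⟨him.le, mul_ne_zero hτc Complex.I_ne_zero, fun p hp h0 => hsqc p hp ?_⟩
    rw [← h0, hI2]
    ring
  rw [hr.eq _ hmem, hr.m_eq _ him, hI2, poleSum, hI2]
  have e4 : ∑ p ∈ P, (α p : ℂ) * ((τ : ℂ) * Complex.I / (-(τ : ℂ) ^ 2 - p)) =
      -Complex.I * ∑ p ∈ P, (α p : ℂ) * (τ / (τ ^ 2 + p)) := by
    rw [Finset.mul_sum]
    refine Finset.sum_congr rfl fun p hp => ?_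
    have h1 := hsqc p hp
    have h2 : -(τ : ℂ) ^ 2 - p ≠ 0 := fun h => h1 (by linear_combination -h)
    rw [show -(τ : ℂ) ^ 2 - p = -((τ : ℂ) ^ 2 + p) by ring, div_neg]
    ring
  rw [e4]
  have := Complex.I_sq
  linear_combination (τ * M (-(τ : ℂ) ^ 2) + 1 + ∑ p ∈ P, (α p : ℂ) * (τ / (τ ^ 2 + p))) * this

/-- `1 / (s + i)` is an odd function minus `i` times a Poisson kernel. It serves as a comparison
function with tail `1 / k` and no singularity in the closed upper half-plane. -/
theorem tendsto_integral_inv_add_I :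
    Tendsto (fun R : ℝ => ∫ s in (-R)..R, ((s : ℂ) + Complex.I)⁻¹) atTop
      (𝓝 (-Complex.I * Real.pi)) := by
  have h1 := tendsto_poisson_integral (N := fun _ => 1) (by fun_prop) (by fun_prop) (C := 1)
    (fun k _ _ => by simp) one_pos
  have h2 := h1.const_mul (-Complex.I)
  rw [mul_one] at h2
  refine h2.congr fun R => ?_
  have hpos : ∀ s : ℝ, (1 : ℂ) + (s : ℂ) ^ 2 ≠ 0 := fun s => by
    have : 1 + s ^ 2 ≠ 0 := by positivity
    exact_mod_cast this
  have e1 : ∀ s : ℝ, ((s : ℂ) + Complex.I)⁻¹ = s * (1 + (s : ℂ) ^ 2)⁻¹ +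
      -Complex.I * (1 * ((1 / (1 ^ 2 + s ^ 2) : ℝ) : ℂ)) := fun s => by
    have hne : (s : ℂ) + Complex.I ≠ 0 := fun h => by
      have := congrArg Complex.im h
      simp at this
    have := hpos s
    push_cast
    rw [one_pow]
    field_simp
    linear_combination Complex.I_sq
  have e2 : ∫ s : ℝ in (-R)..R, (s : ℂ) * (1 + (s : ℂ) ^ 2)⁻¹ = 0 :=
    integral_symm_of_odd (f := fun s : ℝ => (s : ℂ) * (1 + (s : ℂ) ^ 2)⁻¹)
      (fun s => by push_cast; rw [neg_sq, neg_mul]) R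
  simp_rw [e1]
  have c1 : Continuous fun s : ℝ => (s : ℂ) * (1 + (s : ℂ) ^ 2)⁻¹ := by
    fun_prop (disch := exact hpos)
  have c2 : Continuous fun s : ℝ => -Complex.I * (1 * ((1 / (1 ^ 2 + s ^ 2) : ℝ) : ℂ)) := by
    have : ∀ s : ℝ, (1 : ℝ) ^ 2 + s ^ 2 ≠ 0 := fun s => by positivity
    fun_prop (disch := exact this)
  rw [intervalIntegral.integral_add (c1.intervalIntegrable _ _) (c2.intervalIntegrable _ _), e2,
    zero_add, intervalIntegral.integral_const_mul (-Complex.I)]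

/-- With `c = h - ∑ α`, the function `N - c / (k + i)` is `o(1/k)` and integrates to zero by Cauchy,
so the integral part of `a(0)` is `c`; the finite sum restores `∑ α`. In the inverse problem this
fixes the initial value of the kernel. -/
theorem IsReduced.apply_zero {h : ℝ} {M m N : ℂ → ℂ} {P : Finset ℝ} {α : ℝ → ℝ}
    (hr : IsReduced h M m P α N) (hP : ∀ p ∈ P, p < 0) {a : ℝ → ℂ}
    (ha : ∀ t ≥ 0, Tendsto (gCutoff M P α t 0) atTop (𝓝 (a t))) : a 0 = h := by
  obtain ⟨C, hC0, hC⟩ := hr.exists_norm_le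
  obtain ⟨c, hc⟩ : ∃ c : ℂ, c = (h : ℂ) - ∑ p ∈ P, (α p : ℂ) := ⟨_, rfl⟩
  have hge : ∀ k : ℂ, 0 ≤ k.im → 1 ≤ ‖k + Complex.I‖ := fun k hk => by
    refine le_trans ?_ (Complex.abs_im_le_norm _)
    rw [Complex.add_im, Complex.I_im]
    exact le_trans (by linarith) (le_abs_self _)
  have hne : ∀ k : ℂ, 0 ≤ k.im → k + Complex.I ≠ 0 := fun k hk h => by
    have := hge k hk
    rw [h, norm_zero] at this
    linarith
  have hG := tendsto_integral_of_upperHalfPlane (G := fun k => N k - c * (k + Complex.I)⁻¹)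
    (C := C + ‖c‖)
    (hr.diff.sub ((differentiableOn_const _).mul (DifferentiableOn.inv (by fun_prop)
      fun k hk => hne k (le_of_lt hk))))
    (hr.cont.sub (continuousOn_const.mul (ContinuousOn.inv₀ (by fun_prop)
      fun k hk => hne k hk.1))) one_pos
    (fun k hk _ hk0 => by
      refine (norm_sub_le _ _).trans (add_le_add ?_ ?_)
      · exact hC k hk hk0
      · rw [norm_mul, norm_inv]
        exact mul_le_of_le_one_right (norm_nonneg _) (inv_le_one_of_one_le₀ (hge k hk)))
    (fun ε hε => by
      obtain ⟨R₀, hR₀, hR⟩ := hr.decay (ε / 2) (half_pos hε)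
      refine ⟨max R₀ (1 + 2 * ‖c‖ / ε + 1), fun k hk hkR => ?_⟩
      have k1 : R₀ ≤ ‖k‖ := (le_max_left _ _).trans hkR
      have k2 : 1 + 2 * ‖c‖ / ε + 1 ≤ ‖k‖ := (le_max_right _ _).trans hkR
      have h0 : 0 ≤ 2 * ‖c‖ / ε := by positivity
      have hkp : 0 < ‖k‖ := by linarith
      have hk0 : k ≠ 0 := norm_pos_iff.1 hkp
      have e : k * (N k - c * (k + Complex.I)⁻¹) = k * (N k - c / k) +
          c * Complex.I / (k + Complex.I) := by
        have := hne k hk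
        field_simp
        ring
      rw [← norm_mul, e]
      refine (norm_add_le _ _).trans ?_
      rw [norm_mul]
      have h1 := hR k hk k1
      rw [← hc] at h1
      have h2 : ‖c * Complex.I / (k + Complex.I)‖ ≤ ε / 2 := by
        rw [norm_div, norm_mul, Complex.norm_I, mul_one, div_le_iff₀ (by linarith [hge k hk])]
        have h3 : ‖k‖ - 1 ≤ ‖k + Complex.I‖ := by
          have := norm_sub_norm_le k (-Complex.I)
          rwa [norm_neg, Complex.norm_I, sub_neg_eq_add] at this
        have h4 : 2 * ‖c‖ / ε ≤ ‖k + Complex.I‖ := by linarith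
        rw [div_le_iff₀ hε] at h4
        linarith
      linarith)
  have h2 := hG.add (tendsto_integral_inv_add_I.const_mul c)
  have h3 := (h2.const_mul (Complex.I / Real.pi))
  have h4 := hr.tendsto_cosTransform hP ha le_rfl
  simp only [Complex.ofReal_zero, mul_zero, Complex.cos_zero, mul_one] at h4
  have h5 := tendsto_nhds_unique h4 (h3.congr fun R => ?_)
  · have hpi : (Real.pi : ℂ) ≠ 0 := by exact_mod_cast Real.pi_ne_zero
    have h6 : Complex.I / Real.pi * (0 + c * (-Complex.I * Real.pi)) = c := by
      field_simp
      linear_combination -(Real.pi * c) * Complex.I_sq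
    rw [h6, hc] at h5
    linear_combination h5
  · have hinv : Continuous fun s : ℝ => ((s : ℂ) + Complex.I)⁻¹ := by
      have : ∀ s : ℝ, (s : ℂ) + Complex.I ≠ 0 := fun s => hne s (by simp)
      fun_prop (disch := exact this)
    have hinv' : Continuous fun s : ℝ => c * ((s : ℂ) + Complex.I)⁻¹ := continuous_const.mul hinv
    rw [intervalIntegral.integral_sub (hr.intervalIntegrable _ _)
      (hinv'.intervalIntegrable _ _), intervalIntegral.integral_const_mul]
    ring

namespace IsLaplaceInverse

/-- The difference is the integral over `(y, ∞)`, compared with the absolutely convergent one at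
`τ₀`; this costs only a factor `e^{τ₀ y}`, bounded on `[0, X]`. -/
theorem norm_sub_integral_le {M : ℂ → ℂ} {a : ℝ → ℂ} (h : IsLaplaceInverse M a) (X : ℝ) :
    ∃ C τ₁ : ℝ, ∀ τ : ℝ, τ₁ ≤ τ → ∀ y ∈ Icc 0 X,
      ‖(-τ * M (-(τ : ℂ) ^ 2) - 1) - ∫ u in (0)..y, Complex.exp (-τ * u) * a u‖ ≤
        C * Real.exp (-τ * y) := by
  obtain ⟨τ₀, h⟩ := h
  obtain ⟨i₀, -⟩ := h τ₀ le_rfl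
  obtain ⟨A, hA⟩ : ∃ A, A = ∫ u in Ioi (0 : ℝ), ‖Complex.exp (-τ₀ * u) * a u‖ := ⟨_, rfl⟩
  have hA0 : 0 ≤ A := hA ▸ integral_nonneg fun u => norm_nonneg _
  refine ⟨Real.exp (|τ₀| * X) * A, τ₀, fun τ hτ y hy => ?_⟩
  obtain ⟨i, e⟩ := h τ hτ
  have hy0 : Ioi y ⊆ Ioi (0 : ℝ) := Ioi_subset_Ioi hy.1
  rw [← e, intervalIntegral.integral_of_le hy.1, ← Ioc_union_Ioi_eq_Ioi hy.1,
    setIntegral_union (Ioc_disjoint_Ioi le_rfl) measurableSet_Ioi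
      (i.mono_set Ioc_subset_Ioi_self) (i.mono_set hy0), add_sub_cancel_left]
  have h1 : ‖∫ u : ℝ in Ioi y, Complex.exp (-τ * u) * a u‖ ≤
      ∫ u : ℝ in Ioi y, Real.exp (-(τ - τ₀) * y) * ‖Complex.exp (-τ₀ * u) * a u‖ := by
    refine norm_integral_le_of_norm_le ((i₀.mono_set hy0).norm.const_mul _) ?_
    refine ae_restrict_of_forall_mem measurableSet_Ioi fun u hu => ?_
    have hu' : y < u := hu
    rw [norm_mul, norm_mul, ← mul_assoc]
    refine mul_le_mul_of_nonneg_right ?_ (norm_nonneg _)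
    rw [Complex.norm_exp, Complex.norm_exp, ← Real.exp_add, Real.exp_le_exp]
    have e1 : (-(τ : ℂ) * u).re = -τ * u := by simp
    have e2 : (-(τ₀ : ℂ) * u).re = -τ₀ * u := by simp
    rw [e1, e2]
    nlinarith
  refine h1.trans ?_
  rw [integral_const_mul]
  have h2 : ∫ u : ℝ in Ioi y, ‖Complex.exp (-τ₀ * u) * a u‖ ≤ A := by
    rw [hA]
    exact setIntegral_mono_set i₀.norm (Eventually.of_forall fun u => norm_nonneg _)
      (Eventually.of_forall hy0)
  have h3 : Real.exp (-(τ - τ₀) * y) ≤ Real.exp (|τ₀| * X) * Real.exp (-τ * y) := by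
    rw [← Real.exp_add, Real.exp_le_exp]
    have : τ₀ * y ≤ |τ₀| * X :=
      mul_le_mul (le_abs_self _) hy.2 hy.1 (abs_nonneg _)
    linarith
  calc Real.exp (-(τ - τ₀) * y) * ∫ u : ℝ in Ioi y, ‖Complex.exp (-τ₀ * u) * a u‖
      ≤ Real.exp (|τ₀| * X) * Real.exp (-τ * y) * A :=
        mul_le_mul h3 h2 (integral_nonneg fun u => norm_nonneg _) (by positivity)
    _ = Real.exp (|τ₀| * X) * A * Real.exp (-τ * y) := by ring

/-- Equal transforms make the truncated integrals at `X = t + 1` differ by `O(e^{-τX})`, which is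
the hypothesis of the Paley–Wiener criterion. -/
theorem unique {M M' : ℂ → ℂ} {a a' : ℝ → ℂ} (h : IsLaplaceInverse M a)
    (h' : IsLaplaceInverse M' a') (ha : ContinuousOn a (Ici 0)) (ha' : ContinuousOn a' (Ici 0))
    (hM : ∀ᶠ τ : ℝ in atTop, M (-(τ : ℂ) ^ 2) = M' (-(τ : ℂ) ^ 2)) {t : ℝ} (ht : 0 ≤ t) :
    a t = a' t := by
  have hX : 0 < t + 1 := by linarith
  obtain ⟨C, τ₁, hC⟩ := h.norm_sub_integral_le (t + 1)
  obtain ⟨C', τ₁', hC'⟩ := h'.norm_sub_integral_le (t + 1)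
  obtain ⟨τ₂, hτ₂⟩ := eventually_atTop.1 hM
  have hsub : Icc 0 (t + 1) ⊆ Ici (0 : ℝ) := fun _ h => h.1
  have hd : ContinuousOn (fun u => a u - a' u) (Icc 0 (t + 1)) := (ha.mono hsub).sub (ha'.mono hsub)
  have h0 := eqOn_zero_of_exp_integral_bounded hX hd (C := C + C') (τ₀ := max τ₂ (max τ₁ τ₁'))
    fun τ hτ => by
      have t2 : τ₂ ≤ τ := (le_max_left _ _).trans hτ
      have t1 : τ₁ ≤ τ := (le_max_left _ _).trans ((le_max_right _ _).trans hτ)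
      have t1' : τ₁' ≤ τ := (le_max_right _ _).trans ((le_max_right _ _).trans hτ)
      have b1 := hC τ t1 (t + 1) ⟨hX.le, le_rfl⟩
      have b2 := hC' τ t1' (t + 1) ⟨hX.le, le_rfl⟩
      rw [hτ₂ τ t2] at b1
      have hi : ∀ f : ℝ → ℂ, ContinuousOn f (Ici 0) →
          IntervalIntegrable (fun u : ℝ => Complex.exp (-τ * u) * f u) volume 0 (t + 1) :=
        fun f hf => by
          refine ContinuousOn.intervalIntegrable ?_
          rw [uIcc_of_le hX.le]
          exact ContinuousOn.mul (by fun_prop) (hf.mono hsub)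
      have e : ∫ u in (0)..(t + 1), Real.exp (τ * (t + 1 - u)) • (a u - a' u) =
          (Real.exp (τ * (t + 1)) : ℂ) * ((∫ u in (0)..(t + 1), Complex.exp (-τ * u) * a u) -
            ∫ u in (0)..(t + 1), Complex.exp (-τ * u) * a' u) := by
        rw [← intervalIntegral.integral_sub (hi a ha) (hi a' ha'),
          ← intervalIntegral.integral_const_mul]
        refine intervalIntegral.integral_congr fun u _ => ?_
        have : τ * (t + 1 - u) = τ * (t + 1) + -τ * u := by ring
        simp only [Complex.real_smul]
        rw [this, Real.exp_add]
        push_cast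
        ring
      rw [e, norm_mul, Complex.norm_real, Real.norm_of_nonneg (Real.exp_pos _).le]
      have b3 := (norm_sub_le _ _).trans (add_le_add b2 b1)
      rw [sub_sub_sub_cancel_left] at b3
      calc _ ≤ Real.exp (τ * (t + 1)) * (C' * Real.exp (-τ * (t + 1)) +
            C * Real.exp (-τ * (t + 1))) := by gcongr
        _ = (C + C') * (Real.exp (τ * (t + 1)) * Real.exp (-τ * (t + 1))) := by ring
        _ = C + C' := by rw [← Real.exp_add]; simp
  exact sub_eq_zero.1 (h0 ⟨ht, by linarith⟩)

end IsLaplaceInverse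

end

/-! ### Convergence of the cut-off integrals for a cubic remainder. -/

section

/-- The quantitative decay, `O(|k|⁻²)` instead of `o(|k|⁻¹)`, is what makes the corrected integrand
absolutely integrable. -/
theorem IsReduced.exists_norm_sub_le {h : ℝ} {M m N : ℂ → ℂ} {P : Finset ℝ} {α : ℝ → ℝ}
    (hr : IsReduced h M m P α N) {C R₀ : ℝ} (hM : ∀ k : ℂ, 0 < k.im → R₀ ≤ ‖k‖ →
      ‖M (k ^ 2) - (1 / (Complex.I * k) + h / k ^ 2)‖ ≤ C / ‖k‖ ^ 3) :
    ∃ D R₁ : ℝ, 0 ≤ D ∧ 1 ≤ R₁ ∧ ∀ k : ℂ, 0 ≤ k.im → R₁ ≤ ‖k‖ →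
      ‖N k - ((h : ℂ) - ∑ p ∈ P, (α p : ℂ)) / k‖ ≤ D / ‖k‖ ^ 2 := by
  obtain ⟨S, hS⟩ : ∃ S, S = ∑ p ∈ P, |α p| * |p| := ⟨_, rfl⟩
  obtain ⟨S', hS'⟩ : ∃ S', S' = ∑ p ∈ P, |p| := ⟨_, rfl⟩
  have hS0 : 0 ≤ S := hS ▸ Finset.sum_nonneg fun p _ => by positivity
  have hS0' : 0 ≤ S' := hS' ▸ Finset.sum_nonneg fun p _ => by positivity
  obtain ⟨R, hR⟩ : ∃ R, R = |R₀| + 1 + 2 * S' := ⟨_, rfl⟩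
  have upper : ∀ k ∈ {k : ℂ | R < ‖k‖}, 0 < k.im →
      ‖N k - ((h : ℂ) - ∑ p ∈ P, (α p : ℂ)) / k‖ ≤ (|C| + 2 * S) / ‖k‖ ^ 2 := by
    intro k hkR hk
    have hkR : R < ‖k‖ := hkR
    have hk1 : 1 ≤ ‖k‖ := by linarith [abs_nonneg R₀]
    have hk2 : R₀ ≤ ‖k‖ := by linarith [le_abs_self R₀]
    have hkp : 0 < ‖k‖ := by linarith
    have hk0 : k ≠ 0 := norm_pos_iff.1 hkp
    have hsq : ‖k‖ ≤ ‖k‖ ^ 2 := by nlinarith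
    have hp : ∀ p ∈ P, ‖k‖ ^ 2 / 2 ≤ ‖k ^ 2 - (p : ℂ)‖ := fun p hp => by
      have h1 := norm_sub_norm_le (k ^ 2) (p : ℂ)
      rw [norm_pow, Complex.norm_real, Real.norm_eq_abs] at h1
      have h2 : |p| ≤ S' := hS' ▸ Finset.single_le_sum (f := fun p : ℝ => |p|)
        (fun p _ => abs_nonneg p) hp
      linarith [abs_nonneg R₀]
    have hkP : ∀ p ∈ P, k ^ 2 ≠ (p : ℂ) := fun p hpP h => by
      have := hp p hpP
      rw [h, sub_self, norm_zero] at this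
      nlinarith
    have key := mul_reduced_sub (α := α) hk0 hkP h (m k)
    rw [← hr.eq k ⟨hk.le, hk0, hkP⟩, hr.m_eq k hk] at key
    have b1 : ‖k ^ 2 * (M (k ^ 2) - (1 / (Complex.I * k) + h / k ^ 2))‖ ≤ |C| / ‖k‖ := by
      rw [norm_mul, norm_pow]
      calc ‖k‖ ^ 2 * _ ≤ ‖k‖ ^ 2 * (C / ‖k‖ ^ 3) := by gcongr; exact hM k hk hk2
        _ = C / ‖k‖ := by field_simp
        _ ≤ |C| / ‖k‖ := by gcongr; exact le_abs_self C
    have b2 : ‖∑ p ∈ P, (α p : ℂ) * (p / (k ^ 2 - p))‖ ≤ 2 * S / ‖k‖ := by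
      rw [hS, Finset.mul_sum, Finset.sum_div]
      refine norm_sum_le_of_le P fun p hpP => ?_
      rw [norm_mul, norm_div, Complex.norm_real, Complex.norm_real, Real.norm_eq_abs,
        Real.norm_eq_abs]
      have h2 : ‖k‖ / 2 ≤ ‖k ^ 2 - (p : ℂ)‖ := by linarith [hp p hpP]
      calc |α p| * (|p| / ‖k ^ 2 - (p : ℂ)‖) ≤ |α p| * (|p| / (‖k‖ / 2)) := by gcongr
        _ = 2 * (|α p| * |p|) / ‖k‖ := by field_simp
    have b3 := (norm_sub_le _ _).trans (add_le_add b1 b2)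
    rw [← key, norm_mul, ← add_div, le_div_iff₀ hkp] at b3
    rw [le_div_iff₀ (by positivity)]
    linarith
  refine ⟨|C| + 2 * S, R + 1, by positivity, by linarith [abs_nonneg R₀], fun k hk hkR => ?_⟩
  have hkp : 0 < ‖k‖ := by linarith [abs_nonneg R₀]
  exact norm_le_of_upper (G := fun k => N k - ((h : ℂ) - ∑ p ∈ P, (α p : ℂ)) / k)
    (c := fun k => (|C| + 2 * S) / ‖k‖ ^ 2)
    (hr.cont.sub (continuousOn_const.div continuousOn_id fun k hk => hk.2))
    (continuousOn_const.div (continuous_norm.pow 2).continuousOn fun k hk =>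
      pow_ne_zero _ (norm_ne_zero_iff.2 hk))
    (O := {k | R < ‖k‖}) (isOpen_lt continuous_const continuous_norm) upper
    (by simp only [mem_ofPred_eq]; linarith) hk (norm_pos_iff.1 hkp)

theorem norm_cos_ofReal_mul_le (s t : ℝ) : ‖Complex.cos (s * t)‖ ≤ 1 := by
  rw [← Complex.ofReal_mul, ← Complex.ofReal_cos, Complex.norm_real, Real.norm_eq_abs]
  exact Real.abs_cos_le_one _

/-- The function `c s / (s² + 1)` has the same `c / s` tail as `N` but is odd, so it contributes
nothing to symmetric integrals. The difference is `O(1 / (1 + s²))`, and its cosine transform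
converges absolutely to a continuous function. -/
theorem IsReduced.exists_tendsto_gCutoff {h : ℝ} {M m N : ℂ → ℂ} {P : Finset ℝ} {α : ℝ → ℝ}
    (hr : IsReduced h M m P α N) (hP : ∀ p ∈ P, p < 0) {C R₀ : ℝ}
    (hM : ∀ k : ℂ, 0 < k.im → R₀ ≤ ‖k‖ →
      ‖M (k ^ 2) - (1 / (Complex.I * k) + h / k ^ 2)‖ ≤ C / ‖k‖ ^ 3) :
    ∃ a : ℝ → ℂ, Continuous a ∧ ∀ t : ℝ, Tendsto (gCutoff M P α t 0) atTop (𝓝 (a t)) := by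
  obtain ⟨D, R₁, hD, hR₁, hN⟩ := hr.exists_norm_sub_le hM
  obtain ⟨C₁, hC₁0, hC₁⟩ := hr.exists_norm_le
  obtain ⟨c, hc⟩ : ∃ c : ℂ, c = (h : ℂ) - ∑ p ∈ P, (α p : ℂ) := ⟨_, rfl⟩
  rw [← hc] at hN
  have hden : ∀ s : ℝ, (s : ℂ) ^ 2 + 1 ≠ 0 := fun s => by
    have : s ^ 2 + 1 ≠ 0 := by positivity
    exact_mod_cast this
  have hdn : ∀ s : ℝ, ‖(s : ℂ) ^ 2 + 1‖ = s ^ 2 + 1 := fun s => by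
    have : (s : ℂ) ^ 2 + 1 = ((s ^ 2 + 1 : ℝ) : ℂ) := by push_cast; ring
    rw [this, Complex.norm_real, Real.norm_of_nonneg (by positivity)]
  let u : ℝ → ℂ := fun s => c * (s / ((s : ℂ) ^ 2 + 1))
  have hu : Continuous u := by
    unfold u
    fun_prop (disch := exact hden)
  let G : ℝ → ℂ := fun s => N s - u s
  have hGm : AEStronglyMeasurable G volume := hr.aestronglyMeasurable.sub hu.aestronglyMeasurable
  have hne : ∀ᵐ t : ℝ, t ≠ 0 := by simp [ae_iff, measure_singleton]
  let E : ℝ := 2 * (D + ‖c‖) + (C₁ + ‖c‖) * (1 + R₁ ^ 2)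
  have hGb : ∀ s : ℝ, s ≠ 0 → ‖G s‖ ≤ E * (1 + s ^ 2)⁻¹ := by
    intro s hs
    have hsc : (s : ℂ) ≠ 0 := by exact_mod_cast hs
    have hsn : ‖(s : ℂ)‖ = |s| := by rw [Complex.norm_real, Real.norm_eq_abs]
    have hs2 := sq_abs s
    have hspos : 0 < |s| := abs_pos.2 hs
    have p1 : 0 ≤ 2 * (D + ‖c‖) := by positivity
    have p2 : 0 ≤ (C₁ + ‖c‖) * (1 + R₁ ^ 2) := by positivity
    rw [← div_eq_mul_inv, le_div_iff₀ (by positivity)]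
    rcases le_or_gt R₁ |s| with h1 | h1
    · have b1 := hN s (by simp) (by rw [hsn]; exact h1)
      rw [hsn] at b1
      have e1 : G s = (N s - c / s) + c / (s * ((s : ℂ) ^ 2 + 1)) := by
        have := hden s
        simp only [G, u]
        field_simp
        ring
      have b2 : ‖c / (s * ((s : ℂ) ^ 2 + 1))‖ ≤ ‖c‖ / |s| ^ 2 := by
        rw [norm_div, norm_mul, hsn, hdn]
        refine div_le_div_of_nonneg_left (norm_nonneg _) (by positivity) ?_
        nlinarith
      have b3 : ‖G s‖ ≤ (D + ‖c‖) / |s| ^ 2 := by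
        rw [e1, add_div]
        exact (norm_add_le _ _).trans (add_le_add b1 b2)
      rw [le_div_iff₀ (by positivity), hs2] at b3
      have : 1 ≤ s ^ 2 := by nlinarith
      have : ‖G s‖ * 1 ≤ ‖G s‖ * s ^ 2 := by gcongr
      simp only [E]
      linarith
    · have b1 := hC₁ s (by simp) hsc
      have b2 : ‖u s‖ ≤ ‖c‖ := by
        simp only [u]
        rw [norm_mul, norm_div, hsn, hdn]
        refine mul_le_of_le_one_right (norm_nonneg _) ((div_le_one (by positivity)).2 ?_)
        nlinarith
      have b3 : ‖G s‖ ≤ C₁ + ‖c‖ := (norm_sub_le _ _).trans (add_le_add b1 b2)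
      have b4 : 1 + s ^ 2 ≤ 1 + R₁ ^ 2 := by nlinarith
      have := mul_le_mul b3 b4 (by positivity) (by positivity)
      simp only [E]
      linarith
  have hGi : Integrable G := (integrable_inv_one_add_sq.const_mul E).mono' hGm
    (hne.mono fun s hs => hGb s hs)
  have hGt : ∀ t : ℝ, Integrable fun s : ℝ => G s * Complex.cos (s * t) := fun t =>
    hGi.mul_bdd (c := 1) (Continuous.aestronglyMeasurable (by fun_prop))
      (Eventually.of_forall fun s => norm_cos_ofReal_mul_le s t)
  refine ⟨fun t => Complex.I / Real.pi * (∫ s : ℝ, G s * Complex.cos (s * t)) +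
    ∑ p ∈ P, α p * Complex.cos (physRoot p * t), ?_, fun t => ?_⟩
  · refine Continuous.add (continuous_const.mul ?_) (by fun_prop)
    refine continuous_of_dominated (bound := fun s => ‖G s‖) (fun t => (hGt t).aestronglyMeasurable)
      (fun t => Eventually.of_forall fun s => ?_) hGi.norm
      (Eventually.of_forall fun s => by fun_prop)
    rw [norm_mul]
    exact mul_le_of_le_one_right (norm_nonneg _) (norm_cos_ofReal_mul_le s t)
  · have h1 := intervalIntegral_tendsto_integral (hGt t) tendsto_neg_atTop_atBot tendsto_id
    refine ((h1.const_mul (Complex.I / Real.pi)).add_const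
      (∑ p ∈ P, α p * Complex.cos (physRoot p * t))).congr fun R => ?_
    rw [hr.gCutoff_eq hP]
    simp only [Complex.ofReal_zero, mul_zero, Complex.cos_zero, mul_one, id]
    congr 2
    have e0 : ∫ s in (-R)..R, u s * Complex.cos (s * t) = 0 := by
      refine integral_symm_of_odd (f := fun s : ℝ => u s * Complex.cos (s * t)) (fun s => ?_) R
      simp only [u, Complex.ofReal_neg, neg_sq, neg_mul, neg_div, mul_neg, Complex.cos_neg]
    have huc : Continuous fun s : ℝ => u s * Complex.cos (s * t) := hu.mul (by fun_prop)
    have e1 : ∫ s in (-R)..R, N s * Complex.cos (s * t) =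
        ∫ s in (-R)..R, (G s * Complex.cos (s * t) + u s * Complex.cos (s * t)) := by
      refine intervalIntegral.integral_congr fun s _ => ?_
      simp only [G]
      ring
    rw [e1, intervalIntegral.integral_add (hGt t).intervalIntegrable
      (huc.intervalIntegrable _ _), e0, add_zero]

end

/-! ### Spectral data of a potential. -/

section

theorem IsJostFamily.exists_norm_le {q : ℝ → ℝ} {b : ℝ} {f f' : ℂ → ℝ → ℂ}
    (hJ : IsJostFamily q b f f') (hb : 0 < b) (hq : Continuous q) :
    ∃ τ₁ : ℝ, 0 < τ₁ ∧ ∀ τ ≥ τ₁, ∀ x ≥ 0, ‖f (Complex.I * τ) x‖ ≤ 2 * Real.exp (-τ * x) := by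
  obtain ⟨B, hB⟩ := isCompact_Icc.exists_bound_of_continuousOn (hq.continuousOn (s := Icc 0 b))
  have hB0 : 0 ≤ B := (norm_nonneg _).trans (hB 0 ⟨le_rfl, hb.le⟩)
  refine ⟨1 + 2 * (B * b), by positivity, fun τ hτ x hx => ?_⟩
  have hBb : 0 ≤ B * b := by positivity
  have hτ0 : 0 < τ := by linarith
  have hII : Complex.I * (Complex.I * (τ : ℂ)) = -τ := by
    rw [← mul_assoc, Complex.I_mul_I, neg_one_mul]
  have hn : ‖Complex.I * (τ : ℂ)‖ = τ := by
    rw [norm_mul, Complex.norm_I, one_mul, Complex.norm_real, Real.norm_of_nonneg hτ0.le]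
  have hexp : ‖Complex.exp (-(τ : ℂ) * x)‖ = Real.exp (-τ * x) := by
    rw [Complex.norm_exp]; simp
  rcases le_total x b with h1 | h1
  · have h2 := hJ.norm_exp_mul_sub_one_le hb hq (fun t ht => hB t ht) (k := Complex.I * τ)
      (by simpa using hτ0.le) (by rw [hn]; linarith)
      (mul_ne_zero Complex.I_ne_zero (by exact_mod_cast hτ0.ne')) ⟨hx, h1⟩
    rw [hn, hII, neg_neg] at h2
    have h3 : 2 * (B * b) / τ ≤ 1 := by rw [div_le_one hτ0]; linarith
    have h4 : ‖Complex.exp (τ * x) * f (Complex.I * τ) x‖ ≤ 2 := by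
      have := norm_sub_norm_le (Complex.exp (τ * x) * f (Complex.I * τ) x) 1
      rw [norm_one] at this
      linarith
    have h5 : f (Complex.I * τ) x =
        (Complex.exp (τ * x) * f (Complex.I * τ) x) * Complex.exp (-(τ : ℂ) * x) := by
      rw [mul_right_comm, ← Complex.exp_add, neg_mul, add_neg_cancel, Complex.exp_zero, one_mul]
    rw [h5, norm_mul, hexp]
    gcongr
  · rw [hJ.eq_exp _ x h1, hII, hexp]
    linarith [Real.exp_pos (-τ * x)]

/-- The spectral data attached to a potential. -/
structure IsSpectralData (h xI : ℝ) (V : ℝ → ℝ) (P : Finset ℝ) (α : ℝ → ℝ) (a : ℝ → ℂ)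
    (K : ℝ → ℝ → ℝ) : Prop where
  zero_of_mem : ∀ p ∈ P, weylFunction h xI V p = 0
  hasPoles : HasPoles (weylFunction h xI V) P α
  hasBoundaryValues : HasBoundaryValues (weylFunction h xI V) P
  jump_pos : ∀ l > 0, ∃ t : ℝ, 0 < t ∧ jump (weylFunction h xI V) l = t
  asymptotics : HasWeylAsymptotics h (weylFunction h xI V)
  cont : Continuous a
  tendsto : ∀ x ≥ 0, ∀ y ≥ 0,
    Tendsto (gCutoff (weylFunction h xI V) P α x y) atTop (𝓝 (glKernel a x y))
  laplace : IsLaplaceInverse (weylFunction h xI V) a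
  kernel : IsTransformationKernel h (extendPot V) K
  gl : ∀ x > 0, ∀ y ∈ Icc 0 x, factorKernel K (glKernel a) x y = -K x y

/-- The whole direct problem in one package; both injectivity and surjectivity start from it. -/
theorem exists_isSpectralData {xI : ℝ} (hxI : 0 < xI) {V : ℝ → ℝ}
    (hV : ∀ b > 0, AbsolutelyContinuousOnInterval V 0 b) (hs : tsupport V ⊆ Icc 0 xI) (h : ℝ) :
    ∃ P α a K, IsSpectralData h xI V P α a K := by
  have hq := continuous_extendPot hV
  have hq0 := extendPot_eq_zero hxI hV hs
  obtain ⟨f, f', hJ, C, R₀, hC, hR₀, hfF⟩ := exists_family hxI hV hs h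
  have hfin := hJ.finite_zeros h fun k hk hkR => (hfF k hk hkR).1
  obtain ⟨P, hP0, hP⟩ := exists_poles hxI hV hs hJ hfin
  obtain ⟨hz, α, hα⟩ := exists_hasPoles hxI hV hs hJ hP0 hP
  have hbd := hasBoundaryValues_weylFunction hxI hV hs hJ hP
  have hM : ∀ k : ℂ, 0 < k.im → R₀ ≤ ‖k‖ →
      ‖weylFunction h xI V (k ^ 2) - (1 / (Complex.I * k) + h / k ^ 2)‖ ≤ C / ‖k‖ ^ 3 :=
    fun k hk hkR => by
      rw [← weylFunction_sq hxI hV hs hJ hk]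
      exact (hfF k hk.le hkR).2.1
  have has := hasWeylAsymptotics_of_bound hM
  obtain ⟨N, hr⟩ := exists_isReduced hα (continuousOn_jostRatio hxI hV hs hJ hP)
    (fun k hk => weylFunction_sq hxI hV hs hJ hk) hbd.2 has
  obtain ⟨a, ha, hlim⟩ := hr.exists_tendsto_gCutoff hP0 hM
  have hlap := hr.isLaplaceInverse hP0 fun t _ => hlim t
  obtain ⟨K, hK⟩ := exists_isTransformationKernel h hxI hq hq0
  obtain ⟨c, c', s, s', H⟩ := exists_isFundamentalSystem hxI hq hq0
  obtain ⟨τ₁, hτ₁, hf⟩ := hJ.exists_norm_le hxI hq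
  -- Matching Cauchy data at `0` identifies `M φ + s` with `f / f_h`. The bounds `|f| ≤ 2 e^{-τx}`
  -- and `|f_h| ≥ τ / 4` give the constant `8`.
  have hψ : ∃ C τ₁ : ℝ, ∀ τ ≥ τ₁, ∀ x ≥ 0,
      τ * ‖weylFunction h xI V (-(τ : ℂ) ^ 2) * regSol K (Complex.I * τ) x +
        s (Complex.I * τ) x‖ ≤ C * Real.exp (-τ * x) := by
    refine ⟨8, max τ₁ R₀, fun τ hτ x hx => ?_⟩
    have t1 : τ₁ ≤ τ := (le_max_left _ _).trans hτ
    have hτ0 : 0 < τ := hτ₁.trans_le t1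
    have him : 0 < (Complex.I * (τ : ℂ)).im := by simpa using hτ0
    have hn : ‖Complex.I * (τ : ℂ)‖ = τ := by
      rw [norm_mul, Complex.norm_I, one_mul, Complex.norm_real, Real.norm_of_nonneg hτ0.le]
    have hsq : (Complex.I * (τ : ℂ)) ^ 2 = -(τ : ℂ) ^ 2 := by
      rw [mul_pow, Complex.I_sq, neg_one_mul]
    obtain ⟨hF, -, hF4⟩ := hfF _ him.le (by rw [hn]; exact (le_max_right _ _).trans hτ)
    have hw := weylFunction_sq (h := h) hxI hV hs hJ him
    rw [hsq] at hw
    rw [hn] at hF4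
    rw [← hw]
    obtain ⟨k, hk⟩ : ∃ k, k = Complex.I * (τ : ℂ) := ⟨_, rfl⟩
    rw [← hk] at hF hF4 ⊢
    have hb := hf τ t1 x hx
    rw [← hk] at hb
    have hsol := (((isSol_regSol hq hK k).lin (H.sol_s k) (f k 0 / (h * f k 0 + f' k 0)) 1).sub
      ((hJ.sol k).lin (hJ.sol k) (1 / (h * f k 0 + f' k 0)) 0))
    have hz := (hsol.eq_zero hxI hq hq0 le_rfl (by
      rw [regSol_zero_right, H.s_zero]
      field_simp
      ring) (by
      rw [regSolDeriv_zero_right, H.s'_zero, div_eq_mul_inv, one_div]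
      linear_combination -(mul_inv_cancel₀ hF)) hx).1
    have e : f k 0 / (h * f k 0 + f' k 0) * regSol K k x + s k x =
        f k x / (h * f k 0 + f' k 0) := by
      rw [sub_eq_zero] at hz
      linear_combination hz
    rw [e, norm_div, ← mul_div_assoc, div_le_iff₀ (by linarith)]
    have := Real.exp_pos (-τ * x)
    calc τ * ‖f k x‖ ≤ τ * (2 * Real.exp (-τ * x)) := by gcongr
      _ = 8 * Real.exp (-τ * x) * (τ / 4) := by ring
      _ ≤ _ := by gcongr
  refine ⟨P, α, a, K, hz, hα, hbd, fun l hl => jump_weylFunction_pos hxI hV hs hJ hP0 hP hl, has, ha,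
    fun x hx y hy => hr.tendsto_glKernel hP0 (fun t _ => hlim t) hx hy, hlap, hK,
    fun x hx y hy => ?_⟩
  have := gelfandLevitan_of_weyl hq hK H.sol_s (fun κ => H.cont_s.comp (Continuous.prodMk_right κ))
    H.s_zero H.s'_zero ha (m := fun τ : ℝ => weylFunction h xI V (-(τ : ℂ) ^ 2)) hψ
    (fun X => hlap.norm_sub_integral_le X) hx hy
  rw [factorKernel]
  linear_combination this

end

/-! ### The Weyl function of a potential belongs to the class. -/

section

theorem hasDerivWithinAt_diag {h : ℝ} {q : ℝ → ℝ} {K : ℝ → ℝ → ℝ} (hq : Continuous q)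
    (hK : IsTransformationKernel h q K) {x : ℝ} (hx : 0 ≤ x) :
    HasDerivWithinAt (fun t => K t t) (q x / 2) (Ici 0) x := by
  have h1 : HasDerivAt (fun t => -h + (1 / 2) * ∫ u in (0)..t, q u) ((1 / 2) * q x) x :=
    ((intervalIntegral.integral_hasDerivAt_right (hq.intervalIntegrable _ _)
      (hq.stronglyMeasurableAtFilter _ _) hq.continuousAt).const_mul _).const_add _
  refine (h1.hasDerivWithinAt.congr (fun t ht => hK.diag t ht) (hK.diag x hx)).congr_deriv ?_
  ring

theorem IsSpectralData.isGLSolution {h xI : ℝ} {V : ℝ → ℝ} {P : Finset ℝ} {α : ℝ → ℝ}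
    {a : ℝ → ℂ} {K : ℝ → ℝ → ℝ} (H : IsSpectralData h xI V P α a K) {x : ℝ} (hx : 0 < x) :
    IsGLSolution (glKernel a) x fun s => K x s := by
  refine ⟨Continuous.continuousOn ?_, fun y hy => ?_⟩
  · have := H.kernel.cont.comp (Continuous.prodMk_right x)
    exact Complex.continuous_ofReal.comp this
  · have := H.gl x hx y hy
    rw [factorKernel] at this
    linear_combination this

theorem IsSpectralData.eqOn_of_isGLSolution {h xI : ℝ} {V : ℝ → ℝ} {P : Finset ℝ} {α : ℝ → ℝ}
    {a : ℝ → ℂ} {K : ℝ → ℝ → ℝ} (H : IsSpectralData h xI V P α a K) {x : ℝ} (hx : 0 < x)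
    {κ : ℝ → ℂ} (hκ : IsGLSolution (glKernel a) x κ) : EqOn κ (fun s => (K x s : ℂ)) (Icc 0 x) := by
  obtain ⟨B, hB⟩ := H.kernel.bdd
  obtain ⟨hKc, hKe⟩ := H.isGLSolution hx
  obtain ⟨hκc, hκe⟩ := hκ
  have hd : ContinuousOn (fun s => κ s - K x s) (Icc 0 x) := hκc.sub hKc
  obtain ⟨C, hC⟩ := isCompact_Icc.exists_bound_of_continuousOn hd
  -- Retraction of the line to `[0, x]`, to extend the difference of two solutions to a bounded
  -- continuous function.
  let r : ℝ → ℝ := fun s => max 0 (min s x)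
  have hr : ∀ s, r s ∈ Icc 0 x := fun s =>
    ⟨le_max_left _ _, max_le hx.le (min_le_right _ _)⟩
  have hre : ∀ s ∈ Icc 0 x, r s = s := fun s hs => by
    simp only [r]
    rw [min_eq_left hs.2, max_eq_right hs.1]
  have hk : Continuous fun s => κ (r s) - K x (r s) :=
    hd.comp_continuous (by fun_prop) hr
  have hg := continuous_glKernel H.cont
  have h0 := eq_zero_of_gl_homogeneous (g := glKernel a) H.kernel.cont hB hg
    (fun s hs t ht => H.gl s hs.1 t ht) hk (fun t => hC _ (hr t)) fun t ht => by
      have e : ∫ s in (0)..x, (κ (r s) - K x (r s)) * glKernel a s t =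
          (∫ s in (0)..x, κ s * glKernel a s t) - ∫ s in (0)..x, (K x s : ℂ) * glKernel a s t := by
        have hgt : Continuous fun s => glKernel a s t := hg.comp (Continuous.prodMk_left t)
        rw [← intervalIntegral.integral_sub]
        · refine intervalIntegral.integral_congr fun s hs => ?_
          rw [uIcc_of_le hx.le] at hs
          simp only [hre s hs]
          ring
        · refine ContinuousOn.intervalIntegrable ?_
          rw [uIcc_of_le hx.le]
          exact hκc.mul hgt.continuousOn
        · refine ContinuousOn.intervalIntegrable ?_
          rw [uIcc_of_le hx.le]
          exact hKc.mul hgt.continuousOn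
      rw [e, hre t ht]
      linear_combination hκe t ht - hKe t ht
  intro s hs
  have := h0 s hs
  rw [hre s hs] at this
  exact sub_eq_zero.1 this

/-- Positive measure provides a support point other than the origin, hence a nearby point with `V ≠
0`, and continuity on the positive half-line gives an open set of them. The origin is avoided
because `V`, extended by zero, may jump there. -/
theorem volume_pos_of_tsupport {xI : ℝ} {V : ℝ → ℝ}
    (hV : ∀ b > 0, AbsolutelyContinuousOnInterval V 0 b) (hs : tsupport V ⊆ Icc 0 xI) {ε : ℝ}
    (h : 0 < volume (Ioo (xI - ε) xI ∩ tsupport V)) :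
    0 < volume {x | x ∈ Ioo (xI - ε) xI ∧ 0 < x ∧ V x ≠ 0} := by
  have h1 : 0 < volume ((Ioo (xI - ε) xI ∩ tsupport V) \ {0}) := by
    rwa [measure_sdiff_null (measure_singleton 0)]
  obtain ⟨y, ⟨hy1, hy2⟩, hy0⟩ := nonempty_of_measure_ne_zero h1.ne'
  have hy : 0 < y := lt_of_le_of_ne (hs hy2).1 fun h => hy0 h.symm
  have ho : IsOpen (Ioo (xI - ε) xI ∩ Ioi 0) := isOpen_Ioo.inter isOpen_Ioi
  obtain ⟨z, hz1, hz2⟩ := mem_closure_iff.1 hy2 _ ho ⟨hy1, hy⟩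
  have ho' : IsOpen ((Ioo (xI - ε) xI ∩ Ioi 0) ∩ {x | extendPot V x ≠ 0}) :=
    ho.inter (isOpen_ne_fun (continuous_extendPot hV) continuous_const)
  refine (ho'.measure_pos volume ⟨z, hz1, ?_⟩).trans_le (measure_mono ?_)
  · rw [mem_ofPred_eq, extendPot_of_nonneg V (le_of_lt hz1.2)]
    exact hz2
  · rintro x ⟨⟨hx1, hx2⟩, hx3⟩
    have hx3' : extendPot V x ≠ 0 := hx3
    rw [extendPot_of_nonneg V (le_of_lt hx2)] at hx3'
    exact ⟨hx1, hx2, hx3'⟩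

theorem weylFunction_mem_weylClass {h xI : ℝ} (hxI : 0 < xI) {V : ℝ → ℝ}
    (hV : V ∈ potentialClass xI) : weylFunction h xI V ∈ weylClass h xI := by
  obtain ⟨hac, -, -, hs, hpos⟩ := hV
  obtain ⟨P, α, a, K, H⟩ := exists_isSpectralData hxI hac hs h
  refine ⟨P, α, fun z hz => indicator_of_notMem hz _, H.zero_of_mem, H.hasPoles,
    H.hasBoundaryValues, H.jump_pos, H.asymptotics, glKernel a, fun x y => K x y, H.tendsto,
    ?_, fun x hx => ⟨H.isGLSolution hx, fun κ hκ => H.eqOn_of_isGLSolution hx hκ⟩,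
    fun x _ => Complex.ofReal_im _, fun x => 1 / 2 * V x, fun x hx => ?_,
    fun b hb => (hac b hb).const_mul (1 / 2), fun x hx => ?_,
    fun ε hε => ?_⟩
  · exact (Complex.continuous_ofReal.comp H.kernel.cont).continuousOn
  · have := hasDerivWithinAt_diag (continuous_extendPot hac) H.kernel hx
    rw [extendPot_of_nonneg V hx] at this
    rw [div_eq_inv_mul, ← one_div] at this
    simpa only [Complex.ofReal_re] using this
  · have := eq_zero_of_tsupport_subset hs (t := x) fun h => not_lt.2 h.2 hx
    simp only [this, mul_zero]
  · have := volume_pos_of_tsupport hac hs (hpos ε hε)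
    refine this.trans_le (measure_mono fun x hx => ⟨hx.1, hx.2.1, ?_⟩)
    exact mul_ne_zero (by norm_num) hx.2.2

end

/-! ### The identity theorem on the cut plane, and injectivity. -/

section

theorem isPreconnected_cutPlane : IsPreconnected cutPlane := by
  have h : cutPlane = (fun z : ℂ => -z) '' Complex.slitPlane := by
    ext z
    simp only [image_neg_eq_neg, Set.mem_neg, Complex.mem_slitPlane_iff, cutPlane, mem_ofPred_eq,
      not_and_or, not_le, Complex.neg_re, Complex.neg_im, neg_pos, Ne, neg_eq_zero]
  rw [h]
  refine IsPreconnected.image ?_ _ (by fun_prop)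
  exact (Complex.starConvex_one_slitPlane.isPathConnected
    Complex.one_mem_slitPlane).isConnected.isPreconnected

/-- The principal part at every real point. -/
theorem HasPoles.exists_tendsto {M : ℂ → ℂ} {P : Finset ℝ} {α : ℝ → ℝ} (hM : HasPoles M P α)
    {p : ℝ} (hp : p < 0) : ∃ c : ℂ, Tendsto (fun z : ℂ => (z - p) * M z) (𝓝[≠] (p : ℂ)) (𝓝 c) ∧
      (p ∉ P → c = 0) := by
  by_cases hpP : p ∈ P
  · exact ⟨α p, (hM.2 p hpP).2.2, fun h => absurd hpP h⟩
  · have h1 : ContinuousAt (fun z : ℂ => (z - p) * M z) p := by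
      refine ContinuousAt.mul (by fun_prop) (hM.1 p ⟨ofReal_mem_cutPlane hp, ?_⟩).continuousAt
      rintro ⟨q, hq, hqp⟩
      exact hpP ((Complex.ofReal_injective hqp) ▸ hq)
    have h2 := h1.tendsto
    rw [sub_self, zero_mul] at h2
    exact ⟨0, h2.mono_left nhdsWithin_le_nhds, fun _ => rfl⟩

open Classical in
/-- A function of the class is determined by its values at large negative points. -/
theorem HasPoles.eqOn_of_eventually_eq {M M' : ℂ → ℂ} {P P' : Finset ℝ} {α α' : ℝ → ℝ}
    (hM : HasPoles M P α) (hM' : HasPoles M' P' α')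
    (h : ∀ᶠ τ : ℝ in atTop, M (-(τ : ℂ) ^ 2) = M' (-(τ : ℂ) ^ 2)) :
    ∀ z ∈ cutPlane, z ∉ ((↑) '' ((P ∪ P' : Finset ℝ) : Set ℝ) : Set ℂ) → M z = M' z := by
  let Z : Set ℂ := (↑) '' ((P ∪ P' : Finset ℝ) : Set ℝ)
  have hZ : Z.Finite := (P ∪ P').finite_toSet.image _
  have hneg : ∀ p ∈ P ∪ P', p < 0 := fun p hp => by
    rcases Finset.mem_union.1 hp with h | h
    exacts [(hM.2 p h).1, (hM'.2 p h).1]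
  have han : ∀ z ∈ cutPlane \ Z, AnalyticAt ℂ M z ∧ AnalyticAt ℂ M' z := fun z hz => by
    refine ⟨hM.1 z ⟨hz.1, fun ⟨p, hp, hpz⟩ => hz.2 ⟨p, ?_, hpz⟩⟩,
      hM'.1 z ⟨hz.1, fun ⟨p, hp, hpz⟩ => hz.2 ⟨p, ?_, hpz⟩⟩⟩
    · exact Finset.mem_coe.2 (Finset.mem_union_left _ hp)
    · exact Finset.mem_coe.2 (Finset.mem_union_right _ hp)
  -- Multiplication by `W` clears the simple poles of both functions, so the difference extends
  -- analytically to the whole cut plane.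
  let W : ℂ → ℂ := fun z => ∏ p ∈ P ∪ P', (z - p)
  have hW : Differentiable ℂ W := by
    unfold W
    fun_prop
  have hW0 : ∀ z ∉ Z, W z ≠ 0 := fun z hz => Finset.prod_ne_zero_iff.2 fun p hp h =>
    hz ⟨p, hp, (sub_eq_zero.1 h).symm⟩
  obtain ⟨F, hFd, hF⟩ := exists_differentiableOn_extension isOpen_cutPlane hZ
    (f := fun z => W z * (M z - M' z))
    (fun z hz => ((hW z).mul ((han z hz).1.differentiableAt.sub
      (han z hz).2.differentiableAt)).differentiableWithinAt)
    (by
      rintro _ ⟨p, hp, rfl⟩ _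
      obtain ⟨c, hc, -⟩ := hM.exists_tendsto (hneg p hp)
      obtain ⟨c', hc', -⟩ := hM'.exists_tendsto (hneg p hp)
      have hWp : W p = 0 := Finset.prod_eq_zero hp (sub_self _)
      have h1 : Tendsto W (𝓝[≠] (p : ℂ)) (𝓝 0) :=
        hWp ▸ (hW p).continuousAt.tendsto.mono_left nhdsWithin_le_nhds
      have h2 := h1.mul (hc.sub hc')
      rw [zero_mul] at h2
      refine h2.congr fun w => ?_
      ring)
  obtain ⟨T₁, hT₁⟩ := eventually_atTop.1 h
  have hFa : AnalyticOnNhd ℂ F cutPlane := hFd.analyticOnNhd isOpen_cutPlane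
  have hout : ∀ᶠ z in Bornology.cobounded ℂ, z ∉ Z := Bornology.isBounded_def.1 hZ.isBounded
  have tsq : Tendsto (fun τ : ℝ => -(τ : ℂ) ^ 2) atTop (Bornology.cobounded ℂ) := by
    rw [← tendsto_norm_atTop_iff_cobounded]
    refine (tendsto_pow_atTop (α := ℝ) two_ne_zero).congr fun τ => ?_
    rw [norm_neg, norm_pow, Complex.norm_real, Real.norm_eq_abs, sq_abs]
  have hev : ∀ᶠ τ : ℝ in atTop, F (-(τ : ℂ) ^ 2) = 0 := by
    filter_upwards [h, tsq.eventually hout] with τ h1 h2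
    rw [hF _ h2, h1, sub_self, mul_zero]
  obtain ⟨T, hT⟩ := eventually_atTop.1 hev
  -- The points `-τ²` with `τ > T'` are zeros accumulating at `-T'²`, which is negative and so lies
  -- inside the domain.
  obtain ⟨T', hT'⟩ : ∃ T', T' = max T 1 := ⟨_, rfl⟩
  have hT'0 : 0 < T' := hT' ▸ lt_max_of_lt_right one_pos
  have hmem : -(T' : ℂ) ^ 2 ∈ cutPlane := by
    have : -(T' : ℂ) ^ 2 = ((-T' ^ 2 : ℝ) : ℂ) := by push_cast; ring
    rw [this]
    exact ofReal_mem_cutPlane (by simpa using pow_pos hT'0 2)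
  have hfreq : ∃ᶠ z in 𝓝[≠] (-(T' : ℂ) ^ 2), F z = 0 := by
    have t1 : Tendsto (fun τ : ℝ => -(τ : ℂ) ^ 2) (𝓝[>] T') (𝓝[≠] (-(T' : ℂ) ^ 2)) := by
      refine tendsto_nhdsWithin_of_tendsto_nhds_of_eventually_within _
        ((Continuous.tendsto (by fun_prop) _).mono_left nhdsWithin_le_nhds) ?_
      filter_upwards [self_mem_nhdsWithin] with τ hτ h0
      have hτ' : T' < τ := hτ
      rw [mem_singleton_iff, neg_inj] at h0
      have h1 : τ ^ 2 = T' ^ 2 := by exact_mod_cast h0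
      nlinarith
    refine t1.frequently (Eventually.frequently ?_)
    filter_upwards [self_mem_nhdsWithin] with τ hτ
    have hτ' : T' < τ := hτ
    exact hT τ ((le_max_left _ _).trans (hT' ▸ hτ'.le))
  have hzero := hFa.eqOn_zero_of_preconnected_of_frequently_eq_zero isPreconnected_cutPlane hmem
    hfreq
  intro z hz hzZ
  have h1 := hzero hz
  rw [hF z hzZ] at h1
  exact sub_eq_zero.1 ((mul_eq_zero.1 h1).resolve_left (hW0 z hzZ))

-- A pole of `M` at which `M'` is regular would have residue zero, whereas residues are positive.
open Classical in
theorem HasPoles.subset_of_eventually_eq {M M' : ℂ → ℂ} {P P' : Finset ℝ} {α α' : ℝ → ℝ}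
    (hM : HasPoles M P α) (hM' : HasPoles M' P' α')
    (h : ∀ᶠ τ : ℝ in atTop, M (-(τ : ℂ) ^ 2) = M' (-(τ : ℂ) ^ 2)) : P ⊆ P' := by
  intro p hp
  by_contra hp'
  obtain ⟨hp0, hα, ht⟩ := hM.2 p hp
  obtain ⟨c, hc, hc0⟩ := hM'.exists_tendsto hp0
  have heq := hM.eqOn_of_eventually_eq hM' h
  have hne : ∀ᶠ z in 𝓝[≠] (p : ℂ), (z - p) * M z = (z - p) * M' z := by
    have h1 : IsOpen (cutPlane \ ((↑) '' (((P ∪ P').erase p : Finset ℝ) : Set ℝ) : Set ℂ)) :=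
      isOpen_cutPlane.sdiff ((Finset.finite_toSet _).image _).isClosed
    have h2 : (p : ℂ) ∈ cutPlane \ ((↑) '' (((P ∪ P').erase p : Finset ℝ) : Set ℝ) : Set ℂ) := by
      refine ⟨ofReal_mem_cutPlane hp0, ?_⟩
      rintro ⟨q, hq, hqp⟩
      exact (Finset.mem_erase.1 hq).1 (Complex.ofReal_injective hqp)
    filter_upwards [mem_nhdsWithin_of_mem_nhds (h1.mem_nhds h2), self_mem_nhdsWithin] with z hz hzp
    rw [heq z hz.1]
    rintro ⟨q, hq, rfl⟩
    exact hz.2 ⟨q, Finset.mem_coe.2 (Finset.mem_erase.2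
      ⟨fun hqp => hzp (by rw [mem_singleton_iff, hqp]), hq⟩), rfl⟩
  have h3 := tendsto_nhds_unique (ht.congr' hne) hc
  rw [hc0 hp'] at h3
  exact hα.ne' (by exact_mod_cast h3)

-- The pole sets coincide, so the recorded values also agree at the poles and outside the cut plane.
open Classical in
theorem HasPoles.eq_of_eventually_eq {M M' : ℂ → ℂ} {P P' : Finset ℝ} {α α' : ℝ → ℝ}
    (hM : HasPoles M P α) (hM' : HasPoles M' P' α')
    (h : ∀ᶠ τ : ℝ in atTop, M (-(τ : ℂ) ^ 2) = M' (-(τ : ℂ) ^ 2))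
    (h0 : ∀ z ∉ cutPlane, M z = 0) (h0' : ∀ z ∉ cutPlane, M' z = 0)
    (hz : ∀ p ∈ P, M p = 0) (hz' : ∀ p ∈ P', M' p = 0) : M = M' := by
  have hP : P = P' := (hM.subset_of_eventually_eq hM' h).antisymm
    (hM'.subset_of_eventually_eq hM (h.mono fun _ => Eq.symm))
  have heq := hM.eqOn_of_eventually_eq hM' h
  funext z
  by_cases hzc : z ∈ cutPlane
  · by_cases hzP : z ∈ ((↑) '' ((P ∪ P' : Finset ℝ) : Set ℝ) : Set ℂ)
    · obtain ⟨p, hp, rfl⟩ := hzP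
      rw [← hP, Finset.union_idempotent] at hp
      rw [hz p hp, hz' p (hP ▸ hp)]
    · exact heq z hzc hzP
  · rw [h0 z hzc, h0' z hzc]

theorem IsGLSolution.congr {g g' : ℝ → ℝ → ℂ} {x : ℝ} {κ : ℝ → ℂ} (hκ : IsGLSolution g x κ)
    (hx : 0 ≤ x) (h : ∀ s ≥ 0, ∀ y ≥ 0, g s y = g' s y) : IsGLSolution g' x κ := by
  refine ⟨hκ.1, fun y hy => ?_⟩
  rw [← hκ.2 y hy, h x hx y hy.1]
  congr 1
  refine intervalIntegral.integral_congr fun s hs => ?_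
  rw [uIcc_of_le hx] at hs
  simp only [h s hs.1 y hy.1]

/-- The Weyl function fixes `a` on `[0, ∞)` by uniqueness of the Laplace transform, `a` fixes the
kernel by uniqueness in the Gelfand–Levitan equation, and the potential is twice the derivative of
its diagonal. -/
theorem injOn_weylFunction {h xI : ℝ} (hxI : 0 < xI) :
    InjOn (weylFunction h xI) (potentialClass xI) := by
  rintro V ⟨hac, -, -, hs, -⟩ V' ⟨hac', -, -, hs', -⟩ hVV
  obtain ⟨P, α, a, K, H⟩ := exists_isSpectralData hxI hac hs h
  obtain ⟨P', α', a', K', H'⟩ := exists_isSpectralData hxI hac' hs' h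
  have ha : ∀ t ≥ 0, a t = a' t := fun t ht => H.laplace.unique H'.laplace H.cont.continuousOn
    H'.cont.continuousOn (Eventually.of_forall fun τ => by rw [hVV]) ht
  have hg : ∀ s ≥ 0, ∀ y ≥ 0, glKernel a' s y = glKernel a s y := fun s hs y hy => by
    rw [glKernel, glKernel, ha _ (add_nonneg hs hy), ha _ (abs_nonneg _)]
  have hK : ∀ x ≥ 0, K x x = K' x x := by
    intro x hx
    rcases hx.eq_or_lt with rfl | hx0
    · rw [H.kernel.diag 0 le_rfl, H'.kernel.diag 0 le_rfl]
      simp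
    · have := H.eqOn_of_isGLSolution hx0 ((H'.isGLSolution hx0).congr hx0.le hg) ⟨hx0.le, le_rfl⟩
      exact Complex.ofReal_injective this.symm
  funext x
  rcases lt_or_ge x 0 with hx | hx
  · rw [eq_zero_of_tsupport_subset hs fun h => not_lt.2 h.1 hx,
      eq_zero_of_tsupport_subset hs' fun h => not_lt.2 h.1 hx]
  · have d1 := hasDerivWithinAt_diag (continuous_extendPot hac) H.kernel hx
    have d2 := (hasDerivWithinAt_diag (continuous_extendPot hac') H'.kernel hx).congr
      (fun t ht => hK t ht) (hK x hx)
    have := (uniqueDiffOn_Ici (0 : ℝ) x hx).eq_deriv _ d1 d2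
    rw [extendPot_of_nonneg V hx, extendPot_of_nonneg V' hx] at this
    linarith

end

/-! ### Regularity of the Gelfand–Levitan data, and surjectivity. -/

section

/-- Integration of a kernel on the triangle against an integrable function gives a continuous
function. -/
theorem continuousAt_integral_kernel {L : ℝ → ℝ → ℂ} (hL : Continuous (Function.uncurry L))
    {a : ℝ → ℂ} (ha : ∀ X Y : ℝ, IntervalIntegrable a volume X Y) {x₀ : ℝ} (hx₀ : 0 ≤ x₀) :
    ContinuousAt (fun x => ∫ s in (0)..x, L x s * a s) x₀ := by
  obtain ⟨C, hC⟩ := (isCompact_Icc.prod isCompact_Icc).exists_bound_of_continuousOn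
    (hL.continuousOn (s := Icc (x₀ - 1) (x₀ + 1) ×ˢ Icc (-1) (x₀ + 1)))
  have h1 := intervalIntegral.continuousAt_parametric_primitive_of_dominated (μ := volume)
    (F := fun x s => L x s * a s) (fun s => C * ‖a s‖) (-1) (x₀ + 1) (a₀ := 0) (b₀ := x₀)
    (x₀ := x₀) (fun x => ?_) ?_ ((ha _ _).norm.const_mul C) ?_ ⟨by norm_num, by linarith⟩
    ⟨by linarith, by linarith⟩ (measure_singleton _)
  · have h2 : ContinuousAt (fun x : ℝ => (x, x)) x₀ := by fun_prop
    exact ContinuousAt.comp (f := fun x : ℝ => (x, x)) h1 h2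
  · exact (hL.comp (Continuous.prodMk_right x)).aestronglyMeasurable.mul
      (intervalIntegrable_iff.1 (ha _ _)).aestronglyMeasurable
  · filter_upwards [Icc_mem_nhds (show x₀ - 1 < x₀ by linarith) (show x₀ < x₀ + 1 by linarith)]
      with x hx
    refine ae_restrict_of_forall_mem measurableSet_uIoc fun s hs => ?_
    rw [uIoc_of_le (by linarith)] at hs
    rw [norm_mul]
    exact mul_le_mul_of_nonneg_right (hC (x, s) ⟨hx, hs.1.le, hs.2⟩) (norm_nonneg _)
  · refine Eventually.of_forall fun s => ?_
    exact ((hL.comp (Continuous.prodMk_left s)).mul continuous_const).continuousAt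

/-- If a Gelfand–Levitan equation with an integrable `a` has a continuous solution, then `a` is
continuous and its value at the origin is determined. -/
theorem exists_continuous_of_gelfandLevitan {L : ℝ → ℝ → ℂ}
    (hL : ContinuousOn (fun p : ℝ × ℝ => L p.1 p.2) {p | 0 ≤ p.2 ∧ p.2 ≤ p.1}) {a : ℝ → ℂ}
    (ha : ∀ X ≥ 0, IntervalIntegrable a volume 0 X)
    (hGL : ∀ x > 0, IsGLSolution (glKernel a) x (L x)) :
    ∃ A : ℝ → ℂ, Continuous A ∧ (∀ t ≥ 0, a t = A t) ∧ L 0 0 = -a 0 := by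
  let Λ : ℝ → ℝ → ℂ := fun x s => L (max x 0) (max 0 (min s (max x 0)))
  have hΛ : Continuous (Function.uncurry Λ) := by
    refine hL.comp_continuous (f := fun p : ℝ × ℝ => (max p.1 0, max 0 (min p.2 (max p.1 0))))
      (by fun_prop) fun p => ⟨le_max_left _ _, max_le (le_max_right _ _) (min_le_right _ _)⟩
  have hΛe : ∀ x ≥ 0, ∀ s ∈ Icc 0 x, Λ x s = L x s := fun x hx s hs => by
    simp only [Λ]
    rw [max_eq_left hx, min_eq_left hs.2, max_eq_right hs.1]
  let a' : ℝ → ℂ := (Ioi (0 : ℝ)).indicator a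
  have ha'e : ∀ s > 0, a' s = a s := fun s hs => indicator_of_mem (mem_Ioi.2 hs) a
  have ha' : ∀ X Y : ℝ, IntervalIntegrable a' volume X Y := by
    have h1 : ∀ X : ℝ, IntervalIntegrable a' volume 0 X := fun X => by
      rcases le_total 0 X with hX | hX
      · refine (ha X hX).congr fun s hs => ?_
        rw [uIoc_of_le hX] at hs
        exact (ha'e s hs.1).symm
      · refine (intervalIntegrable_const (c := (0 : ℂ))).congr fun s hs => ?_
        rw [uIoc_of_ge hX] at hs
        exact (indicator_of_notMem (fun h => not_lt.2 hs.2 h) a).symm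
    exact fun X Y => (h1 X).symm.trans (h1 Y)
  -- Since `g(s,0) = a(s)`, the equation at `y = 0` expresses `a(x)` for `x > 0` by this right-hand
  -- side, which is continuous when `a` is merely integrable.
  let F : ℝ → ℂ := fun x => -(Λ x 0 + ∫ s in (0)..x, Λ x s * a' s)
  have hF : ∀ x ≥ 0, ContinuousAt F x := fun x hx =>
    ((hΛ.comp (Continuous.prodMk_left (0 : ℝ))).continuousAt.add
      (continuousAt_integral_kernel hΛ ha' hx)).neg
  let A : ℝ → ℂ := fun t => F (max t 0)
  have hA : Continuous A := continuous_iff_continuousAt.2 fun t =>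
    ContinuousAt.comp (f := fun t : ℝ => max t 0) (hF _ (le_max_right _ _)) (by fun_prop)
  have hAF : ∀ t ≥ 0, A t = F t := fun t ht => by simp only [A]; rw [max_eq_left ht]
  have hpos : ∀ t > 0, a t = A t := by
    intro t ht
    have h1 := (hGL t ht).2 0 ⟨le_rfl, ht.le⟩
    have hg : ∀ s ≥ 0, glKernel a s 0 = a s := fun s hs => by
      rw [glKernel, add_zero, sub_zero, abs_of_nonneg hs]
      ring
    have h2 : ∫ s in (0)..t, Λ t s * a' s = ∫ s in (0)..t, L t s * glKernel a s 0 := by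
      refine intervalIntegral.integral_congr_uIoo fun s hs => ?_
      rw [uIoo_of_le ht.le] at hs
      simp only [hΛe t ht.le s ⟨hs.1.le, hs.2.le⟩, ha'e s hs.1, hg s hs.1.le]
    rw [hg t ht.le] at h1
    rw [hAF t ht.le]
    simp only [F]
    rw [h2, hΛe t ht.le 0 ⟨le_rfl, ht.le⟩]
    linear_combination h1
  have hA0 : A 0 = -L 0 0 := by
    rw [hAF 0 le_rfl]
    simp only [F]
    rw [hΛe 0 le_rfl 0 ⟨le_rfl, le_rfl⟩, intervalIntegral.integral_same, add_zero]
  have hgA := continuous_glKernel hA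
  -- The value `a(0)` itself is not controlled by the row `y = 0`. It enters on the diagonal through
  -- `|x - x|`, and letting `x → 0` there yields `(A(0) + a(0)) / 2 + L(0,0) = 0`.
  have hcont : Continuous fun x : ℝ => (A (2 * x) + a 0) / 2 + Λ x x +
      ∫ s in (0)..x, Λ x s * glKernel A s x := by
    have h1 : Continuous fun x => Λ x x := hΛ.comp (f := fun x : ℝ => (x, x)) (by fun_prop)
    have h2 : Continuous fun p : ℝ × ℝ => Λ p.1 p.2 * glKernel A p.2 p.1 :=
      hΛ.mul (hgA.comp (f := fun p : ℝ × ℝ => (p.2, p.1)) (by fun_prop))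
    have h3 := (intervalIntegral.continuous_parametric_primitive_of_continuous (μ := volume)
      (f := fun x s => Λ x s * glKernel A s x) (a₀ := 0) h2).comp
      (f := fun x : ℝ => (x, x)) (by fun_prop)
    exact (Continuous.add (by fun_prop) h1).add h3
  have hzero : ∀ x > 0, (A (2 * x) + a 0) / 2 + Λ x x +
      ∫ s in (0)..x, Λ x s * glKernel A s x = 0 := by
    intro x hx
    rw [← (hGL x hx).2 x ⟨hx.le, le_rfl⟩, hΛe x hx.le x ⟨hx.le, le_rfl⟩]
    congr 1
    · rw [glKernel, sub_self, abs_zero, ← two_mul, hpos (2 * x) (by linarith)]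
    · refine intervalIntegral.integral_congr_uIoo fun s hs => ?_
      rw [uIoo_of_le hx.le] at hs
      have : 0 < |s - x| := abs_pos.2 (sub_ne_zero.2 hs.2.ne)
      simp only [hΛe x hx.le s ⟨hs.1.le, hs.2.le⟩, glKernel, hpos _ this,
        hpos _ (add_pos hs.1 hx)]
  have h0 : (A (2 * 0) + a 0) / 2 + Λ 0 0 + ∫ s in (0)..0, Λ 0 s * glKernel A s 0 = 0 := by
    refine tendsto_nhds_unique ((hcont.tendsto 0).mono_left nhdsWithin_le_nhds)
      (tendsto_const_nhds.congr' (eventually_nhdsWithin_of_forall (s := Ioi 0) fun x hx => ?_))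
    exact (hzero x hx).symm
  rw [intervalIntegral.integral_same, mul_zero, hA0, hΛe 0 le_rfl 0 ⟨le_rfl, le_rfl⟩] at h0
  have h00 : L 0 0 = -a 0 := by linear_combination 2 * h0
  refine ⟨A, hA, fun t ht => ?_, h00⟩
  rcases ht.eq_or_lt with rfl | ht
  · rw [hA0, h00, neg_neg]
  · exact hpos t ht

theorem IsLaplaceInverse.intervalIntegrable {M : ℂ → ℂ} {a : ℝ → ℂ} (h : IsLaplaceInverse M a)
    {X : ℝ} (hX : 0 ≤ X) : IntervalIntegrable a volume 0 X := by
  obtain ⟨τ, h⟩ := h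
  obtain ⟨i, -⟩ := h τ le_rfl
  have h1 : IntervalIntegrable (fun t : ℝ => Complex.exp (-τ * t) * a t) volume 0 X := by
    rw [intervalIntegrable_iff, uIoc_of_le hX]
    exact i.mono_set Ioc_subset_Ioi_self
  refine (h1.continuousOn_mul (g := fun t : ℝ => Complex.exp (τ * t)) (by fun_prop)).congr
    fun t _ => ?_
  rw [← mul_assoc, ← Complex.exp_add, neg_mul, add_neg_cancel, Complex.exp_zero, one_mul]

theorem absolutelyContinuousOnInterval_congr {f g : ℝ → ℝ} {a b : ℝ}
    (hf : AbsolutelyContinuousOnInterval f a b) (h : EqOn f g (uIcc a b)) :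
    AbsolutelyContinuousOnInterval g a b := by
  rw [absolutelyContinuousOnInterval_iff] at hf ⊢
  intro ε hε
  obtain ⟨δ, hδ, H⟩ := hf ε hε
  refine ⟨δ, hδ, fun E hE hEδ => ?_⟩
  have := H E hE hEδ
  refine lt_of_eq_of_lt (Finset.sum_congr rfl fun i hi => ?_) this
  rw [h (hE.1 i hi).1, h (hE.1 i hi).2]

theorem indicator_mem_potentialClass {xI : ℝ} (hxI : 0 < xI) {D : ℝ → ℝ}
    (hD : ∀ b > 0, AbsolutelyContinuousOnInterval D 0 b) (hD0 : ∀ x > xI, D x = 0)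
    (hpos : ∀ ε > 0, 0 < volume {x | x ∈ Ioo (xI - ε) xI ∧ 0 < x ∧ D x ≠ 0}) :
    (Ici 0).indicator (fun x => 2 * D x) ∈ potentialClass xI := by
  obtain ⟨V, hV⟩ : ∃ V : ℝ → ℝ, V = (Ici 0).indicator (fun x => 2 * D x) := ⟨_, rfl⟩
  rw [← hV]
  have hVe : ∀ x ≥ 0, V x = 2 * D x := fun x hx => by rw [hV, indicator_of_mem (mem_Ici.2 hx)]
  have hac : ∀ b > 0, AbsolutelyContinuousOnInterval V 0 b := fun b hb =>
    absolutelyContinuousOnInterval_congr ((hD b hb).const_mul 2) fun x hx => by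
      rw [uIcc_of_le hb.le] at hx
      exact (hVe x hx.1).symm
  have hV0 : ∀ x > xI, V x = 0 := fun x hx => by rw [hVe x (by linarith), hD0 x hx, mul_zero]
  have hsupp : Function.support V ⊆ Icc 0 xI := fun x hx => by
    refine ⟨?_, ?_⟩
    · by_contra h
      exact hx (by rw [hV, indicator_of_notMem (by simpa using h)])
    · by_contra h
      exact hx (hV0 x (not_le.1 h))
  have hsplit : ∀ f : ℝ → ℝ, IntervalIntegrable f volume 0 xI → (∀ x > xI, f x = 0) →
      IntegrableOn f (Ioi 0) := fun f hf hf0 => by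
    rw [← Ioc_union_Ioi_eq_Ioi hxI.le]
    refine IntegrableOn.union ?_ ?_
    · rwa [intervalIntegrable_iff, uIoc_of_le hxI.le] at hf
    · exact integrableOn_zero.congr_fun (fun x hx => (hf0 x hx).symm) measurableSet_Ioi
  refine ⟨hac, hsplit V (hac xI hxI).continuousOn.intervalIntegrable hV0,
    hsplit _ (hac xI hxI).intervalIntegrable_deriv fun x hx => ?_,
    closure_minimal hsupp isClosed_Icc, fun ε hε => ?_⟩
  · have : V =ᶠ[𝓝 x] fun _ => 0 := by
      filter_upwards [Ioi_mem_nhds hx] with y hy using hV0 y hy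
    rw [this.deriv_eq, deriv_const]
  · refine (hpos ε hε).trans_le (measure_mono fun x hx => ⟨hx.1, subset_tsupport V ?_⟩)
    rw [Function.mem_support, hVe x hx.2.1.le]
    exact mul_ne_zero two_ne_zero hx.2.2

/-- The candidate potential is twice the derivative of the given diagonal. The direct problem for it
produces a second Gelfand–Levitan equation with the same diagonal, which forces equal data and hence
equal Weyl functions. -/
theorem surjOn_weylFunction {h xI : ℝ} (hxI : 0 < xI) :
    SurjOn (weylFunction h xI) (potentialClass xI) (weylClass h xI) := by
  rintro M ⟨P, α, hout, hz, hM, ⟨⟨m, hm, hmM⟩, hO⟩, -, has, g, L, hg, hL, hGL, him, D, hD, hDac,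
    hD0, hDpos⟩
  have hP : ∀ p ∈ P, p < 0 := fun p hp => (hM.2 p hp).1
  obtain ⟨N, hr⟩ := exists_isReduced hM hm hmM hO has
  obtain ⟨a, ha⟩ : ∃ a : ℝ → ℂ, a = fun t => g t 0 := ⟨_, rfl⟩
  have hat : ∀ t ≥ 0, Tendsto (gCutoff M P α t 0) atTop (𝓝 (a t)) := fun t ht => by
    rw [ha]; exact hg t ht 0 le_rfl
  have hge : ∀ x ≥ 0, ∀ y ≥ 0, g x y = glKernel a x y := fun x hx y hy => by
    rw [hr.eq_glKernel_of_tendsto hP hg hx hy, ha]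
  have hlap := hr.isLaplaceInverse hP hat
  have hGLa : ∀ x > 0, IsGLSolution (glKernel a) x (L x) := fun x hx =>
    (hGL x hx).1.congr (le_of_lt hx) hge
  obtain ⟨A, hA, hAe, hL0⟩ := exists_continuous_of_gelfandLevitan hL
    (fun X hX => hlap.intervalIntegrable hX) hGLa
  rw [hr.apply_zero hP hat] at hL0
  have hgA : ∀ x ≥ 0, ∀ y ≥ 0, glKernel a x y = glKernel A x y := fun x hx y hy => by
    rw [glKernel, glKernel, hAe _ (add_nonneg hx hy), hAe _ (abs_nonneg _)]
  obtain ⟨V, hV⟩ : ∃ V : ℝ → ℝ, V = (Ici 0).indicator (fun x => 2 * D x) := ⟨_, rfl⟩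
  have hVmem : V ∈ potentialClass xI := hV ▸ indicator_mem_potentialClass hxI hDac hD0 hDpos
  obtain ⟨hac, -, -, hs, -⟩ := id hVmem
  obtain ⟨P', α', A', K, H⟩ := exists_isSpectralData hxI hac hs h
  obtain ⟨B, hB⟩ := H.kernel.bdd
  -- Both diagonals have the derivative `D` and the initial value `-h`; for `L` the latter comes
  -- from `a(0) = h`.
  have hre : ∀ x ≥ 0, (L x x).re = K x x := by
    intro x hx
    have hd : ∀ t ≥ 0, HasDerivWithinAt (fun t => (L t t).re - K t t) 0 (Ici 0) t := fun t ht => by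
      refine ((hD t ht).sub (hasDerivWithinAt_diag (continuous_extendPot hac) H.kernel
        ht)).congr_deriv ?_
      rw [extendPot_of_nonneg V ht, hV, indicator_of_mem (mem_Ici.2 ht)]
      ring
    have h1 := constant_of_has_deriv_right_zero (f := fun t => (L t t).re - K t t) (a := 0) (b := x)
      (fun t ht => (hd t ht.1).continuousWithinAt.mono fun _ h => h.1)
      (fun t ht => (hd t ht.1).mono (Ici_subset_Ici.2 ht.1)) x ⟨hx, le_rfl⟩
    rw [H.kernel.diag 0 le_rfl, hL0] at h1
    simp only [Complex.neg_re, Complex.ofReal_re, intervalIntegral.integral_same, mul_zero,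
      add_zero, sub_self] at h1
    exact sub_eq_zero.1 h1
  have hdiag : ∀ x > 0, L x x = K x x := fun x hx => by
    apply Complex.ext
    · rw [hre x (le_of_lt hx), Complex.ofReal_re]
    · rw [him x (le_of_lt hx), Complex.ofReal_im]
  have hAA : ∀ t ≥ 0, A t = A' t := fun t ht =>
    eq_of_gl_diagonal_eq H.kernel.cont hB hA H.cont H.gl hL
      (fun x hx => ((hGLa x hx).congr (le_of_lt hx) hgA).2) hdiag ht
  obtain ⟨T, hT⟩ := hlap
  obtain ⟨T', hT'⟩ := H.laplace
  -- Equal `a` means equal Laplace transforms, that is, equal values at the points `-τ²` for large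
  -- `τ`.
  have hMM : ∀ᶠ τ : ℝ in atTop, M (-(τ : ℂ) ^ 2) = weylFunction h xI V (-(τ : ℂ) ^ 2) := by
    filter_upwards [eventually_ge_atTop T, eventually_ge_atTop T', eventually_gt_atTop 0]
      with τ h1 h2 h3
    have h4 := (hT τ h1).2
    have h5 := (hT' τ h2).2
    have h6 : ∫ t : ℝ in Ioi 0, Complex.exp (-τ * t) * a t =
        ∫ t : ℝ in Ioi 0, Complex.exp (-τ * t) * A' t :=
      setIntegral_congr_fun measurableSet_Ioi fun t ht => by
        simp only [hAe t (le_of_lt ht), hAA t (le_of_lt ht)]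
    rw [h4, h5] at h6
    have hτ : (τ : ℂ) ≠ 0 := by exact_mod_cast h3.ne'
    exact mul_left_cancel₀ hτ (by linear_combination -h6)
  exact ⟨V, hVmem, (hM.eq_of_eventually_eq H.hasPoles hMM hout
    (fun z hz => indicator_of_notMem hz _) hz H.zero_of_mem).symm⟩

end

end LoveProblem

end

theorem mainTheorem1 (h xI : ℝ) (hxI : 0 < xI) :
    Set.BijOn (LoveProblem.weylFunction h xI)
      (LoveProblem.potentialClass xI) (LoveProblem.weylClass h xI) := by
  exact ⟨fun V hV => LoveProblem.weylFunction_mem_weylClass hxI hV,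
    LoveProblem.injOn_weylFunction hxI, LoveProblem.surjOn_weylFunction hxI⟩
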